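/- Let $\mathfrak g=\bigoplus_{i\in\mathbb Z}\mathfrak g_i$ be a $\mathbb Z$-graded complex Lie algebra with all $\mathfrak g_i$ finite dimensional, $\mathfrak n_\pm=\bigoplus_{\pm i>0}\mathfrak g_i$, and let $x\mapsto x_0$ be the projection to $\mathfrak g_0$. Let $\chi:\mathfrak g_0\to\mathbb C$ be a nonsingular character, i.e. a character for which the pairing $\mathfrak n_+\times\mathfrak n_-\to\mathbb C$, $(u,v)\mapsto\chi([u,v]_0)$, is nondegenerate. For $\lambda\in\mathbb C$ let $(x,y)_\lambda=(\lambda\chi)(\phi(S(y)x))$, for $x\in U\mathfrak n_-$, $y\in U\mathfrak n_+$, be the Shapovalov pairing; here $S$ is the antipode and $\phi:U\mathfrak g\to U\mathfrak g_0$ is the projection along $\mathfrak n_-U\mathfrak g+U\mathfrak g\,\mathfrak n_+$. Put $W=U\mathfrak g/U\mathfrak g\cdot\mathfrak g_0$, with $\pi:U\mathfrak g^{\otimes2}\to W^{\otimes 2}$ the projection. Subscripts $d$ on $U\mathfrak g$, $U\mathfrak n_\pm$ and $W$ denote components of degree $d$. (1) The pairing $(\cdot,\cdot)_\lambda$ is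 nondegenerate for all but countably many $\lambda$. For such $\lambda$ it has a canonical element $F_\lambda=(F_{\lambda,n})_n\in\prod_{n\ge 0}(U\mathfrak n_-)_{-n}\otimes(U\mathfrak n_+)_n$ (for each $n$, $F_{\lambda,n}=\sum_k x_k\otimes y_k$ with $(x_k)$, $(y_k)$ bases that are dual for the pairing). There is a unique formal power series $F_{\hbar^{-1}}$ in $\hbar$, with coefficients in this product, whose $n$-th component converges for each $n$ to $F_{\lambda,n}$ at $\hbar=\lambda^{-1}$, for all large enough $\lambda$ for which $F_\lambda$ is defined. (2) The series $B:=\pi(F_{\hbar^{-1}})$, with coefficients in $\prod_n W_{-n}\otimes W_n$, has $\hbar^0$-coefficient $1\otimes1$, all its coefficients are invariant under the diagonal adjoint action of $\mathfrak g_0$, and it satisfies the associativity equation $$((\Delta\otimes1)B)(B\otimes1)=((1\otimes\Delta)B)(1\otimes B)$$ in $W^{\otimes 3}[[\hbar]]$, where $W^{\otimes3}$ is completed with respect to the tri-degree. The two sides are computed from any representatives of $B$ with coefficients in $\prod_n(U\mathfrak g)_{-n}\otimes(U\mathfrak g)_n$ and do not depend on their choice. (3) If $\mathfrak g$ is finite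 dimensional, no completion is needed: each coefficient of $F_{\hbar^{-1}}$ has only finitely many nonzero components, $B$ lies in $(W^{\otimes2})^{\mathfrak g_0}[[\hbar]]$, and it satisfies the associativity equation in $W^{\otimes3}[[\hbar]]$, for any representatives of $B$ in $U\mathfrak g^{\otimes 2}[[\hbar]]$. (4) Suppose moreover that $\mathfrak g$ is identified with the complexified Lie algebra of a finite dimensional real Lie group $G$, and that $H\subset G$ is a closed subgroup with complexified Lie algebra $\mathfrak g_0$ such that $\mathrm{Ad}_H$ preserves the grading of $\mathfrak g$ and the character $\chi$ (both automatic for $H$ connected). Then $B$ defines an invariant $*$-product on $G/H$: acting on smooth complex functions on $G/H$, pulled back to $G$, by left invariant bidifferential operators, the coefficients $B_m$ of $B$ give well-defined $G$-invariant bidifferential operators on $G/H$, $B_0(f,f')=ff'$, and $f*f'=\sum_m\hbar^mB_m(f,f')$ is associative. -/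

import Mathlib

open scoped TensorProduct Manifold ContDiff LieGroup

attribute [local instance 100] LieRing.ofAssociativeRing

noncomputable section

namespace InvStar

universe u v w

/-! ### The universal enveloping algebra as a bialgebra with antipode -/

section Enveloping

/-- The universal enveloping algebra of a complex Lie algebra. -/
abbrev U (L : Type u) [LieRing L] [LieAlgebra ℂ L] : Type u := UniversalEnvelopingAlgebra ℂ L

variable (L : Type u) [LieRing L] [LieAlgebra ℂ L]

/-- The canonical Lie algebra map from a Lie algebra to its universal enveloping algebra. -/
abbrev inc : L →ₗ⁅ℂ⁆ U L := UniversalEnvelopingAlgebra.ι ℂ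

/-- The coproduct `Δ : U L → U L ⊗ U L`, the algebra homomorphism with `Δ x = x ⊗ 1 + 1 ⊗ x`
for `x` in `L`. -/
def coprod : U L →ₐ[ℂ] U L ⊗[ℂ] U L :=
  UniversalEnvelopingAlgebra.lift ℂ
    { toFun := fun x => inc L x ⊗ₜ[ℂ] 1 + 1 ⊗ₜ[ℂ] inc L x
      map_add' := fun x y => by
        simp only [map_add, TensorProduct.add_tmul, TensorProduct.tmul_add]; abel
      map_smul' := fun c x => by
        simp only [map_smul, TensorProduct.smul_tmul', TensorProduct.tmul_smul, smul_add,
          RingHom.id_apply]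
      map_lie' := fun {x y} => by
        simp only [LieHom.map_lie, LieRing.of_associative_ring_bracket, mul_add, add_mul,
          Algebra.TensorProduct.tmul_mul_tmul, one_mul, mul_one, TensorProduct.sub_tmul,
          TensorProduct.tmul_sub]
        abel }

/-- The antipode of `U L` as an algebra homomorphism to the opposite algebra. -/
def antipodeOp : U L →ₐ[ℂ] (U L)ᵐᵒᵖ :=
  UniversalEnvelopingAlgebra.lift ℂ
    { toFun := fun x => MulOpposite.op (-inc L x)
      map_add' := fun x y => by
        rw [map_add, neg_add, MulOpposite.op_add]
      map_smul' := fun c x => by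
        rw [map_smul, ← smul_neg, MulOpposite.op_smul, RingHom.id_apply]
      map_lie' := fun {x y} => by
        simp only [LieHom.map_lie, LieRing.of_associative_ring_bracket, ← MulOpposite.op_mul,
          ← MulOpposite.op_sub, neg_mul_neg, neg_sub] }

/-- The antipode `S`, the anti-automorphism of `U L` with `S x = -x` for `x` in `L`. -/
def antipode : U L →ₗ[ℂ] U L :=
  (MulOpposite.opLinearEquiv ℂ).symm.toLinearMap ∘ₗ (antipodeOp L).toLinearMap

end Enveloping

/-! ### Graded Lie algebras -/

/-- A `ℤ`-grading of a complex Lie algebra with finite dimensional graded pieces. -/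
structure Grading (L : Type u) [LieRing L] [LieAlgebra ℂ L] where
  /-- The graded pieces. -/
  piece : ℤ → Submodule ℂ L
  isInternal : DirectSum.IsInternal piece
  lie_mem : ∀ {i j : ℤ} {x y : L}, x ∈ piece i → y ∈ piece j → ⁅x, y⁆ ∈ piece (i + j)
  finite : ∀ i, FiniteDimensional ℂ (piece i)

namespace Grading

variable {L : Type u} [LieRing L] [LieAlgebra ℂ L] (Γ : Grading L)

/-- The decomposition of `L` as the direct sum of its graded pieces. -/
def decomp : L ≃ₗ[ℂ] DirectSum ℤ (fun i => Γ.piece i) :=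
  (LinearEquiv.ofBijective (DirectSum.coeLinearMap Γ.piece) Γ.isInternal).symm

/-- The projection of `L` to its graded piece of degree `i`. -/
def comp (i : ℤ) : L →ₗ[ℂ] Γ.piece i :=
  DirectSum.component ℂ ℤ (fun i => Γ.piece i) i ∘ₗ Γ.decomp.toLinearMap

/-- The Lie subalgebra of elements of degree zero. -/
def zeroPart : LieSubalgebra ℂ L :=
  { Γ.piece 0 with
    lie_mem' := fun {x y} hx hy => by
      have h := Γ.lie_mem (i := 0) (j := 0) hx hy
      rwa [add_zero] at h }

/-- The span of the elements of positive degree. -/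
def posPart : Submodule ℂ L := ⨆ i : {i : ℤ // 0 < i}, Γ.piece i

/-- The span of the elements of negative degree. -/
def negPart : Submodule ℂ L := ⨆ i : {i : ℤ // i < 0}, Γ.piece i

/-- The projection `x ↦ x₀` of `L` to the subalgebra of degree zero. -/
def toZero : L →ₗ[ℂ] Γ.zeroPart := Γ.comp 0

/-- A character `χ` of the subalgebra of degree zero is nonsingular if the pairing
`(u, v) ↦ χ ([u, v]₀)` between the positive and the negative part is nondegenerate. -/
def IsNonsingularCharacter (χ : LieAlgebra.LieCharacter ℂ Γ.zeroPart) : Prop :=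
  (∀ u ∈ Γ.posPart, (∀ v ∈ Γ.negPart, χ (Γ.toZero ⁅u, v⁆) = 0) → u = 0) ∧
  (∀ v ∈ Γ.negPart, (∀ u ∈ Γ.posPart, χ (Γ.toZero ⁅u, v⁆) = 0) → v = 0)

/-- The linear map sending `x` to the Laurent polynomial `∑ i, x_i t ^ i`. -/
def weightLin : L →ₗ[ℂ] AddMonoidAlgebra (U L) ℤ :=
  DirectSum.toModule ℂ ℤ (AddMonoidAlgebra (U L) ℤ)
    (fun i => (AddMonoidAlgebra.coeffLinearEquiv ℂ).symm.toLinearMap ∘ₗ Finsupp.lsingle i ∘ₗ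
      (inc L).toLinearMap ∘ₗ (Γ.piece i).subtype) ∘ₗ Γ.decomp.toLinearMap

theorem weightLin_of_mem {i : ℤ} {x : L} (hx : x ∈ Γ.piece i) :
    Γ.weightLin x = AddMonoidAlgebra.single i (inc L x) := by
  have h : Γ.decomp x = DirectSum.lof ℂ ℤ (fun i => Γ.piece i) i ⟨x, hx⟩ := by
    rw [decomp, LinearEquiv.symm_apply_eq]
    exact (DirectSum.coeLinearMap_lof Γ.piece i ⟨x, hx⟩).symm
  rw [weightLin, LinearMap.comp_apply, LinearEquiv.coe_coe, h, DirectSum.toModule_lof]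
  rfl

theorem weightLin_lie (x y : L) : Γ.weightLin ⁅x, y⁆ =
    Γ.weightLin x * Γ.weightLin y - Γ.weightLin y * Γ.weightLin x := by
  have hx : x ∈ ⨆ i, Γ.piece i := by rw [Γ.isInternal.submodule_iSup_eq_top]; trivial
  have hy : y ∈ ⨆ i, Γ.piece i := by rw [Γ.isInternal.submodule_iSup_eq_top]; trivial
  induction hx using Submodule.iSup_induction' with
  | zero => simp
  | add a b _ _ ha hb => rw [add_lie, map_add, map_add, ha, hb]; noncomm_ring
  | mem i a hi =>
    induction hy using Submodule.iSup_induction' with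
    | zero => simp
    | add c d _ _ hc hd => rw [lie_add, map_add, map_add, hc, hd]; noncomm_ring
    | mem j b hj =>
      rw [Γ.weightLin_of_mem (Γ.lie_mem hi hj), Γ.weightLin_of_mem hi, Γ.weightLin_of_mem hj,
        AddMonoidAlgebra.single_mul_single, AddMonoidAlgebra.single_mul_single, add_comm j i,
        LieHom.map_lie, LieRing.of_associative_ring_bracket, AddMonoidAlgebra.single_sub]

/-- The algebra homomorphism `U L → U L [t, t⁻¹]` sending a homogeneous element `u` of degree `d`
to `u t ^ d`. -/
def weight : U L →ₐ[ℂ] AddMonoidAlgebra (U L) ℤ :=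
  UniversalEnvelopingAlgebra.lift ℂ
    { Γ.weightLin with map_lie' := fun {x y} => Γ.weightLin_lie x y }

/-- The projection of `U L` to its elements of degree `d`. -/
def degProj (d : ℤ) : U L →ₗ[ℂ] U L :=
  Finsupp.lapply d ∘ₗ (AddMonoidAlgebra.coeffLinearEquiv ℂ).toLinearMap ∘ₗ Γ.weight.toLinearMap

/-- The elements of degree `d` of `U L`. -/
def homog (d : ℤ) : Submodule ℂ (U L) := LinearMap.range (Γ.degProj d)

/-- The enveloping algebra of the negative part, as a subalgebra of `U L`. -/
def Uneg : Subalgebra ℂ (U L) := Algebra.adjoin ℂ (inc L '' Γ.negPart)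

/-- The enveloping algebra of the positive part, as a subalgebra of `U L`. -/
def Upos : Subalgebra ℂ (U L) := Algebra.adjoin ℂ (inc L '' Γ.posPart)

/-- The component of degree `-n` of the enveloping algebra of the negative part. -/
def UnegDeg (n : ℤ) : Submodule ℂ (U L) := Γ.Uneg.toSubmodule ⊓ Γ.homog (-n)

/-- The component of degree `n` of the enveloping algebra of the positive part. -/
def UposDeg (n : ℤ) : Submodule ℂ (U L) := Γ.Upos.toSubmodule ⊓ Γ.homog n

/-! ### The Shapovalov pairing -/

/-- The subspace `n₋ U(g) + U(g) n₊` of `U(g)`. -/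
def offZero : Submodule ℂ (U L) :=
  Submodule.span ℂ {z | ∃ a ∈ Γ.negPart, ∃ b : U L, z = inc L a * b} ⊔
  Submodule.span ℂ {z | ∃ a ∈ Γ.posPart, ∃ b : U L, z = b * inc L a}

/-- The algebra homomorphism `U(g₀) → U(g)`. -/
def zeroIncl : U Γ.zeroPart →ₐ[ℂ] U L :=
  UniversalEnvelopingAlgebra.lift ℂ ((inc L).comp Γ.zeroPart.incl)

/-- The map `U(g₀) → U(g) / (n₋ U(g) + U(g) n₊)`. -/
def zeroToQuot : U Γ.zeroPart →ₗ[ℂ] U L ⧸ Γ.offZero :=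
  Γ.offZero.mkQ ∘ₗ Γ.zeroIncl.toLinearMap

open Classical in
/-- The projection `φ : U(g) → U(g₀)` along `n₋ U(g) + U(g) n₊`. That `U(g)` is the direct sum of
these two subspaces, i.e. that `zeroToQuot` is bijective, is a consequence of the
Poincaré-Birkhoff-Witt theorem, so that the second case of the definition never occurs. -/
def zeroProj : U L →ₗ[ℂ] U Γ.zeroPart :=
  if h : Function.Bijective Γ.zeroToQuot then
    (LinearEquiv.ofBijective Γ.zeroToQuot h).symm.toLinearMap ∘ₗ Γ.offZero.mkQ
  else 0

variable (χ : LieAlgebra.LieCharacter ℂ Γ.zeroPart)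

/-- The rescaled character `lam • χ`, as an algebra homomorphism on `U(g₀)`. -/
def scaledChar (lam : ℂ) : U Γ.zeroPart →ₐ[ℂ] ℂ :=
  UniversalEnvelopingAlgebra.lift ℂ
    { lam • χ.toLinearMap with
      map_lie' := fun {x y} => by
        simp [LieRing.of_associative_ring_bracket, mul_comm] }

/-- The bilinear form `(x, y) ↦ χ_lam (φ (S y * x))` on `U(g)`. Its restriction to
`U(n₋) × U(n₊)` is the Shapovalov pairing. -/
def shapovalov (lam : ℂ) : U L →ₗ[ℂ] U L →ₗ[ℂ] ℂ :=
  LinearMap.mk₂ ℂ (fun x y => Γ.scaledChar χ lam (Γ.zeroProj (antipode L y * x)))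
    (fun x x' y => by simp [mul_add]) (fun c x y => by simp)
    (fun x y y' => by simp [add_mul]) (fun c x y => by simp)

/-- The Shapovalov pairing between `U(n₋)` and `U(n₊)` is nondegenerate. -/
def PairingNonsingular (lam : ℂ) : Prop :=
  (∀ x ∈ Γ.Uneg, (∀ y ∈ Γ.Upos, Γ.shapovalov χ lam x y = 0) → x = 0) ∧
  (∀ y ∈ Γ.Upos, (∀ x ∈ Γ.Uneg, Γ.shapovalov χ lam x y = 0) → y = 0)

/-- `T` in `U(n₋)_{-n} ⊗ U(n₊)_n` is canonical: contracting its second factor against an element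
`x` of `U(n₋)_{-n}` gives `x`, and contracting its first factor against an element `y` of
`U(n₊)_n` gives `y`. In other words `T = ∑ x_k ⊗ y_k` for dual bases `x_k`, `y_k`. -/
def IsCanonical (lam : ℂ) (n : ℤ) (T : Γ.UnegDeg n ⊗[ℂ] Γ.UposDeg n) : Prop :=
  (∀ x : Γ.UnegDeg n, TensorProduct.rid ℂ (Γ.UnegDeg n)
    (LinearMap.lTensor (Γ.UnegDeg n)
      ((Γ.shapovalov χ lam x) ∘ₗ (Γ.UposDeg n).subtype) T) = x) ∧
  (∀ y : Γ.UposDeg n, TensorProduct.lid ℂ (Γ.UposDeg n)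
    (LinearMap.rTensor (Γ.UposDeg n)
      (((Γ.shapovalov χ lam).flip y) ∘ₗ (Γ.UnegDeg n).subtype) T) = y)

open Classical in
/-- The component in `U(n₋)_{-n} ⊗ U(n₊)_n` of the canonical element `F_lam` of the Shapovalov
pairing. The completed tensor product of `U(n₋)` and `U(n₊)` is the product of the spaces
`U(n₋)_{-i} ⊗ U(n₊)_j`, and the components of `F_lam` with `i ≠ j` are zero.
The value is only meaningful when the pairing is nondegenerate. -/
def canonicalElement (lam : ℂ) (n : ℤ) : Γ.UnegDeg n ⊗[ℂ] Γ.UposDeg n :=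
  if h : ∃ T, Γ.IsCanonical χ lam n T then h.choose else 0

/-- The formal power series with coefficients `F 0 n, F 1 n, ...` are the Taylor series at `0` of
the components of `F_{1/t}`, as functions of the complex variable `t`: for each `n` and each linear
coordinate `ℓ` on `U(n₋)_{-n} ⊗ U(n₊)_n`, the series `∑ m, ℓ (F m n) t ^ m` converges to the value
of `ℓ` on the canonical element at all small `t ≠ 0` for which the latter is defined. -/
def IsExpansionAtInfinity (F : ℕ → ∀ n : ℤ, Γ.UnegDeg n ⊗[ℂ] Γ.UposDeg n) : Prop :=
  ∀ (n : ℤ) (l : Module.Dual ℂ (Γ.UnegDeg n ⊗[ℂ] Γ.UposDeg n)), ∃ r : ℝ, 0 < r ∧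
    ∀ t : ℂ, t ≠ 0 → ‖t‖ < r → Γ.PairingNonsingular χ t⁻¹ →
      HasSum (fun m : ℕ => l (F m n) * t ^ m) (l (Γ.canonicalElement χ t⁻¹ n))

/-! ### The quotient `U(g) / U(g) g₀` and the associativity equation -/

/-- The left ideal `U(g) g₀`, as a complex subspace. -/
def leftIdeal : Submodule ℂ (U L) :=
  (Submodule.span (U L) (inc L '' Γ.piece 0)).restrictScalars ℂ

/-- The quotient `U(g) / U(g) g₀`. -/
abbrev W : Type u := U L ⧸ Γ.leftIdeal

/-- The projection of `U(g) ⊗ U(g)` to `W ⊗ W`. -/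
def proj₂ : U L ⊗[ℂ] U L →ₗ[ℂ] Γ.W ⊗[ℂ] Γ.W :=
  TensorProduct.map Γ.leftIdeal.mkQ Γ.leftIdeal.mkQ

/-- The projection of `U(g) ⊗ U(g) ⊗ U(g)` to `W ⊗ W ⊗ W`. -/
def proj₃ : U L ⊗[ℂ] (U L ⊗[ℂ] U L) →ₗ[ℂ] Γ.W ⊗[ℂ] (Γ.W ⊗[ℂ] Γ.W) :=
  TensorProduct.map Γ.leftIdeal.mkQ (TensorProduct.map Γ.leftIdeal.mkQ Γ.leftIdeal.mkQ)

theorem leftIdeal_le_comap_ad (x : Γ.zeroPart) : Γ.leftIdeal ≤ Γ.leftIdeal.comap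
    (LinearMap.mulLeft ℂ (inc L x) - LinearMap.mulRight ℂ (inc L x)) := by
  intro z hz
  have hx : inc L (x : L) ∈ Submodule.span (U L) (inc L '' (Γ.piece 0 : Set L)) :=
    Submodule.subset_span ⟨x, x.2, rfl⟩
  have hz' : z ∈ Submodule.span (U L) (inc L '' (Γ.piece 0 : Set L)) := hz
  change inc L x * z - z * inc L x ∈ Submodule.span (U L) (inc L '' (Γ.piece 0 : Set L))
  exact Submodule.sub_mem _ (Submodule.smul_mem _ (inc L x) hz') (Submodule.smul_mem _ z hx)

/-- The adjoint action of `x` in `g₀` on `W`, induced by `u ↦ x u - u x`. -/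
def adW (x : Γ.zeroPart) : Γ.W →ₗ[ℂ] Γ.W :=
  Γ.leftIdeal.mapQ Γ.leftIdeal
    (LinearMap.mulLeft ℂ (inc L x) - LinearMap.mulRight ℂ (inc L x)) (Γ.leftIdeal_le_comap_ad x)

/-- Invariance under the diagonal adjoint action of `g₀` on `W ⊗ W`. -/
def IsInvariant (b : Γ.W ⊗[ℂ] Γ.W) : Prop :=
  ∀ x : Γ.zeroPart,
    LinearMap.rTensor Γ.W (Γ.adW x) b + LinearMap.lTensor Γ.W (Γ.adW x) b = 0

/-- The product `((Δ ⊗ 1) b) (c ⊗ 1)` in `U(g) ⊗ U(g) ⊗ U(g)`. -/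
def leftComp (b c : U L ⊗[ℂ] U L) : U L ⊗[ℂ] (U L ⊗[ℂ] U L) :=
  Algebra.TensorProduct.assoc ℂ ℂ ℂ (U L) (U L) (U L)
    (Algebra.TensorProduct.map (coprod L) (AlgHom.id ℂ (U L)) b * (c ⊗ₜ[ℂ] (1 : U L)))

/-- The product `((1 ⊗ Δ) b) (1 ⊗ c)` in `U(g) ⊗ U(g) ⊗ U(g)`. -/
def rightComp (b c : U L ⊗[ℂ] U L) : U L ⊗[ℂ] (U L ⊗[ℂ] U L) :=
  Algebra.TensorProduct.map (AlgHom.id ℂ (U L)) (coprod L) b * ((1 : U L) ⊗ₜ[ℂ] c)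

/-- The projection of `U(g) ⊗ U(g) ⊗ U(g)` to its component of tri-degree `(i, j, k)`. -/
def triProj (i j k : ℤ) :
    U L ⊗[ℂ] (U L ⊗[ℂ] U L) →ₗ[ℂ] U L ⊗[ℂ] (U L ⊗[ℂ] U L) :=
  TensorProduct.map (Γ.degProj i) (TensorProduct.map (Γ.degProj j) (Γ.degProj k))

/-- A formal power series in `ħ` with coefficients in `W ⊗ W` satisfies the associativity equation
`((Δ ⊗ 1) B) (B ⊗ 1) = ((1 ⊗ Δ) B) (1 ⊗ B)` in `(W ⊗ W ⊗ W)[[ħ]]`. The products are computed on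
arbitrary representatives in `U(g) ⊗ U(g)`, chosen independently on the two sides. -/
def IsAssociative (B : ℕ → Γ.W ⊗[ℂ] Γ.W) : Prop :=
  ∀ R R' : ℕ → U L ⊗[ℂ] U L, (∀ m, Γ.proj₂ (R m) = B m) → (∀ m, Γ.proj₂ (R' m) = B m) →
    ∀ m : ℕ,
      Γ.proj₃ (∑ p ∈ Finset.HasAntidiagonal.antidiagonal m, leftComp (R p.1) (R p.2)) =
      Γ.proj₃ (∑ p ∈ Finset.HasAntidiagonal.antidiagonal m, rightComp (R' p.1) (R' p.2))

/-- `R` represents the formal power series `B` with coefficients in the completed tensor product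
`∏ n, W_{-n} ⊗ W_n`: the component `R m n` lies in `U(g)_{-n} ⊗ U(g)_n` and projects to `B m n`. -/
def IsRepresentative (B : ℕ → ℤ → Γ.W ⊗[ℂ] Γ.W) (R : ℕ → ℤ → U L ⊗[ℂ] U L) : Prop :=
  ∀ m n, R m n ∈ LinearMap.range (TensorProduct.map (Γ.homog (-n)).subtype (Γ.homog n).subtype) ∧
    Γ.proj₂ (R m n) = B m n

/-- The associativity equation `((Δ ⊗ 1) B) (B ⊗ 1) = ((1 ⊗ Δ) B) (1 ⊗ B)` for a formal power
series in `ħ` with coefficients in the completed tensor product `∏ n, W_{-n} ⊗ W_n`, as an equality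
in `(W ⊗ W ⊗ W)[[ħ]]`, the triple tensor product being completed with respect to the tri-degree.
Each component of the products is a sum with finitely many nonzero terms: the third degree `k`
on the left forces `q.1 = k`, and then, the coproduct of a given element having only finitely many
components, the first degree leaves finitely many values of `q.2`; similarly on the right. -/
def IsAssociativeCompleted (B : ℕ → ℤ → Γ.W ⊗[ℂ] Γ.W) : Prop :=
  ∀ R R' : ℕ → ℤ → U L ⊗[ℂ] U L, Γ.IsRepresentative B R → Γ.IsRepresentative B R' →
    ∀ (m : ℕ) (i j k : ℤ),
      Γ.proj₃ (∑ p ∈ Finset.HasAntidiagonal.antidiagonal m,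
        ∑ᶠ q : ℤ × ℤ, Γ.triProj i j k (leftComp (R p.1 q.1) (R p.2 q.2))) =
      Γ.proj₃ (∑ p ∈ Finset.HasAntidiagonal.antidiagonal m,
        ∑ᶠ q : ℤ × ℤ, Γ.triProj i j k (rightComp (R' p.1 q.1) (R' p.2 q.2)))

/-- The components of `π F`, for a formal power series `F` with coefficients in the completed tensor
product of `U(n₋)` and `U(n₊)`, where `π` is the projection to `W ⊗ W`. -/
def projSeries (F : ℕ → ∀ n : ℤ, Γ.UnegDeg n ⊗[ℂ] Γ.UposDeg n) : ℕ → ℤ → Γ.W ⊗[ℂ] Γ.W :=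
  fun m n => Γ.proj₂ (TensorProduct.map (Γ.UnegDeg n).subtype (Γ.UposDeg n).subtype (F m n))

/-- The coefficients in `W ⊗ W` of a formal power series all of whose coefficients have finitely
many nonzero components. -/
def total (B : ℕ → ℤ → Γ.W ⊗[ℂ] Γ.W) (m : ℕ) : Γ.W ⊗[ℂ] Γ.W := ∑ᶠ n : ℤ, B m n

end Grading

/-! ### Invariant star products on homogeneous spaces -/

section Geometry

variable {E : Type v} [NormedAddCommGroup E] [NormedSpace ℝ E]
  {G : Type w} [TopologicalSpace G] [ChartedSpace E G] [Group G] [LieGroup 𝓘(ℝ, E) ∞ G]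

variable (E G) in
/-- The real Lie algebra of a Lie group. -/
abbrev LieAlg : Type w := LeftInvariantDerivation 𝓘(ℝ, E) G

variable (E G) in
/-- Real-valued smooth functions on the group. -/
abbrev RealFun : Type w := C^∞⟮𝓘(ℝ, E), G; ℝ⟯

/-- The Lie algebra of a Lie group acts on smooth functions by left invariant vector fields. -/
instance lieRingModuleRealFun : LieRingModule (LieAlg E G) (RealFun E G) where
  bracket X f := X f
  add_lie _ _ _ := rfl
  lie_add X f g := map_add X f g
  leibniz_lie X Y f := by
    change X (Y f) = ⁅X, Y⁆ f + Y (X f)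
    rw [LeftInvariantDerivation.commutator_apply, sub_add_cancel]

instance lieModuleRealFun : LieModule ℝ (LieAlg E G) (RealFun E G) where
  smul_lie _ _ _ := rfl
  lie_smul c X f := map_smul X c f

variable (E G) in
/-- The complexified Lie algebra of a Lie group. -/
abbrev CLieAlg : Type w := ℂ ⊗[ℝ] LieAlg E G

variable (E G) in
/-- Complex-valued smooth functions on the group, as the complexification of the space of
real-valued ones: `1 ⊗ f₁ + i ⊗ f₂` stands for `f₁ + i f₂`. -/
abbrev CFun : Type w := ℂ ⊗[ℝ] RealFun E G

/-- The complex-valued function on the group given by an element of `CFun E G`. -/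
def CFun.eval : CFun E G →ₗ[ℝ] (G → ℂ) :=
  TensorProduct.lift (LinearMap.mk₂ ℝ (fun (z : ℂ) (f : RealFun E G) => fun g => z * (f g : ℂ))
    (fun z z' f => by ext g; simp [add_mul])
    (fun c z f => by ext g; simp [mul_assoc])
    (fun z f f' => by ext g; simp [mul_add])
    (fun c z f => by ext g; simp; ring))

variable {L : Type u} [LieRing L] [LieAlgebra ℂ L]

/-- The action of `U(g)` on smooth functions on `G` by left invariant differential operators, for an
identification `e` of `g` with the complexified Lie algebra of `G`. -/
def diffOp (e : L ≃ₗ⁅ℂ⁆ CLieAlg E G) : U L →ₐ[ℂ] Module.End ℂ (CFun E G) :=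
  UniversalEnvelopingAlgebra.lift ℂ
    ((LieModule.toEnd ℂ (CLieAlg E G) (CFun E G)).comp e.toLieHom)

/-- The left invariant bidifferential operator on `G` given by an element of `U(g) ⊗ U(g)`: the
element `u ⊗ v` sends `(f, f')` to `(u f) (v f')`. -/
def biDiffOp (e : L ≃ₗ⁅ℂ⁆ CLieAlg E G) (T : U L ⊗[ℂ] U L) (a b : CFun E G) : CFun E G :=
  LinearMap.mul' ℂ (CFun E G)
    (TensorProduct.homTensorHomMap (RingHom.id ℂ) (CFun E G) (CFun E G) (CFun E G) (CFun E G)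
      (TensorProduct.map (diffOp e).toLinearMap (diffOp e).toLinearMap T) (a ⊗ₜ[ℂ] b))

/-- The adjoint action of `h` in `G` on the Lie algebra of `G`: the left invariant derivation
`f ↦ R_h (X (R_{h⁻¹} f))`, where `(R_h f) g = f (g h)`. -/
def Ad (h : G) : LieAlg E G →ₗ[ℝ] LieAlg E G where
  toFun X :=
    { Derivation.mk'
        { toFun := fun f : RealFun E G => (X (f.comp (𝑹 𝓘(ℝ, E) h⁻¹))).comp (𝑹 𝓘(ℝ, E) h)
          map_add' := fun f f' => by
            ext g
            have : (f + f').comp (𝑹 𝓘(ℝ, E) h⁻¹) =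
              f.comp (𝑹 𝓘(ℝ, E) h⁻¹) + f'.comp (𝑹 𝓘(ℝ, E) h⁻¹) := rfl
            rw [this, X.map_add]; rfl
          map_smul' := fun c f => by
            ext g
            have : (c • f).comp (𝑹 𝓘(ℝ, E) h⁻¹) = c • f.comp (𝑹 𝓘(ℝ, E) h⁻¹) := rfl
            rw [this, X.map_smul]; rfl }
        (fun f f' => by
          ext g
          have h1 : (f * f').comp (𝑹 𝓘(ℝ, E) h⁻¹) =
            f.comp (𝑹 𝓘(ℝ, E) h⁻¹) * f'.comp (𝑹 𝓘(ℝ, E) h⁻¹) := rfl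
          have h2 : ∀ k : RealFun E G, k (g * h * h⁻¹) = k g := fun k => by
            rw [mul_inv_cancel_right]
          change (X ((f * f').comp (𝑹 𝓘(ℝ, E) h⁻¹))) (g * h) =
            f g * (X (f'.comp (𝑹 𝓘(ℝ, E) h⁻¹))) (g * h) +
            f' g * (X (f.comp (𝑹 𝓘(ℝ, E) h⁻¹))) (g * h)
          rw [h1, X.leibniz]
          change f (g * h * h⁻¹) * (X (f'.comp (𝑹 𝓘(ℝ, E) h⁻¹))) (g * h) +
            f' (g * h * h⁻¹) * (X (f.comp (𝑹 𝓘(ℝ, E) h⁻¹))) (g * h) = _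
          rw [h2, h2]) with
      left_invariant'' := fun g => by
        ext f
        change (X ((f.comp (𝑳 𝓘(ℝ, E) g)).comp (𝑹 𝓘(ℝ, E) h⁻¹))) (1 * h) =
          (X (f.comp (𝑹 𝓘(ℝ, E) h⁻¹))) (g * h)
        have h1 : (f.comp (𝑳 𝓘(ℝ, E) g)).comp (𝑹 𝓘(ℝ, E) h⁻¹) =
            (f.comp (𝑹 𝓘(ℝ, E) h⁻¹)).comp (𝑳 𝓘(ℝ, E) g) := by
          ext k
          change f (g * (k * h⁻¹)) = f (g * k * h⁻¹)
          rw [mul_assoc]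
        rw [h1, ← LeftInvariantDerivation.comp_L, one_mul]
        rfl }
  map_add' _ _ := rfl
  map_smul' _ _ := rfl

/-- The adjoint action of `h` in `G` on `g`, for an identification `e` of `g` with the complexified
Lie algebra of `G`. -/
def AdC (e : L ≃ₗ⁅ℂ⁆ CLieAlg E G) (h : G) : L →ₗ[ℂ] L :=
  e.symm.toLinearEquiv.toLinearMap ∘ₗ (Ad h).baseChange ℂ ∘ₗ e.toLinearEquiv.toLinearMap

variable (E) in
/-- The Lie algebra of a closed subgroup `H`: the left invariant derivations `X` that are the
velocity at `1` of a smooth one-parameter subgroup contained in `H`. -/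
def lieOfSubgroup (H : Subgroup G) : Set (LieAlg E G) :=
  {X | ∃ γ : ℝ → G, ContMDiff 𝓘(ℝ, ℝ) 𝓘(ℝ, E) ∞ γ ∧ (∀ s t, γ (s + t) = γ s * γ t) ∧
    (∀ t, γ t ∈ H) ∧ ∀ f : RealFun E G, HasDerivAt (fun t => f (γ t)) ((X f) 1) 0}

/-- The complexification of the Lie algebra of `H`, inside the complexified Lie algebra of `G`. -/
def complexLieOfSubgroup (H : Subgroup G) : Submodule ℂ (CLieAlg E G) :=
  Submodule.span ℂ ((fun X => (1 : ℂ) ⊗ₜ[ℝ] X) '' lieOfSubgroup E H)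

variable (E) in
/-- The algebra of complex-valued smooth functions on `G / H`. As the projection from `G` is a
submersion, these are the functions whose pullback to `G` is smooth. -/
def smoothFun (H : Subgroup G) : Subalgebra ℂ (G ⧸ H → ℂ) where
  carrier := {f | ContMDiff 𝓘(ℝ, E) 𝓘(ℝ, ℂ) ∞ (fun g : G => f (g : G ⧸ H))}
  mul_mem' hf hf' := contDiff_mul.contMDiff.comp (hf.prodMk_space hf')
  add_mem' hf hf' := contDiff_add.contMDiff.comp (hf.prodMk_space hf')
  algebraMap_mem' _ := contMDiff_const

/-- A linear operator on a commutative algebra is a differential operator of order at most `k`: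
its iterated commutators with `k + 1` multiplication operators are zero. On the algebra of smooth
functions on a manifold these are the usual differential operators. -/
def IsDiffOp {A : Type*} [CommRing A] [Algebra ℂ A] : ℕ → (A →ₗ[ℂ] A) → Prop
  | 0, D => ∀ f, D ∘ₗ LinearMap.mulLeft ℂ f = LinearMap.mulLeft ℂ f ∘ₗ D
  | k + 1, D => ∀ f, IsDiffOp k (D ∘ₗ LinearMap.mulLeft ℂ f - LinearMap.mulLeft ℂ f ∘ₗ D)

/-- The bilinear operators `P 0, P 1, ...` define an invariant star product
`f * f' = f f' + ∑ m > 0, ħ ^ m P m f f'` on `G / H`. -/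
structure IsInvariantStarProduct (H : Subgroup G)
    (P : ℕ → smoothFun E H →ₗ[ℂ] smoothFun E H →ₗ[ℂ] smoothFun E H) : Prop where
  /-- All coefficients are bidifferential operators. -/
  biDiff : ∀ m, ∃ k, ∀ f, IsDiffOp k (P m f) ∧ IsDiffOp k ((P m).flip f)
  /-- The coefficient of order zero is the product of functions. -/
  zero : ∀ f f', P 0 f f' = f * f'
  /-- The star product is associative. -/
  assoc : ∀ m f₁ f₂ f₃, ∑ p ∈ Finset.HasAntidiagonal.antidiagonal m, P p.1 (P p.2 f₁ f₂) f₃ =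
    ∑ p ∈ Finset.HasAntidiagonal.antidiagonal m, P p.1 f₁ (P p.2 f₂ f₃)
  /-- All coefficients commute with the action of `G`. -/
  invariant : ∀ (m : ℕ) (g : G) (f f' k k' : smoothFun E H),
    (∀ x : G ⧸ H, (k : G ⧸ H → ℂ) x = (f : G ⧸ H → ℂ) (g • x)) →
    (∀ x : G ⧸ H, (k' : G ⧸ H → ℂ) x = (f' : G ⧸ H → ℂ) (g • x)) →
    ∀ x : G ⧸ H, (P m k k' : G ⧸ H → ℂ) x = (P m f f' : G ⧸ H → ℂ) (g • x)

/-- The bilinear operators `P m` on functions on `G / H` are given by the classes `B m` in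
`(U(g) / U(g) g₀) ⊗ (U(g) / U(g) g₀)`: pulling back functions on `G / H` to `G` turns `P m` into the
left invariant bidifferential operator on `G` given by any representative of `B m`. -/
def IsDefinedBy (Γ : Grading L) (e : L ≃ₗ⁅ℂ⁆ CLieAlg E G) (H : Subgroup G)
    (P : ℕ → smoothFun E H →ₗ[ℂ] smoothFun E H →ₗ[ℂ] smoothFun E H)
    (B : ℕ → Γ.W ⊗[ℂ] Γ.W) : Prop :=
  ∀ (m : ℕ) (T : U L ⊗[ℂ] U L), Γ.proj₂ T = B m → ∀ (f f' : smoothFun E H) (a a' : CFun E G),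
    (∀ g : G, CFun.eval a g = (f : G ⧸ H → ℂ) g) →
    (∀ g : G, CFun.eval a' g = (f' : G ⧸ H → ℂ) g) →
    ∀ g : G, CFun.eval (biDiffOp e T a a') g = (P m f f' : G ⧸ H → ℂ) g

/-- The group `H` is compatible with the graded Lie algebra `g` and the character `χ`: it is a
closed subgroup of `G` with complexified Lie algebra `g₀`, whose adjoint action preserves the
grading and the character. The last two conditions are automatic when `H` is connected. -/
structure IsCompatible (Γ : Grading L) (χ : LieAlgebra.LieCharacter ℂ Γ.zeroPart)
    (e : L ≃ₗ⁅ℂ⁆ CLieAlg E G) (H : Subgroup G) : Prop where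
  closed : IsClosed (H : Set G)
  lie : (Γ.piece 0).map e.toLinearEquiv.toLinearMap = complexLieOfSubgroup H
  grading : ∀ h ∈ H, ∀ i, ∀ x ∈ Γ.piece i, AdC e h x ∈ Γ.piece i
  character : ∀ h ∈ H, ∀ x y : Γ.zeroPart, (y : L) = AdC e h x → χ y = χ x

end Geometry

end InvStar

end

/-! Put `t = 1/λ`. Nonsingularity of `χ` yields homogeneous bases `e_i` of `n₋` and `f_i` of `n₊`
with `χ([f_i, e_j]₀) = -δ_ij` (`DualSystem`). Treat `λ` as an indeterminate `X`. When an `f` is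
commuted through a product of `e`'s, the terms that gain a factor `X` lose a letter `e`. Hence the
form of a product of `k` letters `e` with a product of `l` letters `f` has degree at most `min k l`
in `X` (`coeff_polyForm_eq_zero`). For `k = l` its coefficient of `X ^ k` is that of the pairing of
symmetric algebras: zero unless the two multisets of indices agree, otherwise a product of
factorials (`DualSystem.coeff_polyForm_mono`).

Take the Gram matrix of ordered monomials of degree `n` and multiply the row of a monomial of length
`k` by `t ^ k`. The result is polynomial in `t`, and at `t = 0` it is triangular for the order by
length, with nonzero diagonal (`det_revGram_coeff_ne_zero`). So in each degree only finitely many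
`λ` are singular; the monomials are linearly independent; and the inverse Gram matrix, which is the
canonical element in coordinates, is regular at `t = 0`. Its Taylor series is the expansion. Since
only countably many parameters are excluded, the identity theorem gives uniqueness
(`Expands.eq_zero`), and it also carries linear and bilinear identities from the canonical elements
`F_λ` to the coefficients of the expansion.

Associativity is proved for fixed nonsingular `λ`. The right kernel of the form is a left ideal
complementary to `U(n₊)`, the left kernel one complementary to `U(n₋)`; let `P` and `Q` be the
projections. Expanding the outer tensor factors of the two sides in dual bases leaves in the middle
`∑ u'' P(S(u') y)` on the left and `∑ y'' Q(S(y') u)` on the right, with `u` in `U(n₋)` and `y` in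
`U(n₊)`. Both expressions `T(u, y)` satisfy `T(z u, y) = z T(u, y) - T(u, z y)` for every `z` in
`g`. Together with the triangular decomposition and the defining properties of `P` and `Q` this
forces them to agree modulo `U(g) g₀` (`IsSplitting.twist_sub_twist_mem`).

The form is `g₀`-invariant, hence so is `B`, and invariance makes the products independent of
representatives. In finite dimension the degrees of the `f_i` are bounded, while the coefficient of
`ħ ^ m` only involves monomials `e` of length at most `m`; so it has finitely many components.

On `G`, elements of `U(g)` act by left invariant operators, and `U(g) g₀` kills functions invariant
under right translation by `H`, which are the functions on `G / H`. The Leibniz rule is the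
coproduct, so the associativity equation becomes associativity of the product. The adjoint action of
`H` preserves the form, hence the canonical element, so the coefficients map `H`-invariant functions
to `H`-invariant functions.

That the projection `φ` exists is seen on the universal Verma module `U(n₋) ⊗ U(g₀)`, constructed by
hand (`zeroToQuot_bijective`). -/

noncomputable section

namespace InvStar

universe u v w

open TensorProduct

/-! ### Generators of the enveloping algebra and induction principles -/

section Basics

variable {K : Type u} [LieRing K] [LieAlgebra ℂ K]

theorem lift_inc {A : Type v} [Ring A] [Algebra ℂ A] (f : K →ₗ⁅ℂ⁆ A) (x : K) :
    UniversalEnvelopingAlgebra.lift ℂ f (inc K x) = f x :=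
  UniversalEnvelopingAlgebra.lift_ι_apply ℂ f x

theorem inc_lie (x y : K) : inc K ⁅x, y⁆ = inc K x * inc K y - inc K y * inc K x := by
  rw [LieHom.map_lie, LieRing.of_associative_ring_bracket]

/-- The universal property lifts the inclusion to a map into the generated subalgebra; composed with
the embedding of that subalgebra it is the identity, by uniqueness of lifts. -/
theorem adjoin_range_inc : Algebra.adjoin ℂ (Set.range (inc K)) = ⊤ := by
  set S := Algebra.adjoin ℂ (Set.range (inc K)) with hS
  let j : K →ₗ⁅ℂ⁆ S :=
    { toFun := fun x => ⟨inc K x, Algebra.subset_adjoin ⟨x, rfl⟩⟩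
      map_add' := fun x y => Subtype.ext (map_add _ x y)
      map_smul' := fun c x => Subtype.ext (map_smul _ c x)
      map_lie' := fun {x y} => Subtype.ext (inc_lie x y) }
  have h : S.val.comp (UniversalEnvelopingAlgebra.lift ℂ j) = AlgHom.id ℂ (U K) := by
    apply UniversalEnvelopingAlgebra.hom_ext
    ext x
    change ((UniversalEnvelopingAlgebra.lift ℂ j (inc K x) : S) : U K) = inc K x
    rw [lift_inc]; rfl
  rw [eq_top_iff]
  intro u _
  have := DFunLike.congr_fun h u
  change ((UniversalEnvelopingAlgebra.lift ℂ j u : S) : U K) = u at this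
  rw [← this]
  exact Subtype.property _

/-- Left induction in the enveloping algebra. -/
theorem U_induction {p : U K → Prop} (one : p 1) (smul : ∀ (c : ℂ) a, p a → p (c • a))
    (add : ∀ a b, p a → p b → p (a + b))
    (mul : ∀ (x : K) a, p a → p (inc K x * a)) (u : U K) : p u := by
  have hu : u ∈ Submodule.span ℂ (Submonoid.closure (Set.range (inc K)) : Set (U K)) := by
    rw [← Algebra.adjoin_eq_span, adjoin_range_inc]; trivial
  have hp0 : p 0 := by simpa using smul 0 1 one
  induction hu using Submodule.span_induction with
  | mem x hx =>
    induction hx using Submonoid.closure_induction_left with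
    | one => exact one
    | mul_left a ha b _ hb => obtain ⟨y, rfl⟩ := ha; exact mul y b hb
  | zero => exact hp0
  | add a b _ _ ha hb => exact add a b ha hb
  | smul c a _ ha => exact smul c a ha

/-- Multiplicative induction in the enveloping algebra. -/
theorem U_mul_induction {p : U K → Prop} (one : p 1) (smul : ∀ (c : ℂ) a, p a → p (c • a))
    (add : ∀ a b, p a → p b → p (a + b)) (inc : ∀ x, p (inc K x))
    (mul : ∀ a b, p a → p b → p (a * b)) (u : U K) : p u :=
  U_induction one smul add (fun x _ ha => mul _ _ (inc x) ha) u

variable (K) in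
/-- The counit of the enveloping algebra. -/
def counit : U K →ₐ[ℂ] ℂ := UniversalEnvelopingAlgebra.lift ℂ 0

theorem counit_inc (x : K) : counit K (inc K x) = 0 := lift_inc _ x

end Basics

/-! ### Induced modules -/

section Induced

variable {L : Type u} [LieRing L] [LieAlgebra ℂ L] (A : LieSubalgebra ℂ L)
  {V : Type v} [AddCommGroup V] [Module ℂ V] (pA : L →ₗ[ℂ] A) (τ : L →ₗ[ℂ] Module.End ℂ V)

/-- Left multiplication by an element of `U A` on `U A ⊗ V`. -/
def leftMulTensor (V : Type v) [AddCommGroup V] [Module ℂ V] (x : A) :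
    Module.End ℂ (U A ⊗[ℂ] V) := LinearMap.rTensor V (LinearMap.mulLeft ℂ (inc A x))

/-- The action of a subalgebra `A` on the space of linear maps from `L` to `U A ⊗ V`. -/
def homAction (V : Type v) [AddCommGroup V] [Module ℂ V] :
    A →ₗ⁅ℂ⁆ Module.End ℂ (L →ₗ[ℂ] U A ⊗[ℂ] V) where
  -- For fixed `m` consider the function `f : a ↦ a m` on `L`. An action of `L` must satisfy `a (x
  -- m) = x (a m) + [a, x] m`; the right side, as a function of `a`, dictates how `x` acts on `f`.
  toFun x := LinearMap.mk₂ ℂ (fun f a => leftMulTensor A V x (f a) + f ⁅a, (x : L)⁆)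
    (fun f g a => by simp; abel) (fun c f a => by simp) (fun f a b => by simp; abel)
    (fun c f a => by simp)
  map_add' x y := by
    ext f a
    have h0 : ⁅a, ((x + y : A) : L)⁆ = ⁅a, (x : L)⁆ + ⁅a, (y : L)⁆ := lie_add _ _ _
    simp only [leftMulTensor, LinearMap.mk₂_apply, LinearMap.add_apply, map_add, h0]
    have : LinearMap.rTensor V (LinearMap.mulLeft ℂ (inc A x + inc A y)) (f a) =
      LinearMap.rTensor V (LinearMap.mulLeft ℂ (inc A x)) (f a) +
      LinearMap.rTensor V (LinearMap.mulLeft ℂ (inc A y)) (f a) := by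
      rw [← LinearMap.add_apply, ← LinearMap.rTensor_add]
      congr 2; ext u; simp [add_mul]
    rw [this]; abel
  map_smul' c x := by
    ext f a
    have h0 : ⁅a, ((c • x : A) : L)⁆ = c • ⁅a, (x : L)⁆ := lie_smul _ _ _
    simp only [leftMulTensor, LinearMap.mk₂_apply, LinearMap.smul_apply, map_smul, h0,
      RingHom.id_apply, smul_add]
    congr 1
    rw [← LinearMap.smul_apply, ← LinearMap.rTensor_smul]
    congr 2; ext u; simp
  map_lie' {x y} := by
    ext f a
    have h : leftMulTensor A V ⁅x, y⁆ (f a) = leftMulTensor A V x (leftMulTensor A V y (f a)) -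
        leftMulTensor A V y (leftMulTensor A V x (f a)) := by
      simp only [leftMulTensor]
      rw [← LinearMap.rTensor_comp_apply, ← LinearMap.rTensor_comp_apply, ← LinearMap.sub_apply,
        ← LinearMap.rTensor_sub]
      congr 2; ext u
      simp only [LinearMap.mulLeft_apply, LinearMap.sub_apply, LinearMap.comp_apply]
      rw [inc_lie, sub_mul, mul_assoc, mul_assoc]
    simp only [LieRing.of_associative_ring_bracket, LinearMap.mk₂_apply, LinearMap.sub_apply,
      Module.End.mul_apply, LieSubalgebra.coe_bracket, h, map_add]
    have h2 : f ⁅a, ⁅(x : L), (y : L)⁆⁆ =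
        f ⁅⁅a, (x : L)⁆, (y : L)⁆ - f ⁅⁅a, (y : L)⁆, (x : L)⁆ := by
      rw [← map_sub]; congr 1
      rw [lie_lie a (x : L), ← lie_skew ⁅a, (y : L)⁆ (x : L)]; abel
    rw [h2]; abel

/-- The value at the generator `1 ⊗ v` of the action of `L` on the induced module. -/
def genAction : V →ₗ[ℂ] L →ₗ[ℂ] U A ⊗[ℂ] V :=
  LinearMap.mk₂ ℂ (fun v a => inc A (pA a) ⊗ₜ v + 1 ⊗ₜ τ a v)
    (fun v v' a => by simp only [tmul_add, map_add]; abel)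
    (fun c v a => by simp only [tmul_smul, map_smul, smul_add])
    (fun v a b => by simp only [map_add, add_tmul, tmul_add, LinearMap.add_apply]; abel)
    (fun c v a => by simp only [map_smul, smul_tmul', tmul_smul, LinearMap.smul_apply, smul_add])

/-- The operators on `U A ⊗ V` by which the elements of `L` act on the module induced from a
complement of `A`. -/
def indAction : L →ₗ[ℂ] Module.End ℂ (U A ⊗[ℂ] V) :=
  (TensorProduct.lift (LinearMap.mk₂ ℂ
    -- The function `a ↦ a (u ⊗ v)` is obtained from `a ↦ a (1 ⊗ v)` by letting `u` act on
    -- functions. Since `U A ⊗ V` is free over `U A`, nothing has to be checked for this to be well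
    -- defined.
    (fun (u : U A) (v : V) => UniversalEnvelopingAlgebra.lift ℂ (homAction A V) u
      (genAction A pA τ v))
    (fun u u' v => by simp) (fun c u v => by simp) (fun u v v' => by simp)
    (fun c u v => by simp))).flip

theorem indAction_tmul (a : L) (u : U A) (v : V) : indAction A pA τ a (u ⊗ₜ v) =
    UniversalEnvelopingAlgebra.lift ℂ (homAction A V) u (genAction A pA τ v) a := rfl

theorem indAction_one_tmul (a : L) (v : V) :
    indAction A pA τ a (1 ⊗ₜ v) = inc A (pA a) ⊗ₜ v + 1 ⊗ₜ τ a v := by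
  rw [indAction_tmul, map_one]; rfl

/-- The rule `a x = x a + [a, x]`, built into `homAction`: the function attached to `x u ⊗ v` is `x`
applied to the function attached to `u ⊗ v`. -/
theorem indAction_leftMulTensor (a : L) (x : A) (m : U A ⊗[ℂ] V) :
    indAction A pA τ a (leftMulTensor A V x m) =
      leftMulTensor A V x (indAction A pA τ a m) + indAction A pA τ ⁅a, (x : L)⁆ m := by
  induction m using TensorProduct.induction_on with
  | zero => simp
  | add m m' h h' => simp only [map_add, h, h']; abel
  | tmul u v =>
    have h1 : leftMulTensor A V x (u ⊗ₜ v) = (inc A x * u) ⊗ₜ[ℂ] v := rfl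
    rw [h1, indAction_tmul, map_mul, lift_inc, Module.End.mul_apply]
    rfl

theorem indAction_coe (hpA : ∀ x : A, pA x = x) (hτ : ∀ x : A, τ x = 0) (x : A)
    (m : U A ⊗[ℂ] V) : indAction A pA τ x m = leftMulTensor A V x m := by
  induction m using TensorProduct.induction_on with
  | zero => simp
  | add m m' h h' => simp only [map_add, h, h']
  | tmul u v =>
    induction u using U_induction generalizing x with
    | one => rw [indAction_one_tmul, hpA, hτ]; simp [leftMulTensor]
    | smul c a h => rw [← smul_tmul', map_smul, map_smul, h]
    | add a b ha hb => rw [add_tmul, map_add, map_add, ha, hb]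
    | mul y a h =>
      have h1 : ∀ z : A, ∀ w : U A, (inc A z * w) ⊗ₜ[ℂ] v = leftMulTensor A V z (w ⊗ₜ v) :=
        fun _ _ => rfl
      rw [h1, indAction_leftMulTensor, h, ← LieSubalgebra.coe_bracket, h, ← h1, ← h1, ← h1, ← h1,
        ← add_tmul, inc_lie, sub_mul, mul_assoc, mul_assoc, add_sub_cancel]
      rfl

/-- Brackets with an element of `A` are covered by the commutation rule. On a generator `1 ⊗ v`,
split `a` and `b` along `A` and the kernel of `pA`; the hypotheses say that this kernel is a
subalgebra represented by `τ`, which settles the remaining bracket. The Jacobi identity then passes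
from `u ⊗ v` to `x u ⊗ v`. -/
theorem indAction_lie (hpA : ∀ x : A, pA x = x) (hτ : ∀ x : A, τ x = 0)
    (hker : ∀ a b, pA a = 0 → pA b = 0 → pA ⁅a, b⁆ = 0)
    (hτ' : ∀ a b, pA a = 0 → pA b = 0 → τ ⁅a, b⁆ = τ a * τ b - τ b * τ a) (a b : L) :
    indAction A pA τ ⁅a, b⁆ =
      indAction A pA τ a * indAction A pA τ b - indAction A pA τ b * indAction A pA τ a := by
  set ρ := indAction A pA τ with hρ
  have hsub : ∀ (x : A) (b : L) m, ρ ⁅(x : L), b⁆ m = ρ x (ρ b m) - ρ b (ρ x m) := by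
    intro x b m
    rw [hρ, indAction_coe A pA τ hpA hτ, indAction_coe A pA τ hpA hτ, indAction_leftMulTensor,
      ← lie_skew, map_neg, LinearMap.neg_apply]
    abel
  have key : ∀ (u : U A) (a b : L) (v : V),
      ρ ⁅a, b⁆ (u ⊗ₜ v) = ρ a (ρ b (u ⊗ₜ v)) - ρ b (ρ a (u ⊗ₜ v)) := by
    intro u
    induction u using U_induction with
    | one =>
      intro a b v
      have hd : ∀ c : L, ∃ (x : A) (d : L), pA d = 0 ∧ c = x + d := fun c =>
        ⟨pA c, c - pA c, by rw [map_sub, hpA, sub_self], by abel⟩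
      obtain ⟨x, a', ha', rfl⟩ := hd a
      obtain ⟨y, b', hb', rfl⟩ := hd b
      have h0 : ρ ⁅a', b'⁆ (1 ⊗ₜ v) = ρ a' (ρ b' (1 ⊗ₜ v)) - ρ b' (ρ a' (1 ⊗ₜ v)) := by
        rw [hρ, indAction_one_tmul, indAction_one_tmul, indAction_one_tmul, ha', hb',
          hker a' b' ha' hb', hτ' a' b' ha' hb']
        simp only [map_zero, zero_tmul, zero_add, indAction_one_tmul, ha', hb']
        simp [tmul_sub]
      have h1 : ρ ⁅a', (y : L)⁆ (1 ⊗ₜ v) = ρ a' (ρ y (1 ⊗ₜ v)) - ρ y (ρ a' (1 ⊗ₜ v)) := by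
        rw [← lie_skew, map_neg, LinearMap.neg_apply, hsub]; abel
      rw [add_lie, lie_add, lie_add]
      simp only [map_add, LinearMap.add_apply, hsub, h0, h1]
      abel
    | smul c u h => intro a b v; simp only [← smul_tmul', map_smul, h, smul_sub]
    | add u u' h h' => intro a b v; simp only [add_tmul, map_add, h, h']; abel
    | mul x u h =>
      intro a b v
      have h1 : (inc A x * u) ⊗ₜ[ℂ] v = leftMulTensor A V x (u ⊗ₜ v) := rfl
      have h2 : ∀ c m, ρ c (leftMulTensor A V x m) =
        leftMulTensor A V x (ρ c m) + ρ ⁅c, (x : L)⁆ m := fun c =>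
      indAction_leftMulTensor A pA τ c x
      rw [h1]
      simp only [h2, map_add]
      have h3 : ⁅⁅a, b⁆, (x : L)⁆ = ⁅⁅a, (x : L)⁆, b⁆ + ⁅a, ⁅b, (x : L)⁆⁆ := by
        rw [lie_lie, ← lie_skew b ⁅a, (x : L)⁆]; abel
      rw [h3]
      simp only [map_add, LinearMap.add_apply, h, map_sub]
      abel
  ext m
  change ρ ⁅a, b⁆ _ = ρ a (ρ b _) - ρ b (ρ a _)
  exact key _ a b _

/-- The induced module as an algebra homomorphism on `U L`. -/
def indRep (hpA : ∀ x : A, pA x = x) (hτ : ∀ x : A, τ x = 0)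
    (hker : ∀ a b, pA a = 0 → pA b = 0 → pA ⁅a, b⁆ = 0)
    (hτ' : ∀ a b, pA a = 0 → pA b = 0 → τ ⁅a, b⁆ = τ a * τ b - τ b * τ a) :
    U L →ₐ[ℂ] Module.End ℂ (U A ⊗[ℂ] V) :=
  UniversalEnvelopingAlgebra.lift ℂ
    { indAction A pA τ with
      map_lie' := fun {a b} => by
        rw [LieRing.of_associative_ring_bracket]
        exact indAction_lie A pA τ hpA hτ hker hτ' a b }

end Induced


/-! ### Graded pieces, the universal Verma module and the projection to `U(g₀)` -/

namespace Grading

variable {L : Type u} [LieRing L] [LieAlgebra ℂ L] (Γ : Grading L)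

theorem piece_induction {p : L → Prop} (zero : p 0) (add : ∀ x y, p x → p y → p (x + y))
    (mem : ∀ i, ∀ x ∈ Γ.piece i, p x) (x : L) : p x := by
  have hx : x ∈ ⨆ i, Γ.piece i := by rw [Γ.isInternal.submodule_iSup_eq_top]; trivial
  induction hx using Submodule.iSup_induction' with
  | zero => exact zero
  | add a b _ _ ha hb => exact add a b ha hb
  | mem i a hi => exact mem i a hi

theorem mem_negPart {i : ℤ} (hi : i < 0) {x : L} (hx : x ∈ Γ.piece i) : x ∈ Γ.negPart :=
  Submodule.mem_iSup_of_mem (p := fun i : {i : ℤ // i < 0} => Γ.piece i) ⟨i, hi⟩ hx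

theorem mem_posPart {i : ℤ} (hi : 0 < i) {x : L} (hx : x ∈ Γ.piece i) : x ∈ Γ.posPart :=
  Submodule.mem_iSup_of_mem (p := fun i : {i : ℤ // 0 < i} => Γ.piece i) ⟨i, hi⟩ hx

theorem neg_induction {p : (x : L) → x ∈ Γ.negPart → Prop} (zero : p 0 (zero_mem _))
    (add : ∀ x y hx hy, p x hx → p y hy → p (x + y) (add_mem hx hy))
    (mem : ∀ i, ∀ hi : i < 0, ∀ x, ∀ hx : x ∈ Γ.piece i, p x (Γ.mem_negPart hi hx)) {x : L}
    (hx : x ∈ Γ.negPart) : p x hx := by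
  unfold negPart at hx
  induction hx using Submodule.iSup_induction' with
  | zero => exact zero
  | add a b ha hb iha ihb => exact add a b ha hb iha ihb
  | mem i a hi => exact mem i i.2 a hi

theorem pos_induction {p : (x : L) → x ∈ Γ.posPart → Prop} (zero : p 0 (zero_mem _))
    (add : ∀ x y hx hy, p x hx → p y hy → p (x + y) (add_mem hx hy))
    (mem : ∀ i, ∀ hi : 0 < i, ∀ x, ∀ hx : x ∈ Γ.piece i, p x (Γ.mem_posPart hi hx)) {x : L}
    (hx : x ∈ Γ.posPart) : p x hx := by
  unfold posPart at hx
  induction hx using Submodule.iSup_induction' with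
  | zero => exact zero
  | add a b ha hb iha ihb => exact add a b ha hb iha ihb
  | mem i a hi => exact mem i i.2 a hi

theorem decomp_of_mem {i : ℤ} {x : L} (hx : x ∈ Γ.piece i) :
    Γ.decomp x = DirectSum.lof ℂ ℤ (fun i => Γ.piece i) i ⟨x, hx⟩ := by
  rw [decomp, LinearEquiv.symm_apply_eq]
  exact (DirectSum.coeLinearMap_lof Γ.piece i ⟨x, hx⟩).symm

theorem comp_of_mem {i : ℤ} {x : L} (hx : x ∈ Γ.piece i) : Γ.comp i x = ⟨x, hx⟩ := by
  rw [comp, LinearMap.comp_apply, LinearEquiv.coe_coe, Γ.decomp_of_mem hx,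
    DirectSum.component.lof_self]

theorem comp_of_mem_ne {i j : ℤ} (hij : i ≠ j) {x : L} (hx : x ∈ Γ.piece i) :
    Γ.comp j x = 0 := by
  rw [comp, LinearMap.comp_apply, LinearEquiv.coe_coe, Γ.decomp_of_mem hx, DirectSum.component.of,
    dif_neg hij]

theorem toZero_of_mem {x : L} (hx : x ∈ Γ.piece 0) : Γ.toZero x = ⟨x, hx⟩ := Γ.comp_of_mem hx

theorem toZero_coe (x : Γ.zeroPart) : Γ.toZero x = x := Γ.comp_of_mem x.2

theorem toZero_of_mem_ne {i : ℤ} (hi : i ≠ 0) {x : L} (hx : x ∈ Γ.piece i) : Γ.toZero x = 0 :=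
  Γ.comp_of_mem_ne hi hx

open Classical in
/-- The projection of `L` to the sum of the graded pieces whose degree satisfies `S`. -/
def partProj (S : ℤ → Prop) : L →ₗ[ℂ] L :=
  DirectSum.toModule ℂ ℤ L (fun i => if S i then (Γ.piece i).subtype else 0) ∘ₗ
    Γ.decomp.toLinearMap

theorem partProj_of_mem {S : ℤ → Prop} {i : ℤ} (hi : S i) {x : L} (hx : x ∈ Γ.piece i) :
    Γ.partProj S x = x := by
  rw [partProj, LinearMap.comp_apply, LinearEquiv.coe_coe, Γ.decomp_of_mem hx,
    DirectSum.toModule_lof, if_pos hi]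
  rfl

theorem partProj_of_mem_not {S : ℤ → Prop} {i : ℤ} (hi : ¬ S i) {x : L} (hx : x ∈ Γ.piece i) :
    Γ.partProj S x = 0 := by
  rw [partProj, LinearMap.comp_apply, LinearEquiv.coe_coe, Γ.decomp_of_mem hx,
    DirectSum.toModule_lof, if_neg hi]
  rfl

theorem partProj_neg_mem (x : L) : Γ.partProj (· < 0) x ∈ Γ.negPart := by
  induction x using Γ.piece_induction with
  | zero => simp
  | add x y hx hy => rw [map_add]; exact add_mem hx hy
  | mem i x hx =>
    by_cases hi : i < 0
    · rw [Γ.partProj_of_mem (S := (· < 0)) hi hx]; exact Γ.mem_negPart hi hx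
    · rw [Γ.partProj_of_mem_not (S := (· < 0)) hi hx]; exact zero_mem _

theorem partProj_pos_mem (x : L) : Γ.partProj (0 < ·) x ∈ Γ.posPart := by
  induction x using Γ.piece_induction with
  | zero => simp
  | add x y hx hy => rw [map_add]; exact add_mem hx hy
  | mem i x hx =>
    by_cases hi : 0 < i
    · rw [Γ.partProj_of_mem (S := (0 < ·)) hi hx]; exact Γ.mem_posPart hi hx
    · rw [Γ.partProj_of_mem_not (S := (0 < ·)) hi hx]; exact zero_mem _

theorem partProj_add (x : L) :
    Γ.partProj (· < 0) x + (Γ.toZero x : L) + Γ.partProj (0 < ·) x = x := by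
  induction x using Γ.piece_induction with
  | zero => simp
  | add x y hx hy =>
    rw [map_add, map_add, map_add]
    conv_rhs => rw [← hx, ← hy]
    rw [show ((Γ.toZero x + Γ.toZero y : Γ.zeroPart) : L) = Γ.toZero x + Γ.toZero y from rfl]
    abel
  | mem i x hx =>
    rcases lt_trichotomy i 0 with hi | hi | hi
    · rw [Γ.partProj_of_mem (S := (· < 0)) hi hx, Γ.toZero_of_mem_ne hi.ne hx,
        Γ.partProj_of_mem_not (S := (0 < ·)) hi.not_gt hx]
      simp
    · subst hi
      rw [Γ.partProj_of_mem_not (S := (· < 0)) (lt_irrefl _) hx, Γ.toZero_of_mem hx,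
        Γ.partProj_of_mem_not (S := (0 < ·)) (lt_irrefl _) hx]
      simp
    · rw [Γ.partProj_of_mem_not (S := (· < 0)) hi.not_gt hx, Γ.toZero_of_mem_ne hi.ne' hx,
        Γ.partProj_of_mem (S := (0 < ·)) hi hx]
      simp

/-- A decomposition of an element into its negative, zero and positive parts. -/
theorem exists_decomp (x : L) :
    ∃ a ∈ Γ.negPart, ∃ h : Γ.zeroPart, ∃ b ∈ Γ.posPart, x = a + h + b ∧ h = Γ.toZero x :=
  ⟨_, Γ.partProj_neg_mem x, _, _, Γ.partProj_pos_mem x, (Γ.partProj_add x).symm, rfl⟩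

theorem lie_mem_negPart {x y : L} (hx : x ∈ Γ.negPart) (hy : y ∈ Γ.negPart) :
    ⁅x, y⁆ ∈ Γ.negPart := by
  induction hx using Γ.neg_induction with
  | zero => simp
  | add a b _ _ ha hb => rw [add_lie]; exact add_mem ha hb
  | mem i hi a ha =>
    induction hy using Γ.neg_induction with
    | zero => simp
    | add c d _ _ hc hd => rw [lie_add]; exact add_mem hc hd
    | mem j hj c hc => exact Γ.mem_negPart (add_neg hi hj) (Γ.lie_mem ha hc)

theorem lie_mem_posPart {x y : L} (hx : x ∈ Γ.posPart) (hy : y ∈ Γ.posPart) :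
    ⁅x, y⁆ ∈ Γ.posPart := by
  induction hx using Γ.pos_induction with
  | zero => simp
  | add a b _ _ ha hb => rw [add_lie]; exact add_mem ha hb
  | mem i hi a ha =>
    induction hy using Γ.pos_induction with
    | zero => simp
    | add c d _ _ hc hd => rw [lie_add]; exact add_mem hc hd
    | mem j hj c hc => exact Γ.mem_posPart (add_pos hi hj) (Γ.lie_mem ha hc)

theorem zero_lie_mem_negPart (h : Γ.zeroPart) {y : L} (hy : y ∈ Γ.negPart) :
    ⁅(h : L), y⁆ ∈ Γ.negPart := by
  induction hy using Γ.neg_induction with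
  | zero => simp
  | add c d _ _ hc hd => rw [lie_add]; exact add_mem hc hd
  | mem j hj c hc => exact Γ.mem_negPart (by omega) (Γ.lie_mem (i := 0) (j := j) h.2 hc)

theorem zero_lie_mem_posPart (h : Γ.zeroPart) {y : L} (hy : y ∈ Γ.posPart) :
    ⁅(h : L), y⁆ ∈ Γ.posPart := by
  induction hy using Γ.pos_induction with
  | zero => simp
  | add c d _ _ hc hd => rw [lie_add]; exact add_mem hc hd
  | mem j hj c hc => exact Γ.mem_posPart (by omega) (Γ.lie_mem (i := 0) (j := j) h.2 hc)

/-- The negative part as a Lie subalgebra. -/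
def negLie : LieSubalgebra ℂ L := { Γ.negPart with lie_mem' := Γ.lie_mem_negPart }

/-- The projection to the negative part. -/
def toNeg : L →ₗ[ℂ] Γ.negLie := (Γ.partProj (· < 0)).codRestrict _ Γ.partProj_neg_mem

theorem partProj_neg_of_mem_negPart {x : L} (hx : x ∈ Γ.negPart) : Γ.partProj (· < 0) x = x := by
  induction hx using Γ.neg_induction with
  | zero => simp
  | add a b _ _ ha hb => rw [map_add, ha, hb]
  | mem i hi a ha => exact Γ.partProj_of_mem (S := (· < 0)) hi ha

theorem toZero_of_mem_negPart {x : L} (hx : x ∈ Γ.negPart) : Γ.toZero x = 0 := by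
  induction hx using Γ.neg_induction with
  | zero => simp
  | add a b _ _ ha hb => rw [map_add, ha, hb, add_zero]
  | mem i hi a ha => exact Γ.toZero_of_mem_ne hi.ne ha

theorem toZero_of_mem_posPart {x : L} (hx : x ∈ Γ.posPart) : Γ.toZero x = 0 := by
  induction hx using Γ.pos_induction with
  | zero => simp
  | add a b _ _ ha hb => rw [map_add, ha, hb, add_zero]
  | mem i hi a ha => exact Γ.toZero_of_mem_ne hi.ne' ha

theorem partProj_neg_of_mem_posPart {x : L} (hx : x ∈ Γ.posPart) : Γ.partProj (· < 0) x = 0 := by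
  induction hx using Γ.pos_induction with
  | zero => simp
  | add a b _ _ ha hb => rw [map_add, ha, hb, add_zero]
  | mem i hi a ha => exact Γ.partProj_of_mem_not (S := (· < 0)) hi.not_gt ha

/-- The action of `L` on `U(g₀)` in which only the component of degree zero acts. -/
def zeroAction : L →ₗ[ℂ] Module.End ℂ (U Γ.zeroPart) :=
  LinearMap.mul ℂ (U Γ.zeroPart) ∘ₗ (inc Γ.zeroPart).toLinearMap ∘ₗ Γ.toZero

theorem zeroAction_apply (x : L) (v : U Γ.zeroPart) :
    Γ.zeroAction x v = inc _ (Γ.toZero x) * v := rfl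

theorem exists_of_toNeg_eq_zero {a : L} (ha : Γ.toNeg a = 0) :
    ∃ h : Γ.zeroPart, ∃ b ∈ Γ.posPart, a = h + b := by
  refine ⟨Γ.toZero a, _, Γ.partProj_pos_mem a, ?_⟩
  have h0 : Γ.partProj (· < 0) a = 0 := congrArg Subtype.val ha
  conv_lhs => rw [← Γ.partProj_add a, h0, zero_add]

/-- In the subalgebra of nonnegative degrees the positive part is an ideal with quotient `g₀`. This
is what makes `U(g₀)` a module over it and so provides both hypotheses on the complement of `n₋` in
`vermaRep`. -/
theorem exists_lie_of_toNeg_eq_zero {a b : L} (ha : Γ.toNeg a = 0) (hb : Γ.toNeg b = 0) :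
    ∃ c ∈ Γ.posPart, ⁅a, b⁆ = (⁅Γ.toZero a, Γ.toZero b⁆ : Γ.zeroPart) + c := by
  obtain ⟨h, x, hx, rfl⟩ := Γ.exists_of_toNeg_eq_zero ha
  obtain ⟨k, y, hy, rfl⟩ := Γ.exists_of_toNeg_eq_zero hb
  rw [map_add, map_add, toZero_coe, toZero_coe, Γ.toZero_of_mem_posPart hx,
    Γ.toZero_of_mem_posPart hy, add_zero, add_zero]
  refine ⟨⁅(h : L), y⁆ + ⁅x, (k : L)⁆ + ⁅x, y⁆, ?_, ?_⟩
  · refine add_mem (add_mem (Γ.zero_lie_mem_posPart h hy) ?_) (Γ.lie_mem_posPart hx hy)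
    rw [← lie_skew]; exact neg_mem (Γ.zero_lie_mem_posPart k hx)
  · rw [LieSubalgebra.coe_bracket, add_lie, lie_add, lie_add]; abel

/-- The representation of `U(g)` on `U(n₋) ⊗ U(g₀)`, the universal Verma module. -/
def vermaRep : U L →ₐ[ℂ] Module.End ℂ (U Γ.negLie ⊗[ℂ] U Γ.zeroPart) :=
  indRep Γ.negLie Γ.toNeg Γ.zeroAction
    (fun x => Subtype.ext (Γ.partProj_neg_of_mem_negPart x.2))
    (fun x => by ext v; rw [zeroAction_apply, Γ.toZero_of_mem_negPart x.2]; simp)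
    (fun a b ha hb => by
      obtain ⟨c, hc, h⟩ := Γ.exists_lie_of_toNeg_eq_zero ha hb
      refine Subtype.ext ?_
      change Γ.partProj (· < 0) ⁅a, b⁆ = 0
      rw [h, map_add, Γ.partProj_neg_of_mem_posPart hc,
        Γ.partProj_of_mem_not (S := (· < 0)) (lt_irrefl 0)
          (x := ((⁅Γ.toZero a, Γ.toZero b⁆ : Γ.zeroPart) : L)) (Subtype.property _), add_zero])
    (fun a b ha hb => by
      obtain ⟨c, hc, h⟩ := Γ.exists_lie_of_toNeg_eq_zero ha hb
      ext v
      rw [h]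
      simp only [LinearMap.sub_apply, Module.End.mul_apply, zeroAction_apply]
      rw [map_add, toZero_coe, Γ.toZero_of_mem_posPart hc, add_zero, inc_lie, sub_mul, mul_assoc,
        mul_assoc])

theorem vermaRep_inc (x : L) :
    Γ.vermaRep (inc L x) = indAction Γ.negLie Γ.toNeg Γ.zeroAction x := lift_inc _ x

/-- The projection `U(g) → U(g₀)` obtained from the universal Verma module. -/
def vermaProj : U L →ₗ[ℂ] U Γ.zeroPart :=
  (TensorProduct.lid ℂ (U Γ.zeroPart)).toLinearMap ∘ₗ
    LinearMap.rTensor (U Γ.zeroPart) (counit Γ.negLie).toLinearMap ∘ₗ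
      Γ.vermaRep.toLinearMap.flip (1 ⊗ₜ 1)

theorem vermaProj_apply (u : U L) : Γ.vermaProj u = TensorProduct.lid ℂ (U Γ.zeroPart)
    (LinearMap.rTensor (U Γ.zeroPart) (counit Γ.negLie).toLinearMap
      (Γ.vermaRep u (1 ⊗ₜ 1))) := rfl

/-- A left factor in `n₋` acts on `U(n₋) ⊗ U(g₀)` by left multiplication and is killed by the
counit; a right factor in `n₊` already kills the generator `1 ⊗ 1`. -/
theorem vermaProj_offZero {z : U L} (hz : z ∈ Γ.offZero) : Γ.vermaProj z = 0 := by
  change z ∈ LinearMap.ker Γ.vermaProj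
  refine (sup_le ?_ ?_ : Γ.offZero ≤ _) hz
  · rw [Submodule.span_le]
    rintro _ ⟨a, ha, b, rfl⟩
    change Γ.vermaProj _ = 0
    rw [vermaProj_apply, map_mul, Module.End.mul_apply, vermaRep_inc]
    generalize Γ.vermaRep b (1 ⊗ₜ 1) = m
    have h1 := indAction_coe Γ.negLie Γ.toNeg Γ.zeroAction
      (fun x => Subtype.ext (Γ.partProj_neg_of_mem_negPart x.2))
      (fun x => by ext v; rw [zeroAction_apply, Γ.toZero_of_mem_negPart x.2]; simp) ⟨a, ha⟩ m
    change indAction Γ.negLie Γ.toNeg Γ.zeroAction a m = _ at h1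
    rw [h1, leftMulTensor, ← LinearMap.rTensor_comp_apply]
    have h2 : (counit Γ.negLie).toLinearMap ∘ₗ LinearMap.mulLeft ℂ (inc Γ.negLie ⟨a, ha⟩) = 0 := by
      ext u
      change counit _ (inc _ _ * u) = 0
      rw [map_mul, counit_inc, zero_mul]
    rw [h2]; simp
  · rw [Submodule.span_le]
    rintro _ ⟨a, ha, b, rfl⟩
    change Γ.vermaProj _ = 0
    rw [vermaProj_apply, map_mul, Module.End.mul_apply, vermaRep_inc, indAction_one_tmul]
    have h1 : Γ.toNeg a = 0 := Subtype.ext (Γ.partProj_neg_of_mem_posPart ha)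
    rw [h1, zeroAction_apply, Γ.toZero_of_mem_posPart ha]
    simp

theorem zeroIncl_inc (x : Γ.zeroPart) : Γ.zeroIncl (inc _ x) = inc L x := lift_inc _ x

theorem vermaRep_zeroIncl (u v : U Γ.zeroPart) :
    Γ.vermaRep (Γ.zeroIncl u) (1 ⊗ₜ v) = 1 ⊗ₜ (u * v) := by
  induction u using U_induction with
  | one => simp
  | smul c a h => simp [h]
  | add a b ha hb => simp [ha, hb, add_mul, tmul_add]
  | mul x a h =>
    rw [map_mul, map_mul, Module.End.mul_apply, h, zeroIncl_inc, vermaRep_inc, indAction_one_tmul]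
    have h1 : Γ.toNeg x = 0 :=
      Subtype.ext (Γ.partProj_of_mem_not (S := (· < 0)) (lt_irrefl 0) x.2)
    rw [h1, zeroAction_apply, toZero_coe, map_zero, zero_tmul, zero_add, mul_assoc]

theorem vermaProj_zeroIncl (u : U Γ.zeroPart) : Γ.vermaProj (Γ.zeroIncl u) = u := by
  rw [vermaProj_apply, vermaRep_zeroIncl]; simp

theorem neg_mul_mem_offZero {a : L} (ha : a ∈ Γ.negPart) (b : U L) : inc L a * b ∈ Γ.offZero :=
  Submodule.mem_sup_left (Submodule.subset_span ⟨a, ha, b, rfl⟩)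

theorem mul_pos_mem_offZero {a : L} (ha : a ∈ Γ.posPart) (b : U L) : b * inc L a ∈ Γ.offZero :=
  Submodule.mem_sup_right (Submodule.subset_span ⟨a, ha, b, rfl⟩)

/-- If bracketing with `A` preserves `B`, and left multiplication by `B` maps `D` into `U(A) D`,
then left multiplication by `B` preserves `U(A) D`. -/
theorem inc_mul_mem_adjoin_mul {A B : Submodule ℂ L} {D : Submodule ℂ (U L)}
    (hAB : ∀ b ∈ B, ∀ a ∈ A, ⁅b, a⁆ ∈ B)
    (hD : ∀ b ∈ B, ∀ d ∈ D, inc L b * d ∈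
      Subalgebra.toSubmodule (Algebra.adjoin ℂ (inc L '' A)) * D)
    {b : L} (hb : b ∈ B) {u : U L}
    (hu : u ∈ Subalgebra.toSubmodule (Algebra.adjoin ℂ (inc L '' A)) * D) :
    inc L b * u ∈ Subalgebra.toSubmodule (Algebra.adjoin ℂ (inc L '' A)) * D := by
  set E := Subalgebra.toSubmodule (Algebra.adjoin ℂ (inc L '' (A : Set L))) * D with hE
  have hAE : ∀ a ∈ A, ∀ u ∈ E, inc L a * u ∈ E := by
    intro a ha u hu
    induction hu using Submodule.mul_induction_on' with
    | mem_mul_mem m hm n hn =>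
      rw [← mul_assoc]
      exact Submodule.mul_mem_mul
        (Subalgebra.mul_mem _ (Algebra.subset_adjoin ⟨a, ha, rfl⟩) hm) hn
    | add x _ y _ hx hy => rw [mul_add]; exact add_mem hx hy
  induction hu using Submodule.mul_induction_on' with
  | add x _ y _ hx hy => rw [mul_add]; exact add_mem hx hy
  | mem_mul_mem m hm n hn =>
    have hm' : m ∈ Submodule.span ℂ (Submonoid.closure (inc L '' (A : Set L)) : Set (U L)) := by
      rw [← Algebra.adjoin_eq_span]; exact hm
    clear hm
    -- The element `b` varies in the induction: moving it past a letter `a` of `A` produces `[b,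
    -- a]`, another element of `B`.
    induction hm' using Submodule.span_induction generalizing b with
    | mem x hx =>
      induction hx using Submonoid.closure_induction_left generalizing b with
      | one => rw [one_mul]; exact hD b hb n hn
      | mul_left a ha y _ ih =>
        obtain ⟨a, ha, rfl⟩ := ha
        have h : inc L b * (inc L a * y * n) =
            inc L a * (inc L b * (y * n)) + inc L ⁅b, a⁆ * (y * n) := by
          rw [inc_lie]; noncomm_ring
        rw [h]
        exact add_mem (hAE a ha _ (ih hb)) (ih (hAB b hb a ha))
    | zero => simp
    | add x y _ _ hx hy => rw [add_mul, mul_add]; exact add_mem (hx hb) (hy hb)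
    | smul c x _ hx => rw [smul_mul_assoc, mul_smul_comm]; exact Submodule.smul_mem _ _ (hx hb)

theorem eq_top_of_inc_mul_mem {D : Submodule ℂ (U L)} (one : (1 : U L) ∈ D)
    (mul : ∀ x : L, ∀ d ∈ D, inc L x * d ∈ D) : D = ⊤ := by
  rw [eq_top_iff]
  rintro u -
  induction u using U_induction with
  | one => exact one
  | smul c a h => exact Submodule.smul_mem _ _ h
  | add a b ha hb => exact add_mem ha hb
  | mul x a h => exact mul x a h

/-- Triangular decomposition, with respect to `g = A + g₀ + B`. -/
theorem adjoin_mul_zero_mul_adjoin {A B : Submodule ℂ L}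
    (hB : ∀ b ∈ B, ∀ h : Γ.zeroPart, ⁅b, (h : L)⁆ ∈ B)
    (hAB : ∀ x : L, ∃ a ∈ A, ∃ h : Γ.zeroPart, ∃ b ∈ B, x = a + h + b) :
    Subalgebra.toSubmodule (Algebra.adjoin ℂ (inc L '' A)) *
      (Subalgebra.toSubmodule (Algebra.adjoin ℂ (inc L '' Γ.piece 0)) *
        Subalgebra.toSubmodule (Algebra.adjoin ℂ (inc L '' B))) = ⊤ := by
  set UA := Subalgebra.toSubmodule (Algebra.adjoin ℂ (inc L '' (A : Set L))) with hUA
  set UZ := Subalgebra.toSubmodule (Algebra.adjoin ℂ (inc L '' (Γ.piece 0 : Set L))) with hUZ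
  set UB := Subalgebra.toSubmodule (Algebra.adjoin ℂ (inc L '' (B : Set L))) with hUB
  have oneA : (1 : U L) ∈ UA := one_mem (Algebra.adjoin ℂ (inc L '' (A : Set L)))
  have oneZ : (1 : U L) ∈ UZ := one_mem (Algebra.adjoin ℂ (inc L '' (Γ.piece 0 : Set L)))
  have oneB : (1 : U L) ∈ UB := one_mem (Algebra.adjoin ℂ (inc L '' (B : Set L)))
  have hZB : ∀ b ∈ B, ∀ d ∈ UZ * UB, inc L b * d ∈ UZ * UB := by
    intro b hb d hd
    refine inc_mul_mem_adjoin_mul (fun b hb a ha => hB b hb ⟨a, ha⟩) (fun b hb d hd => ?_) hb hd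
    rw [← one_mul (inc L b * d)]
    exact Submodule.mul_mem_mul oneZ (Subalgebra.mul_mem _
      (Algebra.subset_adjoin ⟨b, hb, rfl⟩) hd)
  have hZZ : ∀ h : Γ.zeroPart, ∀ d ∈ UZ * UB, inc L h * d ∈ UZ * UB := by
    intro h d hd
    induction hd using Submodule.mul_induction_on' with
    | add x _ y _ hx hy => rw [mul_add]; exact add_mem hx hy
    | mem_mul_mem m hm n hn =>
      rw [← mul_assoc]
      exact Submodule.mul_mem_mul (Subalgebra.mul_mem _
        (Algebra.subset_adjoin ⟨h, h.2, rfl⟩) hm) hn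
  refine eq_top_of_inc_mul_mem ?_ fun x d hd => ?_
  · rw [← one_mul (1 : U L)]
    refine Submodule.mul_mem_mul oneA ?_
    rw [← one_mul (1 : U L)]
    exact Submodule.mul_mem_mul oneZ oneB
  -- With `B = ⊤`, any element of `g` is moved past `U(A)`; it remains to multiply `U(g₀) U(B)` by
  -- the three components of an element separately.
  · refine inc_mul_mem_adjoin_mul (B := ⊤) (fun _ _ _ _ => trivial) (fun x _ d hd => ?_) trivial hd
    obtain ⟨a, ha, h, b, hb, rfl⟩ := hAB x
    rw [map_add, map_add, add_mul, add_mul]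
    refine add_mem (add_mem ?_ ?_) ?_
    · exact Submodule.mul_mem_mul (Algebra.subset_adjoin ⟨a, ha, rfl⟩) hd
    · rw [← one_mul (inc L (h : L) * d)]; exact Submodule.mul_mem_mul oneA (hZZ h d hd)
    · rw [← one_mul (inc L b * d)]; exact Submodule.mul_mem_mul oneA (hZB b hb d hd)

theorem lie_zero_mem_negPart {y : L} (hy : y ∈ Γ.negPart) (h : Γ.zeroPart) :
    ⁅y, (h : L)⁆ ∈ Γ.negPart := by
  rw [← lie_skew]; exact neg_mem (Γ.zero_lie_mem_negPart h hy)

theorem lie_zero_mem_posPart {y : L} (hy : y ∈ Γ.posPart) (h : Γ.zeroPart) :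
    ⁅y, (h : L)⁆ ∈ Γ.posPart := by
  rw [← lie_skew]; exact neg_mem (Γ.zero_lie_mem_posPart h hy)

/-- The image of `U(g₀)` in `U(g)`. -/
abbrev Uzero : Subalgebra ℂ (U L) := Algebra.adjoin ℂ (inc L '' Γ.piece 0)

theorem neg_zero_pos_eq_top : Subalgebra.toSubmodule Γ.Uneg *
    (Subalgebra.toSubmodule Γ.Uzero * Subalgebra.toSubmodule Γ.Upos) = ⊤ :=
  Γ.adjoin_mul_zero_mul_adjoin (fun _ hb h => Γ.lie_zero_mem_posPart hb h) fun x => by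
    obtain ⟨a, ha, h, b, hb, hx, -⟩ := Γ.exists_decomp x
    exact ⟨a, ha, h, b, hb, hx⟩

theorem pos_zero_neg_eq_top : Subalgebra.toSubmodule Γ.Upos *
    (Subalgebra.toSubmodule Γ.Uzero * Subalgebra.toSubmodule Γ.Uneg) = ⊤ :=
  Γ.adjoin_mul_zero_mul_adjoin (fun _ hb h => Γ.lie_zero_mem_negPart hb h) fun x => by
    obtain ⟨a, ha, h, b, hb, hx, -⟩ := Γ.exists_decomp x
    exact ⟨b, hb, h, a, ha, by rw [hx]; abel⟩

theorem mul_mem_span_inc_mul {A : Submodule ℂ L} {u : U L}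
    (hu : u ∈ Submodule.span ℂ {z | ∃ a ∈ A, ∃ b : U L, z = inc L a * b}) (v : U L) :
    u * v ∈ Submodule.span ℂ {z | ∃ a ∈ A, ∃ b : U L, z = inc L a * b} := by
  induction hu using Submodule.span_induction with
  | mem z hz =>
    obtain ⟨a, ha, b, rfl⟩ := hz
    exact Submodule.subset_span ⟨a, ha, b * v, mul_assoc _ _ _⟩
  | zero => simp
  | add z w _ _ hz hw => rw [add_mul]; exact add_mem hz hw
  | smul e z _ hz => rw [smul_mul_assoc]; exact Submodule.smul_mem _ _ hz

theorem mul_mem_span_mul_inc {A : Submodule ℂ L} {u : U L}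
    (hu : u ∈ Submodule.span ℂ {z | ∃ a ∈ A, ∃ b : U L, z = b * inc L a}) (v : U L) :
    v * u ∈ Submodule.span ℂ {z | ∃ a ∈ A, ∃ b : U L, z = b * inc L a} := by
  induction hu using Submodule.span_induction with
  | mem z hz =>
    obtain ⟨a, ha, b, rfl⟩ := hz
    exact Submodule.subset_span ⟨a, ha, v * b, (mul_assoc _ _ _).symm⟩
  | zero => simp
  | add z w _ _ hz hw => rw [mul_add]; exact add_mem hz hw
  | smul e z _ hz => rw [mul_smul_comm]; exact Submodule.smul_mem _ _ hz

/-- An element of the algebra generated by `A` is a scalar modulo the right ideal, and modulo the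
left ideal, generated by `A`. -/
theorem exists_scalar_of_mem_adjoin {A : Submodule ℂ L} {u : U L}
    (hu : u ∈ Algebra.adjoin ℂ (inc L '' (A : Set L))) : ∃ c : ℂ,
      u - algebraMap ℂ _ c ∈ Submodule.span ℂ {z | ∃ a ∈ A, ∃ b : U L, z = inc L a * b} ∧
      u - algebraMap ℂ _ c ∈ Submodule.span ℂ {z | ∃ a ∈ A, ∃ b : U L, z = b * inc L a} := by
  induction hu using Algebra.adjoin_induction with
  | mem x hx =>
    obtain ⟨a, ha, rfl⟩ := hx
    refine ⟨0, ?_, ?_⟩ <;> rw [map_zero, sub_zero]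
    · exact Submodule.subset_span ⟨a, ha, 1, (mul_one _).symm⟩
    · exact Submodule.subset_span ⟨a, ha, 1, (one_mul _).symm⟩
  | algebraMap r => exact ⟨r, by simp⟩
  | add x y _ _ hx hy =>
    obtain ⟨c, h1, h2⟩ := hx
    obtain ⟨d, h3, h4⟩ := hy
    have h : x + y - algebraMap ℂ _ (c + d) =
      (x - algebraMap ℂ _ c) + (y - algebraMap ℂ _ d) := by rw [map_add]; abel
    exact ⟨c + d, by rw [h]; exact add_mem h1 h3, by rw [h]; exact add_mem h2 h4⟩
  | mul x y _ _ hx hy =>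
    obtain ⟨c, h1, h2⟩ := hx
    obtain ⟨d, h3, h4⟩ := hy
    refine ⟨c * d, ?_, ?_⟩
    · have h : x * y - algebraMap ℂ _ (c * d) =
        (x - algebraMap ℂ _ c) * y + c • (y - algebraMap ℂ _ d) := by
        rw [map_mul, Algebra.smul_def]; noncomm_ring
      rw [h]
      exact add_mem (mul_mem_span_inc_mul h1 y) (Submodule.smul_mem _ _ h3)
    · have h : x * y - algebraMap ℂ _ (c * d) =
        x * (y - algebraMap ℂ _ d) + d • (x - algebraMap ℂ _ c) := by
        rw [mul_comm c d, map_mul, Algebra.smul_def, mul_sub, mul_sub, Algebra.commutes d x]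
        noncomm_ring
      rw [h]
      exact add_mem (mul_mem_span_mul_inc h4 x) (Submodule.smul_mem _ _ h2)

theorem mem_range_zeroIncl {u : U L} (hu : u ∈ Γ.Uzero) : ∃ v, Γ.zeroIncl v = u := by
  have : Γ.Uzero ≤ Γ.zeroIncl.range := by
    refine Algebra.adjoin_le ?_
    rintro _ ⟨x, hx, rfl⟩
    exact ⟨inc _ ⟨x, hx⟩, Γ.zeroIncl_inc _⟩
  exact this hu

/-- By the triangular decomposition `u` is a sum of products `a z b` from `U(n₋)`, `U(g₀)`, `U(n₊)`;
modulo `n₋ U(g)` and `U(g) n₊` the outer factors become scalars. -/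
theorem exists_sub_mem_offZero (u : U L) : ∃ v : U Γ.zeroPart, Γ.zeroIncl v - u ∈ Γ.offZero := by
  have hu : u ∈ Subalgebra.toSubmodule Γ.Uneg *
    (Subalgebra.toSubmodule Γ.Uzero * Subalgebra.toSubmodule Γ.Upos) := by
    rw [neg_zero_pos_eq_top]; trivial
  have hadd : ∀ x y : U L, (∃ v : U Γ.zeroPart, Γ.zeroIncl v - x ∈ Γ.offZero) →
      (∃ v : U Γ.zeroPart, Γ.zeroIncl v - y ∈ Γ.offZero) →
      ∃ v : U Γ.zeroPart, Γ.zeroIncl v - (x + y) ∈ Γ.offZero := by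
    rintro x y ⟨v, hv⟩ ⟨w, hw⟩
    exact ⟨v + w, by rw [map_add, add_sub_add_comm]; exact add_mem hv hw⟩
  induction hu using Submodule.mul_induction_on' with
  | add x _ y _ hx hy => exact hadd x y hx hy
  | mem_mul_mem a ha n hn =>
    induction hn using Submodule.mul_induction_on' with
    | add x _ y _ hx hy => rw [mul_add]; exact hadd _ _ hx hy
    | mem_mul_mem z hz b hb =>
      obtain ⟨c, hc, -⟩ := exists_scalar_of_mem_adjoin ha
      obtain ⟨d, -, hd⟩ := exists_scalar_of_mem_adjoin hb
      obtain ⟨v, rfl⟩ := Γ.mem_range_zeroIncl hz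
      refine ⟨(c * d) • v, ?_⟩
      have h : Γ.zeroIncl ((c * d) • v) - a * (Γ.zeroIncl v * b) =
          -((a - algebraMap ℂ _ c) * (Γ.zeroIncl v * b)) -
          (c • Γ.zeroIncl v) * (b - algebraMap ℂ _ d) := by
        rw [map_smul, mul_smul, Algebra.algebraMap_eq_smul_one, Algebra.algebraMap_eq_smul_one,
          sub_mul, mul_sub, smul_mul_assoc, one_mul, mul_smul_comm, mul_one, smul_mul_assoc,
          smul_comm d c]
        abel
      rw [h]
      exact sub_mem (neg_mem (Submodule.mem_sup_left (mul_mem_span_inc_mul hc _)))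
        (Submodule.mem_sup_right (mul_mem_span_mul_inc hd _))

/-- Injectivity needs a freeness statement, supplied by the universal Verma module: `vermaProj`
kills `offZero` and is a left inverse of `zeroIncl`. Consequently the default value in `zeroProj` is
never taken. -/
theorem zeroToQuot_bijective : Function.Bijective Γ.zeroToQuot := by
  constructor
  · rw [← LinearMap.ker_eq_bot, LinearMap.ker_eq_bot']
    intro v hv
    have h : Γ.zeroIncl v ∈ Γ.offZero := (Submodule.Quotient.mk_eq_zero _).mp hv
    rw [← Γ.vermaProj_zeroIncl v, Γ.vermaProj_offZero h]
  · intro q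
    obtain ⟨u, rfl⟩ := Γ.offZero.mkQ_surjective q
    obtain ⟨v, hv⟩ := Γ.exists_sub_mem_offZero u
    exact ⟨v, (Submodule.Quotient.eq _).mpr hv⟩

theorem zeroProj_zeroIncl (v : U Γ.zeroPart) : Γ.zeroProj (Γ.zeroIncl v) = v := by
  rw [zeroProj, dif_pos Γ.zeroToQuot_bijective]
  exact (LinearEquiv.ofBijective Γ.zeroToQuot Γ.zeroToQuot_bijective).symm_apply_apply v

theorem zeroProj_of_mem {z : U L} (hz : z ∈ Γ.offZero) : Γ.zeroProj z = 0 := by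
  rw [zeroProj, dif_pos Γ.zeroToQuot_bijective, LinearMap.comp_apply, Submodule.mkQ_apply,
    (Submodule.Quotient.mk_eq_zero _).mpr hz, map_zero]

end Grading


/-! ### The antipode and the coproduct on generators -/

section Antipode

variable {L : Type u} [LieRing L] [LieAlgebra ℂ L]

theorem antipode_apply (u : U L) : antipode L u = MulOpposite.unop (antipodeOp L u) := rfl

theorem antipode_one : antipode L 1 = 1 := by rw [antipode_apply, map_one]; rfl

theorem antipode_mul (u v : U L) : antipode L (u * v) = antipode L v * antipode L u := by
  rw [antipode_apply, map_mul]; rfl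

theorem antipode_inc (x : L) : antipode L (inc L x) = -inc L x := by
  rw [antipode_apply, antipodeOp, lift_inc]; rfl

theorem antipode_antipode (u : U L) : antipode L (antipode L u) = u := by
  induction u using U_induction with
  | one => rw [antipode_one, antipode_one]
  | smul c a h => rw [map_smul, map_smul, h]
  | add a b ha hb => rw [map_add, map_add, ha, hb]
  | mul x a h => rw [antipode_mul, antipode_mul, h, antipode_inc, map_neg, antipode_inc, neg_neg]

theorem coprod_inc (x : L) : coprod L (inc L x) = inc L x ⊗ₜ 1 + 1 ⊗ₜ inc L x := lift_inc _ x

end Antipode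

namespace Grading

variable {L : Type u} [LieRing L] [LieAlgebra ℂ L] (Γ : Grading L)

/-! ### The grading of the enveloping algebra -/

theorem weight_inc {i : ℤ} {x : L} (hx : x ∈ Γ.piece i) :
    Γ.weight (inc L x) = AddMonoidAlgebra.single i (inc L x) := by
  rw [weight, lift_inc]; exact Γ.weightLin_of_mem hx

theorem degProj_apply (d : ℤ) (u : U L) : Γ.degProj d u = (Γ.weight u).coeff d := rfl

/-- Elements whose image under `weight` is a monomial. -/
def IsHomog (d : ℤ) (u : U L) : Prop := Γ.weight u = AddMonoidAlgebra.single d u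

theorem IsHomog.mul {Γ : Grading L} {d e : ℤ} {u v : U L} (hu : Γ.IsHomog d u)
    (hv : Γ.IsHomog e v) : Γ.IsHomog (d + e) (u * v) := by
  rw [IsHomog, map_mul, hu, hv, AddMonoidAlgebra.single_mul_single]

theorem IsHomog.add {Γ : Grading L} {d : ℤ} {u v : U L} (hu : Γ.IsHomog d u)
    (hv : Γ.IsHomog d v) : Γ.IsHomog d (u + v) := by
  rw [IsHomog, map_add, hu, hv, AddMonoidAlgebra.single_add]

theorem IsHomog.smul {Γ : Grading L} {d : ℤ} {u : U L} (c : ℂ) (hu : Γ.IsHomog d u) :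
    Γ.IsHomog d (c • u) := by
  rw [IsHomog, map_smul, hu, AddMonoidAlgebra.smul_single]

theorem isHomog_one : Γ.IsHomog 0 1 := by rw [IsHomog, map_one]; rfl

theorem isHomog_inc {i : ℤ} {x : L} (hx : x ∈ Γ.piece i) : Γ.IsHomog i (inc L x) :=
  Γ.weight_inc hx

theorem IsHomog.degProj_eq {Γ : Grading L} {d : ℤ} {u : U L} (hu : Γ.IsHomog d u) :
    Γ.degProj d u = u := by
  rw [degProj_apply, hu, AddMonoidAlgebra.coeff_single, Finsupp.single_eq_same]

theorem IsHomog.degProj_ne {Γ : Grading L} {d e : ℤ} {u : U L} (hu : Γ.IsHomog d u)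
    (h : d ≠ e) : Γ.degProj e u = 0 := by
  rw [degProj_apply, hu, AddMonoidAlgebra.coeff_single, Finsupp.single_eq_of_ne h.symm]

theorem homog_induction {p : U L → Prop} (zero : p 0) (add : ∀ a b, p a → p b → p (a + b))
    (homog : ∀ d a, Γ.IsHomog d a → p a) (u : U L) : p u := by
  have htop : Submodule.span ℂ {u : U L | ∃ d, Γ.IsHomog d u} = ⊤ := by
    refine eq_top_of_inc_mul_mem (Submodule.subset_span ⟨0, Γ.isHomog_one⟩) fun x d hd => ?_
    induction hd using Submodule.span_induction with
    | zero => simp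
    | add a b _ _ ha hb => rw [mul_add]; exact add_mem ha hb
    | smul c a _ ha => rw [mul_smul_comm]; exact Submodule.smul_mem _ _ ha
    | mem a ha =>
      obtain ⟨d, hd⟩ := ha
      induction x using Γ.piece_induction with
      | zero => simp
      | add x y hx hy => rw [map_add, add_mul]; exact add_mem hx hy
      | mem i x hx => exact Submodule.subset_span ⟨i + d, (Γ.isHomog_inc hx).mul hd⟩
  have hu : u ∈ Submodule.span ℂ {u : U L | ∃ d, Γ.IsHomog d u} := by rw [htop]; trivial
  -- The predicate `p` is not assumed stable under scalars, but homogeneous elements are; so the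
  -- induction runs over all multiples of `u`.
  have key : ∀ c : ℂ, p (c • u) := by
    induction hu using Submodule.span_induction with
    | zero => simpa using zero
    | add a b _ _ ha hb => intro c; rw [smul_add]; exact add _ _ (ha c) (hb c)
    | smul e a _ ha => intro c; rw [smul_smul]; exact ha _
    | mem a ha => obtain ⟨d, hd⟩ := ha; exact fun c => homog d _ (hd.smul c)
  simpa using key 1

theorem isHomog_degProj (d : ℤ) (u : U L) : Γ.IsHomog d (Γ.degProj d u) := by
  induction u using Γ.homog_induction with
  | zero => rw [map_zero, IsHomog, map_zero, AddMonoidAlgebra.single_zero]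
  | add a b ha hb => rw [map_add]; exact ha.add hb
  | homog e a ha =>
    by_cases h : e = d
    · subst h; rwa [ha.degProj_eq]
    · rw [ha.degProj_ne h, IsHomog, map_zero, AddMonoidAlgebra.single_zero]

theorem mem_homog_iff {d : ℤ} {u : U L} : u ∈ Γ.homog d ↔ Γ.IsHomog d u :=
  ⟨fun ⟨v, hv⟩ => hv ▸ Γ.isHomog_degProj d v, fun h => ⟨u, h.degProj_eq⟩⟩

theorem exists_sum_degProj (u : U L) :
    ∃ s : Finset ℤ, ∀ t, s ⊆ t → ∑ d ∈ t, Γ.degProj d u = u := by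
  induction u using Γ.homog_induction with
  | zero => exact ⟨∅, fun t _ => by simp⟩
  | add a b ha hb =>
    classical
    obtain ⟨s, hs⟩ := ha
    obtain ⟨s', hs'⟩ := hb
    refine ⟨s ∪ s', fun t ht => ?_⟩
    simp only [map_add, Finset.sum_add_distrib]
    rw [hs t (Finset.union_subset_left ht), hs' t (Finset.union_subset_right ht)]
  | homog d a ha =>
    refine ⟨{d}, fun t ht => ?_⟩
    rw [Finset.sum_eq_single d, ha.degProj_eq]
    · exact fun e _ he => ha.degProj_ne he.symm
    · exact fun h => absurd (ht (Finset.mem_singleton_self d)) h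

theorem IsHomog.antipode {Γ : Grading L} {d : ℤ} {u : U L} (hu : Γ.IsHomog d u) :
    Γ.IsHomog d (antipode L u) := by
  have key : ∀ v : U L, ∀ d, InvStar.antipode L (Γ.degProj d v) =
      Γ.degProj d (InvStar.antipode L v) := by
    intro v
    have : v ∈ Submodule.span ℂ {v : U L | ∃ d, Γ.IsHomog d v ∧
        Γ.IsHomog d (InvStar.antipode L v)} := by
      rw [eq_top_of_inc_mul_mem
        (D := Submodule.span ℂ {v : U L | ∃ d, Γ.IsHomog d v ∧ Γ.IsHomog d (InvStar.antipode L v)})]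
      · trivial
      · refine Submodule.subset_span ⟨0, Γ.isHomog_one, ?_⟩
        rw [antipode_one]; exact Γ.isHomog_one
      · intro x v hv
        induction hv using Submodule.span_induction with
        | zero => simp
        | add a b _ _ ha hb => rw [mul_add]; exact add_mem ha hb
        | smul c a _ ha => rw [mul_smul_comm]; exact Submodule.smul_mem _ _ ha
        | mem a ha =>
          obtain ⟨d, hd, hd'⟩ := ha
          induction x using Γ.piece_induction with
          | zero => simp
          | add x y hx hy => rw [map_add, add_mul]; exact add_mem hx hy
          | mem i x hx =>
            refine Submodule.subset_span ⟨i + d, (Γ.isHomog_inc hx).mul hd, ?_⟩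
            rw [antipode_mul, antipode_inc, add_comm i d, ← neg_one_smul ℂ]
            exact hd'.mul ((Γ.isHomog_inc hx).smul _)
    intro d
    induction this using Submodule.span_induction with
    | zero => simp
    | add a b _ _ ha hb => simp only [map_add, ha, hb]
    | smul c a _ ha => simp only [map_smul, ha]
    | mem a ha =>
      obtain ⟨e, he, he'⟩ := ha
      by_cases h : e = d
      · subst h; rw [he.degProj_eq, he'.degProj_eq]
      · rw [he.degProj_ne h, he'.degProj_ne h, map_zero]
  have := key u d
  rw [hu.degProj_eq] at this
  rw [this]
  exact Γ.isHomog_degProj d _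

theorem degProj_offZero {z : U L} (hz : z ∈ Γ.offZero) (d : ℤ) : Γ.degProj d z ∈ Γ.offZero := by
  suffices h : Γ.offZero ≤ Γ.offZero.comap (Γ.degProj d) from h hz
  refine sup_le (Submodule.span_le.mpr ?_) (Submodule.span_le.mpr ?_)
  · rintro _ ⟨a, ha, b, rfl⟩
    change Γ.degProj d _ ∈ Γ.offZero
    induction b using Γ.homog_induction with
    | zero => simp
    | add b c hb hc => rw [mul_add, map_add]; exact add_mem hb hc
    | homog e b hb =>
      induction ha using Γ.neg_induction with
      | zero => simp
      | add x y _ _ hx hy => rw [map_add, add_mul, map_add]; exact add_mem hx hy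
      | mem i hi x hx =>
        by_cases h : i + e = d
        · subst h
          rw [((Γ.isHomog_inc hx).mul hb).degProj_eq]
          exact Γ.neg_mul_mem_offZero (Γ.mem_negPart hi hx) b
        · rw [((Γ.isHomog_inc hx).mul hb).degProj_ne h]; exact zero_mem _
  · rintro _ ⟨a, ha, b, rfl⟩
    change Γ.degProj d _ ∈ Γ.offZero
    induction b using Γ.homog_induction with
    | zero => simp
    | add b c hb hc => rw [add_mul, map_add]; exact add_mem hb hc
    | homog e b hb =>
      induction ha using Γ.pos_induction with
      | zero => simp
      | add x y _ _ hx hy => rw [map_add, mul_add, map_add]; exact add_mem hx hy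
      | mem i hi x hx =>
        by_cases h : e + i = d
        · subst h
          rw [(hb.mul (Γ.isHomog_inc hx)).degProj_eq]
          exact Γ.mul_pos_mem_offZero (Γ.mem_posPart hi hx) b
        · rw [(hb.mul (Γ.isHomog_inc hx)).degProj_ne h]; exact zero_mem _

theorem isHomog_zeroIncl (v : U Γ.zeroPart) : Γ.IsHomog 0 (Γ.zeroIncl v) := by
  induction v using U_induction with
  | one => rw [map_one]; exact Γ.isHomog_one
  | smul c a h => rw [map_smul]; exact h.smul c
  | add a b ha hb => rw [map_add]; exact ha.add hb
  | mul x a h => rw [map_mul, zeroIncl_inc]; simpa using (Γ.isHomog_inc x.2).mul h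

/-- The subspace `offZero` is graded and `U(g₀)` lies in degree zero. Taking the component of degree
`d ≠ 0` of an element `v - u` of `offZero`, with `v` in `U(g₀)`, shows that `u` itself is in
`offZero`. -/
theorem zeroProj_of_isHomog {d : ℤ} (hd : d ≠ 0) {u : U L} (hu : Γ.IsHomog d u) :
    Γ.zeroProj u = 0 := by
  obtain ⟨v, hv⟩ := Γ.exists_sub_mem_offZero u
  have h := Γ.degProj_offZero hv d
  rw [map_sub, hu.degProj_eq, (Γ.isHomog_zeroIncl v).degProj_ne hd.symm, zero_sub] at h
  exact Γ.zeroProj_of_mem (neg_mem_iff.mp h)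

/-! ### Module properties of the projection to `U(g₀)` -/

theorem mul_zero_mem_offZero {z : U L} (hz : z ∈ Γ.offZero) (h : Γ.zeroPart) :
    z * inc L h ∈ Γ.offZero := by
  suffices h' : Γ.offZero ≤ Γ.offZero.comap (LinearMap.mulRight ℂ (inc L (h : L))) from h' hz
  refine sup_le (Submodule.span_le.mpr ?_) (Submodule.span_le.mpr ?_)
  · rintro _ ⟨a, ha, b, rfl⟩
    change inc L a * b * inc L h ∈ Γ.offZero
    rw [mul_assoc]; exact Γ.neg_mul_mem_offZero ha _
  · rintro _ ⟨a, ha, b, rfl⟩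
    change b * inc L a * inc L h ∈ Γ.offZero
    have : b * inc L a * inc L h = b * inc L h * inc L a + b * inc L ⁅a, (h : L)⁆ := by
      rw [inc_lie]; noncomm_ring
    rw [this]
    exact add_mem (Γ.mul_pos_mem_offZero ha _)
      (Γ.mul_pos_mem_offZero (Γ.lie_zero_mem_posPart ha h) _)

theorem zero_mul_mem_offZero {z : U L} (hz : z ∈ Γ.offZero) (h : Γ.zeroPart) :
    inc L h * z ∈ Γ.offZero := by
  suffices h' : Γ.offZero ≤ Γ.offZero.comap (LinearMap.mulLeft ℂ (inc L (h : L))) from h' hz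
  refine sup_le (Submodule.span_le.mpr ?_) (Submodule.span_le.mpr ?_)
  · rintro _ ⟨a, ha, b, rfl⟩
    change inc L h * (inc L a * b) ∈ Γ.offZero
    have : inc L h * (inc L a * b) = inc L a * (inc L h * b) + inc L ⁅(h : L), a⁆ * b := by
      rw [inc_lie]; noncomm_ring
    rw [this]
    exact add_mem (Γ.neg_mul_mem_offZero ha _)
      (Γ.neg_mul_mem_offZero (Γ.zero_lie_mem_negPart h ha) _)
  · rintro _ ⟨a, ha, b, rfl⟩
    change inc L h * (b * inc L a) ∈ Γ.offZero
    rw [← mul_assoc]; exact Γ.mul_pos_mem_offZero ha _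

theorem zeroProj_eq_of_sub_mem {u : U L} {v : U Γ.zeroPart} (h : Γ.zeroIncl v - u ∈ Γ.offZero) :
    Γ.zeroProj u = v := by
  have := Γ.zeroProj_of_mem h
  rw [map_sub, zeroProj_zeroIncl, sub_eq_zero] at this
  exact this.symm

theorem zeroProj_mul_inc (u : U L) (h : Γ.zeroPart) :
    Γ.zeroProj (u * inc L h) = Γ.zeroProj u * inc _ h := by
  obtain ⟨v, hv⟩ := Γ.exists_sub_mem_offZero u
  rw [Γ.zeroProj_eq_of_sub_mem hv]
  apply Γ.zeroProj_eq_of_sub_mem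
  rw [map_mul, zeroIncl_inc, ← sub_mul]
  exact Γ.mul_zero_mem_offZero hv h

theorem zeroProj_inc_mul (u : U L) (h : Γ.zeroPart) :
    Γ.zeroProj (inc L h * u) = inc _ h * Γ.zeroProj u := by
  obtain ⟨v, hv⟩ := Γ.exists_sub_mem_offZero u
  rw [Γ.zeroProj_eq_of_sub_mem hv]
  apply Γ.zeroProj_eq_of_sub_mem
  rw [map_mul, zeroIncl_inc, ← mul_sub]
  exact Γ.zero_mul_mem_offZero hv h

/-! ### The Shapovalov pairing with polynomial values -/

open Polynomial in
/-- The universal rescaled character, with values in polynomials in the scaling parameter. -/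
def polyChar (χ : LieAlgebra.LieCharacter ℂ Γ.zeroPart) : U Γ.zeroPart →ₐ[ℂ] ℂ[X] :=
  UniversalEnvelopingAlgebra.lift ℂ
    { LinearMap.toSpanSingleton ℂ ℂ[X] X ∘ₗ χ.toLinearMap with
      map_lie' := fun {x y} => by
        simp [LieRing.of_associative_ring_bracket, mul_comm] }

variable (χ : LieAlgebra.LieCharacter ℂ Γ.zeroPart)

open Polynomial

theorem polyChar_inc (h : Γ.zeroPart) : Γ.polyChar χ (inc _ h) = C (χ h) * X := by
  rw [polyChar, lift_inc, ← smul_eq_C_mul]; rfl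

theorem scaledChar_inc (lam : ℂ) (h : Γ.zeroPart) :
    Γ.scaledChar χ lam (inc _ h) = lam * χ h := by
  rw [scaledChar, lift_inc]; rfl

theorem eval_polyChar (lam : ℂ) (u : U Γ.zeroPart) :
    (Γ.polyChar χ u).eval lam = Γ.scaledChar χ lam u := by
  induction u using U_induction with
  | one => simp
  | smul c a h => simp [h]
  | add a b ha hb => simp [ha, hb]
  | mul x a h => 
    rw [map_mul, map_mul, eval_mul, h, polyChar_inc, scaledChar_inc, eval_mul, eval_C, eval_X,
      mul_comm lam]

/-- The Shapovalov form with values in polynomials in the scaling parameter. -/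
def polyForm : U L →ₗ[ℂ] U L →ₗ[ℂ] ℂ[X] :=
  LinearMap.mk₂ ℂ (fun x y => Γ.polyChar χ (Γ.zeroProj (antipode L y * x)))
    (fun x x' y => by rw [mul_add, map_add, map_add])
    (fun c x y => by rw [mul_smul_comm, map_smul, map_smul])
    (fun x y y' => by rw [map_add, add_mul, map_add, map_add])
    (fun c x y => by rw [map_smul, smul_mul_assoc, map_smul, map_smul])

theorem polyForm_apply (x y : U L) :
    Γ.polyForm χ x y = Γ.polyChar χ (Γ.zeroProj (antipode L y * x)) := rfl

theorem eval_polyForm (lam : ℂ) (x y : U L) :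
    (Γ.polyForm χ x y).eval lam = Γ.shapovalov χ lam x y := Γ.eval_polyChar χ lam _

theorem polyForm_mul_left (z x y : U L) :
    Γ.polyForm χ (z * x) y = Γ.polyForm χ x (antipode L z * y) := by
  rw [polyForm_apply, polyForm_apply, antipode_mul, antipode_antipode, mul_assoc]

theorem polyForm_inc_mul (z : L) (x y : U L) :
    Γ.polyForm χ (inc L z * x) y = -Γ.polyForm χ x (inc L z * y) := by
  rw [polyForm_mul_left, antipode_inc, neg_mul, map_neg]

/-- This and the next three lemmas say that the form factors, in its first variable, through the
module generated by a vector killed by `n₊` on which `g₀` acts by `X χ`, and in its second variable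
through the one generated by a vector killed by `n₋` on which `g₀` acts by `-X χ`. -/
theorem polyForm_mul_pos (x : U L) {z : L} (hz : z ∈ Γ.posPart) (y : U L) :
    Γ.polyForm χ (x * inc L z) y = 0 := by
  rw [polyForm_apply, ← mul_assoc, Γ.zeroProj_of_mem (Γ.mul_pos_mem_offZero hz _), map_zero]

theorem polyForm_mul_neg (x y : U L) {z : L} (hz : z ∈ Γ.negPart) :
    Γ.polyForm χ x (y * inc L z) = 0 := by
  rw [polyForm_apply, antipode_mul, antipode_inc, neg_mul, neg_mul, map_neg, mul_assoc,
    Γ.zeroProj_of_mem (Γ.neg_mul_mem_offZero hz _), neg_zero, map_zero]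

theorem polyForm_mul_zero (x : U L) (h : Γ.zeroPart) (y : U L) :
    Γ.polyForm χ (x * inc L h) y = C (χ h) * X * Γ.polyForm χ x y := by
  rw [polyForm_apply, ← mul_assoc, zeroProj_mul_inc, map_mul, polyChar_inc, mul_comm]; rfl

theorem polyForm_mul_zero' (x y : U L) (h : Γ.zeroPart) :
    Γ.polyForm χ x (y * inc L h) = -(C (χ h) * X * Γ.polyForm χ x y) := by
  rw [polyForm_apply, antipode_mul, antipode_inc, neg_mul, neg_mul, map_neg, map_neg, mul_assoc,
    zeroProj_inc_mul, map_mul, polyChar_inc]; rfl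

theorem polyForm_one_one : Γ.polyForm χ 1 1 = 1 := by
  rw [polyForm_apply, antipode_one, mul_one, ← map_one Γ.zeroIncl, zeroProj_zeroIncl, map_one]

theorem polyForm_of_isHomog {d e : ℤ} (h : d + e ≠ 0) {x y : U L} (hx : Γ.IsHomog d x)
    (hy : Γ.IsHomog e y) : Γ.polyForm χ x y = 0 := by
  rw [polyForm_apply, Γ.zeroProj_of_isHomog (by omega : e + d ≠ 0) (hy.antipode.mul hx), map_zero]

section Numeric

variable (lam : ℂ)

theorem shapovalov_mul_left (z x y : U L) :
    Γ.shapovalov χ lam (z * x) y = Γ.shapovalov χ lam x (antipode L z * y) := by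
  simp only [← eval_polyForm, polyForm_mul_left]

theorem shapovalov_mul_right (z x y : U L) :
    Γ.shapovalov χ lam x (z * y) = Γ.shapovalov χ lam (antipode L z * x) y := by
  rw [shapovalov_mul_left, antipode_antipode]

theorem shapovalov_inc_mul (z : L) (x y : U L) :
    Γ.shapovalov χ lam (inc L z * x) y = -Γ.shapovalov χ lam x (inc L z * y) := by
  simp only [← eval_polyForm, polyForm_inc_mul, eval_neg]

theorem shapovalov_mul_pos (x : U L) {z : L} (hz : z ∈ Γ.posPart) (y : U L) :
    Γ.shapovalov χ lam (x * inc L z) y = 0 := by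
  rw [← eval_polyForm, Γ.polyForm_mul_pos χ x hz, eval_zero]

theorem shapovalov_mul_neg (x y : U L) {z : L} (hz : z ∈ Γ.negPart) :
    Γ.shapovalov χ lam x (y * inc L z) = 0 := by
  rw [← eval_polyForm, Γ.polyForm_mul_neg χ x y hz, eval_zero]

theorem shapovalov_mul_zero (x : U L) (h : Γ.zeroPart) (y : U L) :
    Γ.shapovalov χ lam (x * inc L h) y = lam * χ h * Γ.shapovalov χ lam x y := by
  rw [← eval_polyForm, polyForm_mul_zero, ← eval_polyForm, eval_mul, eval_mul, eval_C, eval_X,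
    mul_comm lam]

theorem shapovalov_mul_zero' (x y : U L) (h : Γ.zeroPart) :
    Γ.shapovalov χ lam x (y * inc L h) = -(lam * χ h * Γ.shapovalov χ lam x y) := by
  rw [← eval_polyForm, polyForm_mul_zero', ← eval_polyForm, eval_neg, eval_mul, eval_mul, eval_C,
    eval_X, mul_comm lam]

theorem shapovalov_of_isHomog {d e : ℤ} (h : d + e ≠ 0) {x y : U L} (hx : Γ.IsHomog d x)
    (hy : Γ.IsHomog e y) : Γ.shapovalov χ lam x y = 0 := by
  rw [← eval_polyForm, Γ.polyForm_of_isHomog χ h hx hy, eval_zero]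

end Numeric

end Grading


/-! ### The filtration by length of products, and reordering of monomials -/

section Filtration

variable {L : Type u} [LieRing L] [LieAlgebra ℂ L] (N : Submodule ℂ L)

/-- The span of the products of at most `k` elements of `N`. -/
def filt (k : ℕ) : Submodule ℂ (U L) := (1 ⊔ N.map (inc L).toLinearMap) ^ k

/-- The span of the products of fewer than `k` elements of `N`. -/
def filtLT : ℕ → Submodule ℂ (U L)
  | 0 => ⊥
  | k + 1 => filt N k

variable {N}

theorem filt_le_succ (k : ℕ) : filt N k ≤ filt N (k + 1) := by
  intro u hu
  rw [filt, pow_succ, ← mul_one u]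
  exact Submodule.mul_mem_mul hu (Submodule.mem_sup_left (Submodule.one_le.mp le_rfl))

theorem filt_mono {k l : ℕ} (h : k ≤ l) : filt N k ≤ filt N l :=
  monotone_nat_of_le_succ filt_le_succ h

theorem filtLT_mono {k l : ℕ} (h : k ≤ l) : filtLT N k ≤ filtLT N l := by
  cases k with
  | zero => exact bot_le
  | succ k =>
    cases l with
    | zero => omega
    | succ l => exact filt_mono (by omega)

theorem mul_mem_filt {k l : ℕ} {u v : U L} (hu : u ∈ filt N k) (hv : v ∈ filt N l) :
    u * v ∈ filt N (k + l) := by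
  rw [filt, pow_add]; exact Submodule.mul_mem_mul hu hv

theorem one_mem_filt (k : ℕ) : (1 : U L) ∈ filt N k :=
  filt_mono (Nat.zero_le k) (by rw [filt, pow_zero]; exact Submodule.one_le.mp le_rfl)

theorem inc_mem_filt {x : L} (hx : x ∈ N) : inc L x ∈ filt N 1 := by
  rw [filt, pow_one]; exact Submodule.mem_sup_right ⟨x, hx, rfl⟩

theorem inc_mul_mem_filt {x : L} (hx : x ∈ N) {k : ℕ} {u : U L} (hu : u ∈ filt N k) :
    inc L x * u ∈ filt N (k + 1) := by
  rw [add_comm]; exact mul_mem_filt (inc_mem_filt hx) hu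

theorem inc_mul_mem_filtLT {x : L} (hx : x ∈ N) {k : ℕ} {u : U L} (hu : u ∈ filtLT N k) :
    inc L x * u ∈ filtLT N (k + 1) := by
  cases k with
  | zero => rw [(Submodule.mem_bot ℂ).mp hu, mul_zero]; exact zero_mem _
  | succ k => exact inc_mul_mem_filt hx hu

theorem filt_zero_induction {u : U L} (hu : u ∈ filt N 0) : ∃ c : ℂ, u = c • 1 := by
  rw [filt, pow_zero, Submodule.mem_one] at hu
  obtain ⟨c, rfl⟩ := hu
  exact ⟨c, Algebra.algebraMap_eq_smul_one c⟩

theorem filt_succ_induction {k : ℕ} {p : (u : U L) → u ∈ filt N (k + 1) → Prop}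
    (add : ∀ a b ha hb, p a ha → p b hb → p (a + b) (add_mem ha hb))
    (low : ∀ a, ∀ ha : a ∈ filt N k, p a (filt_le_succ k ha))
    (mul : ∀ x, ∀ hx : x ∈ N, ∀ a, ∀ ha : a ∈ filt N k, p (inc L x * a) (inc_mul_mem_filt hx ha))
    {u : U L} (hu : u ∈ filt N (k + 1)) : p u hu := by
  have hu' : u ∈ (1 ⊔ N.map (inc L).toLinearMap) * filt N k := by
    rw [filt, ← pow_succ']; exact hu
  suffices h : ∃ h, p u h from h.2
  induction hu' using Submodule.mul_induction_on' with
  | add x hx y hy hx' hy' =>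
    have hx : x ∈ filt N (k + 1) := by rw [filt, pow_succ']; exact hx
    have hy : y ∈ filt N (k + 1) := by rw [filt, pow_succ']; exact hy
    obtain ⟨_, h1⟩ := hx' hx
    obtain ⟨_, h2⟩ := hy' hy
    exact ⟨_, add _ _ _ _ h1 h2⟩
  | mem_mul_mem m hm n hn =>
    obtain ⟨c, hc, y, ⟨x, hx, rfl⟩, rfl⟩ := Submodule.mem_sup.mp hm
    obtain ⟨c, rfl⟩ := Submodule.mem_one.mp hc
    refine ⟨hu, ?_⟩
    have h1 : algebraMap ℂ (U L) c * n ∈ filt N k := by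
      rw [← Algebra.smul_def]; exact Submodule.smul_mem _ c hn
    have := add _ _ _ _ (low _ h1) (mul x hx n hn)
    simp only [← add_mul] at this
    exact this

theorem exists_mem_filt {u : U L} (hu : u ∈ Algebra.adjoin ℂ (inc L '' (N : Set L))) :
    ∃ k, u ∈ filt N k := by
  induction hu using Algebra.adjoin_induction with
  | mem x hx => obtain ⟨a, ha, rfl⟩ := hx; exact ⟨1, inc_mem_filt ha⟩
  | algebraMap r =>
    refine ⟨0, ?_⟩
    rw [Algebra.algebraMap_eq_smul_one]; exact Submodule.smul_mem _ _ (one_mem_filt 0)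
  | add x y _ _ hx hy =>
    obtain ⟨k, hk⟩ := hx
    obtain ⟨l, hl⟩ := hy
    exact ⟨max k l, add_mem (filt_mono (le_max_left _ _) hk) (filt_mono (le_max_right _ _) hl)⟩
  | mul x y _ _ hx hy =>
    obtain ⟨k, hk⟩ := hx
    obtain ⟨l, hl⟩ := hy
    exact ⟨k + l, mul_mem_filt hk hl⟩

theorem filt_le_adjoin (k : ℕ) :
    filt N k ≤ Subalgebra.toSubmodule (Algebra.adjoin ℂ (inc L '' (N : Set L))) := by
  induction k with
  | zero =>
    intro u hu
    obtain ⟨c, rfl⟩ := filt_zero_induction hu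
    exact Submodule.smul_mem _ _ (one_mem (Algebra.adjoin ℂ (inc L '' (N : Set L))))
  | succ k ih =>
    intro u hu
    induction hu using filt_succ_induction with
    | add a b _ _ ha hb => exact add_mem ha hb
    | low a ha => exact ih ha
    | mul x hx a ha => exact Subalgebra.mul_mem _ (Algebra.subset_adjoin ⟨x, hx, rfl⟩) (ih ha)

/-- The adjoint action of an element normalizing `N` preserves the filtration. -/
theorem ad_mem_filt {h : L} (hN : ∀ x ∈ N, ⁅h, x⁆ ∈ N) {k : ℕ} {u : U L} (hu : u ∈ filt N k) :
    inc L h * u - u * inc L h ∈ filt N k := by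
  induction k generalizing u with
  | zero => obtain ⟨c, rfl⟩ := filt_zero_induction hu; simp
  | succ k ih =>
    induction hu using filt_succ_induction with
    | add a b _ _ ha hb =>
      have : inc L h * (a + b) - (a + b) * inc L h =
        (inc L h * a - a * inc L h) + (inc L h * b - b * inc L h) := by noncomm_ring
      rw [this]; exact add_mem ha hb
    | low a ha => exact filt_le_succ k (ih ha)
    | mul x hx a ha =>
      have : inc L h * (inc L x * a) - inc L x * a * inc L h =
          inc L ⁅h, x⁆ * a + inc L x * (inc L h * a - a * inc L h) := by
        rw [inc_lie]; noncomm_ring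
      rw [this]
      exact add_mem (inc_mul_mem_filt (hN x hx) ha) (inc_mul_mem_filt hx (ih ha))

variable {ι : Type v} (b : ι → L)

/-- The product of a list of basis elements. -/
def mono (l : List ι) : U L := (l.map fun i => inc L (b i)).prod

theorem mono_cons (i : ι) (l : List ι) : mono b (i :: l) = inc L (b i) * mono b l := by
  rw [mono, List.map_cons, List.prod_cons]; rfl

theorem mono_nil : mono b [] = 1 := rfl

variable {b}

theorem mono_mem_filt (hb : ∀ i, b i ∈ N) (l : List ι) : mono b l ∈ filt N l.length := by
  induction l with
  | nil => exact one_mem_filt 0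
  | cons i l ih => rw [mono_cons]; exact inc_mul_mem_filt (hb i) ih

/-- Permuting the factors of a product changes it by products with fewer factors. -/
theorem mono_sub_mem_filtLT (hN : ∀ x ∈ N, ∀ y ∈ N, ⁅x, y⁆ ∈ N) (hb : ∀ i, b i ∈ N)
    {l l' : List ι} (h : l.Perm l') : mono b l - mono b l' ∈ filtLT N l.length := by
  induction h with
  | nil => rw [sub_self]; exact zero_mem _
  | cons i h ih =>
    rw [mono_cons, mono_cons, ← mul_sub, List.length_cons]
    exact inc_mul_mem_filtLT (hb i) ih
  | swap i j l =>
    have : mono b (j :: i :: l) - mono b (i :: j :: l) = inc L ⁅b j, b i⁆ * mono b l := by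
      simp only [mono_cons, inc_lie]; noncomm_ring
    rw [this]
    exact inc_mul_mem_filt (hN _ (hb j) _ (hb i)) (mono_mem_filt hb l)
  | trans h1 h2 ih1 ih2 =>
    rw [← h1.length_eq] at ih2
    have := add_mem ih1 ih2
    rwa [sub_add_sub_cancel] at this

/-- The spanning half of the Poincaré–Birkhoff–Witt theorem. One product per multiset suffices, in
the arbitrary order fixed by `toList`, because reordering costs only shorter products, which are
covered by induction. -/
theorem filt_le_span (hN : ∀ x ∈ N, ∀ y ∈ N, ⁅x, y⁆ ∈ N) (hb : ∀ i, b i ∈ N)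
    (hspan : N ≤ Submodule.span ℂ (Set.range b)) (k : ℕ) : filt N k ≤
      Submodule.span ℂ {u | ∃ s : Multiset ι, s.card ≤ k ∧ u = mono b s.toList} := by
  induction k with
  | zero =>
    intro u hu
    obtain ⟨c, rfl⟩ := filt_zero_induction hu
    exact Submodule.smul_mem _ _ (Submodule.subset_span ⟨0, by simp, by simp [mono_nil]⟩)
  | succ k ih =>
    have hle : Submodule.span ℂ {u | ∃ s : Multiset ι, s.card ≤ k ∧ u = mono b s.toList} ≤
        Submodule.span ℂ {u | ∃ s : Multiset ι, s.card ≤ k + 1 ∧ u = mono b s.toList} :=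
      Submodule.span_mono fun u ⟨s, hs, hu⟩ => ⟨s, by omega, hu⟩
    intro u hu
    induction hu using filt_succ_induction with
    | add a b _ _ ha hb => exact add_mem ha hb
    | low a ha => exact hle (ih ha)
    | mul x hx a ha =>
      have ha' := ih ha
      clear ha
      induction ha' using Submodule.span_induction with
      | zero => simp
      | add a b _ _ ha hb => rw [mul_add]; exact add_mem ha hb
      | smul c a _ ha => rw [mul_smul_comm]; exact Submodule.smul_mem _ _ ha
      | mem a ha =>
        obtain ⟨s, hs, rfl⟩ := ha
        have hx' := hspan hx
        clear hx
        induction hx' using Submodule.span_induction with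
        | zero => simp
        | add a b _ _ ha hb => rw [map_add, add_mul]; exact add_mem ha hb
        | smul c a _ ha => rw [map_smul, smul_mul_assoc]; exact Submodule.smul_mem _ _ ha
        | mem x hx =>
          obtain ⟨i, rfl⟩ := hx
          -- Prepending `i` to the chosen ordering of `s` need not give the chosen ordering of `i
          -- ::ₘ s`, only a permutation of it.
          have hp : (i :: s.toList).Perm (i ::ₘ s).toList := by
            rw [← Multiset.coe_eq_coe, Multiset.coe_toList, ← Multiset.cons_coe,
              Multiset.coe_toList]
          have h := mono_sub_mem_filtLT hN hb hp
          rw [List.length_cons, Multiset.length_toList] at h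
          have h2 := add_mem (hle (ih (filt_mono hs h)))
            (Submodule.subset_span (R := ℂ) (s := {u | ∃ s : Multiset ι, s.card ≤ k + 1 ∧
              u = mono b s.toList}) ⟨i ::ₘ s, by simp [hs], rfl⟩)
          rwa [sub_add_cancel, mono_cons] at h2

end Filtration

/-! ### Commuting positive elements through products of negative ones -/

namespace Grading

variable {L : Type u} [LieRing L] [LieAlgebra ℂ L] (Γ : Grading L)
  (χ : LieAlgebra.LieCharacter ℂ Γ.zeroPart)

open Polynomial

/-- Modulo the left kernel of the form, an element of the positive part maps products of at most
`k` elements of the negative part to such products, up to `X` times shorter products. -/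
theorem exists_reduce {y : L} (hy : y ∈ Γ.posPart) {k : ℕ} {x : U L} (hx : x ∈ filt Γ.negPart k) :
    ∃ a ∈ filt Γ.negPart k, ∃ c ∈ filtLT Γ.negPart k, ∀ y' : U L,
      Γ.polyForm χ (inc L y * x) y' = Γ.polyForm χ a y' + X * Γ.polyForm χ c y' := by
  induction k generalizing x y with
  | zero =>
    obtain ⟨r, rfl⟩ := filt_zero_induction hx
    refine ⟨0, zero_mem _, 0, zero_mem _, fun y' => ?_⟩
    rw [mul_smul_comm, mul_one, map_smul, ← one_mul (inc L y), LinearMap.smul_apply,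
      Γ.polyForm_mul_pos χ 1 hy]
    simp
  | succ k ih =>
    induction hx using filt_succ_induction with
    | add a b _ _ ha hb =>
      obtain ⟨a1, ha1, c1, hc1, h1⟩ := ha
      obtain ⟨a2, ha2, c2, hc2, h2⟩ := hb
      refine ⟨a1 + a2, add_mem ha1 ha2, c1 + c2, add_mem hc1 hc2, fun y' => ?_⟩
      rw [mul_add]
      simp only [map_add, LinearMap.add_apply, h1, h2]; ring
    | low a ha =>
      obtain ⟨a1, ha1, c1, hc1, h1⟩ := ih hy ha
      exact ⟨a1, filt_le_succ k ha1, c1, filtLT_mono k.le_succ hc1, h1⟩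
    | mul x hx u hu =>
      obtain ⟨n, hn, h, p, hp, hd, -⟩ := Γ.exists_decomp ⁅y, x⁆
      obtain ⟨a1, ha1, c1, hc1, h1⟩ := ih hy hu
      obtain ⟨a2, ha2, c2, hc2, h2⟩ := ih hp hu
      have h3 : inc L h * u - u * inc L h ∈ filt Γ.negPart k :=
        ad_mem_filt (fun x hx => Γ.zero_lie_mem_negPart h hx) hu
      -- Write `y x u = x y u + [y, x] u` with `[y, x] = n + h + p`, and `h u = [h, u] + u h`. The
      -- trailing `h` evaluates to `X χ(h)`; it is the only new source of `X`, and there the letter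
      -- `x` has been used up. All terms without `X` go into the first witness.
      refine ⟨inc L x * a1 + inc L n * u + (inc L h * u - u * inc L h) + a2,
        add_mem (add_mem (add_mem (inc_mul_mem_filt hx ha1) (inc_mul_mem_filt hn hu))
          (filt_le_succ k h3)) (filt_le_succ k ha2),
        inc L x * c1 + χ h • u + c2, add_mem (add_mem (inc_mul_mem_filtLT hx hc1)
          (Submodule.smul_mem _ _ hu)) (filtLT_mono k.le_succ hc2), fun y' => ?_⟩
      have h4 : inc L y * (inc L x * u) = inc L x * (inc L y * u) + inc L n * u +
          (inc L h * u - u * inc L h) + u * inc L h + inc L p * u := by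
        have : inc L y * inc L x = inc L x * inc L y + (inc L n + inc L h + inc L p) := by
          rw [← map_add, ← map_add, ← hd, inc_lie]; abel
        rw [← mul_assoc, this]; noncomm_ring
      rw [h4]
      simp only [map_add, LinearMap.add_apply, h2, polyForm_inc_mul _ _ x, h1, polyForm_mul_zero,
        map_smul, LinearMap.smul_apply, smul_eq_C_mul]
      ring

/-- An element of `U(n₋)` is a scalar modulo `n₋ U(g)`, and `n₋ U(g)` is orthogonal to `1`: for `a`
in `n₋`, moving `a` to the other side puts it to the right of `1`, where it is killed. -/
theorem exists_polyForm_one {k : ℕ} {x : U L} (hx : x ∈ filt Γ.negPart k) :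
    ∃ c : ℂ, Γ.polyForm χ x 1 = C c := by
  obtain ⟨c, hc, -⟩ := exists_scalar_of_mem_adjoin (filt_le_adjoin k hx)
  refine ⟨c, ?_⟩
  have : Γ.polyForm χ (x - algebraMap ℂ _ c) 1 = 0 := by
    generalize x - algebraMap ℂ _ c = w at hc
    induction hc using Submodule.span_induction with
    | mem z hz =>
      obtain ⟨a, ha, b, rfl⟩ := hz
      rw [polyForm_inc_mul, mul_one, ← one_mul (inc L a), Γ.polyForm_mul_neg χ _ _ ha, neg_zero]
    | zero => simp
    | add z w _ _ hz hw => rw [map_add, LinearMap.add_apply, hz, hw, add_zero]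
    | smul e z _ hz => rw [map_smul, LinearMap.smul_apply, hz, smul_zero]
  rw [map_sub, LinearMap.sub_apply, sub_eq_zero] at this
  rw [this, Algebra.algebraMap_eq_smul_one, map_smul, LinearMap.smul_apply, polyForm_one_one,
    smul_eq_C_mul, mul_one]

end Grading


/-! ### Degrees in the parameter, dual systems and leading coefficients -/

namespace Grading

variable {L : Type u} [LieRing L] [LieAlgebra ℂ L] (Γ : Grading L)
  (χ : LieAlgebra.LieCharacter ℂ Γ.zeroPart)

open Polynomial

/-- The form of a product of `k` elements of the negative part and a product of `l` elements of
the positive part has degree at most `min k l`. -/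
theorem coeff_polyForm_eq_zero {k : ℕ} {x : U L} (hx : x ∈ filt Γ.negPart k) {ι : Type v}
    {f : ι → L} (hf : ∀ i, f i ∈ Γ.posPart) (l : List ι) {j : ℕ} (hj : min k l.length < j) :
    (Γ.polyForm χ x (mono f l)).coeff j = 0 := by
  induction l generalizing k x j with
  | nil =>
    obtain ⟨c, hc⟩ := Γ.exists_polyForm_one χ hx
    rw [mono_nil, hc, coeff_C, if_neg (by omega)]
  | cons i l ih =>
    obtain ⟨a, ha, c, hc, h⟩ := Γ.exists_reduce χ (hf i) hx
    rw [List.length_cons] at hj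
    have h1 := polyForm_inc_mul Γ χ (f i) x (mono f l)
    rw [mono_cons, ← neg_eq_iff_eq_neg.mpr h1, h, coeff_neg, coeff_add, ih ha (by omega), zero_add]
    -- The first term pairs length `k` with one letter `f` fewer. In the second, the factor `X` is
    -- paid for by one letter on each side: the degree is at most `1 + min (k - 1) l.length`. For `k
    -- = 0` this term is absent, as `filtLT _ 0 = ⊥`.
    obtain ⟨j, rfl⟩ : ∃ j', j = j' + 1 := ⟨j - 1, by omega⟩
    rw [coeff_X_mul]
    cases k with
    | zero => rw [(Submodule.mem_bot ℂ).mp hc]; simp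
    | succ k => rw [ih (k := k) hc (by omega), neg_zero]

/-- Bases of the negative and of the positive part, consisting of homogeneous elements, that are
dual up to a sign for the pairing defined by `χ`. -/
structure DualSystem where
  /-- The index set. -/
  ι : Type
  /-- The degrees of the elements of the basis of the positive part. -/
  deg : ι → ℤ
  /-- The basis of the negative part. -/
  e : ι → L
  /-- The basis of the positive part. -/
  f : ι → L
  deg_pos : ∀ i, 0 < deg i
  e_mem : ∀ i, e i ∈ Γ.piece (-deg i)
  f_mem : ∀ i, f i ∈ Γ.piece (deg i)
  span_e : Γ.negPart ≤ Submodule.span ℂ (Set.range e)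
  span_f : Γ.posPart ≤ Submodule.span ℂ (Set.range f)
  pair_self : ∀ i, χ (Γ.toZero ⁅f i, e i⁆) = -1
  pair_ne : ∀ i j, i ≠ j → χ (Γ.toZero ⁅f i, e j⁆) = 0
  finite : ∀ n, {i | deg i ≤ n}.Finite

variable {Γ χ}

theorem chi_toZero_lie_of_ne {i j : ℤ} (hij : i + j ≠ 0) {x y : L} (hx : x ∈ Γ.piece i)
    (hy : y ∈ Γ.piece j) : χ (Γ.toZero ⁅x, y⁆) = 0 := by
  rw [Γ.toZero_of_mem_ne hij (Γ.lie_mem hx hy), map_zero]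

/-- The pairing between opposite graded pieces defined by a character. -/
def piecePairing (χ : LieAlgebra.LieCharacter ℂ Γ.zeroPart) (d : ℤ) :
    Γ.piece d →ₗ[ℂ] Γ.piece (-d) →ₗ[ℂ] ℂ :=
  LinearMap.mk₂ ℂ (fun x y => -χ (Γ.toZero ⁅(x : L), (y : L)⁆))
    (fun x y z => by simp [add_comm]) (fun c x y => by simp) (fun x y z => by simp [add_comm])
    (fun c x y => by simp)

/-- Pieces whose degrees do not add up to zero are orthogonal, so an element of degree `d` pairing
trivially with `g_{-d}` pairs trivially with all of the opposite part. -/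
theorem IsNonsingularCharacter.piecePairing_injective (hχ : Γ.IsNonsingularCharacter χ) {d : ℤ}
    (hd : 0 < d) : Function.Injective (piecePairing χ d) ∧
      Function.Injective (piecePairing χ d).flip := by
  constructor
  · rw [← LinearMap.ker_eq_bot, LinearMap.ker_eq_bot']
    intro x hx
    refine Subtype.ext (hχ.1 x (Γ.mem_posPart hd x.2) fun v hv => ?_)
    induction hv using Γ.neg_induction with
    | zero => simp
    | add a b _ _ ha hb => rw [lie_add, map_add, map_add, ha, hb, add_zero]
    | mem i hi v hv =>
      by_cases h : d + i = 0
      · obtain rfl : i = -d := by omega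
        exact neg_eq_zero.mp (DFunLike.congr_fun hx ⟨v, hv⟩)
      · exact chi_toZero_lie_of_ne h x.2 hv
  · rw [← LinearMap.ker_eq_bot, LinearMap.ker_eq_bot']
    intro y hy
    refine Subtype.ext (hχ.2 y (Γ.mem_negPart (by omega) y.2) fun u hu => ?_)
    induction hu using Γ.pos_induction with
    | zero => simp
    | add a b _ _ ha hb => rw [add_lie, map_add, map_add, ha, hb, add_zero]
    | mem i hi u hu =>
      by_cases h : i + -d = 0
      · obtain rfl : i = d := by omega
        exact neg_eq_zero.mp (DFunLike.congr_fun hy ⟨u, hu⟩)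
      · exact chi_toZero_lie_of_ne h hu y.2

/-- Injectivity on both sides makes the finite dimensions of the opposite pieces equal. -/
theorem IsNonsingularCharacter.piecePairing_bijective (hχ : Γ.IsNonsingularCharacter χ) {d : ℤ}
    (hd : 0 < d) : Function.Bijective (piecePairing χ d) := by
  obtain ⟨h1, h2⟩ := hχ.piecePairing_injective hd
  have := Γ.finite d
  have := Γ.finite (-d)
  have e1 := LinearMap.finrank_le_finrank_of_injective h1
  have e2 := LinearMap.finrank_le_finrank_of_injective h2
  have e3 : Module.finrank ℂ (Γ.piece d →ₗ[ℂ] ℂ) = _ := Subspace.dual_finrank_eq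
  have e4 : Module.finrank ℂ (Γ.piece (-d) →ₗ[ℂ] ℂ) = _ := Subspace.dual_finrank_eq
  exact ⟨h1, (LinearMap.injective_iff_surjective_of_finrank_eq_finrank (by omega)).mp h1⟩

/-- In each degree `d > 0` choose a basis of `g_{-d}` and carry the dual basis to `g_d` by the
pairing. The sign in `piecePairing`, hence the value `-1`, cancels the sign of the antipode, so that
the leading coefficients of the form come out positive. -/
theorem IsNonsingularCharacter.exists_dualSystem (hχ : Γ.IsNonsingularCharacter χ) :
    Nonempty (DualSystem Γ χ) := by
  have := Γ.finite
  let be : ∀ d : {d : ℤ // 0 < d}, Module.Basis (Fin (Module.finrank ℂ (Γ.piece (-d)))) ℂ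
    (Γ.piece (-d)) := fun d => Module.finBasis ℂ (Γ.piece (-d))
  let eq : ∀ d : {d : ℤ // 0 < d}, Γ.piece d ≃ₗ[ℂ] Module.Dual ℂ (Γ.piece (-d)) := fun d =>
    LinearEquiv.ofBijective (piecePairing χ d) (hχ.piecePairing_bijective d.2)
  let bf : ∀ d : {d : ℤ // 0 < d}, Module.Basis (Fin (Module.finrank ℂ (Γ.piece (-d)))) ℂ
    (Γ.piece d) := fun d => (be d).dualBasis.map (eq d).symm
  have hpair : ∀ d i j, χ (Γ.toZero ⁅(bf d i : L), (be d j : L)⁆) = if j = i then -1 else 0 := by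
    intro d i j
    have h : piecePairing χ d (bf d i) (be d j) = if j = i then 1 else 0 := by
      have : piecePairing χ d (bf d i) = (be d).dualBasis i := (eq d).apply_symm_apply _
      rw [this, Module.Basis.dualBasis_apply_self]
    have h2 : χ (Γ.toZero ⁅(bf d i : L), (be d j : L)⁆) = -piecePairing χ d (bf d i) (be d j) :=
      (neg_neg _).symm
    rw [h2, h]; split_ifs <;> simp
  refine ⟨{
    ι := Σ d : {d : ℤ // 0 < d}, Fin (Module.finrank ℂ (Γ.piece (-d)))
    deg := fun i => i.1
    e := fun i => be i.1 i.2
    f := fun i => bf i.1 i.2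
    deg_pos := fun i => i.1.2
    e_mem := fun i => (be i.1 i.2).2
    f_mem := fun i => (bf i.1 i.2).2
    span_e := ?_
    span_f := ?_
    pair_self := fun i => by rw [hpair, if_pos rfl]
    pair_ne := ?_
    finite := ?_ }⟩
  · intro x hx
    induction hx using Γ.neg_induction with
    | zero => simp
    | add a b _ _ ha hb => exact add_mem ha hb
    | mem i hi x hx =>
      obtain ⟨d, rfl⟩ : ∃ d, i = -d := ⟨-i, by omega⟩
      have h := (be ⟨d, by omega⟩).sum_repr ⟨x, hx⟩
      have h2 : _ = x := congrArg Subtype.val h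
      rw [← h2, AddSubmonoidClass.coe_finsetSum]
      exact Submodule.sum_mem _ fun j _ => Submodule.smul_mem _ _
        (Submodule.subset_span ⟨⟨⟨d, by omega⟩, j⟩, rfl⟩)
  · intro x hx
    induction hx using Γ.pos_induction with
    | zero => simp
    | add a b _ _ ha hb => exact add_mem ha hb
    | mem d hd x hx =>
      have h := (bf ⟨d, by omega⟩).sum_repr ⟨x, hx⟩
      have h2 : _ = x := congrArg Subtype.val h
      rw [← h2, AddSubmonoidClass.coe_finsetSum]
      exact Submodule.sum_mem _ fun j _ => Submodule.smul_mem _ _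
        (Submodule.subset_span ⟨⟨⟨d, by omega⟩, j⟩, rfl⟩)
  · rintro ⟨d, i⟩ ⟨d', j⟩ hij
    by_cases h : d = d'
    · subst h
      rw [hpair, if_neg]
      rintro rfl; exact hij rfl
    · refine chi_toZero_lie_of_ne ?_ (bf d i).2 (be d' j).2
      intro h'
      exact h (Subtype.ext (by omega))
  · intro n
    have : {i : Σ d : {d : ℤ // 0 < d}, Fin (Module.finrank ℂ (Γ.piece (-d))) | (i.1 : ℤ) ≤ n} =
        ⋃ d ∈ {d : {d : ℤ // 0 < d} | (d : ℤ) ≤ n}, Set.range (Sigma.mk d) := by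
      ext ⟨d, i⟩; simp
    rw [this]
    refine Set.Finite.biUnion ?_ fun d _ => Set.finite_range _
    refine Set.Finite.of_finite_image (f := Subtype.val) ?_ Subtype.val_injective.injOn
    exact (Set.finite_Icc 0 n).subset (by rintro _ ⟨d, hd, rfl⟩; exact ⟨d.2.le, hd⟩)

namespace DualSystem

variable (D : DualSystem Γ χ)

theorem e_neg (i : D.ι) : D.e i ∈ Γ.negPart :=
  Γ.mem_negPart (by have := D.deg_pos i; omega) (D.e_mem i)

theorem f_pos (i : D.ι) : D.f i ∈ Γ.posPart := Γ.mem_posPart (D.deg_pos i) (D.f_mem i)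

open Classical in
-- A sharper `exists_reduce`: to leading order in `X` and modulo the left kernel of the form, `f_j`
-- acts on products of letters `e` as `-X ∂/∂e_j`, because `χ([f_j, e_i]₀) = -δ_ij`.
theorem exists_reduce_mono (j : D.ι) (l : List D.ι) :
    ∃ a ∈ filt Γ.negPart l.length, ∃ c : U L,
      c - (l.count j : ℂ) • mono D.e (l.erase j) ∈ filtLT Γ.negPart (l.length - 1) ∧
      ∀ y' : U L, Γ.polyForm χ (inc L (D.f j) * mono D.e l) y' =
        Γ.polyForm χ a y' - X * Γ.polyForm χ c y' := by
  induction l with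
  | nil =>
    refine ⟨0, zero_mem _, 0, by simp, fun y' => ?_⟩
    rw [mono_nil, mul_one, ← one_mul (inc L (D.f j)), Γ.polyForm_mul_pos χ 1 (D.f_pos j)]
    simp
  | cons i l ih =>
    obtain ⟨a1, ha1, c1, hc1, h1⟩ := ih
    obtain ⟨n, hn, h, p, hp, hd, hh⟩ := Γ.exists_decomp ⁅D.f j, D.e i⁆
    have hl := mono_mem_filt D.e_neg l
    obtain ⟨a2, ha2, c2, hc2, h2⟩ := Γ.exists_reduce χ hp hl
    have h3 : inc L h * mono D.e l - mono D.e l * inc L h ∈ filt Γ.negPart l.length :=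
      ad_mem_filt (fun x hx => Γ.zero_lie_mem_negPart h hx) hl
    refine ⟨inc L (D.e i) * a1 + inc L n * mono D.e l +
        (inc L h * mono D.e l - mono D.e l * inc L h) + a2,
        add_mem (add_mem (add_mem (inc_mul_mem_filt (D.e_neg i) ha1) (inc_mul_mem_filt hn hl))
          (filt_le_succ _ h3)) (filt_le_succ _ ha2),
        inc L (D.e i) * c1 - χ h • mono D.e l - c2, ?_, fun y' => ?_⟩
    · have key : inc L (D.e i) * c1 - χ h • mono D.e l -
          ((i :: l).count j : ℂ) • mono D.e ((i :: l).erase j) ∈ filtLT Γ.negPart l.length := by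
        have e1 : inc L (D.e i) * c1 - (l.count j : ℂ) • mono D.e (i :: l.erase j) ∈
            filtLT Γ.negPart l.length := by
          rw [mono_cons, ← mul_smul_comm, ← mul_sub]
          -- For empty `l` the subtraction truncates: the hypothesis then lies in `filtLT _ 0 = ⊥`,
          -- and multiplying by a letter must not raise the index.
          rcases Nat.eq_zero_or_pos l.length with h0 | h0
          · rw [h0] at hc1 ⊢
            rw [(Submodule.mem_bot ℂ).mp hc1, mul_zero]; exact zero_mem _
          · have := inc_mul_mem_filtLT (D.e_neg i) hc1
            rwa [Nat.sub_add_cancel h0] at this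
        by_cases hij : i = j
        · subst hij
          rw [hh, D.pair_self, List.erase_cons_head, List.count_cons_self]
          by_cases hi : i ∈ l
          · have e2 := mono_sub_mem_filtLT (fun x hx y hy => Γ.lie_mem_negPart hx hy) D.e_neg
              (List.perm_cons_erase hi)
            have := sub_mem e1 (Submodule.smul_mem _ (l.count i : ℂ) e2)
            convert this using 1
            push_cast
            module
          · rw [List.count_eq_zero_of_not_mem hi] at e1 ⊢
            convert e1 using 1
            push_cast
            module
        · rw [hh, D.pair_ne j i (Ne.symm hij), List.erase_cons_tail (by simpa using hij),
            List.count_cons_of_ne hij]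
          convert e1 using 1
          module
      have := sub_mem key hc2
      rw [List.length_cons, Nat.add_sub_cancel]
      convert this using 1
      abel
    · have h4 : inc L (D.f j) * (inc L (D.e i) * mono D.e l) =
          inc L (D.e i) * (inc L (D.f j) * mono D.e l) + inc L n * mono D.e l +
          (inc L h * mono D.e l - mono D.e l * inc L h) + mono D.e l * inc L h +
          inc L p * mono D.e l := by
        have : inc L (D.f j) * inc L (D.e i) =
            inc L (D.e i) * inc L (D.f j) + (inc L n + inc L h + inc L p) := by
          rw [← map_add, ← map_add, ← hd, inc_lie]; abel
        rw [← mul_assoc, this]; noncomm_ring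
      rw [mono_cons, h4]
      simp only [map_add, map_sub, LinearMap.add_apply, LinearMap.sub_apply, h2,
        polyForm_inc_mul _ _ (D.e i), h1, polyForm_mul_zero, map_smul, LinearMap.smul_apply,
        smul_eq_C_mul]
      ring

open Classical in
/-- The product of the factorials of the multiplicities of a list. -/
def multFactorial {α : Type*} : List α → ℕ
  | [] => 1
  | j :: l => (j :: l).count j * multFactorial l

open Classical in
theorem multFactorial_ne_zero {α : Type*} (l : List α) : multFactorial l ≠ 0 := by
  induction l with
  | nil => exact one_ne_zero
  | cons j l ih => rw [multFactorial, List.count_cons_self]; exact mul_ne_zero (by omega) ih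

open Classical in
-- Peel off the first `f`: at top order it differentiates the product of the `e`'s, as in the
-- pairing of two symmetric algebras. The part without `X` is then paired with `m.length` letters
-- `f`, too few to reach the top exponent.
theorem coeff_polyForm_mono (l l' : List D.ι) (h : l.length = l'.length) :
    (Γ.polyForm χ (mono D.e l) (mono D.f l')).coeff l'.length =
      if l.Perm l' then (multFactorial l' : ℂ) else 0 := by
  induction l' generalizing l with
  | nil =>
    obtain rfl := List.length_eq_zero_iff.mp h
    rw [mono_nil, mono_nil, polyForm_one_one, if_pos (List.Perm.refl _)]
    simp [multFactorial]
  | cons j m ih =>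
    obtain ⟨a, ha, c, hc, hred⟩ := D.exists_reduce_mono j l
    rw [List.length_cons] at h ⊢
    rw [h, Nat.add_sub_cancel] at hc
    have h1 := polyForm_inc_mul Γ χ (D.f j) (mono D.e l) (mono D.f m)
    rw [mono_cons, ← neg_eq_iff_eq_neg.mpr h1, hred, coeff_neg, coeff_sub, coeff_X_mul,
      Γ.coeff_polyForm_eq_zero χ ha D.f_pos m (by omega), zero_sub, neg_neg]
    -- The element `c` differs from its leading monomial by shorter products, which do not
    -- contribute in degree `m.length`.
    have h2 : (Γ.polyForm χ (c - (l.count j : ℂ) • mono D.e (l.erase j)) (mono D.f m)).coeff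
        m.length = 0 := by
      rcases hm : m.length with _ | k
      · rw [hm] at hc
        rw [(Submodule.mem_bot ℂ).mp hc]; simp
      · rw [hm] at hc
        exact Γ.coeff_polyForm_eq_zero χ (k := k) hc D.f_pos m (by omega)
    rw [map_sub, map_smul, LinearMap.sub_apply, LinearMap.smul_apply, coeff_sub, coeff_smul,
      sub_eq_zero] at h2
    rw [h2]
    by_cases hj : j ∈ l
    · rw [ih (l.erase j) (by rw [List.length_erase_of_mem hj]; omega)]
      have hp : l.Perm (j :: m) ↔ (l.erase j).Perm m := by
        rw [List.perm_comm, List.cons_perm_iff_perm_erase, List.perm_comm]; simp [hj]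
      by_cases hp' : l.Perm (j :: m)
      · rw [if_pos hp', if_pos (hp.mp hp'), hp'.count_eq, multFactorial]; push_cast; rfl
      · rw [if_neg hp', if_neg (mt hp.mpr hp'), smul_zero]
    · rw [List.count_eq_zero_of_not_mem hj, if_neg fun hp => hj (hp.mem_iff.mpr (by simp))]
      simp

end DualSystem

end Grading


/-! ### Ordered monomials, their weights, and the Gram matrix -/

namespace Grading

variable {L : Type u} [LieRing L] [LieAlgebra ℂ L] {Γ : Grading L}
  {χ : LieAlgebra.LieCharacter ℂ Γ.zeroPart}

open Polynomial

namespace DualSystem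

variable (D : DualSystem Γ χ)

instance : DecidableEq D.ι := Classical.decEq D.ι

/-- The degree of a multiset of basis elements. -/
def wt (s : Multiset D.ι) : ℤ := (s.map D.deg).sum

theorem wt_cons (i : D.ι) (s : Multiset D.ι) : D.wt (i ::ₘ s) = D.deg i + D.wt s := by
  rw [wt, Multiset.map_cons, Multiset.sum_cons]; rfl

theorem card_le_wt (s : Multiset D.ι) : (s.card : ℤ) ≤ D.wt s := by
  induction s using Multiset.induction_on with
  | empty => simp [wt]
  | cons i s ih => rw [wt_cons, Multiset.card_cons]; have := D.deg_pos i; push_cast; omega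

theorem deg_le_wt {i : D.ι} {s : Multiset D.ι} (hi : i ∈ s) : D.deg i ≤ D.wt s := by
  obtain ⟨t, rfl⟩ := Multiset.exists_cons_of_mem hi
  rw [wt_cons]
  have := D.card_le_wt t
  omega

/-- All degrees are at least `1`. A multiset of weight `n` therefore uses only the finitely many
indices of degree at most `n`, each at most `n` times, so it lies below a fixed multiset. -/
theorem finite_wt (n : ℤ) : {s : Multiset D.ι | D.wt s = n}.Finite := by
  classical
  refine (Set.finite_Icc 0 (n.toNat • (D.finite n).toFinset.val)).subset fun s hs => ?_
  refine ⟨Multiset.zero_le s, Multiset.le_iff_count.mpr fun i => ?_⟩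
  obtain rfl : D.wt s = n := hs
  rw [Multiset.count_nsmul]
  by_cases hi : i ∈ s
  · have h1 : Multiset.count i (D.finite (D.wt s)).toFinset.val = 1 :=
      Multiset.count_eq_one_of_mem (Finset.nodup _)
        (by simpa using D.deg_le_wt hi)
    rw [h1, mul_one]
    have := D.card_le_wt s
    have := Multiset.count_le_card i s
    omega
  · rw [Multiset.count_eq_zero_of_notMem hi]; exact Nat.zero_le _

/-- The multisets of basis elements of degree `n`. -/
def index (n : ℤ) : Finset (Multiset D.ι) := (D.finite_wt n).toFinset

theorem mem_index {n : ℤ} {s : Multiset D.ι} : s ∈ D.index n ↔ D.wt s = n := by simp [index]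

/-- Ordered monomials in the basis of the negative part. -/
def E (s : Multiset D.ι) : U L := mono D.e s.toList

/-- Ordered monomials in the basis of the positive part. -/
def F (s : Multiset D.ι) : U L := mono D.f s.toList

theorem mono_e_isHomog (l : List D.ι) : Γ.IsHomog (-D.wt l) (mono D.e l) := by
  induction l with
  | nil => simpa [mono_nil, wt] using Γ.isHomog_one
  | cons i l ih =>
    rw [mono_cons, ← Multiset.cons_coe, wt_cons, neg_add]
    exact (Γ.isHomog_inc (D.e_mem i)).mul ih

theorem mono_f_isHomog (l : List D.ι) : Γ.IsHomog (D.wt l) (mono D.f l) := by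
  induction l with
  | nil => simpa [mono_nil, wt] using Γ.isHomog_one
  | cons i l ih =>
    rw [mono_cons, ← Multiset.cons_coe, wt_cons]
    exact (Γ.isHomog_inc (D.f_mem i)).mul ih

theorem E_isHomog (s : Multiset D.ι) : Γ.IsHomog (-D.wt s) (D.E s) := by
  simpa [E] using D.mono_e_isHomog s.toList

theorem F_isHomog (s : Multiset D.ι) : Γ.IsHomog (D.wt s) (D.F s) := by
  simpa [F] using D.mono_f_isHomog s.toList

theorem E_mem_filt (s : Multiset D.ι) : D.E s ∈ filt Γ.negPart s.card := by
  simpa [E] using mono_mem_filt D.e_neg s.toList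

theorem E_mem (s : Multiset D.ι) : D.E s ∈ Γ.Uneg := filt_le_adjoin _ (D.E_mem_filt s)

theorem F_mem (s : Multiset D.ι) : D.F s ∈ Γ.Upos :=
  filt_le_adjoin _ (mono_mem_filt D.f_pos s.toList)

theorem mem_span_E {x : U L} (hx : x ∈ Γ.Uneg) : x ∈ Submodule.span ℂ (Set.range D.E) := by
  obtain ⟨k, hk⟩ := exists_mem_filt hx
  refine Submodule.span_mono ?_ (filt_le_span (fun x hx y hy => Γ.lie_mem_negPart hx hy) D.e_neg
    D.span_e k hk)
  rintro _ ⟨s, -, rfl⟩; exact ⟨s, rfl⟩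

theorem mem_span_F {x : U L} (hx : x ∈ Γ.Upos) : x ∈ Submodule.span ℂ (Set.range D.F) := by
  obtain ⟨k, hk⟩ := exists_mem_filt hx
  refine Submodule.span_mono ?_ (filt_le_span (fun x hx y hy => Γ.lie_mem_posPart hx hy) D.f_pos
    D.span_f k hk)
  rintro _ ⟨s, -, rfl⟩; exact ⟨s, rfl⟩

theorem mem_UnegDeg {n : ℤ} {s : Multiset D.ι} (hs : s ∈ D.index n) : D.E s ∈ Γ.UnegDeg n :=
  ⟨D.E_mem s, Γ.mem_homog_iff.mpr (D.mem_index.mp hs ▸ D.E_isHomog s)⟩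

theorem mem_UposDeg {n : ℤ} {s : Multiset D.ι} (hs : s ∈ D.index n) : D.F s ∈ Γ.UposDeg n :=
  ⟨D.F_mem s, Γ.mem_homog_iff.mpr (D.mem_index.mp hs ▸ D.F_isHomog s)⟩

theorem mem_span_E_of_mem_UnegDeg {n : ℤ} {x : U L} (hx : x ∈ Γ.UnegDeg n) :
    x ∈ Submodule.span ℂ (Set.range fun s : D.index n => D.E s) := by
  have key : ∀ y ∈ Submodule.span ℂ (Set.range D.E), Γ.degProj (-n) y ∈
      Submodule.span ℂ (Set.range fun s : D.index n => D.E s) := by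
    intro y hy
    induction hy using Submodule.span_induction with
    | mem y hy =>
      obtain ⟨s, rfl⟩ := hy
      by_cases h : D.wt s = n
      · rw [← h, (D.E_isHomog s).degProj_eq]
        exact Submodule.subset_span ⟨⟨s, D.mem_index.mpr rfl⟩, rfl⟩
      · rw [(D.E_isHomog s).degProj_ne (by omega)]; exact zero_mem _
    | zero => simp
    | add a b _ _ ha hb => rw [map_add]; exact add_mem ha hb
    | smul c a _ ha => rw [map_smul]; exact Submodule.smul_mem _ _ ha
  rw [← (Γ.mem_homog_iff.mp hx.2).degProj_eq]
  exact key x (D.mem_span_E hx.1)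

theorem mem_span_F_of_mem_UposDeg {n : ℤ} {x : U L} (hx : x ∈ Γ.UposDeg n) :
    x ∈ Submodule.span ℂ (Set.range fun s : D.index n => D.F s) := by
  have key : ∀ y ∈ Submodule.span ℂ (Set.range D.F), Γ.degProj n y ∈
      Submodule.span ℂ (Set.range fun s : D.index n => D.F s) := by
    intro y hy
    induction hy using Submodule.span_induction with
    | mem y hy =>
      obtain ⟨s, rfl⟩ := hy
      by_cases h : D.wt s = n
      · rw [← h, (D.F_isHomog s).degProj_eq]
        exact Submodule.subset_span ⟨⟨s, D.mem_index.mpr rfl⟩, rfl⟩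
      · rw [(D.F_isHomog s).degProj_ne h]; exact zero_mem _
    | zero => simp
    | add a b _ _ ha hb => rw [map_add]; exact add_mem ha hb
    | smul c a _ ha => rw [map_smul]; exact Submodule.smul_mem _ _ ha
  rw [← (Γ.mem_homog_iff.mp hx.2).degProj_eq]
  exact key x (D.mem_span_F hx.1)

/-! ### The Gram matrix -/

/-- The matrix of the Shapovalov pairing in degree `n`. -/
def gram (lam : ℂ) (n : ℤ) : Matrix (D.index n) (D.index n) ℂ :=
  Matrix.of fun s t => Γ.shapovalov χ lam (D.E s) (D.F t)

theorem gram_apply (lam : ℂ) (n : ℤ) (s t : D.index n) :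
    D.gram lam n s t = Γ.shapovalov χ lam (D.E s) (D.F t) := rfl

/-- The rescaled Gram matrix, as a matrix of polynomials in the inverse of the parameter. -/
def revGram (n : ℤ) : Matrix (D.index n) (D.index n) ℂ[X] :=
  Matrix.of fun s t => (Γ.polyForm χ (D.E s) (D.F t)).reflect (s : Multiset D.ι).card

theorem natDegree_polyForm_le (s t : Multiset D.ι) :
    (Γ.polyForm χ (D.E s) (D.F t)).natDegree ≤ s.card :=
  natDegree_le_iff_coeff_eq_zero.mpr fun _ hj =>
    Γ.coeff_polyForm_eq_zero χ (D.E_mem_filt s) D.f_pos _ (lt_of_le_of_lt (min_le_left _ _) hj)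

/-- Reflecting a polynomial at `k` means `p(X) ↦ t ^ k p(1/t)` as long as its degree is at most `k`;
here `k` is the length of the row monomial. -/
theorem eval_revGram {n : ℤ} {t : ℂ} (ht : t ≠ 0) (a b : D.index n) :
    (D.revGram n a b).eval t = t ^ (a : Multiset D.ι).card * D.gram t⁻¹ n a b := by
  have : Invertible t⁻¹ := invertibleOfNonzero (inv_ne_zero ht)
  have h := eval₂_reflect_mul_pow (RingHom.id ℂ) t⁻¹ (a : Multiset D.ι).card
    (Γ.polyForm χ (D.E a) (D.F b)) (D.natDegree_polyForm_le a b)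
  rw [invOf_eq_inv, inv_inv] at h
  change eval t (reflect _ _) * _ = eval t⁻¹ _ at h
  rw [gram_apply, ← eval_polyForm, ← h, revGram, Matrix.of_apply, inv_pow]
  field_simp

theorem coeff_zero_revGram {n : ℤ} (a b : D.index n) :
    (D.revGram n a b).coeff 0 =
      (Γ.polyForm χ (D.E a) (D.F b)).coeff (a : Multiset D.ι).card := by
  rw [revGram, Matrix.of_apply, coeff_reflect, revAt_le (Nat.zero_le _), Nat.sub_zero]

/-- At `0` the entry `(a, b)` is the coefficient of `X ^ |a|`: zero if `|b| < |a|`, and a nonzero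
multiple of `δ_ab` if the lengths agree. For a null vector, the row of a longest index in its
support reduces to a single nonzero product. -/
theorem det_revGram_coeff_ne_zero (n : ℤ) : (D.revGram n).det.eval 0 ≠ 0 := by
  classical
  have hdet : (D.revGram n).det.eval 0 = ((D.revGram n).map (eval 0)).det := by
    rw [← coe_evalRingHom, RingHom.map_det]; rfl
  rw [hdet]
  intro h0
  obtain ⟨v, hv, hmul⟩ := Matrix.exists_mulVec_eq_zero_iff.mpr h0
  obtain ⟨s, hs, hmax⟩ := Finset.exists_max_image (Finset.univ.filter fun s => v s ≠ 0)
    (fun s => (s : Multiset D.ι).card) (by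
      obtain ⟨s, hs⟩ := Function.ne_iff.mp hv
      exact ⟨s, by simpa using hs⟩)
  have hvs : v s ≠ 0 := by simpa using hs
  have h1 := congrFun hmul s
  rw [Matrix.mulVec, dotProduct, Finset.sum_eq_single s] at h1
  · refine (mul_ne_zero ?_ hvs) h1
    rw [Matrix.map_apply, ← coeff_zero_eq_eval_zero, coeff_zero_revGram]
    have h2 := D.coeff_polyForm_mono (s : Multiset D.ι).toList (s : Multiset D.ι).toList rfl
    rw [if_pos (List.Perm.refl _), Multiset.length_toList] at h2
    exact h2 ▸ Nat.cast_ne_zero.mpr (multFactorial_ne_zero _)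
  · intro t _ hts
    by_cases hvt : v t = 0
    · rw [hvt, mul_zero]
    · have hle := hmax t (by simpa using hvt)
      have : (D.revGram n).map (eval 0) s t = 0 := by
        rw [Matrix.map_apply, ← coeff_zero_eq_eval_zero, coeff_zero_revGram]
        rcases hle.lt_or_eq with hlt | heq
        · exact Γ.coeff_polyForm_eq_zero χ (D.E_mem_filt s) D.f_pos _ (by
            rw [Multiset.length_toList]; exact lt_of_le_of_lt (min_le_right _ _) hlt)
        · have h2 := D.coeff_polyForm_mono (s : Multiset D.ι).toList (t : Multiset D.ι).toList
            (by simpa using heq.symm)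
          rw [Multiset.length_toList, heq, if_neg] at h2
          · exact h2
          · intro hp
            apply hts
            have := Multiset.coe_eq_coe.mpr hp
            rw [Multiset.coe_toList, Multiset.coe_toList] at this
            exact Subtype.ext this.symm
      rw [this, zero_mul]
  · simp

theorem det_gram {n : ℤ} {t : ℂ} (ht : t ≠ 0) : (D.revGram n).det.eval t =
    (∏ s : D.index n, t ^ (s : Multiset D.ι).card) * (D.gram t⁻¹ n).det := by
  have hdet : (D.revGram n).det.eval t = ((D.revGram n).map (eval t)).det := by
    rw [← coe_evalRingHom, RingHom.map_det]; rfl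
  rw [hdet, ← Matrix.det_diagonal, ← Matrix.det_mul]
  congr 1
  ext a b
  rw [Matrix.diagonal_mul, Matrix.map_apply, D.eval_revGram ht]

theorem det_gram_ne_zero_iff {n : ℤ} {t : ℂ} (ht : t ≠ 0) :
    (D.gram t⁻¹ n).det ≠ 0 ↔ (D.revGram n).det.eval t ≠ 0 := by
  rw [D.det_gram ht, mul_ne_zero_iff, and_iff_right]
  exact Finset.prod_ne_zero_iff.mpr fun s _ => pow_ne_zero _ ht

/-- The determinant of the rescaled matrix is a nonzero polynomial; avoiding its roots and `0` gives
a usable inverse parameter. -/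
theorem exists_det_gram_ne_zero (n : ℤ) : ∃ lam : ℂ, (D.gram lam n).det ≠ 0 := by
  have h : (D.revGram n).det ≠ 0 := fun h => D.det_revGram_coeff_ne_zero n (by rw [h, eval_zero])
  obtain ⟨t, ht⟩ := Set.Infinite.nonempty
    (Set.Infinite.sdiff (Set.infinite_univ (α := ℂ))
      (((D.revGram n).det.roots.toFinset.finite_toSet).union (Set.finite_singleton 0)))
  refine ⟨t⁻¹, (D.det_gram_ne_zero_iff ?_).mpr ?_⟩
  · rintro rfl; exact ht.2 (Or.inr rfl)
  · intro h0; exact ht.2 (Or.inl (by simp [h, h0]))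

theorem countable_det_gram_eq_zero (n : ℤ) : {lam : ℂ | (D.gram lam n).det = 0}.Countable := by
  have h : (D.revGram n).det ≠ 0 := fun h => D.det_revGram_coeff_ne_zero n (by rw [h, eval_zero])
  refine Set.Finite.countable ((((D.revGram n).det.roots.toFinset.finite_toSet).image
    (·⁻¹)).union (Set.finite_singleton 0) |>.subset fun lam hl => ?_)
  by_cases h0 : lam = 0
  · exact Or.inr h0
  · refine Or.inl ⟨lam⁻¹, ?_, inv_inv _⟩
    have := (D.det_gram_ne_zero_iff (n := n) (inv_ne_zero h0)).mpr.mt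
    rw [inv_inv, not_not, not_not] at this
    simpa [h] using this hl

end DualSystem

end Grading


/-! ### Power series expansions at zero along a subset of the parameters -/

section Expansions

open Polynomial Filter Topology

/-- The power series with coefficients `a` converges to `f` at all small nonzero `t` in `S`. -/
def Expands (S : Set ℂ) (a : ℕ → ℂ) (f : ℂ → ℂ) : Prop :=
  ∃ r : ℝ, 0 < r ∧ ∀ t : ℂ, t ≠ 0 → ‖t‖ < r → t ∈ S → HasSum (fun m => a m * t ^ m) (f t)

theorem exists_hasSum_div (p q : ℂ[X]) (hq : q.eval 0 ≠ 0) : ∃ a : ℕ → ℂ, ∃ r : ℝ, 0 < r ∧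
    ∀ t : ℂ, ‖t‖ < r → q.eval t ≠ 0 ∧ HasSum (fun m => a m * t ^ m) (p.eval t / q.eval t) := by
  have hp : AnalyticAt ℂ (fun t => p.eval t) 0 := p.differentiable.analyticAt 0
  have hq' : AnalyticAt ℂ (fun t => q.eval t) 0 := q.differentiable.analyticAt 0
  obtain ⟨P, hP⟩ := hp.div hq' hq
  have h1 := hasFPowerSeriesAt_iff.mp hP
  have h2 : ∀ᶠ t in 𝓝 (0 : ℂ), q.eval t ≠ 0 := hq'.continuousAt.eventually_ne hq
  obtain ⟨r, hr, h⟩ := Metric.eventually_nhds_iff.mp (h1.and h2)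
  refine ⟨P.coeff, r, hr, fun t ht => ?_⟩
  obtain ⟨h3, h4⟩ := h (by simpa using ht)
  refine ⟨h4, ?_⟩
  rw [zero_add] at h3
  have e : (fun m => P.coeff m * t ^ m) = fun n => t ^ n • P.coeff n :=
    funext fun n => mul_comm _ _
  rw [e]
  exact h3

theorem hasSum_shift {a : ℕ → ℂ} {t x : ℂ} (h : HasSum (fun m => a m * t ^ m) x) (k : ℕ) :
    HasSum (fun m => (if k ≤ m then a (m - k) else 0) * t ^ m) (t ^ k * x) := by
  rw [← (add_left_injective k).hasSum_iff]
  · have e : (fun m => (if k ≤ m then a (m - k) else 0) * t ^ m) ∘ (fun x => x + k) =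
        fun m => t ^ k * (a m * t ^ m) := by
      funext m
      change (if k ≤ m + k then a (m + k - k) else 0) * t ^ (m + k) = _
      rw [if_pos (Nat.le_add_left k m), Nat.add_sub_cancel, pow_add]; ring
    rw [e]
    exact h.mul_left (t ^ k)
  · intro m hm
    rw [if_neg, zero_mul]
    intro hk
    exact hm ⟨m - k, Nat.sub_add_cancel hk⟩

namespace Expands

variable {S : Set ℂ} {a b : ℕ → ℂ} {f g : ℂ → ℂ}

theorem congr (h : Expands S a f) (hfg : ∀ t ∈ S, f t = g t) : Expands S a g := by
  obtain ⟨r, hr, h⟩ := h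
  exact ⟨r, hr, fun t h0 ht hS => hfg t hS ▸ h t h0 ht hS⟩

theorem const_mul (h : Expands S a f) (c : ℂ) :
    Expands S (fun m => c * a m) (fun t => c * f t) := by
  obtain ⟨r, hr, h⟩ := h
  refine ⟨r, hr, fun t h0 ht hS => ?_⟩
  simpa only [mul_assoc] using (h t h0 ht hS).mul_left c

theorem sum {ι : Type*} (s : Finset ι) {a : ι → ℕ → ℂ} {f : ι → ℂ → ℂ}
    (h : ∀ i ∈ s, Expands S (a i) (f i)) :
    Expands S (fun m => ∑ i ∈ s, a i m) (fun t => ∑ i ∈ s, f i t) := by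
  classical
  induction s using Finset.induction_on with
  | empty => exact ⟨1, one_pos, fun t _ _ _ => by simp⟩
  | insert i s hi ih =>
    obtain ⟨r, hr, h1⟩ := ih fun j hj => h j (Finset.mem_insert_of_mem hj)
    obtain ⟨r', hr', h2⟩ := h i (Finset.mem_insert_self i s)
    refine ⟨min r r', lt_min hr hr', fun t h0 ht hS => ?_⟩
    simp only [Finset.sum_insert hi, add_mul]
    exact (h2 t h0 (ht.trans_le (min_le_right _ _)) hS).add
      (h1 t h0 (ht.trans_le (min_le_left _ _)) hS)

theorem mul (ha : Expands S a f) (hb : Expands S b g) :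
    Expands S (fun m => ∑ p ∈ Finset.HasAntidiagonal.antidiagonal m, a p.1 * b p.2)
      (fun t => f t * g t) := by
  obtain ⟨r, hr, h1⟩ := ha
  obtain ⟨r', hr', h2⟩ := hb
  refine ⟨min r r', lt_min hr hr', fun t h0 ht hS => ?_⟩
  have hf := h1 t h0 (ht.trans_le (min_le_left _ _)) hS
  have hg := h2 t h0 (ht.trans_le (min_le_right _ _)) hS
  have hf' := summable_norm_iff.mpr hf.summable
  have hg' := summable_norm_iff.mpr hg.summable
  have key := tsum_mul_tsum_eq_tsum_sum_antidiagonal_of_summable_norm hf' hg'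
  have hs := (summable_norm_sum_mul_antidiagonal_of_summable_norm hf' hg').of_norm
  rw [hf.tsum_eq, hg.tsum_eq] at key
  have h3 := hs.hasSum
  rw [← key] at h3
  have e : (fun m => (∑ p ∈ Finset.HasAntidiagonal.antidiagonal m, a p.1 * b p.2) * t ^ m) =
      fun n => ∑ kl ∈ Finset.HasAntidiagonal.antidiagonal n,
        a kl.1 * t ^ kl.1 * (b kl.2 * t ^ kl.2) := by
    funext m
    rw [Finset.sum_mul]
    refine Finset.sum_congr rfl fun p hp => ?_
    rw [← Finset.HasAntidiagonal.mem_antidiagonal.mp hp, pow_add]; ring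
  rw [e]
  exact h3

/-- The complement of `S` is countable, so `S` accumulates at `0`. The sum of the series is analytic
near `0` and vanishes at points of `S` arbitrarily close to `0`, hence vanishes identically. -/
theorem eq_zero (hS : Sᶜ.Countable) (ha : Expands S a fun _ => 0) : a = 0 := by
  obtain ⟨r, hr, h⟩ := ha
  have hS' : (S ∩ {0}ᶜ)ᶜ.Countable := by
    rw [Set.compl_inter, compl_compl]; exact hS.union (Set.countable_singleton 0)
  have hdense : Dense (S ∩ {0}ᶜ) := by
    have := hS'.dense_compl ℂ
    rwa [compl_compl] at this
  have hex : ∀ δ > 0, ∃ t : ℂ, t ∈ S ∧ t ≠ 0 ∧ ‖t‖ < δ := by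
    intro δ hδ
    obtain ⟨t, ⟨hS, h0⟩, ht⟩ := hdense.exists_mem_open Metric.isOpen_ball
      (⟨0, Metric.mem_ball_self hδ⟩ : (Metric.ball (0 : ℂ) δ).Nonempty)
    exact ⟨t, hS, h0, by simpa using ht⟩
  obtain ⟨t₀, hS₀, h0₀, ht₀⟩ := hex r hr
  let P := FormalMultilinearSeries.ofScalars ℂ a
  have hP : ∀ n, P.coeff n = a n := fun n =>
    FormalMultilinearSeries.coeff_ofScalars
  -- Convergence at the single point `t₀ ≠ 0` already gives convergence on the disc of radius
  -- `‖t₀‖`, including the points outside `S`.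
  have hsum : HasFPowerSeriesAt (fun t => ∑' m, a m * t ^ m) P 0 := by
    rw [hasFPowerSeriesAt_iff, Metric.eventually_nhds_iff]
    refine ⟨‖t₀‖, norm_pos_iff.mpr h0₀, fun t ht => ?_⟩
    rw [zero_add]
    have := (summable_powerSeries_of_norm_lt 
      (h t₀ h0₀ ht₀ hS₀).tendsto_sum_nat.cauchySeq
      (by simpa using ht)).hasSum
    have e : (fun n => t ^ n • P.coeff n) = fun n => a n * t ^ n :=
      funext fun n => by rw [hP, smul_eq_mul, mul_comm]
    rw [e]
    exact this
  have hz : ∀ᶠ t in 𝓝 (0 : ℂ), ∑' m, a m * t ^ m = 0 := by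
    rw [← hsum.analyticAt.frequently_zero_iff_eventually_zero, frequently_nhdsWithin_iff,
      Metric.nhds_basis_ball.frequently_iff]
    intro δ hδ
    obtain ⟨t, hS, h0, ht⟩ := hex (min δ r) (lt_min hδ hr)
    exact ⟨t, by simpa using ht.trans_le (min_le_left _ _),
      (h t h0 (ht.trans_le (min_le_right _ _)) hS).tsum_eq, h0⟩
  have hP0 : P = 0 := (hsum.congr hz).eq_zero
  funext m
  rw [← hP m, hP0]; rfl

theorem unique (hS : Sᶜ.Countable) (ha : Expands S a f) (hb : Expands S b f) : a = b := by
  have h := (sum Finset.univ (a := ![a, fun m => -1 * b m]) (f := ![f, fun t => -1 * f t])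
    (fun i _ => by
      fin_cases i
      · exact ha
      · exact hb.const_mul (-1)))
  have h' := (h.congr (g := fun _ => 0) (fun t _ => by simp [Fin.sum_univ_two])).eq_zero hS
  funext m
  have := congrFun h' m
  simp only [Fin.sum_univ_two, Matrix.cons_val_zero, Matrix.cons_val_one, Pi.zero_apply] at this
  linear_combination this

end Expands

/-- The coefficients `a m` are those of an expansion of `f` in every linear coordinate. -/
def ExpandsWeakly (S : Set ℂ) {V : Type v} [AddCommGroup V] [Module ℂ V] (a : ℕ → V) (f : ℂ → V) :
    Prop := ∀ l : Module.Dual ℂ V, Expands S (fun m => l (a m)) (fun t => l (f t))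

namespace ExpandsWeakly

variable {S : Set ℂ} {V V' V'' : Type*} [AddCommGroup V] [Module ℂ V] [AddCommGroup V']
  [Module ℂ V'] [AddCommGroup V''] [Module ℂ V''] {a b : ℕ → V} {f : ℂ → V} {a' : ℕ → V'}
  {f' : ℂ → V'}

theorem congr {g : ℂ → V} (h : ExpandsWeakly S a f) (hfg : ∀ t ∈ S, f t = g t) :
    ExpandsWeakly S a g := fun l => (h l).congr fun t ht => by rw [hfg t ht]

theorem map (h : ExpandsWeakly S a f) (φ : V →ₗ[ℂ] V') :
    ExpandsWeakly S (fun m => φ (a m)) (fun t => φ (f t)) := fun l => h (l ∘ₗ φ)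

theorem unique (hS : Sᶜ.Countable) (ha : ExpandsWeakly S a f) (hb : ExpandsWeakly S b f) :
    a = b := by
  funext m
  rw [← sub_eq_zero, ← Module.forall_dual_apply_eq_zero_iff ℂ]
  intro l
  rw [map_sub, sub_eq_zero]
  exact congrFun ((ha l).unique hS (hb l)) m

theorem sum {ι : Type*} (s : Finset ι) {a : ι → ℕ → V} {f : ι → ℂ → V}
    (h : ∀ i ∈ s, ExpandsWeakly S (a i) (f i)) :
    ExpandsWeakly S (fun m => ∑ i ∈ s, a i m) (fun t => ∑ i ∈ s, f i t) := fun l => by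
  simpa only [map_sum] using Expands.sum s fun i hi => h i hi l

/-- The device by which linear identities that hold for all nonsingular parameters are inherited by
each coefficient of the expansion. -/
theorem eq_zero_of_map (hS : Sᶜ.Countable) (h : ExpandsWeakly S a f) (φ : V →ₗ[ℂ] V')
    (hφ : ∀ t ∈ S, φ (f t) = 0) (m : ℕ) : φ (a m) = 0 := by
  have h0 : ExpandsWeakly S (fun _ => (0 : V')) (fun _ => 0) := fun l =>
    ⟨1, one_pos, fun t _ _ _ => by simp⟩
  exact congrFun (((h.map φ).congr hφ).unique hS h0) m

/-- Bilinear maps take pairs of expansions to the expansion with the Cauchy product of the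
coefficients. -/
theorem bilin [FiniteDimensional ℂ V] [FiniteDimensional ℂ V'] (h : ExpandsWeakly S a f)
    (h' : ExpandsWeakly S a' f') (β : V →ₗ[ℂ] V' →ₗ[ℂ] V'') :
    ExpandsWeakly S (fun m => ∑ p ∈ Finset.HasAntidiagonal.antidiagonal m, β (a p.1) (a' p.2))
      (fun t => β (f t) (f' t)) := by
  intro l
  let B := Module.finBasis ℂ V
  let B' := Module.finBasis ℂ V'
  have hβ : ∀ x y, l (β x y) = ∑ i, ∑ j, l (β (B i) (B' j)) * (B.coord i x * B'.coord j y) := by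
    intro x y
    conv_lhs => rw [← B.sum_repr x, ← B'.sum_repr y]
    simp only [map_sum, LinearMap.sum_apply, map_smul, LinearMap.smul_apply, smul_eq_mul,
      Module.Basis.coord_apply, Finset.mul_sum]
    rw [Finset.sum_comm]
    refine Finset.sum_congr rfl fun i _ => Finset.sum_congr rfl fun j _ => ?_
    ring
  have key := Expands.sum (S := S) Finset.univ fun i _ => Expands.sum Finset.univ fun j _ =>
    ((h (B.coord i)).mul (h' (B'.coord j))).const_mul (l (β (B i) (B' j)))
  have e1 : (fun t => l (β (f t) (f' t))) = fun t => ∑ i, ∑ j,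
    l (β (B i) (B' j)) * (B.coord i (f t) * B'.coord j (f' t)) := funext fun t => hβ _ _
  rw [e1]
  convert key using 1
  funext m
  rw [map_sum, Finset.sum_congr rfl fun p _ => hβ (a p.1) (a' p.2), Finset.sum_comm]
  refine Finset.sum_congr rfl fun i _ => ?_
  rw [Finset.sum_comm]
  refine Finset.sum_congr rfl fun j _ => ?_
  rw [Finset.mul_sum]

end ExpandsWeakly

end Expansions


/-! ### Monomial bases, nondegeneracy, and the canonical element in coordinates -/

namespace Grading

variable {L : Type u} [LieRing L] [LieAlgebra ℂ L] {Γ : Grading L}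
  {χ : LieAlgebra.LieCharacter ℂ Γ.zeroPart}

open Polynomial

namespace DualSystem

variable (D : DualSystem Γ χ)

/-- A linear relation between monomials would be a null vector of every Gram matrix, and one of
these is invertible. This replaces the independence half of the Poincaré–Birkhoff–Witt theorem for
`n₋`. -/
theorem linearIndependent_E (n : ℤ) : LinearIndependent ℂ fun s : D.index n => D.E s := by
  rw [Fintype.linearIndependent_iff]
  intro v hv
  obtain ⟨lam, hl⟩ := D.exists_det_gram_ne_zero n
  have h : Matrix.vecMul v (D.gram lam n) = 0 := by
    funext t
    have := congrArg (fun x => Γ.shapovalov χ lam x (D.F t)) hv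
    simpa [Matrix.vecMul, dotProduct, gram_apply, LinearMap.sum_apply] using this
  exact congrFun (Matrix.eq_zero_of_vecMul_eq_zero hl h)

theorem linearIndependent_F (n : ℤ) : LinearIndependent ℂ fun s : D.index n => D.F s := by
  rw [Fintype.linearIndependent_iff]
  intro v hv
  obtain ⟨lam, hl⟩ := D.exists_det_gram_ne_zero n
  have h : Matrix.mulVec (D.gram lam n) v = 0 := by
    funext s
    have := congrArg (fun y => Γ.shapovalov χ lam (D.E s) y) hv
    simpa [Matrix.mulVec, dotProduct, gram_apply, mul_comm] using this
  exact congrFun (Matrix.eq_zero_of_mulVec_eq_zero hl h)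

/-- The basis of `U(n₋)_{-n}` formed by the ordered monomials. -/
def basisE (n : ℤ) : Module.Basis (D.index n) ℂ (Γ.UnegDeg n) :=
  Module.Basis.mk (v := fun s => ⟨D.E s, D.mem_UnegDeg s.2⟩)
    (LinearIndependent.of_comp (Γ.UnegDeg n).subtype (D.linearIndependent_E n)) (by
      rintro ⟨x, hx⟩ -
      have h := D.mem_span_E_of_mem_UnegDeg hx
      have h2 : Submodule.span ℂ (Set.range fun s : D.index n => D.E s) =
          (Submodule.span ℂ (Set.range fun s : D.index n =>
            (⟨D.E s, D.mem_UnegDeg s.2⟩ : Γ.UnegDeg n))).map (Γ.UnegDeg n).subtype := by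
        rw [Submodule.map_span, ← Set.range_comp]; rfl
      rw [h2] at h
      obtain ⟨y, hy, hyx⟩ := h
      rwa [show (⟨x, hx⟩ : Γ.UnegDeg n) = y from Subtype.ext hyx.symm])

/-- The basis of `U(n₊)_n` formed by the ordered monomials. -/
def basisF (n : ℤ) : Module.Basis (D.index n) ℂ (Γ.UposDeg n) :=
  Module.Basis.mk (v := fun s => ⟨D.F s, D.mem_UposDeg s.2⟩)
    (LinearIndependent.of_comp (Γ.UposDeg n).subtype (D.linearIndependent_F n)) (by
      rintro ⟨x, hx⟩ -
      have h := D.mem_span_F_of_mem_UposDeg hx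
      have h2 : Submodule.span ℂ (Set.range fun s : D.index n => D.F s) =
          (Submodule.span ℂ (Set.range fun s : D.index n =>
            (⟨D.F s, D.mem_UposDeg s.2⟩ : Γ.UposDeg n))).map (Γ.UposDeg n).subtype := by
        rw [Submodule.map_span, ← Set.range_comp]; rfl
      rw [h2] at h
      obtain ⟨y, hy, hyx⟩ := h
      rwa [show (⟨x, hx⟩ : Γ.UposDeg n) = y from Subtype.ext hyx.symm])

theorem coe_basisE {n : ℤ} (s : D.index n) : (D.basisE n s : U L) = D.E s := by
  rw [basisE, Module.Basis.mk_apply]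

theorem coe_basisF {n : ℤ} (s : D.index n) : (D.basisF n s : U L) = D.F s := by
  rw [basisF, Module.Basis.mk_apply]

theorem finite_UnegDeg (D : DualSystem Γ χ) (n : ℤ) : FiniteDimensional ℂ (Γ.UnegDeg n) :=
  Module.Basis.finiteDimensional_of_finite (D.basisE n)

theorem finite_UposDeg (D : DualSystem Γ χ) (n : ℤ) : FiniteDimensional ℂ (Γ.UposDeg n) :=
  Module.Basis.finiteDimensional_of_finite (D.basisF n)

/-! ### Nondegeneracy -/

theorem shapovalov_linearCombination_E (lam : ℂ) (c : Multiset D.ι →₀ ℂ) {n : ℤ} (t : D.index n) :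
    Γ.shapovalov χ lam (Finsupp.linearCombination ℂ D.E c) (D.F t) =
      Matrix.vecMul (fun s : D.index n => c s) (D.gram lam n) t := by
  have h1 : Γ.shapovalov χ lam (Finsupp.linearCombination ℂ D.E c) (D.F t) =
      ∑ s ∈ c.support ∪ D.index n, c s * Γ.shapovalov χ lam (D.E s) (D.F t) := by
    rw [Finsupp.linearCombination_apply, Finsupp.sum, map_sum, LinearMap.sum_apply]
    simp only [map_smul, LinearMap.smul_apply, smul_eq_mul]
    refine Finset.sum_subset Finset.subset_union_left fun s _ hs => ?_
    rw [Finsupp.notMem_support_iff.mp hs, zero_mul]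
  rw [h1, Matrix.vecMul, dotProduct]
  simp only [gram_apply]
  rw [Finset.sum_coe_sort (D.index n) fun s => c s * Γ.shapovalov χ lam (D.E s) (D.F t)]
  refine (Finset.sum_subset Finset.subset_union_right fun s _ hs => ?_).symm
  rw [Γ.shapovalov_of_isHomog χ lam _ (D.E_isHomog s) (D.F_isHomog t), mul_zero]
  rw [D.mem_index.mp t.2]
  rw [mem_index] at hs
  omega

theorem shapovalov_linearCombination_F (lam : ℂ) (c : Multiset D.ι →₀ ℂ) {n : ℤ} (s : D.index n) :
    Γ.shapovalov χ lam (D.E s) (Finsupp.linearCombination ℂ D.F c) =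
      Matrix.mulVec (D.gram lam n) (fun t : D.index n => c t) s := by
  have h1 : Γ.shapovalov χ lam (D.E s) (Finsupp.linearCombination ℂ D.F c) =
      ∑ t ∈ c.support ∪ D.index n, Γ.shapovalov χ lam (D.E s) (D.F t) * c t := by
    rw [Finsupp.linearCombination_apply, Finsupp.sum, map_sum]
    simp only [map_smul, smul_eq_mul, mul_comm (c _)]
    refine Finset.sum_subset Finset.subset_union_left fun s _ hs => ?_
    rw [Finsupp.notMem_support_iff.mp hs, mul_zero]
  rw [h1, Matrix.mulVec, dotProduct]
  simp only [gram_apply]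
  rw [Finset.sum_coe_sort (D.index n) fun t => Γ.shapovalov χ lam (D.E s) (D.F t) * c t]
  refine (Finset.sum_subset Finset.subset_union_right fun t _ ht => ?_).symm
  rw [Γ.shapovalov_of_isHomog χ lam _ (D.E_isHomog s) (D.F_isHomog t), zero_mul]
  rw [D.mem_index.mp s.2]
  rw [mem_index] at ht
  omega

/-- Monomials of different weights are orthogonal, so the form is the direct sum of its finite Gram
blocks, and a kernel element has its coefficients in each weight in the kernel of that block. -/
theorem pairingNonsingular_iff (lam : ℂ) :
    Γ.PairingNonsingular χ lam ↔ ∀ n, (D.gram lam n).det ≠ 0 := by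
  constructor
  · intro h n h0
    obtain ⟨v, hv, hmul⟩ := Matrix.exists_mulVec_eq_zero_iff.mpr h0
    refine hv (funext (Fintype.linearIndependent_iff.mp (D.linearIndependent_F n) v ?_))
    refine h.2 _ (sum_mem fun t _ => Subalgebra.smul_mem _ (D.F_mem t) _) fun x hx => ?_
    obtain ⟨c, rfl⟩ := (Finsupp.mem_span_range_iff_exists_finsupp).mp (D.mem_span_E hx)
    rw [← Finsupp.linearCombination_apply, map_sum]
    simp only [map_smul, shapovalov_linearCombination_E, smul_eq_mul]
    have h1 := Matrix.dotProduct_mulVec (fun s : D.index n => c s) (D.gram lam n) v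
    rw [hmul, dotProduct_zero] at h1
    rw [h1, dotProduct]
    exact Finset.sum_congr rfl fun t _ => mul_comm _ _
  · intro h
    constructor
    · intro x hx hxy
      obtain ⟨c, rfl⟩ := (Finsupp.mem_span_range_iff_exists_finsupp).mp (D.mem_span_E hx)
      rw [← Finsupp.linearCombination_apply] at hxy ⊢
      suffices hc : c = 0 by rw [hc, map_zero]
      ext s
      have h1 : Matrix.vecMul (fun s : D.index (D.wt s) => c s) (D.gram lam (D.wt s)) = 0 := by
        funext t
        rw [← shapovalov_linearCombination_E]
        exact hxy _ (D.F_mem t)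
      exact congrFun (Matrix.eq_zero_of_vecMul_eq_zero (h _) h1) ⟨s, D.mem_index.mpr rfl⟩
    · intro x hx hxy
      obtain ⟨c, rfl⟩ := (Finsupp.mem_span_range_iff_exists_finsupp).mp (D.mem_span_F hx)
      rw [← Finsupp.linearCombination_apply] at hxy ⊢
      suffices hc : c = 0 by rw [hc, map_zero]
      ext s
      have h1 : Matrix.mulVec (D.gram lam (D.wt s)) (fun s : D.index (D.wt s) => c s) = 0 := by
        funext t
        rw [← shapovalov_linearCombination_F]
        exact hxy _ (D.E_mem t)
      exact congrFun (Matrix.eq_zero_of_mulVec_eq_zero (h _) h1) ⟨s, D.mem_index.mpr rfl⟩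

theorem countable_singular (D : DualSystem Γ χ) :
    {lam : ℂ | ¬ Γ.PairingNonsingular χ lam}.Countable := by
  refine (Set.countable_iUnion D.countable_det_gram_eq_zero).mono fun lam hl => ?_
  rw [Set.mem_ofPred_eq, D.pairingNonsingular_iff, not_forall] at hl
  obtain ⟨n, hn⟩ := hl
  exact Set.mem_iUnion.mpr ⟨n, not_not.mp hn⟩

/-! ### The canonical element -/

/-- The element of `U(n₋)_{-n} ⊗ U(n₊)_n` with a given matrix of coefficients. -/
def ofMatrix (n : ℤ) (C : Matrix (D.index n) (D.index n) ℂ) : Γ.UnegDeg n ⊗[ℂ] Γ.UposDeg n :=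
  ∑ s, ∑ t, C t s • (D.basisE n s ⊗ₜ[ℂ] D.basisF n t)

theorem exists_ofMatrix {n : ℤ} (T : Γ.UnegDeg n ⊗[ℂ] Γ.UposDeg n) :
    ∃ C, D.ofMatrix n C = T := by
  refine ⟨fun t s => ((D.basisE n).tensorProduct (D.basisF n)).repr T (s, t), ?_⟩
  conv_rhs => rw [← ((D.basisE n).tensorProduct (D.basisF n)).sum_repr T, Fintype.sum_prod_type]
  simp only [ofMatrix, Module.Basis.tensorProduct_apply]

/-- Contracting against the `E` basis gives `G C`, against the `F` basis `C G`. For square matrices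
one of the two being the identity implies the other. -/
theorem isCanonical_ofMatrix_iff {lam : ℂ} {n : ℤ} {C : Matrix (D.index n) (D.index n) ℂ} :
    Γ.IsCanonical χ lam n (D.ofMatrix n C) ↔ C * D.gram lam n = 1 := by
  have hE : ∀ u, TensorProduct.rid ℂ (Γ.UnegDeg n) (LinearMap.lTensor (Γ.UnegDeg n)
      ((Γ.shapovalov χ lam (D.basisE n u)) ∘ₗ (Γ.UposDeg n).subtype) (D.ofMatrix n C)) =
      ∑ s, (D.gram lam n * C) u s • D.basisE n s := by
    intro u
    simp only [ofMatrix, map_sum, map_smul, LinearMap.lTensor_tmul, TensorProduct.rid_tmul,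
      LinearMap.comp_apply, Submodule.subtype_apply, coe_basisE, coe_basisF, smul_smul,
      Matrix.mul_apply, Finset.sum_smul, gram_apply, mul_comm]
  have hF : ∀ u, TensorProduct.lid ℂ (Γ.UposDeg n) (LinearMap.rTensor (Γ.UposDeg n)
      (((Γ.shapovalov χ lam).flip (D.basisF n u)) ∘ₗ (Γ.UnegDeg n).subtype) (D.ofMatrix n C)) =
      ∑ t, (C * D.gram lam n) t u • D.basisF n t := by
    intro u
    simp only [ofMatrix, map_sum, map_smul, LinearMap.rTensor_tmul, TensorProduct.lid_tmul,
      LinearMap.comp_apply, Submodule.subtype_apply, coe_basisE, coe_basisF, smul_smul,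
      Matrix.mul_apply, Finset.sum_smul, gram_apply, LinearMap.flip_apply]
    exact Finset.sum_comm
  constructor
  · rintro ⟨-, h⟩
    ext t u
    have h1 := h (D.basisF n u)
    rw [hF] at h1
    have h2 := congrArg (fun z => (D.basisF n).repr z t) h1
    simpa [Finsupp.single_apply, Matrix.one_apply, eq_comm] using h2
  · intro h
    have h' := mul_eq_one_comm.mp h
    constructor
    · intro x
      let A : Γ.UnegDeg n →ₗ[ℂ] Γ.UnegDeg n :=
        { toFun := fun x => TensorProduct.rid ℂ (Γ.UnegDeg n) (LinearMap.lTensor (Γ.UnegDeg n)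
            ((Γ.shapovalov χ lam x) ∘ₗ (Γ.UposDeg n).subtype) (D.ofMatrix n C))
          map_add' := fun x y => by
            rw [Submodule.coe_add, map_add, LinearMap.add_comp, LinearMap.lTensor_add,
              LinearMap.add_apply, map_add]
          map_smul' := fun c x => by
            rw [Submodule.coe_smul, map_smul, LinearMap.smul_comp, LinearMap.lTensor_smul,
              LinearMap.smul_apply, map_smul, RingHom.id_apply] }
      have hA : A = LinearMap.id := (D.basisE n).ext fun u => by
        change TensorProduct.rid ℂ _ _ = _
        rw [hE, h', LinearMap.id_apply]
        simp [Matrix.one_apply]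
      exact LinearMap.congr_fun hA x
    · intro y
      let A : Γ.UposDeg n →ₗ[ℂ] Γ.UposDeg n :=
        { toFun := fun y => TensorProduct.lid ℂ (Γ.UposDeg n) (LinearMap.rTensor (Γ.UposDeg n)
            (((Γ.shapovalov χ lam).flip y) ∘ₗ (Γ.UnegDeg n).subtype) (D.ofMatrix n C))
          map_add' := fun x y => by
            rw [Submodule.coe_add, map_add, LinearMap.add_comp, LinearMap.rTensor_add,
              LinearMap.add_apply, map_add]
          map_smul' := fun c x => by
            rw [Submodule.coe_smul, map_smul, LinearMap.smul_comp, LinearMap.rTensor_smul,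
              LinearMap.smul_apply, map_smul, RingHom.id_apply] }
      have hA : A = LinearMap.id := (D.basisF n).ext fun u => by
        change TensorProduct.lid ℂ _ _ = _
        rw [hF, h, LinearMap.id_apply]
        simp [Matrix.one_apply]
      exact LinearMap.congr_fun hA y

theorem isCanonical_iff {lam : ℂ} {n : ℤ} (hdet : (D.gram lam n).det ≠ 0)
    {T : Γ.UnegDeg n ⊗[ℂ] Γ.UposDeg n} :
    Γ.IsCanonical χ lam n T ↔ T = D.ofMatrix n (D.gram lam n)⁻¹ := by
  have hu : IsUnit (D.gram lam n).det := isUnit_iff_ne_zero.mpr hdet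
  constructor
  · intro h
    obtain ⟨C, rfl⟩ := D.exists_ofMatrix T
    rw [Matrix.inv_eq_left_inv (D.isCanonical_ofMatrix_iff.mp h)]
  · rintro rfl
    exact D.isCanonical_ofMatrix_iff.mpr (Matrix.nonsing_inv_mul _ hu)

theorem canonicalElement_eq {lam : ℂ} {n : ℤ} (hdet : (D.gram lam n).det ≠ 0) :
    Γ.canonicalElement χ lam n = D.ofMatrix n (D.gram lam n)⁻¹ := by
  have h : ∃ T, Γ.IsCanonical χ lam n T := ⟨_, (D.isCanonical_iff hdet).mpr rfl⟩
  rw [canonicalElement, dif_pos h]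
  exact (D.isCanonical_iff hdet).mp h.choose_spec

theorem isCanonical_canonicalElement (D : DualSystem Γ χ) {lam : ℂ}
    (h : Γ.PairingNonsingular χ lam) (n : ℤ) :
    Γ.IsCanonical χ lam n (Γ.canonicalElement χ lam n) :=
  (D.isCanonical_iff ((D.pairingNonsingular_iff lam).mp h n)).mpr
    (D.canonicalElement_eq ((D.pairingNonsingular_iff lam).mp h n))

/-! ### The expansion of the canonical element at infinity -/

theorem exists_expansion_inv_revGram (n : ℤ) (t s : D.index n) :
    ∃ a : ℕ → ℂ, ∃ r : ℝ, 0 < r ∧ ∀ z : ℂ, ‖z‖ < r → (D.revGram n).det.eval z ≠ 0 ∧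
      HasSum (fun m => a m * z ^ m)
        (((D.revGram n).adjugate t s).eval z / (D.revGram n).det.eval z) :=
  exists_hasSum_div _ _ (D.det_revGram_coeff_ne_zero n)

/-- The rescaled matrix is `diag(z ^ |s|) G`, so `G⁻¹` is its inverse times `diag(z ^ |s|)`: the
columns acquire the powers of `z`, and the remaining factor `adjugate / det` is regular at `0`. -/
theorem inv_gram_apply {n : ℤ} {z : ℂ} (hz : z ≠ 0) (hdet : (D.revGram n).det.eval z ≠ 0)
    (t s : D.index n) : (D.gram z⁻¹ n)⁻¹ t s = z ^ (s : Multiset D.ι).card *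
      (((D.revGram n).adjugate t s).eval z / (D.revGram n).det.eval z) := by
  have h1 : (D.gram z⁻¹ n)⁻¹ = Matrix.of fun t s : D.index n => z ^ (s : Multiset D.ι).card *
      (((D.revGram n).adjugate t s).eval z / (D.revGram n).det.eval z) := by
    refine Matrix.inv_eq_left_inv ?_
    ext t u
    have h2 := congrArg (fun M => eval z (M t u)) (Matrix.adjugate_mul (D.revGram n))
    simp only [Matrix.mul_apply, eval_finsetSum, eval_mul, D.eval_revGram hz, Matrix.smul_apply,
      smul_eq_mul] at h2
    rw [Matrix.mul_apply]
    simp only [Matrix.of_apply]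
    rw [← mul_right_inj' hdet, Finset.mul_sum]
    have h3 : eval z ((1 : Matrix (D.index n) (D.index n) ℂ[X]) t u) =
        (1 : Matrix (D.index n) (D.index n) ℂ) t u := by
      rw [Matrix.one_apply, Matrix.one_apply]; split_ifs <;> simp
    rw [h3] at h2
    rw [← h2]
    refine Finset.sum_congr rfl fun s _ => ?_
    field_simp
  rw [h1, Matrix.of_apply]

/-- The Taylor coefficients at zero of the entries of the inverse of the rescaled Gram matrix. -/
def invCoeff (n : ℤ) (t s : D.index n) : ℕ → ℂ := (D.exists_expansion_inv_revGram n t s).choose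

theorem invCoeff_spec (n : ℤ) (t s : D.index n) : ∃ r : ℝ, 0 < r ∧ ∀ z : ℂ, ‖z‖ < r →
    (D.revGram n).det.eval z ≠ 0 ∧ HasSum (fun m => D.invCoeff n t s m * z ^ m)
        (((D.revGram n).adjugate t s).eval z / (D.revGram n).det.eval z) :=
  (D.exists_expansion_inv_revGram n t s).choose_spec

/-- The coefficients of the expansion of the canonical element at infinity. -/
def expansion (m : ℕ) (n : ℤ) : Γ.UnegDeg n ⊗[ℂ] Γ.UposDeg n :=
  D.ofMatrix n (Matrix.of fun t s => if (s : Multiset D.ι).card ≤ m then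
    D.invCoeff n t s (m - (s : Multiset D.ι).card) else 0)

/-- The parameters `t` such that the pairing is nonsingular at `t⁻¹`. -/
def goodSet (Γ : Grading L) (χ : LieAlgebra.LieCharacter ℂ Γ.zeroPart) : Set ℂ :=
  {t | Γ.PairingNonsingular χ t⁻¹}

theorem countable_compl_goodSet (D : DualSystem Γ χ) : (goodSet Γ χ)ᶜ.Countable :=
  D.countable_singular.preimage inv_injective

theorem isExpansionAtInfinity_iff {F : ℕ → ∀ n : ℤ, Γ.UnegDeg n ⊗[ℂ] Γ.UposDeg n} :
    Γ.IsExpansionAtInfinity χ F ↔ ∀ n, ExpandsWeakly (goodSet Γ χ) (fun m => F m n)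
      (fun t => Γ.canonicalElement χ t⁻¹ n) := Iff.rfl

theorem isExpansionAtInfinity_expansion : Γ.IsExpansionAtInfinity χ D.expansion := by
  rw [isExpansionAtInfinity_iff]
  intro n
  have h : ∀ t s : D.index n, Expands (goodSet Γ χ)
      (fun m => if (s : Multiset D.ι).card ≤ m then
        D.invCoeff n t s (m - (s : Multiset D.ι).card) else 0)
      (fun z => (D.gram z⁻¹ n)⁻¹ t s) := by
    intro t s
    obtain ⟨r, hr, h⟩ := D.invCoeff_spec n t s
    refine ⟨r, hr, fun z hz hzr hS => ?_⟩
    beta_reduce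
    rw [D.inv_gram_apply hz (h z hzr).1]
    exact hasSum_shift (h z hzr).2 _
  have h2 : ExpandsWeakly (goodSet Γ χ) (fun m => D.expansion m n)
      (fun z => D.ofMatrix n (D.gram z⁻¹ n)⁻¹) := by
    intro l
    have := Expands.sum Finset.univ fun s _ => Expands.sum Finset.univ fun t _ =>
      (h t s).const_mul (l (D.basisE n s ⊗ₜ[ℂ] D.basisF n t))
    simpa only [expansion, ofMatrix, Matrix.of_apply, map_sum, map_smul, smul_eq_mul,
      mul_comm] using this
  exact h2.congr fun z hz =>
    (D.canonicalElement_eq ((D.pairingNonsingular_iff _).mp hz n)).symm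

theorem eq_expansion {F : ℕ → ∀ n : ℤ, Γ.UnegDeg n ⊗[ℂ] Γ.UposDeg n}
    (hF : Γ.IsExpansionAtInfinity χ F) : F = D.expansion := by
  funext m n
  exact congrFun ((isExpansionAtInfinity_iff.mp hF n).unique D.countable_compl_goodSet
    (isExpansionAtInfinity_iff.mp D.isExpansionAtInfinity_expansion n)) m

/-- The factor `z ^ |s|` in column `s` delays the appearance of `E s` until order `|s|`. The
vanishing in negative degrees, the constant term and the finiteness below all come from this. -/
theorem expansion_eq_zero {m : ℕ} {n : ℤ} (h : ∀ s ∈ D.index n, m < s.card) :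
    D.expansion m n = 0 :=
  Finset.sum_eq_zero fun s _ => Finset.sum_eq_zero fun t _ => by
    rw [Matrix.of_apply, if_neg (not_le.mpr (h s s.2)), zero_smul]

theorem expansion_neg {m : ℕ} {n : ℤ} (hn : n < 0) : D.expansion m n = 0 :=
  D.expansion_eq_zero fun s hs => by
    have := D.card_le_wt s
    have := D.mem_index.mp hs
    omega

theorem expansion_zero_of_ne {n : ℤ} (hn : n ≠ 0) : D.expansion 0 n = 0 :=
  D.expansion_eq_zero fun s hs => by
    rw [Multiset.card_pos]
    rintro rfl
    exact hn (D.mem_index.mp hs).symm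

theorem mem_index_zero {s : Multiset D.ι} : s ∈ D.index 0 ↔ s = 0 := by
  rw [mem_index]
  constructor
  · intro h
    have := D.card_le_wt s
    exact Multiset.card_eq_zero.mp (by omega)
  · rintro rfl; rfl

theorem canonicalElement_zero (D : DualSystem Γ χ) {lam : ℂ} (h : Γ.PairingNonsingular χ lam) :
    TensorProduct.map (Γ.UnegDeg 0).subtype (Γ.UposDeg 0).subtype (Γ.canonicalElement χ lam 0) =
      1 ⊗ₜ 1 := by
  rw [D.canonicalElement_eq ((D.pairingNonsingular_iff lam).mp h 0)]
  have h0 : ∀ s : D.index 0, s = ⟨0, D.mem_index_zero.mpr rfl⟩ := fun s =>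
    Subtype.ext (D.mem_index_zero.mp s.2)
  have hE : D.E 0 = 1 := by simp [E, mono_nil]
  have hF : D.F 0 = 1 := by simp [F, mono_nil]
  have hG : (D.gram lam 0) = 1 := by
    ext s t
    rw [h0 s, h0 t, gram_apply, Matrix.one_apply_eq, hE, hF, ← eval_polyForm, polyForm_one_one,
      eval_one]
  have : Unique (D.index 0) := ⟨⟨⟨0, D.mem_index_zero.mpr rfl⟩⟩, h0⟩
  rw [hG, inv_one, ofMatrix, Fintype.sum_unique, Fintype.sum_unique, map_smul,
    TensorProduct.map_tmul, Submodule.subtype_apply, Submodule.subtype_apply, coe_basisE,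
    coe_basisF, h0 default]
  rw [hE, hF, Matrix.one_apply_eq, one_smul]

theorem expansion_zero_zero :
    TensorProduct.map (Γ.UnegDeg 0).subtype (Γ.UposDeg 0).subtype (D.expansion 0 0) = 1 := by
  have h1 := (isExpansionAtInfinity_iff.mp D.isExpansionAtInfinity_expansion 0).map
    (TensorProduct.map (Γ.UnegDeg 0).subtype (Γ.UposDeg 0).subtype)
  have h2 : ExpandsWeakly (goodSet Γ χ)
      -- In degree zero the canonical element is the constant `1 ⊗ 1`, whose expansion is its
      -- constant term; uniqueness of expansions identifies the coefficient.
      (fun m => if m = 0 then (1 : U L ⊗[ℂ] U L) else 0) (fun _ => 1) := fun l =>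
    ⟨1, one_pos, fun t _ _ _ => by
      have h3 : (fun m : ℕ => l (if m = 0 then (1 : U L ⊗[ℂ] U L) else 0) * t ^ m) =
          fun m => if m = 0 then l 1 else 0 := by
        funext m
        split_ifs with h
        · rw [h, pow_zero, mul_one]
        · rw [map_zero, zero_mul]
      rw [h3]
      exact hasSum_ite_eq (0 : ℕ) (l 1)⟩
  exact congrFun ((h1.congr fun t ht => D.canonicalElement_zero ht).unique
    D.countable_compl_goodSet h2) 0

/-- Only finitely many pieces are nonzero, so the degrees of the `f_i` are bounded by some `-N`. A
monomial of length at most `m` then has weight at most `m |N|`. -/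
theorem finite_expansion_ne_zero [FiniteDimensional ℂ L] (m : ℕ) :
    {n : ℤ | D.expansion m n ≠ 0}.Finite := by
  have hfin : {i : ℤ | Γ.piece i ≠ ⊥}.Finite :=
    WellFoundedGT.finite_ne_bot_of_iSupIndep Γ.isInternal.submodule_iSupIndep
  obtain ⟨N, hN⟩ := hfin.bddBelow
  have hdeg : ∀ i, D.deg i ≤ -N := by
    intro i
    -- The piece of degree `-deg i` is nonzero because it contains `e i`, and `e i ≠ 0` since its
    -- pairing with `f i` is `-1`.
    have := hN (a := -D.deg i) (by
      intro h0
      have h1 : D.e i = 0 := by have := D.e_mem i; rwa [h0, Submodule.mem_bot] at this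
      have h2 := D.pair_self i
      rw [h1] at h2
      simp at h2)
    omega
  have hwt : ∀ s : Multiset D.ι, D.wt s ≤ s.card * (-N) := by
    intro s
    induction s using Multiset.induction_on with
    | empty => simp [wt]
    | cons i s ih => rw [wt_cons, Multiset.card_cons]; have := hdeg i; push_cast; linarith
  refine (Set.finite_Icc (0 : ℤ) (m * |N|)).subset fun n hn => ?_
  have h1 : ¬ n < 0 := fun h => hn (D.expansion_neg h)
  refine ⟨not_lt.mp h1, ?_⟩
  by_contra h2
  refine hn (D.expansion_eq_zero fun s hs => ?_)
  by_contra h3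
  apply h2
  have h4 := hwt s
  rw [D.mem_index.mp hs] at h4
  have h5 : (s.card : ℤ) ≤ m := by exact_mod_cast not_lt.mp h3
  calc n ≤ s.card * (-N) := h4
    _ ≤ s.card * |N| := by gcongr; exact neg_le_abs N
    _ ≤ m * |N| := by gcongr

end DualSystem

end Grading


/-! ### Splittings of `U(g)` and the twisted products they define -/

section Twist

variable {L : Type u} [LieRing L] [LieAlgebra ℂ L]

/-- Cocommutativity lets the same `twist` serve both sides of the associativity equation, where the
antipode falls on different factors of the coproduct. -/
theorem comm_coprod (u : U L) : TensorProduct.comm ℂ (U L) (U L) (coprod L u) = coprod L u := by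
  change Algebra.TensorProduct.comm ℂ (U L) (U L) (coprod L u) = coprod L u
  induction u using U_mul_induction with
  | one => rw [map_one, map_one]
  | smul c a ha => rw [map_smul, map_smul, ha]
  | add a b ha hb => rw [map_add, map_add, ha, hb]
  | inc x =>
    rw [coprod_inc, map_add, Algebra.TensorProduct.comm_tmul, Algebra.TensorProduct.comm_tmul,
      add_comm]
  | mul a b ha hb => rw [map_mul, map_mul, ha, hb]

/-- The map `a ⊗ b ↦ b P(S(a) y)`. -/
def twistAux (P : U L →ₗ[ℂ] U L) : U L ⊗[ℂ] U L →ₗ[ℂ] U L →ₗ[ℂ] U L :=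
  TensorProduct.lift (LinearMap.mk₂ ℂ
    (fun a b => LinearMap.mulLeft ℂ b ∘ₗ P ∘ₗ LinearMap.mulLeft ℂ (antipode L a))
    (fun a a' b => by ext y; simp [add_mul, mul_add]) (fun c a b => by ext y; simp)
    (fun a b b' => by ext y; simp [add_mul]) (fun c a b => by ext y; simp))

theorem twistAux_tmul (P : U L →ₗ[ℂ] U L) (a b y : U L) :
    twistAux P (a ⊗ₜ b) y = b * P (antipode L a * y) := rfl

/-- The map `u, y ↦ ∑ u'' P(S(u') y)`. -/
def twist (P : U L →ₗ[ℂ] U L) (u y : U L) : U L := twistAux P (coprod L u) y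

theorem twist_one_one {P : U L →ₗ[ℂ] U L} (hP : P 1 = 1) : twist P 1 1 = 1 := by
  rw [twist, map_one (coprod L), Algebra.TensorProduct.one_def, twistAux_tmul, antipode_one,
    mul_one, hP, mul_one]

/-- Follows from `Δ z = z ⊗ 1 + 1 ⊗ z` and `S z = -z` for every linear `P`; no property of a
splitting enters. -/
theorem twist_inc_mul (P : U L →ₗ[ℂ] U L) (z : L) (u y : U L) :
    twist P (inc L z * u) y = inc L z * twist P u y - twist P u (inc L z * y) := by
  rw [twist, map_mul, coprod_inc, twist, twist]
  induction coprod L u using TensorProduct.induction_on with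
  | zero => simp
  | add s t hs ht => simp only [mul_add, map_add, LinearMap.add_apply, hs, ht]; abel
  | tmul a b =>
    simp only [add_mul, Algebra.TensorProduct.tmul_mul_tmul, one_mul, map_add,
      LinearMap.add_apply, twistAux_tmul, antipode_mul, antipode_inc, mul_neg, neg_mul, map_neg,
      mul_assoc]
    abel

theorem twist_add_right (P : U L →ₗ[ℂ] U L) (u y y' : U L) :
    twist P u (y + y') = twist P u y + twist P u y' := map_add _ _ _

theorem twist_smul_right (P : U L →ₗ[ℂ] U L) (c : ℂ) (u y : U L) :
    twist P u (c • y) = c • twist P u y := map_smul _ _ _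

theorem twist_add_left (P : U L →ₗ[ℂ] U L) (u u' y : U L) :
    twist P (u + u') y = twist P u y + twist P u' y := by
  rw [twist, map_add, map_add]; rfl

theorem twist_smul_left (P : U L →ₗ[ℂ] U L) (c : ℂ) (u y : U L) :
    twist P (c • u) y = c • twist P u y := by
  rw [twist, map_smul, map_smul]; rfl

namespace Grading

variable (Γ : Grading L)

theorem mul_mem_leftIdeal (u : U L) {v : U L} (hv : v ∈ Γ.leftIdeal) : u * v ∈ Γ.leftIdeal :=
  Submodule.smul_mem (Submodule.span (U L) (inc L '' (Γ.piece 0 : Set L))) u hv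

theorem mul_inc_mem_leftIdeal (u : U L) (h : Γ.zeroPart) : u * inc L h ∈ Γ.leftIdeal :=
  Γ.mul_mem_leftIdeal u (Submodule.subset_span ⟨h, h.2, rfl⟩)

/-- A projection of `U(g)` to the subalgebra generated by `N`, along the left ideal generated by
`N'` and by the elements `h + c(h)` with `h` of degree zero. -/
structure IsSplitting (N N' : Submodule ℂ L) (c : Γ.zeroPart → ℂ) (P : U L →ₗ[ℂ] U L) : Prop where
  one : P 1 = 1
  inc_mul : ∀ z ∈ N, ∀ v, P (inc L z * v) = inc L z * P v
  mul_inc : ∀ z ∈ N', ∀ v, P (v * inc L z) = 0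
  -- Modulo the left ideal, `h v` is `h P(v) = [h, P v] + P(v) h`, and the final `h` counts as
  -- `-c(h)`.
  zero_mul : ∀ (h : Γ.zeroPart) (v : U L),
    P (inc L h * v) = inc L h * P v - P v * inc L h - c h • P v
  mul_zero : ∀ (h : Γ.zeroPart) (v : U L), P (v * inc L h) = -(c h • P v)

theorem zero_mul_sub_mul_zero_mem_adjoin {N : Submodule ℂ L}
    (hN : ∀ (h : Γ.zeroPart), ∀ z ∈ N, ⁅(h : L), z⁆ ∈ N) (h : Γ.zeroPart) {a : U L}
    (ha : a ∈ Algebra.adjoin ℂ (inc L '' (N : Set L))) :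
    inc L h * a - a * inc L h ∈ Algebra.adjoin ℂ (inc L '' (N : Set L)) := by
  induction ha using Algebra.adjoin_induction with
  | mem x hx =>
    obtain ⟨z, hz, rfl⟩ := hx
    rw [← inc_lie]
    exact Algebra.subset_adjoin ⟨_, hN h z hz, rfl⟩
  | algebraMap r => rw [Algebra.commutes, sub_self]; exact zero_mem _
  | add x y _ _ hx hy => rw [mul_add, add_mul, add_sub_add_comm]; exact add_mem hx hy
  | mul x y hx' hy' hx hy =>
    have : inc L (h : L) * (x * y) - x * y * inc L h =
        (inc L h * x - x * inc L h) * y + x * (inc L h * y - y * inc L h) := by noncomm_ring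
    rw [this]
    exact add_mem (mul_mem hx hy') (mul_mem hx' hy)

/-- Elements of `U(g₀) U(N')` are scalars modulo the left ideal `J`, so the triangular decomposition
makes the map from the subalgebra generated by `N` to `U(g) / J` surjective; `hdisj` makes it
injective. All the rules for `P` follow from uniqueness of the representative. -/
theorem exists_isSplitting {N N' : Submodule ℂ L} {J : Submodule ℂ (U L)} {c : Γ.zeroPart → ℂ}
    (hN : ∀ (h : Γ.zeroPart), ∀ z ∈ N, ⁅(h : L), z⁆ ∈ N)
    (htop : Subalgebra.toSubmodule (Algebra.adjoin ℂ (inc L '' (N : Set L))) *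
      (Subalgebra.toSubmodule Γ.Uzero *
        Subalgebra.toSubmodule (Algebra.adjoin ℂ (inc L '' (N' : Set L)))) = ⊤)
    (hJ : ∀ u, ∀ j ∈ J, u * j ∈ J)
    (hdisj : ∀ a ∈ Algebra.adjoin ℂ (inc L '' (N : Set L)), a ∈ J → a = 0)
    (hJN : ∀ z ∈ N', inc L z ∈ J)
    (hJc : ∀ h : Γ.zeroPart, inc L h + algebraMap ℂ (U L) (c h) ∈ J) :
    ∃ P, Γ.IsSplitting N N' c P ∧
      ∀ v, P v ∈ Algebra.adjoin ℂ (inc L '' (N : Set L)) ∧ P v - v ∈ J := by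
  -- The elements acting as scalars modulo `J` form a subalgebra, so it is enough to test generators
  -- of `U(g₀)` and `U(N')`.
  let K : Subalgebra ℂ (U L) :=
    { carrier := {d | ∃ s : ℂ, d - algebraMap ℂ _ s ∈ J}
      mul_mem' := by
        rintro d d' ⟨s, hs⟩ ⟨s', hs'⟩
        refine ⟨s * s', ?_⟩
        have : d * d' - algebraMap ℂ (U L) (s * s') =
            d * (d' - algebraMap ℂ _ s') + algebraMap ℂ _ s' * (d - algebraMap ℂ _ s) := by
          rw [mul_sub, mul_sub, ← map_mul, mul_comm s', ← Algebra.commutes s' d]; abel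
        rw [this]
        exact add_mem (hJ _ _ hs') (hJ _ _ hs)
      add_mem' := by
        rintro d d' ⟨s, hs⟩ ⟨s', hs'⟩
        exact ⟨s + s', by rw [map_add, add_sub_add_comm]; exact add_mem hs hs'⟩
      algebraMap_mem' := fun r => ⟨r, by rw [sub_self]; exact zero_mem _⟩ }
  have hK0 : Γ.Uzero ≤ K := Algebra.adjoin_le (by
    rintro _ ⟨h, hh, rfl⟩
    exact ⟨-c ⟨h, hh⟩, by rw [map_neg, sub_neg_eq_add]; exact hJc ⟨h, hh⟩⟩)
  have hKN : Algebra.adjoin ℂ (inc L '' (N' : Set L)) ≤ K := Algebra.adjoin_le (by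
    rintro _ ⟨z, hz, rfl⟩
    exact ⟨0, by rw [map_zero, sub_zero]; exact hJN z hz⟩)
  have hex : ∀ v : U L, ∃ a ∈ Algebra.adjoin ℂ (inc L '' (N : Set L)), a - v ∈ J := by
    intro v
    have hv : v ∈ (⊤ : Submodule ℂ (U L)) := trivial
    rw [← htop] at hv
    induction hv using Submodule.mul_induction_on' with
    | mem_mul_mem a ha w hw =>
      have hwK : w ∈ K := by
        refine Submodule.mul_induction_on hw (fun d hd b hb => mul_mem (hK0 hd) (hKN hb))
          fun x y hx hy => add_mem hx hy
      obtain ⟨s, hs⟩ := hwK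
      refine ⟨s • a, Subalgebra.smul_mem _ ha s, ?_⟩
      have := neg_mem (hJ a _ hs)
      rwa [mul_sub, ← Algebra.commutes, ← Algebra.smul_def, neg_sub] at this
    | add x _ y _ hx hy =>
      obtain ⟨a, ha, ha'⟩ := hx
      obtain ⟨b, hb, hb'⟩ := hy
      exact ⟨a + b, add_mem ha hb, by rw [add_sub_add_comm]; exact add_mem ha' hb'⟩
  have huniq : ∀ {v a b : U L}, a ∈ Algebra.adjoin ℂ (inc L '' (N : Set L)) → a - v ∈ J →
      b ∈ Algebra.adjoin ℂ (inc L '' (N : Set L)) → b - v ∈ J → a = b := by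
    intro v a b ha ha' hb hb'
    refine sub_eq_zero.mp (hdisj _ (sub_mem ha hb) ?_)
    have := sub_mem ha' hb'
    rwa [sub_sub_sub_cancel_right] at this
  choose f hf hf' using hex
  let P : U L →ₗ[ℂ] U L :=
    { toFun := f
      map_add' := fun x y => huniq (hf _) (hf' _) (add_mem (hf _) (hf _)) (by
        rw [add_sub_add_comm]; exact add_mem (hf' _) (hf' _))
      map_smul' := fun s x => huniq (hf _) (hf' _) (Subalgebra.smul_mem _ (hf _) s) (by
        rw [RingHom.id_apply, ← smul_sub]; exact Submodule.smul_mem _ _ (hf' _)) }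
  refine ⟨P, ⟨?_, ?_, ?_, ?_, ?_⟩, fun v => ⟨hf v, hf' v⟩⟩
  · exact huniq (hf _) (hf' _) (one_mem _) (by rw [sub_self]; exact zero_mem _)
  · intro z hz v
    exact huniq (hf _) (hf' _) (mul_mem (Algebra.subset_adjoin ⟨z, hz, rfl⟩) (hf v)) (by
      rw [← mul_sub]; exact hJ _ _ (hf' v))
  · intro z hz v
    exact huniq (hf _) (hf' _) (zero_mem _) (by
      rw [zero_sub]; exact neg_mem (hJ _ _ (hJN z hz)))
  · intro h v
    refine huniq (hf _) (hf' _) (sub_mem (Γ.zero_mul_sub_mul_zero_mem_adjoin hN h (hf v))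
      (Subalgebra.smul_mem _ (hf v) _)) ?_
    have : inc L (h : L) * f v - f v * inc L h - c h • f v - inc L h * v =
        inc L h * (f v - v) - f v * (inc L h + algebraMap ℂ (U L) (c h)) := by
      rw [mul_sub, mul_add, ← Algebra.commutes, ← Algebra.smul_def]; abel
    change inc L (h : L) * f v - f v * inc L h - c h • f v - inc L h * v ∈ J
    rw [this]
    exact sub_mem (hJ _ _ (hf' v)) (hJ _ _ (hJc h))
  · intro h v
    refine huniq (hf _) (hf' _) (neg_mem (Subalgebra.smul_mem _ (hf v) _)) ?_
    have : -(c h • f v) - v * inc L (h : L) =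
        -(v * (inc L h + algebraMap ℂ (U L) (c h))) - c h • (f v - v) := by
      rw [mul_add, ← Algebra.commutes, ← Algebra.smul_def, smul_sub]; abel
    change -(c h • f v) - v * inc L (h : L) ∈ J
    rw [this]
    exact sub_mem (neg_mem (hJ _ _ (hJc h))) (Submodule.smul_mem _ _ (hf' v))

namespace IsSplitting

variable {Γ} {N N' : Submodule ℂ L} {c : Γ.zeroPart → ℂ} {P : U L →ₗ[ℂ] U L}

/-- The two terms of `Δ z` contribute `-b P(z w)` and `b z P(w)`, with `w = S(a) y`; they cancel
because `P` commutes with left multiplication by `N`. -/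
theorem twist_mul_inc (hP : Γ.IsSplitting N N' c P) {z : L} (hz : z ∈ N) (u y : U L) :
    twist P (u * inc L z) y = 0 := by
  rw [twist, map_mul, coprod_inc]
  induction coprod L u using TensorProduct.induction_on with
  | zero => simp
  | add s t hs ht => rw [add_mul, map_add, LinearMap.add_apply, hs, ht, add_zero]
  | tmul a b =>
    simp only [mul_add, Algebra.TensorProduct.tmul_mul_tmul, mul_one, map_add,
      LinearMap.add_apply, twistAux_tmul, antipode_mul, antipode_inc, neg_mul, map_neg,
      mul_assoc, hP.inc_mul z hz, mul_neg, neg_add_cancel]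

/-- The same cancellation as for `z` in `N`, except that `P(h w)` also contains `-P(w) h`. The
leftover `b P(w) h` lies in `U(g) g₀`, which is why the associativity equation is stated in `W`. -/
theorem twist_mul_zero (hP : Γ.IsSplitting N N' c P) (h : Γ.zeroPart) (u y : U L) :
    twist P (u * inc L h) y - c h • twist P u y ∈ Γ.leftIdeal := by
  rw [twist, map_mul, coprod_inc, twist]
  induction coprod L u using TensorProduct.induction_on with
  | zero => simp
  | add s t hs ht =>
    rw [add_mul, map_add, map_add, LinearMap.add_apply, LinearMap.add_apply, smul_add,
      add_sub_add_comm]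
    exact add_mem hs ht
  | tmul a b =>
    simp only [mul_add, Algebra.TensorProduct.tmul_mul_tmul, mul_one, map_add,
      LinearMap.add_apply, twistAux_tmul, antipode_mul, antipode_inc, neg_mul, map_neg,
      mul_assoc, hP.zero_mul h, mul_neg]
    have : -(b * (inc L (h : L) * P (antipode L a * y) - P (antipode L a * y) * inc L h -
        c h • P (antipode L a * y))) + b * (inc L (h : L) * P (antipode L a * y)) -
        c h • (b * P (antipode L a * y)) = b * P (antipode L a * y) * inc L h := by
      rw [mul_sub, mul_sub, mul_smul_comm, mul_assoc]; abel
    rw [this]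
    exact Γ.mul_inc_mem_leftIdeal _ h

theorem twist_right_inc (hP : Γ.IsSplitting N N' c P) {z : L} (hz : z ∈ N') (u y : U L) :
    twist P u (y * inc L z) = 0 := by
  rw [twist]
  induction coprod L u using TensorProduct.induction_on with
  | zero => simp
  | add s t hs ht => rw [map_add, LinearMap.add_apply, hs, ht, add_zero]
  | tmul a b => rw [twistAux_tmul, ← mul_assoc, hP.mul_inc z hz, MulZeroClass.mul_zero]

theorem twist_right_zero (hP : Γ.IsSplitting N N' c P) (h : Γ.zeroPart) (u y : U L) :
    twist P u (y * inc L h) = -(c h • twist P u y) := by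
  rw [twist, twist]
  induction coprod L u using TensorProduct.induction_on with
  | zero => simp
  | add s t hs ht => rw [map_add, LinearMap.add_apply, hs, ht, LinearMap.add_apply]; simp [add_comm]
  | tmul a b =>
    rw [twistAux_tmul, ← mul_assoc, hP.mul_zero, twistAux_tmul, mul_neg, mul_smul_comm]

/-- The two twisted products defined by opposite splittings agree modulo `U(g) g₀`. -/
theorem twist_sub_twist_mem {Q : U L →ₗ[ℂ] U L} {c' : Γ.zeroPart → ℂ}
    (hP : Γ.IsSplitting Γ.posPart Γ.negPart c P) (hQ : Γ.IsSplitting Γ.negPart Γ.posPart c' Q)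
    (hc : ∀ h, c' h = -c h) (u y : U L) : twist P u y - twist Q y u ∈ Γ.leftIdeal := by
  -- `twist_inc_mul` for `P` in the first argument and for `Q` in the second: after exchanging the
  -- arguments of `Q` both obey the same covariance rule, hence so does the difference.
  have cov : ∀ (z : L) (u y : U L), twist P (inc L z * u) y - twist Q y (inc L z * u) =
      inc L z * (twist P u y - twist Q y u) -
        (twist P u (inc L z * y) - twist Q (inc L z * y) u) := by
    intro z u y
    rw [twist_inc_mul, twist_inc_mul, mul_sub]; abel
  have hneg : ∀ z ∈ Γ.negPart, ∀ u : U L, twist P u (inc L z) - twist Q (inc L z) u = 0 := by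
    intro z hz u
    have h1 := hP.twist_right_inc hz u 1
    have h2 := hQ.twist_mul_inc hz 1 u
    rw [one_mul] at h1 h2
    rw [h1, h2, sub_zero]
  have hzero : ∀ (h : Γ.zeroPart) (u : U L), twist P u 1 - twist Q 1 u ∈ Γ.leftIdeal →
      twist P u (inc L h) - twist Q (inc L h) u ∈ Γ.leftIdeal := by
    intro h u hu
    have h1 := hP.twist_right_zero h u 1
    have h2 := hQ.twist_mul_zero h 1 u
    rw [one_mul] at h1 h2
    have h3 : twist P u (inc L h) - twist Q (inc L h) u =
        -(c h • (twist P u 1 - twist Q 1 u)) - (twist Q (inc L h) u - c' h • twist Q 1 u) := by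
      rw [h1, hc, smul_sub, neg_smul]; abel
    rw [h3]
    exact sub_mem (neg_mem (Submodule.smul_mem _ _ hu)) h2
  -- First `y = 1`. The set `D` of good `u` contains `U(n₊)`, where `P` is linear and `Q` vanishes
  -- on right multiples, and it is stable under left multiplication by `n₋` and `g₀` thanks to
  -- `cov`, `hneg` and `hzero`. The triangular decomposition gives `D = ⊤`.
  let D : Submodule ℂ (U L) :=
    { carrier := {u | twist P u 1 - twist Q 1 u ∈ Γ.leftIdeal}
      zero_mem' := by
        have h1 : twist P 0 1 = 0 := by simpa using twist_smul_left P 0 0 1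
        have h2 : twist Q 1 0 = 0 := by simpa using twist_smul_right Q 0 1 0
        rw [Set.mem_ofPred_eq, h1, h2, sub_zero]; exact zero_mem _
      add_mem' := fun {a b} ha hb => by
        rw [Set.mem_ofPred_eq, twist_add_left, twist_add_right, add_sub_add_comm]
        exact add_mem ha hb
      smul_mem' := fun s a ha => by
        rw [Set.mem_ofPred_eq, twist_smul_left, twist_smul_right, ← smul_sub]
        exact Submodule.smul_mem _ _ ha }
  have hD1 : (1 : U L) ∈ D := by
    change twist P 1 1 - twist Q 1 1 ∈ Γ.leftIdeal
    rw [twist_one_one hP.one, twist_one_one hQ.one, sub_self]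
    exact zero_mem _
  have hDpos : ∀ b ∈ Γ.Upos, b ∈ D := by
    intro b hb
    obtain ⟨s, hs⟩ := exists_scalar_of_mem_adjoin (A := Γ.posPart) hb
    have h1 : b - algebraMap ℂ _ s ∈ D := by
      refine Submodule.span_le.mpr ?_ hs.2
      rintro _ ⟨z, hz, v, rfl⟩
      change twist P (v * inc L z) 1 - twist Q 1 (v * inc L z) ∈ Γ.leftIdeal
      rw [hP.twist_mul_inc hz, hQ.twist_right_inc hz, sub_zero]
      exact zero_mem _
    rw [← sub_add_cancel b (algebraMap ℂ _ s)]
    refine add_mem h1 ?_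
    rw [Algebra.algebraMap_eq_smul_one]
    exact Submodule.smul_mem _ _ hD1
  have hDmul : ∀ z : L, (z ∈ Γ.negPart ∨ z ∈ Γ.piece 0) → ∀ d ∈ D, inc L z * d ∈ D := by
    intro z hz d hd
    change twist P (inc L z * d) 1 - twist Q 1 (inc L z * d) ∈ Γ.leftIdeal
    rw [cov, mul_one]
    refine sub_mem (Γ.mul_mem_leftIdeal _ hd) ?_
    rcases hz with hz | hz
    · rw [hneg z hz]; exact zero_mem _
    · exact hzero ⟨z, hz⟩ d hd
  have hDadj : ∀ S : Set L, (∀ z ∈ S, z ∈ Γ.negPart ∨ z ∈ Γ.piece 0) →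
      ∀ a ∈ Algebra.adjoin ℂ (inc L '' S), ∀ d ∈ D, a * d ∈ D := by
    intro S hS a ha
    induction ha using Algebra.adjoin_induction with
    | mem x hx => obtain ⟨z, hz, rfl⟩ := hx; exact hDmul z (hS z hz)
    | algebraMap r => intro d hd; rw [← Algebra.smul_def]; exact Submodule.smul_mem _ _ hd
    | add x y _ _ hx hy => intro d hd; rw [add_mul]; exact add_mem (hx d hd) (hy d hd)
    | mul x y _ _ hx hy => intro d hd; rw [mul_assoc]; exact hx _ (hy d hd)
  have hD : D = ⊤ := by
    rw [eq_top_iff, ← Γ.neg_zero_pos_eq_top, Submodule.mul_le]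
    intro a ha w hw
    refine hDadj _ (fun z hz => Or.inl hz) a ha w ?_
    revert w
    change Subalgebra.toSubmodule Γ.Uzero * Subalgebra.toSubmodule Γ.Upos ≤ D
    rw [Submodule.mul_le]
    exact fun h hh b hb => hDadj _ (fun z hz => Or.inr hz) h hh b (hDpos b hb)
  -- Now `cov` is read backwards: a letter `z` of `y` is traded for left multiplication of `u` by
  -- `z`, so `u` has to stay arbitrary.
  revert u
  induction y using U_induction with
  | one => intro u; have : u ∈ D := hD ▸ trivial; exact this
  | smul s a ha =>
    intro u; rw [twist_smul_left, twist_smul_right, ← smul_sub]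
    exact Submodule.smul_mem _ _ (ha u)
  | add a b ha hb =>
    intro u; rw [twist_add_left, twist_add_right, add_sub_add_comm]; exact add_mem (ha u) (hb u)
  | mul z a ha =>
    intro u
    have := cov z u a
    rw [eq_sub_iff_add_eq, ← eq_sub_iff_add_eq'] at this
    rw [this]
    exact sub_mem (Γ.mul_mem_leftIdeal _ (ha u)) (ha _)

end IsSplitting

end Grading

end Twist


/-! ### The associativity equation for the canonical element -/

section

variable {L : Type u} [LieRing L] [LieAlgebra ℂ L]

/-- Keeps the factors of the coproduct of `U(n₋)` or `U(n₊)` inside that subalgebra, where products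
can be expanded in the monomial basis. -/
theorem exists_coprod_eq {S : Set L} {u : U L} (hu : u ∈ Algebra.adjoin ℂ (inc L '' S)) :
    ∃ τ, Algebra.TensorProduct.map (Algebra.adjoin ℂ (inc L '' S)).val
      (Algebra.adjoin ℂ (inc L '' S)).val τ = coprod L u := by
  have h : Algebra.adjoin ℂ (inc L '' S) ≤ (AlgHom.range (Algebra.TensorProduct.map
      (Algebra.adjoin ℂ (inc L '' S)).val (Algebra.adjoin ℂ (inc L '' S)).val)).comap
      (coprod L) := by
    refine Algebra.adjoin_le ?_
    rintro _ ⟨x, hx, rfl⟩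
    have hx' : inc L x ∈ Algebra.adjoin ℂ (inc L '' S) := Algebra.subset_adjoin ⟨x, hx, rfl⟩
    refine ⟨⟨_, hx'⟩ ⊗ₜ 1 + 1 ⊗ₜ ⟨_, hx'⟩, ?_⟩
    change Algebra.TensorProduct.map _ _ _ = coprod L (inc L x)
    rw [map_add, Algebra.TensorProduct.map_tmul, Algebra.TensorProduct.map_tmul, map_one,
      coprod_inc]
    rfl
  exact h hu

namespace Grading

theorem leftComp_tmul (x y : U L) (c : U L ⊗[ℂ] U L) :
    leftComp (x ⊗ₜ y) c = TensorProduct.assoc ℂ (U L) (U L) (U L) ((coprod L x * c) ⊗ₜ y) := by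
  rw [leftComp, Algebra.TensorProduct.map_tmul, Algebra.TensorProduct.tmul_mul_tmul, mul_one]
  rfl

theorem rightComp_tmul (x y : U L) (c : U L ⊗[ℂ] U L) :
    rightComp (x ⊗ₜ y) c = x ⊗ₜ (coprod L y * c) := by
  rw [rightComp, Algebra.TensorProduct.map_tmul, Algebra.TensorProduct.tmul_mul_tmul, mul_one]
  rfl

variable (L) in
/-- The product `((Δ ⊗ 1) b) (c ⊗ 1)` as a bilinear map. -/
def leftCompₗ : U L ⊗[ℂ] U L →ₗ[ℂ] U L ⊗[ℂ] U L →ₗ[ℂ] U L ⊗[ℂ] (U L ⊗[ℂ] U L) :=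
  LinearMap.mk₂ ℂ leftComp
    (fun b b' c => by simp only [leftComp, map_add, add_mul])
    (fun r b c => by simp only [leftComp, map_smul, smul_mul_assoc])
    (fun b c c' => by simp only [leftComp, TensorProduct.add_tmul, map_add, mul_add])
    (fun r b c => by simp only [leftComp, ← TensorProduct.smul_tmul', map_smul, mul_smul_comm])

variable (L) in
/-- The product `((1 ⊗ Δ) b) (1 ⊗ c)` as a bilinear map. -/
def rightCompₗ : U L ⊗[ℂ] U L →ₗ[ℂ] U L ⊗[ℂ] U L →ₗ[ℂ] U L ⊗[ℂ] (U L ⊗[ℂ] U L) :=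
  LinearMap.mk₂ ℂ rightComp
    (fun b b' c => by simp only [rightComp, map_add, add_mul])
    (fun r b c => by simp only [rightComp, map_smul, smul_mul_assoc])
    (fun b c c' => by simp only [rightComp, TensorProduct.tmul_add, mul_add])
    (fun r b c => by simp only [rightComp, TensorProduct.tmul_smul, mul_smul_comm])

theorem leftCompₗ_apply (b c : U L ⊗[ℂ] U L) : leftCompₗ L b c = leftComp b c := rfl

theorem rightCompₗ_apply (b c : U L ⊗[ℂ] U L) : rightCompₗ L b c = rightComp b c := rfl

variable (Γ : Grading L)

theorem degProj_mul_homog {e : ℤ} {x : U L} (hx : Γ.IsHomog e x) (d : ℤ) (a : U L) :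
    Γ.degProj d (a * x) = Γ.degProj (d - e) a * x := by
  induction a using Γ.homog_induction with
  | zero => simp
  | add a b ha hb => rw [add_mul, map_add, map_add, add_mul, ha, hb]
  | homog f a ha =>
    by_cases h : f = d - e
    · subst h
      rw [ha.degProj_eq]
      have := ha.mul hx
      rw [sub_add_cancel] at this
      exact this.degProj_eq
    · rw [ha.degProj_ne h, zero_mul]
      exact (ha.mul hx).degProj_ne (by omega)

/-- The generators of the left ideal have degree zero, so right multiplication by them commutes with
projection to a degree. -/
theorem degProj_mem_leftIdeal {u : U L} (hu : u ∈ Γ.leftIdeal) (d : ℤ) :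
    Γ.degProj d u ∈ Γ.leftIdeal := by
  have key : ∀ z ∈ Submodule.span (U L) (inc L '' (Γ.piece 0 : Set L)), ∀ (u : U L) (d : ℤ),
      Γ.degProj d (u * z) ∈ Γ.leftIdeal := by
    intro z hz
    induction hz using Submodule.span_induction with
    | mem z hz =>
      obtain ⟨h, hh, rfl⟩ := hz
      intro u d
      rw [Γ.degProj_mul_homog (Γ.isHomog_inc hh)]
      exact Γ.mul_inc_mem_leftIdeal _ ⟨h, hh⟩
    | zero => intro u d; rw [mul_zero, map_zero]; exact zero_mem _
    | add z w _ _ hz hw => intro u d; rw [mul_add, map_add]; exact add_mem (hz u d) (hw u d)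
    | smul a z _ hz => intro u d; rw [smul_eq_mul, ← mul_assoc]; exact hz _ d
  simpa using key u hu 1 d

theorem triProj_assoc_tmul (i j k : ℤ) (T : U L ⊗[ℂ] U L) (y : U L) :
    Γ.triProj i j k (TensorProduct.assoc ℂ (U L) (U L) (U L) (T ⊗ₜ y)) =
      TensorProduct.assoc ℂ (U L) (U L) (U L)
        (LinearMap.lTensor (U L) (Γ.degProj j) (LinearMap.rTensor (U L) (Γ.degProj i) T) ⊗ₜ
          Γ.degProj k y) := by
  induction T using TensorProduct.induction_on with
  | zero => simp
  | add a b ha hb => simp only [TensorProduct.add_tmul, map_add, ha, hb]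
  | tmul a b => rfl

theorem triProj_tmul (i j k : ℤ) (x : U L) (T : U L ⊗[ℂ] U L) :
    Γ.triProj i j k (x ⊗ₜ T) = Γ.degProj i x ⊗ₜ
      LinearMap.rTensor (U L) (Γ.degProj j) (LinearMap.lTensor (U L) (Γ.degProj k) T) := by
  rw [triProj, TensorProduct.map_tmul]
  congr 1
  induction T using TensorProduct.induction_on with
  | zero => simp
  | add a b ha hb => simp only [map_add, ha, hb]
  | tmul a b => rfl

/-! ### The splittings defined by a nonsingular pairing -/

variable {Γ} {χ : LieAlgebra.LieCharacter ℂ Γ.zeroPart} {lam : ℂ}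

/-- Take for `J` the right kernel of the form on all of `U(g)`. It is a left ideal by
contravariance, contains `n₋` and all `h + λ χ(h)`, and meets `U(n₊)` only in `0` by nondegeneracy.
That `P v - v` is in `J` is the equality of pairings. -/
theorem PairingNonsingular.exists_splitting_pos (hl : Γ.PairingNonsingular χ lam) :
    ∃ P, Γ.IsSplitting Γ.posPart Γ.negPart (fun h => lam * χ h) P ∧
      ∀ v, P v ∈ Γ.Upos ∧ ∀ x, Γ.shapovalov χ lam x (P v) = Γ.shapovalov χ lam x v := by
  have hmem : ∀ j, j ∈ LinearMap.ker (Γ.shapovalov χ lam).flip ↔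
      ∀ x, Γ.shapovalov χ lam x j = 0 := fun j => by
    rw [LinearMap.mem_ker, LinearMap.ext_iff]; rfl
  obtain ⟨P, hP, hP'⟩ := Γ.exists_isSplitting (N := Γ.posPart) (N' := Γ.negPart)
    (J := LinearMap.ker (Γ.shapovalov χ lam).flip) (c := fun h => lam * χ h)
    (fun h z hz => Γ.zero_lie_mem_posPart h hz) Γ.pos_zero_neg_eq_top
    (fun u j hj => (hmem _).mpr fun x => by
      rw [shapovalov_mul_right]; exact (hmem _).mp hj _)
    (fun a ha haJ => hl.2 a ha fun x _ => (hmem _).mp haJ x)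
    (fun z hz => (hmem _).mpr fun x => by
      have := Γ.shapovalov_mul_neg χ lam x 1 hz
      rwa [one_mul] at this)
    (fun h => (hmem _).mpr fun x => by
      have := Γ.shapovalov_mul_zero' χ lam x 1 h
      rw [one_mul] at this
      rw [map_add, this, Algebra.algebraMap_eq_smul_one, map_smul, smul_eq_mul, neg_add_cancel])
  refine ⟨P, hP, fun v => ⟨(hP' v).1, fun x => ?_⟩⟩
  have := (hmem _).mp (hP' v).2 x
  rwa [map_sub, sub_eq_zero] at this

/-- The mirror image, with the left kernel; the sign of the character is reversed because here `h`
acts on the right by `+λ χ(h)`. -/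
theorem PairingNonsingular.exists_splitting_neg (hl : Γ.PairingNonsingular χ lam) :
    ∃ Q, Γ.IsSplitting Γ.negPart Γ.posPart (fun h => -(lam * χ h)) Q ∧
      ∀ v, Q v ∈ Γ.Uneg ∧ ∀ y, Γ.shapovalov χ lam (Q v) y = Γ.shapovalov χ lam v y := by
  have hmem : ∀ j, j ∈ LinearMap.ker (Γ.shapovalov χ lam) ↔
      ∀ y, Γ.shapovalov χ lam j y = 0 := fun j => by
    rw [LinearMap.mem_ker, LinearMap.ext_iff]; rfl
  obtain ⟨P, hP, hP'⟩ := Γ.exists_isSplitting (N := Γ.negPart) (N' := Γ.posPart)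
    (J := LinearMap.ker (Γ.shapovalov χ lam)) (c := fun h => -(lam * χ h))
    (fun h z hz => Γ.zero_lie_mem_negPart h hz) Γ.neg_zero_pos_eq_top
    (fun u j hj => (hmem _).mpr fun x => by
      rw [shapovalov_mul_left]; exact (hmem _).mp hj _)
    (fun a ha haJ => hl.1 a ha fun x _ => (hmem _).mp haJ x)
    (fun z hz => (hmem _).mpr fun x => by
      have := Γ.shapovalov_mul_pos χ lam 1 hz x
      rwa [one_mul] at this)
    (fun h => (hmem _).mpr fun x => by
      have := Γ.shapovalov_mul_zero χ lam 1 h x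
      rw [one_mul] at this
      rw [map_add, LinearMap.add_apply, this, Algebra.algebraMap_eq_smul_one, map_smul,
        LinearMap.smul_apply, smul_eq_mul, neg_mul, add_neg_cancel])
  refine ⟨P, hP, fun v => ⟨(hP' v).1, fun x => ?_⟩⟩
  have := (hmem _).mp (hP' v).2 x
  rwa [map_sub, LinearMap.sub_apply, sub_eq_zero] at this

theorem shapovalov_degProj_right {d : ℤ} {x : U L} (hx : Γ.IsHomog (-d) x) (y : U L) :
    Γ.shapovalov χ lam x (Γ.degProj d y) = Γ.shapovalov χ lam x y := by
  induction y using Γ.homog_induction with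
  | zero => simp
  | add a b ha hb => rw [map_add, map_add, map_add, ha, hb]
  | homog f a ha =>
    by_cases h : f = d
    · subst h; rw [ha.degProj_eq]
    · rw [ha.degProj_ne h, map_zero, Γ.shapovalov_of_isHomog χ lam (by omega) hx ha]

theorem shapovalov_degProj_left {d : ℤ} {y : U L} (hy : Γ.IsHomog d y) (x : U L) :
    Γ.shapovalov χ lam (Γ.degProj (-d) x) y = Γ.shapovalov χ lam x y := by
  induction x using Γ.homog_induction with
  | zero => simp
  | add a b ha hb =>
    rw [map_add, map_add, map_add, LinearMap.add_apply, LinearMap.add_apply, ha, hb]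
  | homog f a ha =>
    by_cases h : f = -d
    · subst h; rw [ha.degProj_eq]
    · rw [ha.degProj_ne h, map_zero, LinearMap.zero_apply,
        Γ.shapovalov_of_isHomog χ lam (by omega) ha hy]

/-- The inclusion of `U(n₋)_{-n} ⊗ U(n₊)_n` in `U(g) ⊗ U(g)`. -/
def inclDeg (Γ : Grading L) (n : ℤ) : Γ.UnegDeg n ⊗[ℂ] Γ.UposDeg n →ₗ[ℂ] U L ⊗[ℂ] U L :=
  TensorProduct.map (Γ.UnegDeg n).subtype (Γ.UposDeg n).subtype

namespace DualSystem

variable (D : DualSystem Γ χ)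

theorem degProj_mem_UnegDeg (D : DualSystem Γ χ) {x : U L} (hx : x ∈ Γ.Uneg) (n : ℤ) :
    Γ.degProj (-n) x ∈ Γ.UnegDeg n := by
  have key : ∀ y ∈ Submodule.span ℂ (Set.range D.E), Γ.degProj (-n) y ∈ Γ.UnegDeg n := by
    intro y hy
    induction hy using Submodule.span_induction with
    | mem y hy =>
      obtain ⟨s, rfl⟩ := hy
      by_cases h : D.wt s = n
      · rw [← h, (D.E_isHomog s).degProj_eq]; exact D.mem_UnegDeg (D.mem_index.mpr rfl)
      · rw [(D.E_isHomog s).degProj_ne (by omega)]; exact zero_mem _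
    | zero => rw [map_zero]; exact zero_mem _
    | add a b _ _ ha hb => rw [map_add]; exact add_mem ha hb
    | smul c a _ ha => rw [map_smul]; exact Submodule.smul_mem _ _ ha
  exact key x (D.mem_span_E hx)

theorem degProj_mem_UposDeg (D : DualSystem Γ χ) {x : U L} (hx : x ∈ Γ.Upos) (n : ℤ) :
    Γ.degProj n x ∈ Γ.UposDeg n := by
  have key : ∀ y ∈ Submodule.span ℂ (Set.range D.F), Γ.degProj n y ∈ Γ.UposDeg n := by
    intro y hy
    induction hy using Submodule.span_induction with
    | mem y hy =>
      obtain ⟨s, rfl⟩ := hy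
      by_cases h : D.wt s = n
      · rw [← h, (D.F_isHomog s).degProj_eq]; exact D.mem_UposDeg (D.mem_index.mpr rfl)
      · rw [(D.F_isHomog s).degProj_ne h]; exact zero_mem _
    | zero => rw [map_zero]; exact zero_mem _
    | add a b _ _ ha hb => rw [map_add]; exact add_mem ha hb
    | smul c a _ ha => rw [map_smul]; exact Submodule.smul_mem _ _ ha
  exact key x (D.mem_span_F hx)

/-- The basis of `U(n₊)_n` dual to the ordered monomials of `U(n₋)_{-n}`. -/
def dualF (lam : ℂ) (n : ℤ) (s : D.index n) : Γ.UposDeg n :=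
  ∑ t, (D.gram lam n)⁻¹ t s • D.basisF n t

variable (hl : Γ.PairingNonsingular χ lam)

include D hl

theorem canonicalElement_eq_sum (n : ℤ) :
    Γ.canonicalElement χ lam n = ∑ s, D.basisE n s ⊗ₜ D.dualF lam n s := by
  rw [D.canonicalElement_eq ((D.pairingNonsingular_iff lam).mp hl n)]
  simp only [ofMatrix, dualF, TensorProduct.tmul_sum, TensorProduct.tmul_smul]

theorem inclDeg_canonicalElement (n : ℤ) : Γ.inclDeg n (Γ.canonicalElement χ lam n) =
    ∑ s : D.index n, D.E s ⊗ₜ (D.dualF lam n s : U L) := by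
  rw [D.canonicalElement_eq_sum hl, map_sum]
  exact Finset.sum_congr rfl fun s _ => by rw [← coe_basisE]; rfl

theorem sum_shapovalov_E {n : ℤ} {x : U L} (hx : x ∈ Γ.UnegDeg n) :
    ∑ s : D.index n, Γ.shapovalov χ lam x (D.dualF lam n s) • D.E s = x := by
  have h := congrArg Subtype.val ((D.isCanonical_canonicalElement hl n).1 ⟨x, hx⟩)
  rw [D.canonicalElement_eq_sum hl] at h
  simpa [coe_basisE] using h

theorem sum_shapovalov_dualF {n : ℤ} {y : U L} (hy : y ∈ Γ.UposDeg n) :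
    ∑ s : D.index n, Γ.shapovalov χ lam (D.E s) y • (D.dualF lam n s : U L) = y := by
  have h := congrArg Subtype.val ((D.isCanonical_canonicalElement hl n).2 ⟨y, hy⟩)
  rw [D.canonicalElement_eq_sum hl] at h
  simpa [coe_basisE] using h

/-- The dual basis expansion of the degree `q` component of `w`. Elements of degree `-q` pair only
with that component, and cannot distinguish `w` from `v`. -/
theorem sum_shapovalov_dualF_eq_degProj {v w : U L} (hw : w ∈ Γ.Upos)
    (hvw : ∀ x, Γ.shapovalov χ lam x w = Γ.shapovalov χ lam x v) (q : ℤ) :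
    ∑ s : D.index q, Γ.shapovalov χ lam (D.E s) v • (D.dualF lam q s : U L) = Γ.degProj q w := by
  rw [← D.sum_shapovalov_dualF hl (D.degProj_mem_UposDeg hw q)]
  refine Finset.sum_congr rfl fun s _ => ?_
  rw [shapovalov_degProj_right (Γ.mem_homog_iff.mp (D.mem_UnegDeg s.2).2), hvw]

theorem sum_shapovalov_E_eq_degProj {v w : U L} (hw : w ∈ Γ.Uneg)
    (hvw : ∀ y, Γ.shapovalov χ lam w y = Γ.shapovalov χ lam v y) (q : ℤ) :
    ∑ s : D.index q, Γ.shapovalov χ lam v (D.dualF lam q s) • D.E s = Γ.degProj (-q) w := by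
  rw [← D.sum_shapovalov_E hl (D.degProj_mem_UnegDeg hw q)]
  refine Finset.sum_congr rfl fun s _ => ?_
  rw [shapovalov_degProj_left (Γ.mem_homog_iff.mp (D.dualF lam q s).2.2), hvw]

/-- Expand the first factor `a E_r` in the monomials `E_s`. Its coefficient is the form of `a E_r`
with the dual vector of `E_s`, and moving `a` across gives `S(a)` applied to that dual vector. The
sum over `r` then reassembles the degree `q` component of the value of `P` there. -/
theorem rTensor_degProj_tmul_mul {P : U L →ₗ[ℂ] U L} (hP : ∀ v, P v ∈ Γ.Upos ∧
    ∀ x, Γ.shapovalov χ lam x (P v) = Γ.shapovalov χ lam x v) (n q : ℤ) {a : U L}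
    (ha : a ∈ Γ.Uneg) (b : U L) :
    LinearMap.rTensor (U L) (Γ.degProj (-n)) ((a ⊗ₜ b) *
      Γ.inclDeg q (Γ.canonicalElement χ lam q)) = ∑ s : D.index n, D.E s ⊗ₜ
        (b * Γ.degProj q (P (antipode L a * D.dualF lam n s))) := by
  rw [D.inclDeg_canonicalElement hl, Finset.mul_sum, map_sum]
  have h1 : ∀ r : D.index q, LinearMap.rTensor (U L) (Γ.degProj (-n))
      ((a ⊗ₜ b) * (D.E r ⊗ₜ (D.dualF lam q r : U L))) = ∑ s : D.index n, D.E s ⊗ₜ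
        (Γ.shapovalov χ lam (D.E r) (antipode L a * D.dualF lam n s) •
          (b * (D.dualF lam q r : U L))) := by
    intro r
    rw [Algebra.TensorProduct.tmul_mul_tmul, LinearMap.rTensor_tmul,
      ← D.sum_shapovalov_E hl (D.degProj_mem_UnegDeg (mul_mem ha (D.E_mem r)) n),
      TensorProduct.sum_tmul]
    refine Finset.sum_congr rfl fun s _ => ?_
    rw [shapovalov_degProj_left (Γ.mem_homog_iff.mp (D.dualF lam n s).2.2),
      shapovalov_mul_left, TensorProduct.smul_tmul]
  rw [Finset.sum_congr rfl fun r _ => h1 r, Finset.sum_comm]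
  refine Finset.sum_congr rfl fun s _ => ?_
  rw [← TensorProduct.tmul_sum, ← D.sum_shapovalov_dualF_eq_degProj hl (hP _).1 (hP _).2 q,
    Finset.mul_sum]
  simp only [mul_smul_comm]

theorem lTensor_degProj_tmul_mul {Q : U L →ₗ[ℂ] U L} (hQ : ∀ v, Q v ∈ Γ.Uneg ∧
    ∀ y, Γ.shapovalov χ lam (Q v) y = Γ.shapovalov χ lam v y) (n q : ℤ) (a : U L) {b : U L}
    (hb : b ∈ Γ.Upos) :
    LinearMap.lTensor (U L) (Γ.degProj n) ((a ⊗ₜ b) *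
      Γ.inclDeg q (Γ.canonicalElement χ lam q)) = ∑ s : D.index n,
        (a * Γ.degProj (-q) (Q (antipode L b * D.E s))) ⊗ₜ (D.dualF lam n s : U L) := by
  rw [D.inclDeg_canonicalElement hl, Finset.mul_sum, map_sum]
  have h1 : ∀ r : D.index q, LinearMap.lTensor (U L) (Γ.degProj n)
      ((a ⊗ₜ b) * (D.E r ⊗ₜ (D.dualF lam q r : U L))) = ∑ s : D.index n,
        (Γ.shapovalov χ lam (antipode L b * D.E s) (D.dualF lam q r) •
          (a * D.E r)) ⊗ₜ (D.dualF lam n s : U L) := by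
    intro r
    rw [Algebra.TensorProduct.tmul_mul_tmul, LinearMap.lTensor_tmul,
      ← D.sum_shapovalov_dualF hl (D.degProj_mem_UposDeg (mul_mem hb (D.dualF lam q r).2.1) n),
      TensorProduct.tmul_sum]
    refine Finset.sum_congr rfl fun s _ => ?_
    rw [shapovalov_degProj_right (Γ.mem_homog_iff.mp (D.mem_UnegDeg s.2).2),
      shapovalov_mul_right, TensorProduct.smul_tmul]
  rw [Finset.sum_congr rfl fun r _ => h1 r, Finset.sum_comm]
  refine Finset.sum_congr rfl fun s _ => ?_
  rw [← TensorProduct.sum_tmul, ← D.sum_shapovalov_E_eq_degProj hl (hQ _).1 (hQ _).2 q,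
    Finset.mul_sum]
  simp only [mul_smul_comm]

/-- Summed over `q`, the components of `P(S(a) y)` add up to `P(S(a) y)` itself, and summed over the
coproduct they form `twist`. Allowing every larger index set lets several such identities be used
together. -/
theorem exists_sum_rTensor {P : U L →ₗ[ℂ] U L} (hP : ∀ v, P v ∈ Γ.Upos ∧
    ∀ x, Γ.shapovalov χ lam x (P v) = Γ.shapovalov χ lam x v) (n : ℤ) {u : U L}
    (hu : u ∈ Γ.Uneg) : ∃ S : Finset ℤ, ∀ t, S ⊆ t →
    ∑ q ∈ t, LinearMap.rTensor (U L) (Γ.degProj (-n)) (coprod L u *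
      Γ.inclDeg q (Γ.canonicalElement χ lam q)) =
      ∑ s : D.index n, D.E s ⊗ₜ twist P u (D.dualF lam n s) := by
  classical
  obtain ⟨τ, hτ⟩ := exists_coprod_eq hu
  simp only [twist, ← hτ]
  clear hτ
  induction τ using TensorProduct.induction_on with
  | zero => exact ⟨∅, fun t _ => by simp⟩
  | add σ τ hσ hτ =>
    obtain ⟨S, hS⟩ := hσ
    obtain ⟨S', hS'⟩ := hτ
    refine ⟨S ∪ S', fun t ht => ?_⟩
    simp only [map_add, add_mul, LinearMap.add_apply, TensorProduct.tmul_add,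
      Finset.sum_add_distrib]
    rw [hS t (Finset.union_subset_left ht), hS' t (Finset.union_subset_right ht)]
  | tmul a b =>
    choose S hS using fun s : D.index n =>
      Γ.exists_sum_degProj (P (antipode L a * D.dualF lam n s))
    refine ⟨Finset.univ.biUnion S, fun t ht => ?_⟩
    rw [Algebra.TensorProduct.map_tmul]
    change ∑ q ∈ t, LinearMap.rTensor (U L) (Γ.degProj (-n)) (((a : U L) ⊗ₜ (b : U L)) * _) = _
    rw [Finset.sum_congr rfl fun q _ => D.rTensor_degProj_tmul_mul hl hP n q a.2 b,
      Finset.sum_comm]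
    refine Finset.sum_congr rfl fun s _ => ?_
    rw [← TensorProduct.tmul_sum, ← Finset.mul_sum,
      hS s t ((Finset.subset_biUnion_of_mem S (Finset.mem_univ s)).trans ht)]
    rfl

theorem exists_sum_lTensor {Q : U L →ₗ[ℂ] U L} (hQ : ∀ v, Q v ∈ Γ.Uneg ∧
    ∀ y, Γ.shapovalov χ lam (Q v) y = Γ.shapovalov χ lam v y) (n : ℤ) {u : U L}
    (hu : u ∈ Γ.Upos) : ∃ S : Finset ℤ, ∀ t, S ⊆ t →
    ∑ q ∈ t, LinearMap.lTensor (U L) (Γ.degProj n) (coprod L u *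
      Γ.inclDeg q (Γ.canonicalElement χ lam q)) =
      ∑ s : D.index n, twist Q u (D.E s) ⊗ₜ (D.dualF lam n s : U L) := by
  classical
  obtain ⟨τ, hτ⟩ := exists_coprod_eq hu
  -- On this side the antipode is applied to the second factor of the coproduct; cocommutativity
  -- restores the order used in `twist`.
  have h : ∀ y, twist Q u y = twistAux Q (TensorProduct.comm ℂ (U L) (U L) (coprod L u)) y :=
    fun y => by rw [comm_coprod]; rfl
  simp only [h, ← hτ]
  clear h hτ
  induction τ using TensorProduct.induction_on with
  | zero => exact ⟨∅, fun t _ => by simp⟩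
  | add σ τ hσ hτ =>
    obtain ⟨S, hS⟩ := hσ
    obtain ⟨S', hS'⟩ := hτ
    refine ⟨S ∪ S', fun t ht => ?_⟩
    simp only [map_add, add_mul, LinearMap.add_apply, TensorProduct.add_tmul,
      Finset.sum_add_distrib]
    rw [hS t (Finset.union_subset_left ht), hS' t (Finset.union_subset_right ht)]
  | tmul a b =>
    choose S hS using fun s : D.index n =>
      Γ.exists_sum_degProj (Q (antipode L b * D.E s))
    refine ⟨(Finset.univ.biUnion S).image (fun q => -q), fun t ht => ?_⟩
    rw [Algebra.TensorProduct.map_tmul]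
    change ∑ q ∈ t, LinearMap.lTensor (U L) (Γ.degProj n) (((a : U L) ⊗ₜ (b : U L)) * _) = _
    rw [Finset.sum_congr rfl fun q _ => D.lTensor_degProj_tmul_mul hl hQ n q a b.2,
      Finset.sum_comm]
    refine Finset.sum_congr rfl fun s _ => ?_
    have h2 := hS s (t.image (fun q => -q)) fun d hd => by
      refine Finset.mem_image.mpr ⟨-d, ht (Finset.mem_image.mpr ⟨d, ?_, rfl⟩), neg_neg d⟩
      exact Finset.mem_biUnion.mpr ⟨s, Finset.mem_univ s, hd⟩
    rw [Finset.sum_image fun x _ y _ hxy => neg_injective hxy] at h2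
    rw [← TensorProduct.sum_tmul, ← Finset.mul_sum, h2]
    rfl

/-- The components of the associativity equation of the canonical element. -/
theorem exists_associativity (n j k : ℤ) : ∃ S : Finset ℤ, ∀ t, S ⊆ t →
    Γ.proj₃ (∑ q ∈ t, Γ.triProj (-n) j k (leftComp (Γ.inclDeg k (Γ.canonicalElement χ lam k))
      (Γ.inclDeg q (Γ.canonicalElement χ lam q)))) =
    Γ.proj₃ (∑ q ∈ t, Γ.triProj (-n) j k (rightComp (Γ.inclDeg n (Γ.canonicalElement χ lam n))
      (Γ.inclDeg q (Γ.canonicalElement χ lam q)))) := by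
  classical
  obtain ⟨P, hP, hP'⟩ := hl.exists_splitting_pos
  obtain ⟨Q, hQ, hQ'⟩ := hl.exists_splitting_neg
  choose S hS using fun r : D.index k => D.exists_sum_rTensor hl hP' n (D.E_mem r)
  choose S' hS' using fun r : D.index n => D.exists_sum_lTensor hl hQ' k (D.dualF lam n r).2.1
  refine ⟨Finset.univ.biUnion S ∪ Finset.univ.biUnion S', fun t ht => ?_⟩
  have hL : ∑ q ∈ t, Γ.triProj (-n) j k (leftComp (Γ.inclDeg k (Γ.canonicalElement χ lam k))
      (Γ.inclDeg q (Γ.canonicalElement χ lam q))) = ∑ r : D.index k, ∑ s : D.index n,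
        D.E s ⊗ₜ (Γ.degProj j (twist P (D.E r) (D.dualF lam n s)) ⊗ₜ
          (D.dualF lam k r : U L)) := by
    simp only [← leftCompₗ_apply]
    conv_lhs => rw [D.inclDeg_canonicalElement hl k]
    simp only [map_sum, LinearMap.sum_apply, leftCompₗ_apply, leftComp_tmul, triProj_assoc_tmul]
    rw [Finset.sum_comm]
    refine Finset.sum_congr rfl fun r _ => ?_
    rw [← map_sum, ← TensorProduct.sum_tmul, ← map_sum, hS r t
      ((Finset.subset_biUnion_of_mem S (Finset.mem_univ r)).trans (Finset.union_subset_left ht)),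
      (Γ.mem_homog_iff.mp (D.dualF lam k r).2.2).degProj_eq]
    simp only [map_sum, TensorProduct.sum_tmul, LinearMap.lTensor_tmul, TensorProduct.assoc_tmul]
  have hR : ∑ q ∈ t, Γ.triProj (-n) j k (rightComp (Γ.inclDeg n (Γ.canonicalElement χ lam n))
      (Γ.inclDeg q (Γ.canonicalElement χ lam q))) = ∑ r : D.index k, ∑ s : D.index n,
        D.E s ⊗ₜ (Γ.degProj j (twist Q (D.dualF lam n s) (D.E r)) ⊗ₜ
          (D.dualF lam k r : U L)) := by
    simp only [← rightCompₗ_apply]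
    conv_lhs => rw [D.inclDeg_canonicalElement hl n]
    simp only [map_sum, LinearMap.sum_apply, rightCompₗ_apply, rightComp_tmul, triProj_tmul]
    rw [Finset.sum_comm, Finset.sum_comm (s := Finset.univ (α := D.index k))]
    refine Finset.sum_congr rfl fun s _ => ?_
    rw [← TensorProduct.tmul_sum, ← map_sum, hS' s t
      ((Finset.subset_biUnion_of_mem S' (Finset.mem_univ s)).trans (Finset.union_subset_right ht)),
      (Γ.mem_homog_iff.mp (D.mem_UnegDeg s.2).2).degProj_eq]
    simp only [map_sum, TensorProduct.tmul_sum, LinearMap.rTensor_tmul]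
  rw [hL, hR, map_sum, map_sum]
  refine Finset.sum_congr rfl fun r _ => ?_
  rw [map_sum, map_sum]
  refine Finset.sum_congr rfl fun s _ => ?_
  -- The outer factors of both sides are now the same basis vectors, and only the middle ones have
  -- to be compared, modulo `U(g) g₀`.
  have h : Γ.leftIdeal.mkQ (Γ.degProj j (twist P (D.E r) (D.dualF lam n s))) =
      Γ.leftIdeal.mkQ (Γ.degProj j (twist Q (D.dualF lam n s) (D.E r))) := by
    rw [← sub_eq_zero, ← map_sub, ← map_sub, ← LinearMap.mem_ker, Submodule.ker_mkQ]
    exact Γ.degProj_mem_leftIdeal (hP.twist_sub_twist_mem hQ (fun h => rfl) _ _) j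
  simp only [proj₃, TensorProduct.map_tmul, h]

end DualSystem

end Grading

end


namespace Grading

variable {L : Type u} [LieRing L] [LieAlgebra ℂ L] (Γ : Grading L)

/-! ### Independence of representatives -/

/-- Left multiplication by an element of `U(g)` on `W`. -/
def mulW (a : U L) : Γ.W →ₗ[ℂ] Γ.W :=
  Γ.leftIdeal.mapQ Γ.leftIdeal (LinearMap.mulLeft ℂ a) fun _ hv => Γ.mul_mem_leftIdeal a hv

/-- The projection of `W` to its component of degree `d`. -/
def degW (d : ℤ) : Γ.W →ₗ[ℂ] Γ.W :=
  Γ.leftIdeal.mapQ Γ.leftIdeal (Γ.degProj d) fun _ hv => Γ.degProj_mem_leftIdeal hv d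

theorem proj₂_tmul (a b : U L) :
    Γ.proj₂ (a ⊗ₜ b) = Γ.leftIdeal.mkQ a ⊗ₜ Γ.leftIdeal.mkQ b := rfl

/-- Since `U(g) g₀` is a left ideal, `W ⊗ W` is a left module over `U(g) ⊗ U(g)`. -/
theorem proj₂_mul_eq_zero (t : U L ⊗[ℂ] U L) {c : U L ⊗[ℂ] U L} (hc : Γ.proj₂ c = 0) :
    Γ.proj₂ (t * c) = 0 := by
  have h : ∀ a b : U L, ∀ c, Γ.proj₂ ((a ⊗ₜ b) * c) =
      TensorProduct.map (Γ.mulW a) (Γ.mulW b) (Γ.proj₂ c) := by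
    intro a b c
    induction c using TensorProduct.induction_on with
    | zero => simp
    | add x y hx hy => rw [mul_add, map_add, map_add, map_add, hx, hy]
    | tmul x y => rw [Algebra.TensorProduct.tmul_mul_tmul]; rfl
  induction t using TensorProduct.induction_on with
  | zero => simp
  | add x y hx hy => rw [add_mul, map_add, hx, hy, add_zero]
  | tmul a b => rw [h, hc, map_zero]

theorem proj₃_triProj (i j k : ℤ) (z : U L ⊗[ℂ] (U L ⊗[ℂ] U L)) :
    Γ.proj₃ (Γ.triProj i j k z) =
      TensorProduct.map (Γ.degW i) (TensorProduct.map (Γ.degW j) (Γ.degW k)) (Γ.proj₃ z) := by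
  have h : Γ.proj₃ ∘ₗ Γ.triProj i j k =
      TensorProduct.map (Γ.degW i) (TensorProduct.map (Γ.degW j) (Γ.degW k)) ∘ₗ Γ.proj₃ := by
    ext x y z
    rfl
  exact LinearMap.congr_fun h z

theorem proj₃_assoc_tmul (T : U L ⊗[ℂ] U L) (y : U L) :
    Γ.proj₃ (TensorProduct.assoc ℂ (U L) (U L) (U L) (T ⊗ₜ y)) =
      TensorProduct.assoc ℂ Γ.W Γ.W Γ.W (Γ.proj₂ T ⊗ₜ Γ.leftIdeal.mkQ y) := by
  induction T using TensorProduct.induction_on with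
  | zero => simp
  | add a b ha hb => simp only [TensorProduct.add_tmul, map_add, ha, hb]
  | tmul a b => rfl

theorem proj₃_tmul (x : U L) (T : U L ⊗[ℂ] U L) :
    Γ.proj₃ (x ⊗ₜ T) = Γ.leftIdeal.mkQ x ⊗ₜ Γ.proj₂ T := rfl

variable {Γ} in
-- For `h` in `g₀`, left multiplication by `Δ h` induces on `W ⊗ W` the diagonal adjoint action,
-- because the terms `x h` of the commutators vanish in `W`. Invariance kills the generators of the
-- left ideal, and left multiplication does the rest.
theorem proj₂_coprod_mul_eq_zero {c : U L ⊗[ℂ] U L} (hc : Γ.IsInvariant (Γ.proj₂ c)) {u : U L}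
    (hu : u ∈ Γ.leftIdeal) : Γ.proj₂ (coprod L u * c) = 0 := by
  have hmem : u ∈ Submodule.span (U L) (inc L '' (Γ.piece 0 : Set L)) := hu
  clear hu
  induction hmem using Submodule.span_induction with
  | mem z hz =>
    obtain ⟨h, hh, rfl⟩ := hz
    have key : ∀ c : U L ⊗[ℂ] U L, Γ.proj₂ (coprod L (inc L h) * c) =
        LinearMap.rTensor Γ.W (Γ.adW ⟨h, hh⟩) (Γ.proj₂ c) +
          LinearMap.lTensor Γ.W (Γ.adW ⟨h, hh⟩) (Γ.proj₂ c) := by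
      intro c
      rw [coprod_inc]
      induction c using TensorProduct.induction_on with
      | zero => simp
      | add x y hx hy => simp only [mul_add, map_add, hx, hy]; abel
      | tmul x y =>
        have h1 : ∀ x : U L, Γ.adW ⟨h, hh⟩ (Γ.leftIdeal.mkQ x) =
            Γ.leftIdeal.mkQ (inc L h * x) := by
          intro x
          change Γ.leftIdeal.mkQ (inc L h * x - x * inc L h) = _
          rw [← sub_eq_zero, ← map_sub, ← LinearMap.mem_ker, Submodule.ker_mkQ, sub_sub_cancel_left]
          exact neg_mem (Γ.mul_inc_mem_leftIdeal x ⟨h, hh⟩)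
        rw [add_mul, map_add, Algebra.TensorProduct.tmul_mul_tmul,
          Algebra.TensorProduct.tmul_mul_tmul, one_mul, one_mul, proj₂_tmul, proj₂_tmul,
          proj₂_tmul, LinearMap.rTensor_tmul, LinearMap.lTensor_tmul, h1, h1]
    rw [key]
    exact hc ⟨h, hh⟩
  | zero => rw [map_zero, zero_mul, map_zero]
  | add x y _ _ hx hy => rw [map_add, add_mul, map_add, hx, hy, add_zero]
  | smul a z _ hz => rw [smul_eq_mul, map_mul (coprod L), mul_assoc]; exact Γ.proj₂_mul_eq_zero _ hz

variable {Γ} in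
-- By right exactness the kernel of the projection to `W ⊗ W` is `I ⊗ U(g) + U(g) ⊗ I`, with `I` the
-- left ideal.
theorem eq_zero_of_proj₂_eq_zero {V : Type*} [AddCommGroup V] [Module ℂ V]
    {φ : U L ⊗[ℂ] U L →ₗ[ℂ] V} (h1 : ∀ i ∈ Γ.leftIdeal, ∀ y, φ (i ⊗ₜ y) = 0)
    (h2 : ∀ x, ∀ i ∈ Γ.leftIdeal, φ (x ⊗ₜ i) = 0) {b : U L ⊗[ℂ] U L} (hb : Γ.proj₂ b = 0) :
    φ b = 0 := by
  have hex : Function.Exact Γ.leftIdeal.subtype Γ.leftIdeal.mkQ := LinearMap.exact_iff.mpr (by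
    rw [Submodule.ker_mkQ, Submodule.range_subtype])
  have hk := TensorProduct.map_ker hex (Submodule.mkQ_surjective _) hex (Submodule.mkQ_surjective _)
  have hb' : b ∈ LinearMap.ker (TensorProduct.map Γ.leftIdeal.mkQ Γ.leftIdeal.mkQ) := hb
  rw [hk] at hb'
  have hle : LinearMap.range (LinearMap.lTensor (U L) Γ.leftIdeal.subtype) ⊔
      LinearMap.range (LinearMap.rTensor (U L) Γ.leftIdeal.subtype) ≤ LinearMap.ker φ := by
    rw [sup_le_iff, LinearMap.range_le_ker_iff, LinearMap.range_le_ker_iff]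
    constructor
    · ext x i; exact h2 x i i.2
    · ext i y; exact h1 i i.2 y
  exact hle hb'

variable {Γ} in
-- Changing `c` is harmless by the left module structure, and so is changing the second factor of
-- `b`. A change of the first factor by an element of `U(g) g₀` enters through its coproduct and
-- needs invariance of `c`.
theorem proj₃_leftComp_congr {b b' c c' : U L ⊗[ℂ] U L} (hb : Γ.proj₂ b = Γ.proj₂ b')
    (hc : Γ.proj₂ c = Γ.proj₂ c') (hinv : Γ.IsInvariant (Γ.proj₂ c)) :
    Γ.proj₃ (leftComp b c) = Γ.proj₃ (leftComp b' c') := by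
  have h1 : Γ.proj₃ (leftComp (b - b') c) = 0 := by
    refine eq_zero_of_proj₂_eq_zero (φ := Γ.proj₃ ∘ₗ (leftCompₗ L).flip c) ?_ ?_
      (b := b - b') (by rw [map_sub, hb, sub_self])
    · intro i hi y
      change Γ.proj₃ (leftComp (i ⊗ₜ y) c) = 0
      rw [leftComp_tmul, proj₃_assoc_tmul, proj₂_coprod_mul_eq_zero hinv hi,
        TensorProduct.zero_tmul, map_zero]
    · intro x i hi
      change Γ.proj₃ (leftComp (x ⊗ₜ i) c) = 0
      rw [leftComp_tmul, proj₃_assoc_tmul, (LinearMap.mem_ker (f := Γ.leftIdeal.mkQ)).mp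
        (by rwa [Submodule.ker_mkQ]), TensorProduct.tmul_zero, map_zero]
  have h2 : Γ.proj₃ (leftComp b' (c - c')) = 0 := by
    have h0 : Γ.proj₂ (c - c') = 0 := by rw [map_sub, hc, sub_self]
    clear hb h1
    induction b' using TensorProduct.induction_on with
    | zero => rw [← leftCompₗ_apply, map_zero, LinearMap.zero_apply, map_zero]
    | add x y hx hy =>
      rw [← leftCompₗ_apply, map_add, LinearMap.add_apply, map_add, leftCompₗ_apply,
        leftCompₗ_apply, hx, hy, add_zero]
    | tmul x y =>
      rw [leftComp_tmul, proj₃_assoc_tmul, Γ.proj₂_mul_eq_zero _ h0, TensorProduct.zero_tmul,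
        map_zero]
  rw [← leftCompₗ_apply, map_sub, LinearMap.sub_apply, map_sub, sub_eq_zero] at h1
  rw [← leftCompₗ_apply, map_sub, map_sub, sub_eq_zero] at h2
  exact h1.trans h2

variable {Γ} in
theorem proj₃_rightComp_congr {b b' c c' : U L ⊗[ℂ] U L} (hb : Γ.proj₂ b = Γ.proj₂ b')
    (hc : Γ.proj₂ c = Γ.proj₂ c') (hinv : Γ.IsInvariant (Γ.proj₂ c)) :
    Γ.proj₃ (rightComp b c) = Γ.proj₃ (rightComp b' c') := by
  have h1 : Γ.proj₃ (rightComp (b - b') c) = 0 := by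
    refine eq_zero_of_proj₂_eq_zero (φ := Γ.proj₃ ∘ₗ (rightCompₗ L).flip c) ?_ ?_
      (b := b - b') (by rw [map_sub, hb, sub_self])
    · intro i hi y
      change Γ.proj₃ (rightComp (i ⊗ₜ y) c) = 0
      rw [rightComp_tmul, proj₃_tmul, (LinearMap.mem_ker (f := Γ.leftIdeal.mkQ)).mp
        (by rwa [Submodule.ker_mkQ]), TensorProduct.zero_tmul]
    · intro x i hi
      change Γ.proj₃ (rightComp (x ⊗ₜ i) c) = 0
      rw [rightComp_tmul, proj₃_tmul, proj₂_coprod_mul_eq_zero hinv hi, TensorProduct.tmul_zero]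
  have h2 : Γ.proj₃ (rightComp b' (c - c')) = 0 := by
    have h0 : Γ.proj₂ (c - c') = 0 := by rw [map_sub, hc, sub_self]
    clear hb h1
    induction b' using TensorProduct.induction_on with
    | zero => rw [← rightCompₗ_apply, map_zero, LinearMap.zero_apply, map_zero]
    | add x y hx hy =>
      rw [← rightCompₗ_apply, map_add, LinearMap.add_apply, map_add, rightCompₗ_apply,
        rightCompₗ_apply, hx, hy, add_zero]
    | tmul x y =>
      rw [rightComp_tmul, proj₃_tmul, Γ.proj₂_mul_eq_zero _ h0, TensorProduct.tmul_zero]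
  rw [← rightCompₗ_apply, map_sub, LinearMap.sub_apply, map_sub, sub_eq_zero] at h1
  rw [← rightCompₗ_apply, map_sub, map_sub, sub_eq_zero] at h2
  exact h1.trans h2

/-! ### Supports of the components of the products -/

/-- The tensors of bidegree `(-q, q)`. -/
def bihomog (q : ℤ) : Submodule ℂ (U L ⊗[ℂ] U L) :=
  LinearMap.range (TensorProduct.map (Γ.homog (-q)).subtype (Γ.homog q).subtype)

variable {Γ} in
theorem bihomog_induction {q : ℤ} {p : (c : U L ⊗[ℂ] U L) → c ∈ Γ.bihomog q → Prop}
    (zero : p 0 (zero_mem _)) (add : ∀ a b ha hb, p a ha → p b hb → p (a + b) (add_mem ha hb))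
    (tmul : ∀ x y, ∀ hx : Γ.IsHomog (-q) x, ∀ hy : Γ.IsHomog q y, p (x ⊗ₜ y)
      ⟨⟨x, Γ.mem_homog_iff.mpr hx⟩ ⊗ₜ ⟨y, Γ.mem_homog_iff.mpr hy⟩, rfl⟩) {c : U L ⊗[ℂ] U L}
    (hc : c ∈ Γ.bihomog q) : p c hc := by
  obtain ⟨T, hT⟩ := id hc
  induction T using TensorProduct.induction_on generalizing c with
  | zero => rw [map_zero] at hT; subst hT; exact zero
  | add x y hx hy =>
    rw [map_add] at hT; subst hT; exact add _ _ _ _ (hx ⟨x, rfl⟩ rfl) (hy ⟨y, rfl⟩ rfl)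
  | tmul x y => subst hT; exact tmul _ _ (Γ.mem_homog_iff.mp x.2) (Γ.mem_homog_iff.mp y.2)

theorem inclDeg_mem_bihomog {q : ℤ} (T : Γ.UnegDeg q ⊗[ℂ] Γ.UposDeg q) :
    Γ.inclDeg q T ∈ Γ.bihomog q := by
  induction T using TensorProduct.induction_on with
  | zero => rw [map_zero]; exact zero_mem _
  | add x y hx hy => rw [map_add]; exact add_mem hx hy
  | tmul x y => exact ⟨⟨x, x.2.2⟩ ⊗ₜ ⟨y, y.2.2⟩, rfl⟩

theorem exists_degProj_eq_zero (u : U L) : ∃ s : Finset ℤ, ∀ d ∉ s, Γ.degProj d u = 0 := by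
  obtain ⟨s, hs⟩ := Γ.exists_sum_degProj u
  refine ⟨s, fun d hd => ?_⟩
  have h1 := hs s subset_rfl
  have h2 := hs (insert d s) (Finset.subset_insert d s)
  rw [Finset.sum_insert hd, h1] at h2
  exact add_eq_right.mp h2

variable {Γ} in
theorem triProj_leftComp_of_ne {q k : ℤ} (h : q ≠ k) {b : U L ⊗[ℂ] U L} (hb : b ∈ Γ.bihomog q)
    (i j : ℤ) (c : U L ⊗[ℂ] U L) : Γ.triProj i j k (leftComp b c) = 0 := by
  induction hb using bihomog_induction with
  | zero => rw [← leftCompₗ_apply, map_zero, LinearMap.zero_apply, map_zero]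
  | add x y _ _ hx hy =>
    rw [← leftCompₗ_apply, map_add, LinearMap.add_apply, map_add, leftCompₗ_apply,
      leftCompₗ_apply, hx, hy, add_zero]
  | tmul x y _ hy =>
    rw [leftComp_tmul, triProj_assoc_tmul, hy.degProj_ne h, TensorProduct.tmul_zero, map_zero]

variable {Γ} in
theorem triProj_rightComp_of_ne {q i : ℤ} (h : -q ≠ i) {b : U L ⊗[ℂ] U L} (hb : b ∈ Γ.bihomog q)
    (j k : ℤ) (c : U L ⊗[ℂ] U L) : Γ.triProj i j k (rightComp b c) = 0 := by
  induction hb using bihomog_induction with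
  | zero => rw [← rightCompₗ_apply, map_zero, LinearMap.zero_apply, map_zero]
  | add x y _ _ hx hy =>
    rw [← rightCompₗ_apply, map_add, LinearMap.add_apply, map_add, rightCompₗ_apply,
      rightCompₗ_apply, hx, hy, add_zero]
  | tmul x y hx _ =>
    rw [rightComp_tmul, triProj_tmul, hx.degProj_ne h, TensorProduct.zero_tmul]

/-- The first factor of `c` has degree `-q`, so only the component of degree `i + q` of the first
factor of `T` matters, and that is nonzero for finitely many `q`. -/
theorem exists_rTensor_degProj_mul_eq_zero (i : ℤ) (T : U L ⊗[ℂ] U L) :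
    ∃ S : Finset ℤ, ∀ q ∉ S, ∀ c ∈ Γ.bihomog q,
      LinearMap.rTensor (U L) (Γ.degProj i) (T * c) = 0 := by
  classical
  induction T using TensorProduct.induction_on with
  | zero => exact ⟨∅, fun q _ c _ => by rw [zero_mul, map_zero]⟩
  | add x y hx hy =>
    obtain ⟨S, hS⟩ := hx
    obtain ⟨S', hS'⟩ := hy
    refine ⟨S ∪ S', fun q hq c hc => ?_⟩
    rw [Finset.notMem_union] at hq
    rw [add_mul, map_add, hS q hq.1 c hc, hS' q hq.2 c hc, add_zero]
  | tmul a b =>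
    obtain ⟨S, hS⟩ := Γ.exists_degProj_eq_zero a
    refine ⟨S.image fun d => d - i, fun q hq c hc => ?_⟩
    induction hc using bihomog_induction with
    | zero => rw [mul_zero, map_zero]
    | add x y _ _ hx hy => rw [mul_add, map_add, hx, hy, add_zero]
    | tmul x y hx _ =>
      rw [Algebra.TensorProduct.tmul_mul_tmul, LinearMap.rTensor_tmul, Γ.degProj_mul_homog hx,
        hS _ fun h => hq (Finset.mem_image.mpr ⟨_, h, by ring⟩), zero_mul, TensorProduct.zero_tmul]

theorem exists_lTensor_degProj_mul_eq_zero (k : ℤ) (T : U L ⊗[ℂ] U L) :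
    ∃ S : Finset ℤ, ∀ q ∉ S, ∀ c ∈ Γ.bihomog q,
      LinearMap.lTensor (U L) (Γ.degProj k) (T * c) = 0 := by
  classical
  induction T using TensorProduct.induction_on with
  | zero => exact ⟨∅, fun q _ c _ => by rw [zero_mul, map_zero]⟩
  | add x y hx hy =>
    obtain ⟨S, hS⟩ := hx
    obtain ⟨S', hS'⟩ := hy
    refine ⟨S ∪ S', fun q hq c hc => ?_⟩
    rw [Finset.notMem_union] at hq
    rw [add_mul, map_add, hS q hq.1 c hc, hS' q hq.2 c hc, add_zero]
  | tmul a b =>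
    obtain ⟨S, hS⟩ := Γ.exists_degProj_eq_zero b
    refine ⟨S.image fun d => k - d, fun q hq c hc => ?_⟩
    induction hc using bihomog_induction with
    | zero => rw [mul_zero, map_zero]
    | add x y _ _ hx hy => rw [mul_add, map_add, hx, hy, add_zero]
    | tmul x y _ hy =>
      rw [Algebra.TensorProduct.tmul_mul_tmul, LinearMap.lTensor_tmul, Γ.degProj_mul_homog hy,
        hS _ fun h => hq (Finset.mem_image.mpr ⟨_, h, by ring⟩), zero_mul, TensorProduct.tmul_zero]

theorem exists_triProj_leftComp_eq_zero (i j k : ℤ) (b : U L ⊗[ℂ] U L) :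
    ∃ S : Finset ℤ, ∀ q ∉ S, ∀ c ∈ Γ.bihomog q, Γ.triProj i j k (leftComp b c) = 0 := by
  classical
  induction b using TensorProduct.induction_on with
  | zero =>
    exact ⟨∅, fun q _ c _ => by
      rw [← leftCompₗ_apply, map_zero, LinearMap.zero_apply, map_zero]⟩
  | add x y hx hy =>
    obtain ⟨S, hS⟩ := hx
    obtain ⟨S', hS'⟩ := hy
    refine ⟨S ∪ S', fun q hq c hc => ?_⟩
    rw [Finset.notMem_union] at hq
    rw [← leftCompₗ_apply, map_add, LinearMap.add_apply, map_add, leftCompₗ_apply,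
      leftCompₗ_apply, hS q hq.1 c hc, hS' q hq.2 c hc, add_zero]
  | tmul a b =>
    obtain ⟨S, hS⟩ := Γ.exists_rTensor_degProj_mul_eq_zero i (coprod L a)
    refine ⟨S, fun q hq c hc => ?_⟩
    rw [leftComp_tmul, triProj_assoc_tmul, hS q hq c hc, map_zero, TensorProduct.zero_tmul,
      map_zero]

theorem exists_triProj_rightComp_eq_zero (i j k : ℤ) (b : U L ⊗[ℂ] U L) :
    ∃ S : Finset ℤ, ∀ q ∉ S, ∀ c ∈ Γ.bihomog q, Γ.triProj i j k (rightComp b c) = 0 := by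
  classical
  induction b using TensorProduct.induction_on with
  | zero =>
    exact ⟨∅, fun q _ c _ => by
      rw [← rightCompₗ_apply, map_zero, LinearMap.zero_apply, map_zero]⟩
  | add x y hx hy =>
    obtain ⟨S, hS⟩ := hx
    obtain ⟨S', hS'⟩ := hy
    refine ⟨S ∪ S', fun q hq c hc => ?_⟩
    rw [Finset.notMem_union] at hq
    rw [← rightCompₗ_apply, map_add, LinearMap.add_apply, map_add, rightCompₗ_apply,
      rightCompₗ_apply, hS q hq.1 c hc, hS' q hq.2 c hc, add_zero]
  | tmul a b =>
    obtain ⟨S, hS⟩ := Γ.exists_lTensor_degProj_mul_eq_zero k (coprod L b)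
    refine ⟨S, fun q hq c hc => ?_⟩
    rw [rightComp_tmul, triProj_tmul, hS q hq c hc, map_zero, TensorProduct.tmul_zero]

/-- A support that is valid for the image of a finite dimensional space of tensors. -/
theorem exists_support_of_finiteDimensional {V X : Type*} [AddCommGroup V] [Module ℂ V]
    [FiniteDimensional ℂ V] [AddCommGroup X] [Module ℂ X]
    (β : V →ₗ[ℂ] U L ⊗[ℂ] U L →ₗ[ℂ] X)
    (h : ∀ v, ∃ S : Finset ℤ, ∀ q ∉ S, ∀ c ∈ Γ.bihomog q, β v c = 0) :
    ∃ S : Finset ℤ, ∀ q ∉ S, ∀ c ∈ Γ.bihomog q, ∀ v, β v c = 0 := by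
  classical
  choose S hS using h
  refine ⟨Finset.univ.biUnion fun i => S (Module.finBasis ℂ V i), fun q hq c hc v => ?_⟩
  have h0 : β.flip c = 0 := (Module.finBasis ℂ V).ext fun i => by
    rw [LinearMap.flip_apply, LinearMap.zero_apply]
    exact hS _ q (fun hi => hq (Finset.mem_biUnion.mpr ⟨i, Finset.mem_univ i, hi⟩)) c hc
  exact LinearMap.congr_fun h0 v

theorem exists_sum_triProj (z : U L ⊗[ℂ] (U L ⊗[ℂ] U L)) : ∃ S : Finset ℤ, ∀ t, S ⊆ t →
    ∑ i ∈ t, ∑ j ∈ t, ∑ k ∈ t, Γ.triProj i j k z = z := by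
  classical
  have hadd : ∀ x y : U L ⊗[ℂ] (U L ⊗[ℂ] U L),
      (∃ S : Finset ℤ, ∀ t, S ⊆ t → ∑ i ∈ t, ∑ j ∈ t, ∑ k ∈ t, Γ.triProj i j k x = x) →
      (∃ S : Finset ℤ, ∀ t, S ⊆ t → ∑ i ∈ t, ∑ j ∈ t, ∑ k ∈ t, Γ.triProj i j k y = y) →
      ∃ S : Finset ℤ, ∀ t, S ⊆ t →
        ∑ i ∈ t, ∑ j ∈ t, ∑ k ∈ t, Γ.triProj i j k (x + y) = x + y := by
    rintro x y ⟨S, hS⟩ ⟨S', hS'⟩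
    refine ⟨S ∪ S', fun t ht => ?_⟩
    simp only [map_add, Finset.sum_add_distrib]
    rw [hS t (Finset.union_subset_left ht), hS' t (Finset.union_subset_right ht)]
  induction z using TensorProduct.induction_on with
  | zero => exact ⟨∅, fun t _ => by simp⟩
  | add x y hx hy => exact hadd x y hx hy
  | tmul a T =>
    induction T using TensorProduct.induction_on with
    | zero => exact ⟨∅, fun t _ => by simp⟩
    | add x y hx hy => rw [TensorProduct.tmul_add]; exact hadd _ _ hx hy
    | tmul b c =>
      obtain ⟨S₁, h₁⟩ := Γ.exists_sum_degProj a
      obtain ⟨S₂, h₂⟩ := Γ.exists_sum_degProj b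
      obtain ⟨S₃, h₃⟩ := Γ.exists_sum_degProj c
      refine ⟨S₁ ∪ (S₂ ∪ S₃), fun t ht => ?_⟩
      simp only [triProj, TensorProduct.map_tmul, ← TensorProduct.tmul_sum,
        ← TensorProduct.sum_tmul]
      rw [h₁ t (Finset.union_subset_left ht),
        h₂ t (Finset.union_subset_left (Finset.union_subset_right ht)),
        h₃ t (Finset.union_subset_right (Finset.union_subset_right ht))]

end Grading


namespace Grading

variable {L : Type u} [LieRing L] [LieAlgebra ℂ L] {Γ : Grading L}
  {χ : LieAlgebra.LieCharacter ℂ Γ.zeroPart}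

/-! ### Invariance -/

/-- The adjoint action of an element of degree zero on `U(g)`. -/
def adU (h : Γ.zeroPart) : U L →ₗ[ℂ] U L :=
  LinearMap.mulLeft ℂ (inc L h) - LinearMap.mulRight ℂ (inc L h)

theorem adU_apply (h : Γ.zeroPart) (x : U L) : adU h x = inc L h * x - x * inc L h := rfl

theorem adU_mem_homog (h : Γ.zeroPart) {d : ℤ} {x : U L} (hx : x ∈ Γ.homog d) :
    adU h x ∈ Γ.homog d := by
  have hx' := Γ.mem_homog_iff.mp hx
  have hh := Γ.isHomog_inc h.2
  have h1 := hh.mul hx'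
  have h2 := hx'.mul hh
  rw [zero_add] at h1
  rw [add_zero] at h2
  exact sub_mem (Γ.mem_homog_iff.mpr h1) (Γ.mem_homog_iff.mpr h2)

theorem adU_mem_UnegDeg (h : Γ.zeroPart) {n : ℤ} {x : U L} (hx : x ∈ Γ.UnegDeg n) :
    adU h x ∈ Γ.UnegDeg n :=
  ⟨Γ.zero_mul_sub_mul_zero_mem_adjoin (fun h _ hz => Γ.zero_lie_mem_negPart h hz) h hx.1,
    adU_mem_homog h hx.2⟩

theorem adU_mem_UposDeg (h : Γ.zeroPart) {n : ℤ} {x : U L} (hx : x ∈ Γ.UposDeg n) :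
    adU h x ∈ Γ.UposDeg n :=
  ⟨Γ.zero_mul_sub_mul_zero_mem_adjoin (fun h _ hz => Γ.zero_lie_mem_posPart h hz) h hx.1,
    adU_mem_homog h hx.2⟩

/-- Left multiplications by `h` are skew-adjoint, and the right multiplications contribute `λ χ(h)`
with opposite signs. -/
theorem shapovalov_adU (lam : ℂ) (h : Γ.zeroPart) (x y : U L) :
    Γ.shapovalov χ lam (adU h x) y + Γ.shapovalov χ lam x (adU h y) = 0 := by
  rw [adU_apply, adU_apply, map_sub, map_sub, LinearMap.sub_apply, shapovalov_inc_mul,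
    shapovalov_mul_zero, shapovalov_mul_zero']
  ring

theorem isInvariant_proj₂ {T : U L ⊗[ℂ] U L} (hT : ∀ h : Γ.zeroPart,
    LinearMap.rTensor (U L) (adU h) T + LinearMap.lTensor (U L) (adU h) T = 0) :
    Γ.IsInvariant (Γ.proj₂ T) := by
  have key : ∀ (h : Γ.zeroPart) (T : U L ⊗[ℂ] U L),
      LinearMap.rTensor Γ.W (Γ.adW h) (Γ.proj₂ T) + LinearMap.lTensor Γ.W (Γ.adW h) (Γ.proj₂ T) =
        Γ.proj₂ (LinearMap.rTensor (U L) (adU h) T + LinearMap.lTensor (U L) (adU h) T) := by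
    intro h T
    induction T using TensorProduct.induction_on with
    | zero => simp
    | add x y hx hy => simp only [map_add] at hx hy ⊢; rw [add_add_add_comm, hx, hy]; abel
    | tmul x y => rw [map_add]; rfl
  intro h
  rw [key, hT h, map_zero]

namespace DualSystem

variable (D : DualSystem Γ χ)

/-- In dual bases the skew-adjoint action of `h` has opposite transposed matrices on the two
factors, so the contributions to each `E_r ⊗ dualF_s` cancel. -/
theorem canonicalElement_invariant (D : DualSystem Γ χ) {lam : ℂ}
    (hl : Γ.PairingNonsingular χ lam) (n : ℤ) (h : Γ.zeroPart) :
    (LinearMap.rTensor (U L) (adU h) + LinearMap.lTensor (U L) (adU h))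
      (Γ.inclDeg n (Γ.canonicalElement χ lam n)) = 0 := by
  rw [LinearMap.add_apply, D.inclDeg_canonicalElement hl, map_sum, map_sum]
  have h1 : ∀ s : D.index n, LinearMap.rTensor (U L) (adU h)
      (D.E s ⊗ₜ (D.dualF lam n s : U L)) = ∑ r : D.index n,
        Γ.shapovalov χ lam (adU h (D.E s)) (D.dualF lam n r) •
          (D.E r ⊗ₜ[ℂ] (D.dualF lam n s : U L)) := by
    intro s
    rw [LinearMap.rTensor_tmul]
    conv_lhs => rw [← D.sum_shapovalov_E hl (adU_mem_UnegDeg h (D.mem_UnegDeg s.2))]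
    rw [TensorProduct.sum_tmul]
    rfl
  have h2 : ∀ r : D.index n, LinearMap.lTensor (U L) (adU h)
      (D.E r ⊗ₜ (D.dualF lam n r : U L)) = ∑ s : D.index n,
        Γ.shapovalov χ lam (D.E s) (adU h (D.dualF lam n r)) •
          (D.E r ⊗ₜ[ℂ] (D.dualF lam n s : U L)) := by
    intro r
    rw [LinearMap.lTensor_tmul]
    conv_lhs => rw [← D.sum_shapovalov_dualF hl (adU_mem_UposDeg h (D.dualF lam n r).2)]
    rw [TensorProduct.tmul_sum]
    simp only [TensorProduct.tmul_smul]
  rw [Finset.sum_congr rfl fun s _ => h1 s, Finset.sum_congr rfl fun s _ => h2 s,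
    Finset.sum_comm, ← Finset.sum_add_distrib]
  refine Finset.sum_eq_zero fun r _ => ?_
  rw [← Finset.sum_add_distrib]
  refine Finset.sum_eq_zero fun s _ => ?_
  rw [← add_smul, shapovalov_adU, zero_smul]

theorem expansion_expandsWeakly (n : ℤ) : ExpandsWeakly (goodSet Γ χ)
    (fun m => D.expansion m n) (fun t => Γ.canonicalElement χ t⁻¹ n) :=
  isExpansionAtInfinity_iff.mp D.isExpansionAtInfinity_expansion n

theorem isInvariant_projSeries (m : ℕ) (n : ℤ) : Γ.IsInvariant (Γ.projSeries D.expansion m n) :=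
  isInvariant_proj₂ fun h => (D.expansion_expandsWeakly n).eq_zero_of_map
    D.countable_compl_goodSet
    ((LinearMap.rTensor (U L) (adU h) + LinearMap.lTensor (U L) (adU h)) ∘ₗ Γ.inclDeg n)
    (fun _ ht => D.canonicalElement_invariant ht n h) m

/-! ### The associativity equation for the coefficients -/

/-- The components of the associativity equation for the coefficients of the expansion. -/
theorem exists_sum_triProj_expansion (n j k : ℤ) : ∃ S₀ : Finset ℤ, ∀ S, S₀ ⊆ S → ∀ m : ℕ,
    ∑ p ∈ Finset.HasAntidiagonal.antidiagonal m, ∑ q ∈ S, Γ.proj₃ (Γ.triProj (-n) j k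
      (leftComp (Γ.inclDeg k (D.expansion p.1 k)) (Γ.inclDeg q (D.expansion p.2 q)))) =
    ∑ p ∈ Finset.HasAntidiagonal.antidiagonal m, ∑ q ∈ S, Γ.proj₃ (Γ.triProj (-n) j k
      (rightComp (Γ.inclDeg n (D.expansion p.1 n)) (Γ.inclDeg q (D.expansion p.2 q)))) := by
  classical
  have := fun q => D.finite_UnegDeg q
  have := fun q => D.finite_UposDeg q
  -- The degrees `q` that contribute must be fixed before `t`, since the canonical element varies
  -- with `t`; finite dimension of its degree `k` component provides a uniform finite set.
  obtain ⟨SL, hSL⟩ := Γ.exists_support_of_finiteDimensional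
    (((leftCompₗ L).comp (Γ.inclDeg k)).compr₂ (Γ.triProj (-n) j k))
    (fun v => Γ.exists_triProj_leftComp_eq_zero (-n) j k (Γ.inclDeg k v))
  obtain ⟨SR, hSR⟩ := Γ.exists_support_of_finiteDimensional
    (((rightCompₗ L).comp (Γ.inclDeg n)).compr₂ (Γ.triProj (-n) j k))
    (fun v => Γ.exists_triProj_rightComp_eq_zero (-n) j k (Γ.inclDeg n v))
  refine ⟨SL ∪ SR, fun S hS m => ?_⟩
  let βL : ∀ q : ℤ, Γ.UnegDeg k ⊗[ℂ] Γ.UposDeg k →ₗ[ℂ] Γ.UnegDeg q ⊗[ℂ] Γ.UposDeg q →ₗ[ℂ]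
      Γ.W ⊗[ℂ] (Γ.W ⊗[ℂ] Γ.W) := fun q =>
    ((leftCompₗ L).compl₁₂ (Γ.inclDeg k) (Γ.inclDeg q)).compr₂ (Γ.proj₃ ∘ₗ Γ.triProj (-n) j k)
  let βR : ∀ q : ℤ, Γ.UnegDeg n ⊗[ℂ] Γ.UposDeg n →ₗ[ℂ] Γ.UnegDeg q ⊗[ℂ] Γ.UposDeg q →ₗ[ℂ]
      Γ.W ⊗[ℂ] (Γ.W ⊗[ℂ] Γ.W) := fun q =>
    ((rightCompₗ L).compl₁₂ (Γ.inclDeg n) (Γ.inclDeg q)).compr₂ (Γ.proj₃ ∘ₗ Γ.triProj (-n) j k)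
  have hL := ExpandsWeakly.sum S fun q _ =>
    (D.expansion_expandsWeakly k).bilin (D.expansion_expandsWeakly q) (βL q)
  have hR := ExpandsWeakly.sum S fun q _ =>
    (D.expansion_expandsWeakly n).bilin (D.expansion_expandsWeakly q) (βR q)
  have hLR : ∀ t ∈ goodSet Γ χ,
      ∑ q ∈ S, βL q (Γ.canonicalElement χ t⁻¹ k) (Γ.canonicalElement χ t⁻¹ q) =
      ∑ q ∈ S, βR q (Γ.canonicalElement χ t⁻¹ n) (Γ.canonicalElement χ t⁻¹ q) := by
    intro t ht
    -- For this `t` the identity is known for large index sets only; the degrees outside `S`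
    -- contribute zero on both sides.
    obtain ⟨S₁, h₁⟩ := D.exists_associativity ht n j k
    have h2 := h₁ (S ∪ S₁) Finset.subset_union_right
    rw [map_sum, map_sum] at h2
    refine (Finset.sum_subset Finset.subset_union_left fun q _ hq => ?_).trans (h2.trans
      (Finset.sum_subset Finset.subset_union_left fun q _ hq => ?_).symm)
    · have := hSL q (fun h => hq (hS (Finset.mem_union_left _ h))) _
        (Γ.inclDeg_mem_bihomog (Γ.canonicalElement χ t⁻¹ q)) (Γ.canonicalElement χ t⁻¹ k)
      exact (congrArg Γ.proj₃ this).trans (map_zero _)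
    · have := hSR q (fun h => hq (hS (Finset.mem_union_right _ h))) _
        (Γ.inclDeg_mem_bihomog (Γ.canonicalElement χ t⁻¹ q)) (Γ.canonicalElement χ t⁻¹ n)
      exact (congrArg Γ.proj₃ this).trans (map_zero _)
  have h3 := congrFun (hL.unique D.countable_compl_goodSet (hR.congr fun t ht => (hLR t ht).symm)) m
  rw [Finset.sum_comm, Finset.sum_comm (s := Finset.HasAntidiagonal.antidiagonal m)]
  exact h3

/-- The third degree forces the first index to be `k`, the first degree then leaves finitely many
second indices, and invariance allows the chosen representative to be replaced by the expansion
itself. -/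
theorem sum_finsum_leftComp {R : ℕ → ℤ → U L ⊗[ℂ] U L}
    (hR : Γ.IsRepresentative (Γ.projSeries D.expansion) R) (i j k : ℤ) (p p' : ℕ) :
    ∃ S₀ : Finset ℤ, ∀ S, S₀ ⊆ S →
      Γ.proj₃ (∑ᶠ q : ℤ × ℤ, Γ.triProj i j k (leftComp (R p q.1) (R p' q.2))) =
      ∑ q ∈ S, Γ.proj₃ (Γ.triProj i j k
        (leftComp (Γ.inclDeg k (D.expansion p k)) (Γ.inclDeg q (D.expansion p' q)))) := by
  classical
  obtain ⟨S₀, h₀⟩ := Γ.exists_triProj_leftComp_eq_zero i j k (R p k)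
  refine ⟨S₀, fun S hS => ?_⟩
  have hsupp : (Function.support fun q : ℤ × ℤ =>
      Γ.triProj i j k (leftComp (R p q.1) (R p' q.2))) ⊆ (S.image fun q => (k, q) : Finset _) := by
    rintro ⟨a, b⟩ hq
    rw [Function.mem_support] at hq
    by_cases ha : a = k
    · subst ha
      refine Finset.mem_coe.mpr (Finset.mem_image.mpr ⟨b, ?_, rfl⟩)
      by_contra hb
      exact hq (h₀ b (fun h => hb (hS h)) _ (hR p' b).1)
    · exact absurd (triProj_leftComp_of_ne ha (hR p a).1 i j _) hq
  rw [finsum_eq_sum_of_support_subset _ hsupp, map_sum,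
    Finset.sum_image fun x _ y _ h => congrArg Prod.snd h]
  refine Finset.sum_congr rfl fun q _ => ?_
  rw [proj₃_triProj, proj₃_triProj]
  congr 1
  refine proj₃_leftComp_congr (hR p k).2 (hR p' q).2 ?_
  rw [(hR p' q).2]
  exact D.isInvariant_projSeries p' q

theorem sum_finsum_rightComp {R : ℕ → ℤ → U L ⊗[ℂ] U L}
    (hR : Γ.IsRepresentative (Γ.projSeries D.expansion) R) (n j k : ℤ) (p p' : ℕ) :
    ∃ S₀ : Finset ℤ, ∀ S, S₀ ⊆ S →
      Γ.proj₃ (∑ᶠ q : ℤ × ℤ, Γ.triProj (-n) j k (rightComp (R p q.1) (R p' q.2))) =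
      ∑ q ∈ S, Γ.proj₃ (Γ.triProj (-n) j k
        (rightComp (Γ.inclDeg n (D.expansion p n)) (Γ.inclDeg q (D.expansion p' q)))) := by
  classical
  obtain ⟨S₀, h₀⟩ := Γ.exists_triProj_rightComp_eq_zero (-n) j k (R p n)
  refine ⟨S₀, fun S hS => ?_⟩
  have hsupp : (Function.support fun q : ℤ × ℤ =>
      Γ.triProj (-n) j k (rightComp (R p q.1) (R p' q.2))) ⊆
        (S.image fun q => (n, q) : Finset _) := by
    rintro ⟨a, b⟩ hq
    rw [Function.mem_support] at hq
    by_cases ha : a = n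
    · subst ha
      refine Finset.mem_coe.mpr (Finset.mem_image.mpr ⟨b, ?_, rfl⟩)
      by_contra hb
      exact hq (h₀ b (fun h => hb (hS h)) _ (hR p' b).1)
    · exact absurd (triProj_rightComp_of_ne (fun h => ha (neg_injective h)) (hR p a).1 j k _) hq
  rw [finsum_eq_sum_of_support_subset _ hsupp, map_sum,
    Finset.sum_image fun x _ y _ h => congrArg Prod.snd h]
  refine Finset.sum_congr rfl fun q _ => ?_
  rw [proj₃_triProj, proj₃_triProj]
  congr 1
  refine proj₃_rightComp_congr (hR p n).2 (hR p' q).2 ?_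
  rw [(hR p' q).2]
  exact D.isInvariant_projSeries p' q

theorem isAssociativeCompleted : Γ.IsAssociativeCompleted (Γ.projSeries D.expansion) := by
  classical
  intro R R' hR hR' m i j k
  obtain ⟨n, rfl⟩ : ∃ n, i = -n := ⟨-i, (neg_neg i).symm⟩
  obtain ⟨S₀, h₀⟩ := D.exists_sum_triProj_expansion n j k
  choose SL hL using fun p : ℕ × ℕ => D.sum_finsum_leftComp hR (-n) j k p.1 p.2
  choose SR hR using fun p : ℕ × ℕ => D.sum_finsum_rightComp hR' n j k p.1 p.2
  let S := S₀ ∪ ((Finset.HasAntidiagonal.antidiagonal m).biUnion SL ∪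
    (Finset.HasAntidiagonal.antidiagonal m).biUnion SR)
  rw [map_sum, map_sum]
  calc _ = _ := Finset.sum_congr rfl fun p hp => hL p S
        ((Finset.subset_biUnion_of_mem SL hp).trans
          (Finset.subset_union_left.trans Finset.subset_union_right))
    _ = _ := h₀ S Finset.subset_union_left m
    _ = _ := (Finset.sum_congr rfl fun p hp => hR p S
        ((Finset.subset_biUnion_of_mem SR hp).trans
          (Finset.subset_union_right.trans Finset.subset_union_right))).symm

/-! ### The finite dimensional case -/

theorem total_eq [FiniteDimensional ℂ L] (m : ℕ) {A : Finset ℤ}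
    (hA : ∀ n, D.expansion m n ≠ 0 → n ∈ A) : Γ.total (Γ.projSeries D.expansion) m =
      Γ.proj₂ (∑ n ∈ A, Γ.inclDeg n (D.expansion m n)) := by
  rw [total, map_sum]
  refine finsum_eq_sum_of_support_subset _ fun n hn => hA n fun h => hn ?_
  change Γ.proj₂ (Γ.inclDeg n (D.expansion m n)) = 0
  rw [h, map_zero, map_zero]

theorem isInvariant_total [FiniteDimensional ℂ L] (m : ℕ) :
    Γ.IsInvariant (Γ.total (Γ.projSeries D.expansion) m) := by
  intro h
  rw [D.total_eq m (A := (D.finite_expansion_ne_zero m).toFinset) fun n hn => by simpa using hn,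
    map_sum, map_sum, map_sum, ← Finset.sum_add_distrib]
  exact Finset.sum_eq_zero fun n _ => D.isInvariant_projSeries m n h

/-- Invariance reduces arbitrary representatives to finite sums of components of the expansion. The
difference of the two sides is then the sum of its tri-degree components, each zero by the identity
of the completed case. -/
theorem isAssociative_total [FiniteDimensional ℂ L] :
    Γ.IsAssociative (Γ.total (Γ.projSeries D.expansion)) := by
  classical
  intro R R' hR hR' m
  -- One finite set of degrees that is large enough for all orders up to `m`.
  let A₀ : Finset ℤ := (Finset.range (m + 1)).biUnion fun p =>
    (D.finite_expansion_ne_zero p).toFinset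
  have hA₀ : ∀ p ≤ m, ∀ n, D.expansion p n ≠ 0 → n ∈ A₀ := fun p hp n hn =>
    Finset.mem_biUnion.mpr ⟨p, Finset.mem_range.mpr (by omega), by simpa using hn⟩
  have hle : ∀ p ∈ Finset.HasAntidiagonal.antidiagonal m, p.1 ≤ m ∧ p.2 ≤ m := fun p hp => by
    have := Finset.HasAntidiagonal.mem_antidiagonal.mp hp
    omega
  let T : ℕ → U L ⊗[ℂ] U L := fun p => ∑ n ∈ A₀, Γ.inclDeg n (D.expansion p n)
  have hT : ∀ A, A₀ ⊆ A → ∀ p ≤ m, T p = ∑ n ∈ A, Γ.inclDeg n (D.expansion p n) := by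
    intro A hA p hp
    refine Finset.sum_subset hA fun n _ hn => ?_
    by_contra h
    exact hn (hA₀ p hp n fun h0 => h (by rw [h0, map_zero]))
  have hrep : ∀ R : ℕ → U L ⊗[ℂ] U L, (∀ m, Γ.proj₂ (R m) =
      Γ.total (Γ.projSeries D.expansion) m) → ∀ p ≤ m, Γ.proj₂ (R p) = Γ.proj₂ (T p) :=
    fun R hR p hp => (hR p).trans (D.total_eq p (hA₀ p hp))
  have hinv : ∀ R : ℕ → U L ⊗[ℂ] U L, (∀ m, Γ.proj₂ (R m) =
      Γ.total (Γ.projSeries D.expansion) m) → ∀ p, Γ.IsInvariant (Γ.proj₂ (R p)) :=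
    fun R hR p => by rw [hR p]; exact D.isInvariant_total p
  have h1 : Γ.proj₃ (∑ p ∈ Finset.HasAntidiagonal.antidiagonal m, leftComp (R p.1) (R p.2)) =
      Γ.proj₃ (∑ p ∈ Finset.HasAntidiagonal.antidiagonal m, leftComp (T p.1) (T p.2)) := by
    rw [map_sum, map_sum]
    exact Finset.sum_congr rfl fun p hp => proj₃_leftComp_congr (hrep R hR _ (hle p hp).1)
      (hrep R hR _ (hle p hp).2) (hinv R hR _)
  have h2 : Γ.proj₃ (∑ p ∈ Finset.HasAntidiagonal.antidiagonal m, rightComp (R' p.1) (R' p.2)) =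
      Γ.proj₃ (∑ p ∈ Finset.HasAntidiagonal.antidiagonal m, rightComp (T p.1) (T p.2)) := by
    rw [map_sum, map_sum]
    exact Finset.sum_congr rfl fun p hp => proj₃_rightComp_congr (hrep R' hR' _ (hle p hp).1)
      (hrep R' hR' _ (hle p hp).2) (hinv R' hR' _)
  rw [h1, h2, ← sub_eq_zero, ← map_sub]
  set z := ∑ p ∈ Finset.HasAntidiagonal.antidiagonal m, leftComp (T p.1) (T p.2) -
    ∑ p ∈ Finset.HasAntidiagonal.antidiagonal m, rightComp (T p.1) (T p.2) with hz
  obtain ⟨S, hS⟩ := Γ.exists_sum_triProj z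
  rw [← hS S subset_rfl, map_sum]
  refine Finset.sum_eq_zero fun i _ => ?_
  rw [map_sum]
  refine Finset.sum_eq_zero fun j _ => ?_
  rw [map_sum]
  refine Finset.sum_eq_zero fun k _ => ?_
  obtain ⟨n, rfl⟩ : ∃ n, i = -n := ⟨-i, (neg_neg i).symm⟩
  obtain ⟨S₀, h₀⟩ := D.exists_sum_triProj_expansion n j k
  -- The degrees `k` and `n` are included because, in tri-degree `(-n, j, k)`, they are the only
  -- ones that survive in the first argument of `leftComp` and of `rightComp`.
  let A := insert k (insert n (S₀ ∪ A₀))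
  have hA : A₀ ⊆ A := fun x hx => by simp [A, hx]
  have h3 := h₀ A (fun x hx => by simp [A, hx]) m
  rw [hz, map_sub, map_sub, map_sum, map_sum, map_sum, map_sum, sub_eq_zero]
  convert! h3 using 1
  · refine Finset.sum_congr rfl fun p hp => ?_
    rw [hT A hA p.1 (hle p hp).1, hT A hA p.2 (hle p hp).2, ← leftCompₗ_apply]
    simp only [map_sum, LinearMap.sum_apply]
    refine Finset.sum_congr rfl fun q _ => ?_
    rw [Finset.sum_eq_single k]
    · rfl
    · intro b _ hb
      rw [leftCompₗ_apply, triProj_leftComp_of_ne hb (Γ.inclDeg_mem_bihomog _), map_zero]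
    · intro h; exact absurd (by simp [A]) h
  · refine Finset.sum_congr rfl fun p hp => ?_
    rw [hT A hA p.1 (hle p hp).1, hT A hA p.2 (hle p hp).2, ← rightCompₗ_apply]
    simp only [map_sum, LinearMap.sum_apply]
    refine Finset.sum_congr rfl fun q _ => ?_
    rw [Finset.sum_eq_single n]
    · rfl
    · intro b _ hb
      rw [rightCompₗ_apply, triProj_rightComp_of_ne (fun h => hb (neg_injective h))
        (Γ.inclDeg_mem_bihomog _), map_zero]
    · intro h; exact absurd (by simp [A]) h

end DualSystem

end Grading


/-! ### Complex functions on the group and the action of `U(g)` on them -/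

section Functions

variable {E : Type v} [NormedAddCommGroup E] [NormedSpace ℝ E]
  {G : Type w} [TopologicalSpace G] [ChartedSpace E G] [Group G] [LieGroup 𝓘(ℝ, E) ∞ G]

namespace CFun

omit [Group G] [LieGroup 𝓘(ℝ, E) ∞ G] in
theorem eval_tmul (z : ℂ) (f : RealFun E G) (g : G) : eval (z ⊗ₜ f) g = z * (f g : ℂ) := rfl

omit [Group G] [LieGroup 𝓘(ℝ, E) ∞ G] in
theorem eval_add (a b : CFun E G) (g : G) : eval (a + b) g = eval a g + eval b g := by
  rw [map_add]; rfl

omit [Group G] [LieGroup 𝓘(ℝ, E) ∞ G] in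
theorem eval_smul (c : ℂ) (a : CFun E G) (g : G) : eval (c • a) g = c * eval a g := by
  induction a using TensorProduct.induction_on with
  | zero => rw [smul_zero, map_zero, Pi.zero_apply, mul_zero]
  | add x y hx hy => rw [smul_add, eval_add, eval_add, hx, hy, mul_add]
  | tmul z f => rw [TensorProduct.smul_tmul', eval_tmul, eval_tmul, smul_eq_mul, mul_assoc]

omit [Group G] [LieGroup 𝓘(ℝ, E) ∞ G] in
theorem eval_mul (a b : CFun E G) (g : G) : eval (a * b) g = eval a g * eval b g := by
  induction a using TensorProduct.induction_on with
  | zero => rw [zero_mul, map_zero, Pi.zero_apply, zero_mul]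
  | add x y hx hy => rw [add_mul, eval_add, eval_add, hx, hy, add_mul]
  | tmul z f =>
    induction b using TensorProduct.induction_on with
    | zero => rw [mul_zero, map_zero, Pi.zero_apply, mul_zero]
    | add x y hx hy => rw [mul_add, eval_add, eval_add, hx, hy, mul_add]
    | tmul w f' =>
      rw [Algebra.TensorProduct.tmul_mul_tmul, eval_tmul, eval_tmul, eval_tmul,
        ContMDiffMap.coe_mul, Pi.mul_apply, Complex.ofReal_mul]
      ring

omit [Group G] [LieGroup 𝓘(ℝ, E) ∞ G] in
theorem eval_one (g : G) : eval (1 : CFun E G) g = 1 := by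
  rw [Algebra.TensorProduct.one_def, eval_tmul, ContMDiffMap.coe_one, Pi.one_apply,
    Complex.ofReal_one, mul_one]

omit [Group G] [LieGroup 𝓘(ℝ, E) ∞ G] in
theorem exists_eq (a : CFun E G) : ∃ f f' : RealFun E G,
    a = (1 : ℂ) ⊗ₜ f + Complex.I ⊗ₜ f' := by
  induction a using TensorProduct.induction_on with
  | zero => exact ⟨0, 0, by simp⟩
  | add x y hx hy =>
    obtain ⟨f, f', rfl⟩ := hx
    obtain ⟨k, k', rfl⟩ := hy
    exact ⟨f + k, f' + k', by rw [TensorProduct.tmul_add, TensorProduct.tmul_add]; abel⟩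
  | tmul z f =>
    refine ⟨z.re • f, z.im • f, ?_⟩
    rw [← TensorProduct.smul_tmul, ← TensorProduct.smul_tmul, ← TensorProduct.add_tmul]
    congr 1
    rw [Complex.real_smul, Complex.real_smul, mul_one, Complex.re_add_im]

omit [Group G] [LieGroup 𝓘(ℝ, E) ∞ G] in
theorem eval_eq (f f' : RealFun E G) (g : G) :
    eval ((1 : ℂ) ⊗ₜ f + Complex.I ⊗ₜ f') g = f g + f' g * Complex.I := by
  rw [eval_add, eval_tmul, eval_tmul, one_mul, mul_comm Complex.I]

omit [Group G] [LieGroup 𝓘(ℝ, E) ∞ G] in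
theorem eval_injective : Function.Injective (eval : CFun E G →ₗ[ℝ] (G → ℂ)) := by
  rw [← LinearMap.ker_eq_bot, LinearMap.ker_eq_bot']
  intro a ha
  obtain ⟨f, f', rfl⟩ := exists_eq a
  have h : ∀ g, f g = 0 ∧ f' g = 0 := by
    intro g
    have h1 := congrFun ha g
    rw [eval_eq, Pi.zero_apply] at h1
    constructor
    · simpa using congrArg Complex.re h1
    · simpa using congrArg Complex.im h1
  have hf : f = 0 := by ext g; exact (h g).1
  have hf' : f' = 0 := by ext g; exact (h g).2
  rw [hf, hf', TensorProduct.tmul_zero, TensorProduct.tmul_zero, add_zero]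

omit [Group G] [LieGroup 𝓘(ℝ, E) ∞ G] in
theorem ext {a b : CFun E G} (h : ∀ g, eval a g = eval b g) : a = b :=
  eval_injective (funext h)

omit [Group G] [LieGroup 𝓘(ℝ, E) ∞ G] in
theorem contMDiff_eval (a : CFun E G) : ContMDiff 𝓘(ℝ, E) 𝓘(ℝ, ℂ) ∞ (eval a) := by
  obtain ⟨f, f', rfl⟩ := exists_eq a
  have h : eval ((1 : ℂ) ⊗ₜ f + Complex.I ⊗ₜ f') =
      (fun p : ℝ × ℝ => (p.1 + p.2 * Complex.I : ℂ)) ∘ fun g => (f g, f' g) :=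
    funext fun g => eval_eq f f' g
  rw [h]
  refine ContMDiff.comp (I' := 𝓘(ℝ, ℝ × ℝ)) ?_ (f.contMDiff.prodMk_space f'.contMDiff)
  refine ContDiff.contMDiff ?_
  exact (Complex.ofRealCLM.contDiff.comp contDiff_fst).add
    ((Complex.ofRealCLM.contDiff.comp contDiff_snd).mul contDiff_const)

omit [Group G] [LieGroup 𝓘(ℝ, E) ∞ G] in
theorem exists_eval_eq {F : G → ℂ} (hF : ContMDiff 𝓘(ℝ, E) 𝓘(ℝ, ℂ) ∞ F) :
    ∃ a : CFun E G, ∀ g, eval a g = F g := by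
  let f : RealFun E G := ⟨fun g => (F g).re, Complex.reCLM.contDiff.contMDiff.comp hF⟩
  let f' : RealFun E G := ⟨fun g => (F g).im, Complex.imCLM.contDiff.contMDiff.comp hF⟩
  refine ⟨(1 : ℂ) ⊗ₜ f + Complex.I ⊗ₜ f', fun g => ?_⟩
  rw [eval_eq]
  exact Complex.re_add_im (F g)

/-- Pullback of functions along a smooth map. -/
def pullback (φ : C^∞⟮𝓘(ℝ, E), G; 𝓘(ℝ, E), G⟯) : CFun E G →ₐ[ℂ] CFun E G :=
  Algebra.TensorProduct.map (AlgHom.id ℂ ℂ)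
    { toFun := fun f : RealFun E G => f.comp φ
      map_one' := rfl
      map_mul' := fun _ _ => rfl
      map_zero' := rfl
      map_add' := fun _ _ => rfl
      commutes' := fun _ => rfl }

omit [Group G] [LieGroup 𝓘(ℝ, E) ∞ G] in
theorem pullback_tmul (φ : C^∞⟮𝓘(ℝ, E), G; 𝓘(ℝ, E), G⟯) (z : ℂ) (f : RealFun E G) :
    pullback φ (z ⊗ₜ f) = z ⊗ₜ f.comp φ := rfl

omit [Group G] [LieGroup 𝓘(ℝ, E) ∞ G] in
theorem eval_pullback (φ : C^∞⟮𝓘(ℝ, E), G; 𝓘(ℝ, E), G⟯) (a : CFun E G) (g : G) :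
    eval (pullback φ a) g = eval a (φ g) := by
  induction a using TensorProduct.induction_on with
  | zero => rw [map_zero, map_zero, Pi.zero_apply, Pi.zero_apply]
  | add x y hx hy => rw [map_add, eval_add, eval_add, hx, hy]
  | tmul z f => rfl

variable (E) in
/-- Left translation of functions. -/
def left (g : G) : CFun E G →ₐ[ℂ] CFun E G := pullback (𝑳 𝓘(ℝ, E) g)

variable (E) in
/-- Right translation of functions. -/
def right (g : G) : CFun E G →ₐ[ℂ] CFun E G := pullback (𝑹 𝓘(ℝ, E) g)

theorem eval_left (g : G) (a : CFun E G) (x : G) : eval (left E g a) x = eval a (g * x) :=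
  eval_pullback _ a x

theorem eval_right (g : G) (a : CFun E G) (x : G) : eval (right E g a) x = eval a (x * g) :=
  eval_pullback _ a x

end CFun

/-! ### The action of the enveloping algebra on functions -/

theorem lie_tmul (z w : ℂ) (X : LieAlg E G) (f : RealFun E G) :
    ⁅(z ⊗ₜ[ℝ] X : CLieAlg E G), (w ⊗ₜ[ℝ] f : CFun E G)⁆ = (z * w) ⊗ₜ[ℝ] X f := rfl

theorem lie_fun_zero (X : CLieAlg E G) : ⁅X, (0 : CFun E G)⁆ = 0 := lie_zero X

theorem lie_fun_add (X : CLieAlg E G) (a b : CFun E G) : ⁅X, a + b⁆ = ⁅X, a⁆ + ⁅X, b⁆ :=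
  lie_add X a b

theorem clie_zero (X : CLieAlg E G) : ⁅X, (0 : CLieAlg E G)⁆ = 0 := lie_zero X

theorem clie_add (X Y Z : CLieAlg E G) : ⁅X, Y + Z⁆ = ⁅X, Y⁆ + ⁅X, Z⁆ := lie_add X Y Z

theorem lie_mul (X : CLieAlg E G) (a b : CFun E G) : ⁅X, a * b⁆ = a * ⁅X, b⁆ + ⁅X, a⁆ * b := by
  induction X using TensorProduct.induction_on with
  | zero => simp only [zero_lie, mul_zero, zero_mul, add_zero]
  | add x y hx hy => rw [add_lie, add_lie, add_lie, hx, hy, mul_add, add_mul]; abel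
  | tmul z X =>
    induction a using TensorProduct.induction_on with
    | zero => simp only [lie_fun_zero, zero_mul, add_zero]
    | add x y hx hy => rw [add_mul, lie_fun_add, lie_fun_add, hx, hy, add_mul, add_mul]; abel
    | tmul w f =>
      induction b using TensorProduct.induction_on with
      | zero => simp only [lie_fun_zero, mul_zero, add_zero]
      | add x y hx hy => rw [mul_add, lie_fun_add, lie_fun_add, hx, hy, mul_add, mul_add]; abel
      | tmul w' f' =>
        rw [Algebra.TensorProduct.tmul_mul_tmul, lie_tmul, lie_tmul, lie_tmul,
          Algebra.TensorProduct.tmul_mul_tmul, Algebra.TensorProduct.tmul_mul_tmul,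
          LeftInvariantDerivation.leibniz, smul_eq_mul, smul_eq_mul, TensorProduct.tmul_add,
          mul_comm f' (X f)]
        congr 2 <;> ring

theorem left_lie (g : G) (X : CLieAlg E G) (a : CFun E G) :
    CFun.left E g ⁅X, a⁆ = ⁅X, CFun.left E g a⁆ := by
  induction X using TensorProduct.induction_on with
  | zero => simp only [zero_lie, map_zero]
  | add x y hx hy => rw [add_lie, map_add, hx, hy, add_lie]
  | tmul z X =>
    induction a using TensorProduct.induction_on with
    | zero => simp only [lie_fun_zero, map_zero]
    | add x y hx hy => rw [lie_fun_add, map_add, hx, hy, map_add, lie_fun_add]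
    | tmul w f =>
      rw [lie_tmul, CFun.left, CFun.pullback_tmul, LeftInvariantDerivation.comp_L]
      rfl

/-- Left invariant fields do not commute with right translations; the conjugated field is the
adjoint transform, by the definition of `Ad`. -/
theorem right_lie (h : G) (X : CLieAlg E G) (a : CFun E G) :
    CFun.right E h ⁅X, a⁆ = ⁅(Ad h).baseChange ℂ X, CFun.right E h a⁆ := by
  induction X using TensorProduct.induction_on with
  | zero => simp only [zero_lie, map_zero]
  | add x y hx hy => rw [add_lie, map_add, hx, hy, map_add, add_lie]
  | tmul z X =>
    induction a using TensorProduct.induction_on with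
    | zero => simp only [lie_fun_zero, map_zero]
    | add x y hx hy => rw [lie_fun_add, map_add, hx, hy, map_add, lie_fun_add]
    | tmul w f =>
      rw [lie_tmul, CFun.right, CFun.pullback_tmul, CFun.pullback_tmul, LinearMap.baseChange_tmul,
        lie_tmul]
      congr 1
      change (X f).comp _ = (X ((f.comp (𝑹 𝓘(ℝ, E) h)).comp (𝑹 𝓘(ℝ, E) h⁻¹))).comp _
      congr 2
      ext g
      change f g = f (g * h⁻¹ * h)
      rw [inv_mul_cancel_right]

theorem Ad_apply (h : G) (X : LieAlg E G) (f : RealFun E G) :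
    Ad h X f = (X (f.comp (𝑹 𝓘(ℝ, E) h⁻¹))).comp (𝑹 𝓘(ℝ, E) h) := rfl

theorem Ad_lie (h : G) (X Y : LieAlg E G) : Ad h ⁅X, Y⁆ = ⁅Ad h X, Ad h Y⁆ := by
  have hcomp : ∀ f : RealFun E G, (f.comp (𝑹 𝓘(ℝ, E) h)).comp (𝑹 𝓘(ℝ, E) h⁻¹) = f := by
    intro f
    ext g
    change f (g * h⁻¹ * h) = f g
    rw [inv_mul_cancel_right]
  refine LeftInvariantDerivation.ext fun f => ?_
  rw [LeftInvariantDerivation.commutator_apply, Ad_apply, Ad_apply, Ad_apply, Ad_apply, Ad_apply,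
    hcomp, hcomp, LeftInvariantDerivation.commutator_apply]
  rfl

theorem Ad_Ad_inv (h : G) (X : LieAlg E G) : Ad h (Ad h⁻¹ X) = X := by
  refine LeftInvariantDerivation.ext fun f => ?_
  rw [Ad_apply, Ad_apply]
  have h1 : (f.comp (𝑹 𝓘(ℝ, E) h⁻¹)).comp (𝑹 𝓘(ℝ, E) h⁻¹⁻¹) = f := by
    ext g
    change f (g * h⁻¹⁻¹ * h⁻¹) = f g
    rw [inv_inv, mul_inv_cancel_right]
  rw [h1]
  ext g
  change (X f) (g * h * h⁻¹) = _
  rw [mul_inv_cancel_right]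

variable {L : Type u} [LieRing L] [LieAlgebra ℂ L] (e : L ≃ₗ⁅ℂ⁆ CLieAlg E G)

theorem AdC_apply (h : G) (x : L) : AdC e h x = e.symm ((Ad h).baseChange ℂ (e x)) := rfl

theorem AdC_lie (h : G) (x y : L) : AdC e h ⁅x, y⁆ = ⁅AdC e h x, AdC e h y⁆ := by
  have key : ∀ X Y : CLieAlg E G, (Ad h).baseChange ℂ ⁅X, Y⁆ =
      ⁅(Ad h).baseChange ℂ X, (Ad h).baseChange ℂ Y⁆ := by
    intro X Y
    induction X using TensorProduct.induction_on with
    | zero => simp only [zero_lie, map_zero]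
    | add x y hx hy => rw [add_lie, map_add, hx, hy, map_add, add_lie]
    | tmul z X =>
      induction Y using TensorProduct.induction_on with
      | zero => simp only [clie_zero, map_zero]
      | add x y hx hy => rw [clie_add, map_add, hx, hy, map_add, clie_add]
      | tmul w Y =>
        rw [LieAlgebra.ExtendScalars.bracket_tmul, LinearMap.baseChange_tmul,
          LinearMap.baseChange_tmul, LinearMap.baseChange_tmul,
          LieAlgebra.ExtendScalars.bracket_tmul, Ad_lie]
  rw [AdC_apply, AdC_apply, AdC_apply, LieEquiv.map_lie, key, LieEquiv.map_lie]

theorem AdC_AdC_inv (h : G) (x : L) : AdC e h (AdC e h⁻¹ x) = x := by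
  rw [AdC_apply, AdC_apply, LieEquiv.apply_symm_apply, ← LinearMap.comp_apply,
    ← LinearMap.baseChange_comp]
  have : Ad h ∘ₗ Ad h⁻¹ = (LinearMap.id : LieAlg E G →ₗ[ℝ] LieAlg E G) :=
    LinearMap.ext fun X => Ad_Ad_inv h X
  rw [this, LinearMap.baseChange_id, LinearMap.id_apply, LieEquiv.symm_apply_apply]

/-- The automorphism of `U(g)` induced by the adjoint action. -/
def AdU (h : G) : U L →ₐ[ℂ] U L :=
  UniversalEnvelopingAlgebra.lift ℂ
    ((inc L).comp { AdC e h with map_lie' := fun {x y} => AdC_lie e h x y })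

theorem AdU_inc (h : G) (x : L) : AdU e h (inc L x) = inc L (AdC e h x) := lift_inc _ x

theorem AdU_AdU_inv (h : G) (u : U L) : AdU e h (AdU e h⁻¹ u) = u := by
  induction u using U_mul_induction with
  | one => rw [map_one, map_one]
  | smul c a ha => rw [map_smul, map_smul, ha]
  | add a b ha hb => rw [map_add, map_add, ha, hb]
  | inc x => rw [AdU_inc, AdU_inc, AdC_AdC_inv]
  | mul a b ha hb => rw [map_mul, map_mul, ha, hb]

theorem diffOp_inc (x : L) (a : CFun E G) : diffOp e (inc L x) a = ⁅e x, a⁆ := by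
  rw [diffOp, lift_inc]; rfl

theorem diffOp_mul (u v : U L) (a : CFun E G) : diffOp e (u * v) a = diffOp e u (diffOp e v a) := by
  rw [map_mul]; rfl

theorem diffOp_one (a : CFun E G) : diffOp e 1 a = a := by rw [map_one]; rfl

theorem left_diffOp (g : G) (u : U L) (a : CFun E G) :
    CFun.left E g (diffOp e u a) = diffOp e u (CFun.left E g a) := by
  induction u using U_mul_induction generalizing a with
  | one => rw [diffOp_one, diffOp_one]
  | smul c u hu => simp only [map_smul, LinearMap.smul_apply, hu]
  | add u v hu hv => simp only [map_add, LinearMap.add_apply, hu, hv]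
  | inc x => rw [diffOp_inc, diffOp_inc, left_lie]
  | mul u v hu hv => rw [diffOp_mul, hu, hv, diffOp_mul]

theorem right_diffOp (h : G) (u : U L) (a : CFun E G) :
    CFun.right E h (diffOp e u a) = diffOp e (AdU e h u) (CFun.right E h a) := by
  induction u using U_mul_induction generalizing a with
  | one => rw [map_one (AdU e h), diffOp_one, diffOp_one]
  | smul c u hu => simp only [map_smul, LinearMap.smul_apply, hu]
  | add u v hu hv => simp only [map_add, LinearMap.add_apply, hu, hv]
  | inc x => rw [diffOp_inc, AdU_inc, diffOp_inc, right_lie, AdC_apply, LieEquiv.apply_symm_apply]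
  | mul u v hu hv => rw [diffOp_mul, hu, hv, map_mul (AdU e h), diffOp_mul]

theorem biDiffOp_tmul (u v : U L) (a b : CFun E G) :
    biDiffOp e (u ⊗ₜ v) a b = diffOp e u a * diffOp e v b := rfl

theorem biDiffOp_add (S T : U L ⊗[ℂ] U L) (a b : CFun E G) :
    biDiffOp e (S + T) a b = biDiffOp e S a b + biDiffOp e T a b := by
  simp only [biDiffOp, map_add, LinearMap.add_apply]

theorem biDiffOp_zero (a b : CFun E G) : biDiffOp e 0 a b = 0 := by
  have h := biDiffOp_add e 0 0 a b
  rw [add_zero] at h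
  exact left_eq_add.mp h

theorem left_biDiffOp (g : G) (T : U L ⊗[ℂ] U L) (a b : CFun E G) :
    CFun.left E g (biDiffOp e T a b) = biDiffOp e T (CFun.left E g a) (CFun.left E g b) := by
  induction T using TensorProduct.induction_on with
  | zero => rw [biDiffOp_zero, map_zero, biDiffOp_zero]
  | add x y hx hy => rw [biDiffOp_add, map_add, hx, hy, biDiffOp_add]
  | tmul u v => rw [biDiffOp_tmul, map_mul, left_diffOp, left_diffOp, biDiffOp_tmul]

theorem right_biDiffOp (h : G) (T : U L ⊗[ℂ] U L) (a b : CFun E G) :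
    CFun.right E h (biDiffOp e T a b) =
      biDiffOp e (TensorProduct.map (AdU e h).toLinearMap (AdU e h).toLinearMap T)
        (CFun.right E h a) (CFun.right E h b) := by
  induction T using TensorProduct.induction_on with
  | zero => rw [biDiffOp_zero, map_zero, map_zero, biDiffOp_zero]
  | add x y hx hy => rw [biDiffOp_add, map_add, hx, hy, map_add, biDiffOp_add]
  | tmul u v => rw [biDiffOp_tmul, map_mul, right_diffOp, right_diffOp]; rfl

/-- The Leibniz rule for the action of the enveloping algebra on products of functions. -/
theorem diffOp_mul_apply (u : U L) (a b : CFun E G) :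
    diffOp e u (a * b) = biDiffOp e (coprod L u) a b := by
  induction u using U_induction with
  | one =>
    rw [map_one (coprod L), diffOp_one, Algebra.TensorProduct.one_def, biDiffOp_tmul, diffOp_one,
      diffOp_one]
  | smul c u hu =>
    rw [map_smul, LinearMap.smul_apply, hu, map_smul]
    simp only [biDiffOp, map_smul, LinearMap.smul_apply]
  | add u v hu hv => rw [map_add, LinearMap.add_apply, hu, hv, map_add, biDiffOp_add]
  | mul x u hu =>
    rw [diffOp_mul, hu, map_mul (coprod L), coprod_inc]
    generalize coprod L u = T
    clear hu
    induction T using TensorProduct.induction_on with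
    | zero => rw [mul_zero, biDiffOp_zero, map_zero]
    | add x y hx hy => rw [biDiffOp_add, map_add, hx, hy, mul_add, biDiffOp_add]
    | tmul s t =>
      rw [biDiffOp_tmul, add_mul, Algebra.TensorProduct.tmul_mul_tmul,
        Algebra.TensorProduct.tmul_mul_tmul, one_mul, one_mul, biDiffOp_add, biDiffOp_tmul,
        biDiffOp_tmul, diffOp_mul, diffOp_mul, diffOp_inc, diffOp_inc, diffOp_inc, lie_mul,
        add_comm]

end Functions


/-! ### Symmetries of the grading and the character preserve the canonical element -/

section Automorphism

variable {L : Type u} [LieRing L] [LieAlgebra ℂ L] {Γ : Grading L}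
  {χ : LieAlgebra.LieCharacter ℂ Γ.zeroPart}

namespace Grading

theorem antipode_algHom {σ : U L →ₐ[ℂ] U L} {s : L → L} (hσ : ∀ x, σ (inc L x) = inc L (s x))
    (u : U L) : antipode L (σ u) = σ (antipode L u) := by
  induction u using U_mul_induction with
  | one => rw [map_one σ, antipode_one, map_one σ]
  | smul c a ha => simp only [map_smul, ha]
  | add a b ha hb => simp only [map_add, ha, hb]
  | inc x => rw [hσ, antipode_inc, antipode_inc, map_neg, hσ]
  | mul a b ha hb => rw [map_mul σ, antipode_mul, ha, hb, antipode_mul, map_mul σ]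

theorem mem_adjoin_of_algHom {σ : U L →ₐ[ℂ] U L} {s : L → L}
    (hσ : ∀ x, σ (inc L x) = inc L (s x)) {N : Submodule ℂ L} (hN : ∀ x ∈ N, s x ∈ N) {u : U L}
    (hu : u ∈ Algebra.adjoin ℂ (inc L '' (N : Set L))) :
    σ u ∈ Algebra.adjoin ℂ (inc L '' (N : Set L)) := by
  have h : Algebra.adjoin ℂ (inc L '' (N : Set L)) ≤
      (Algebra.adjoin ℂ (inc L '' (N : Set L))).comap σ := by
    refine Algebra.adjoin_le ?_
    rintro _ ⟨x, hx, rfl⟩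
    change σ (inc L x) ∈ Algebra.adjoin ℂ (inc L '' (N : Set L))
    rw [hσ]
    exact Algebra.subset_adjoin ⟨s x, hN x hx, rfl⟩
  exact h hu

variable (Γ χ) in
/-- A linear map preserving the grading and the character. -/
structure IsSymmetry (s : L →ₗ[ℂ] L) : Prop where
  piece : ∀ i, ∀ x ∈ Γ.piece i, s x ∈ Γ.piece i
  char : ∀ x y : Γ.zeroPart, (y : L) = s x → χ y = χ x

namespace IsSymmetry

variable {s : L →ₗ[ℂ] L} (hs : Γ.IsSymmetry χ s) {σ : U L →ₐ[ℂ] U L}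
  (hσ : ∀ x, σ (inc L x) = inc L (s x))

include hs

theorem negPart {x : L} (hx : x ∈ Γ.negPart) : s x ∈ Γ.negPart := by
  induction hx using Γ.neg_induction with
  | zero => rw [map_zero]; exact zero_mem _
  | add a b _ _ ha hb => rw [map_add]; exact add_mem ha hb
  | mem i hi x hx => exact Γ.mem_negPart hi (hs.piece i x hx)

theorem posPart {x : L} (hx : x ∈ Γ.posPart) : s x ∈ Γ.posPart := by
  induction hx using Γ.pos_induction with
  | zero => rw [map_zero]; exact zero_mem _
  | add a b _ _ ha hb => rw [map_add]; exact add_mem ha hb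
  | mem i hi x hx => exact Γ.mem_posPart hi (hs.piece i x hx)

include hσ

theorem degProj (d : ℤ) (u : U L) : Γ.degProj d (σ u) = σ (Γ.degProj d u) := by
  induction u using U_induction generalizing d with
  | one =>
    rw [map_one σ]
    by_cases h : (0 : ℤ) = d
    · subst h; rw [Γ.isHomog_one.degProj_eq, map_one σ]
    · rw [Γ.isHomog_one.degProj_ne h, map_zero]
  | smul c a ha => simp only [map_smul, ha]
  | add a b ha hb => simp only [map_add, ha, hb]
  | mul x a ha =>
    have key : ∀ (i : ℤ) (x : L), x ∈ Γ.piece i → ∀ (u : U L),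
        Γ.degProj d (inc L x * u) = inc L x * Γ.degProj (d - i) u := by
      intro i x hx u
      induction u using Γ.homog_induction with
      | zero => simp
      | add a b ha hb => rw [mul_add, map_add, map_add, mul_add, ha, hb]
      | homog f a ha =>
        have hm := (Γ.isHomog_inc hx).mul ha
        by_cases h : f = d - i
        · subst h
          rw [add_sub_cancel] at hm
          rw [ha.degProj_eq, hm.degProj_eq]
        · rw [ha.degProj_ne h, hm.degProj_ne (by omega), mul_zero]
    induction x using Γ.piece_induction with
    | zero => simp
    | add x y hx hy => simp only [map_add, add_mul, hx, hy]
    | mem i x hx =>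
      rw [map_mul σ, hσ, key i _ (hs.piece i x hx), ha, key i x hx, map_mul σ, hσ]

theorem mem_homog {d : ℤ} {u : U L} (hu : u ∈ Γ.homog d) : σ u ∈ Γ.homog d := by
  obtain ⟨v, rfl⟩ := hu
  exact ⟨σ v, hs.degProj hσ d v⟩

theorem mem_UnegDeg {n : ℤ} {u : U L} (hu : u ∈ Γ.UnegDeg n) : σ u ∈ Γ.UnegDeg n :=
  ⟨mem_adjoin_of_algHom hσ (fun _ hx => hs.negPart hx) hu.1, hs.mem_homog hσ hu.2⟩

theorem mem_UposDeg {n : ℤ} {u : U L} (hu : u ∈ Γ.UposDeg n) : σ u ∈ Γ.UposDeg n :=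
  ⟨mem_adjoin_of_algHom hσ (fun _ hx => hs.posPart hx) hu.1, hs.mem_homog hσ hu.2⟩

theorem mem_offZero {u : U L} (hu : u ∈ Γ.offZero) : σ u ∈ Γ.offZero := by
  have h : Γ.offZero ≤ Γ.offZero.comap σ.toLinearMap := by
    refine sup_le (Submodule.span_le.mpr ?_) (Submodule.span_le.mpr ?_)
    · rintro _ ⟨a, ha, b, rfl⟩
      change σ (inc L a * b) ∈ Γ.offZero
      rw [map_mul σ, hσ]
      exact Γ.neg_mul_mem_offZero (hs.negPart ha) _
    · rintro _ ⟨a, ha, b, rfl⟩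
      change σ (b * inc L a) ∈ Γ.offZero
      rw [map_mul σ, hσ]
      exact Γ.mul_pos_mem_offZero (hs.posPart ha) _
  exact h hu

/-- The symmetry preserves `offZero`, so it can be tested on `U(g₀)`. There only some lift `w` of
the transformed element with the same character value is needed, and generators provide it. -/
theorem scaledChar_zeroProj (lam : ℂ) (u : U L) :
    Γ.scaledChar χ lam (Γ.zeroProj (σ u)) = Γ.scaledChar χ lam (Γ.zeroProj u) := by
  have h : ∀ v : U Γ.zeroPart, ∃ w : U Γ.zeroPart, Γ.zeroIncl w = σ (Γ.zeroIncl v) ∧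
      Γ.scaledChar χ lam w = Γ.scaledChar χ lam v := by
    intro v
    induction v using U_mul_induction with
    | one => exact ⟨1, by simp only [map_one], rfl⟩
    | smul c a ha =>
      obtain ⟨w, h1, h2⟩ := ha
      exact ⟨c • w, by simp only [map_smul, h1], by simp only [map_smul, h2]⟩
    | add a b ha hb =>
      obtain ⟨w, h1, h2⟩ := ha
      obtain ⟨w', h1', h2'⟩ := hb
      exact ⟨w + w', by simp only [map_add, h1, h1'], by simp only [map_add, h2, h2']⟩
    | inc x =>
      refine ⟨inc _ ⟨s x, hs.piece 0 x x.2⟩, ?_, ?_⟩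
      · rw [zeroIncl_inc, zeroIncl_inc, hσ]
      · rw [scaledChar_inc, scaledChar_inc, hs.char x ⟨s x, hs.piece 0 x x.2⟩ rfl]
    | mul a b ha hb =>
      obtain ⟨w, h1, h2⟩ := ha
      obtain ⟨w', h1', h2'⟩ := hb
      exact ⟨w * w', by simp only [map_mul, h1, h1'], by simp only [map_mul, h2, h2']⟩
  obtain ⟨v, hv⟩ := Γ.exists_sub_mem_offZero u
  obtain ⟨w, hw, hw'⟩ := h v
  have h1 := hs.mem_offZero hσ hv
  rw [map_sub, ← hw] at h1
  rw [Γ.zeroProj_eq_of_sub_mem hv, Γ.zeroProj_eq_of_sub_mem h1, hw']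

theorem shapovalov_map (lam : ℂ) (x y : U L) :
    Γ.shapovalov χ lam (σ x) (σ y) = Γ.shapovalov χ lam x y := by
  change Γ.scaledChar χ lam (Γ.zeroProj (antipode L (σ y) * σ x)) =
    Γ.scaledChar χ lam (Γ.zeroProj (antipode L y * x))
  rw [antipode_algHom hσ, ← map_mul σ, hs.scaledChar_zeroProj hσ]

/-- A symmetry carries dual bases to dual bases. In coordinates: expand `σ E_r` in the `E_t`;
invariance of the form moves `σ` across as its inverse `σ'`, and the sum over `r` gives `σ (σ' y) =
y` for each dual vector `y`. -/
theorem map_canonicalElement (D : DualSystem Γ χ) {lam : ℂ} (hl : Γ.PairingNonsingular χ lam)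
    {s' : L →ₗ[ℂ] L} (hs' : Γ.IsSymmetry χ s') {σ' : U L →ₐ[ℂ] U L}
    (hσ' : ∀ x, σ' (inc L x) = inc L (s' x)) (hinv : ∀ u, σ (σ' u) = u) (n : ℤ) :
    TensorProduct.map σ.toLinearMap σ.toLinearMap (Γ.inclDeg n (Γ.canonicalElement χ lam n)) =
      Γ.inclDeg n (Γ.canonicalElement χ lam n) := by
  rw [D.inclDeg_canonicalElement hl, map_sum]
  have h1 : ∀ r : D.index n, TensorProduct.map σ.toLinearMap σ.toLinearMap
      (D.E r ⊗ₜ (D.dualF lam n r : U L)) = ∑ t : D.index n, D.E t ⊗ₜ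
        σ (Γ.shapovalov χ lam (D.E r) (σ' (D.dualF lam n t)) • (D.dualF lam n r : U L)) := by
    intro r
    rw [TensorProduct.map_tmul, AlgHom.toLinearMap_apply, AlgHom.toLinearMap_apply]
    conv_lhs => rw [← D.sum_shapovalov_E hl (hs.mem_UnegDeg hσ (D.mem_UnegDeg r.2))]
    rw [TensorProduct.sum_tmul]
    refine Finset.sum_congr rfl fun t _ => ?_
    rw [TensorProduct.smul_tmul, map_smul, ← hs.shapovalov_map hσ lam (D.E r), hinv]
  rw [Finset.sum_congr rfl fun r _ => h1 r, Finset.sum_comm]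
  refine Finset.sum_congr rfl fun t _ => ?_
  rw [← TensorProduct.tmul_sum, ← map_sum,
    D.sum_shapovalov_dualF hl (hs'.mem_UposDeg hσ' (D.dualF lam n t).2), hinv]

theorem map_expansion (D : DualSystem Γ χ) {s' : L →ₗ[ℂ] L} (hs' : Γ.IsSymmetry χ s')
    {σ' : U L →ₐ[ℂ] U L} (hσ' : ∀ x, σ' (inc L x) = inc L (s' x)) (hinv : ∀ u, σ (σ' u) = u)
    (m : ℕ) (n : ℤ) :
    TensorProduct.map σ.toLinearMap σ.toLinearMap (Γ.inclDeg n (D.expansion m n)) =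
      Γ.inclDeg n (D.expansion m n) := by
  have h := (D.expansion_expandsWeakly n).eq_zero_of_map D.countable_compl_goodSet
    ((TensorProduct.map σ.toLinearMap σ.toLinearMap - LinearMap.id) ∘ₗ Γ.inclDeg n)
    (fun t ht => by
      rw [LinearMap.comp_apply, LinearMap.sub_apply, hs.map_canonicalElement hσ D ht hs' hσ' hinv,
        LinearMap.id_apply, sub_self]) m
  rw [LinearMap.comp_apply, LinearMap.sub_apply, LinearMap.id_apply, sub_eq_zero] at h
  exact h

end IsSymmetry

end Grading

end Automorphism

/-! ### Algebraic differential operators -/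

section DiffOp

variable {A C : Type*} [CommRing A] [Algebra ℂ A] [CommRing C] [Algebra ℂ C]

theorem IsDiffOp.add {k : ℕ} {D D' : A →ₗ[ℂ] A} (h : IsDiffOp k D) (h' : IsDiffOp k D') :
    IsDiffOp k (D + D') := by
  induction k generalizing D D' with
  | zero => intro f; rw [LinearMap.add_comp, LinearMap.comp_add, h f, h' f]
  | succ k ih =>
    intro f
    have := ih (h f) (h' f)
    rwa [sub_add_sub_comm, ← LinearMap.add_comp, ← LinearMap.comp_add] at this

theorem IsDiffOp.mulLeft_comp {k : ℕ} {D : A →ₗ[ℂ] A} (h : IsDiffOp k D) (g : A) :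
    IsDiffOp k (LinearMap.mulLeft ℂ g ∘ₗ D) := by
  induction k generalizing D with
  | zero =>
    intro f
    rw [LinearMap.comp_assoc, h f]
    ext a
    simp [mul_left_comm]
  | succ k ih =>
    intro f
    have := ih (h f)
    rw [LinearMap.comp_sub] at this
    convert! this using 2
    ext a
    simp [mul_left_comm]

theorem IsDiffOp.succ {k : ℕ} {D : A →ₗ[ℂ] A} (h : IsDiffOp k D) : IsDiffOp (k + 1) D := by
  induction k generalizing D with
  | zero => intro f; rw [h f, sub_self]; intro f; rw [LinearMap.zero_comp, LinearMap.comp_zero]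
  | succ k ih => intro f; exact ih (h f)

theorem IsDiffOp.mono {k l : ℕ} (hkl : k ≤ l) {D : A →ₗ[ℂ] A} (h : IsDiffOp k D) :
    IsDiffOp l D := by
  induction hkl with
  | refl => exact h
  | step _ ih => exact ih.succ

/-- The commutator with multiplication by `f` is `X [D, f] + X(f) D`: the first term falls under the
induction hypothesis, the second keeps the order of `D`. -/
theorem IsDiffOp.derivation_comp {k : ℕ} {D X : A →ₗ[ℂ] A} (h : IsDiffOp k D)
    (hX : ∀ a b, X (a * b) = a * X b + X a * b) : IsDiffOp (k + 1) (X ∘ₗ D) := by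
  have key : ∀ (D : A →ₗ[ℂ] A) (f : A), (X ∘ₗ D) ∘ₗ LinearMap.mulLeft ℂ f -
      LinearMap.mulLeft ℂ f ∘ₗ (X ∘ₗ D) =
        X ∘ₗ (D ∘ₗ LinearMap.mulLeft ℂ f - LinearMap.mulLeft ℂ f ∘ₗ D) +
          LinearMap.mulLeft ℂ (X f) ∘ₗ D := by
    intro D f
    ext a
    simp [hX]
    abel
  induction k generalizing D with
  | zero =>
    intro f
    rw [key, h f, sub_self, LinearMap.comp_zero, zero_add]
    exact h.mulLeft_comp _
  | succ k ih =>
    intro f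
    rw [key]
    exact (ih (h f)).add (h.mulLeft_comp _)

theorem isDiffOp_zero (k : ℕ) : IsDiffOp k (0 : A →ₗ[ℂ] A) :=
  IsDiffOp.mono (Nat.zero_le k) fun f => by rw [LinearMap.zero_comp, LinearMap.comp_zero]

/-- Differential operators restrict along injective algebra homomorphisms. -/
theorem IsDiffOp.of_injective {k : ℕ} (φ : A →ₐ[ℂ] C) (hφ : Function.Injective φ)
    {D : A →ₗ[ℂ] A} {Q : C →ₗ[ℂ] C} (hQ : IsDiffOp k Q) (h : ∀ a, φ (D a) = Q (φ a)) :
    IsDiffOp k D := by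
  induction k generalizing D Q with
  | zero =>
    intro f
    ext a
    apply hφ
    have := LinearMap.congr_fun (hQ (φ f)) (φ a)
    simp only [LinearMap.comp_apply, LinearMap.mulLeft_apply, ← map_mul, ← h] at this ⊢
    exact this
  | succ k ih =>
    intro f
    refine ih (hQ (φ f)) fun a => ?_
    simp only [LinearMap.sub_apply, LinearMap.comp_apply, LinearMap.mulLeft_apply, map_sub,
      map_mul, h]

end DiffOp


/-! ### Right invariant functions and composition of left invariant operators -/

section Homogeneous

variable {E : Type v} [NormedAddCommGroup E] [NormedSpace ℝ E]
  {G : Type w} [TopologicalSpace G] [ChartedSpace E G] [Group G] [LieGroup 𝓘(ℝ, E) ∞ G]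

variable (E) in
/-- The functions on the group that are invariant under right translation by a subgroup. -/
def rightInvariant (H : Subgroup G) : Subalgebra ℂ (CFun E G) where
  carrier := {a | ∀ h ∈ H, CFun.right E h a = a}
  mul_mem' ha hb h hh := by rw [map_mul, ha h hh, hb h hh]
  add_mem' ha hb h hh := by rw [map_add, ha h hh, hb h hh]
  algebraMap_mem' c h _ := AlgHom.commutes (CFun.right E h) c

theorem eval_mul_right {H : Subgroup G} {a : CFun E G} (ha : a ∈ rightInvariant E H) {h : G}
    (hh : h ∈ H) (g : G) : CFun.eval a (g * h) = CFun.eval a g := by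
  rw [← CFun.eval_right, ha h hh]

theorem mem_rightInvariant {H : Subgroup G} {a : CFun E G}
    (ha : ∀ h ∈ H, ∀ g, CFun.eval a (g * h) = CFun.eval a g) : a ∈ rightInvariant E H :=
  fun h hh => CFun.ext fun g => by rw [CFun.eval_right, ha h hh]

/-- Vector fields tangent to the cosets of `H` kill the functions that are constant on them. -/
theorem apply_eq_zero_of_mem_lieOfSubgroup {H : Subgroup G} {X : LieAlg E G}
    (hX : X ∈ lieOfSubgroup E H) {f : RealFun E G} (hf : ∀ h ∈ H, ∀ g, f (g * h) = f g) :
    X f = 0 := by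
  obtain ⟨γ, -, -, hγ, hd⟩ := hX
  ext g
  -- The translate of `f` by `g` is constant along the one-parameter subgroup, so its derivative
  -- there is zero; by left invariance this derivative is `X f` at `g`.
  have h1 := hd (f.comp (𝑳 𝓘(ℝ, E) g))
  have h2 : (fun t => (f.comp (𝑳 𝓘(ℝ, E) g)) (γ t)) = fun _ => f g :=
    funext fun t => hf (γ t) (hγ t) g
  rw [h2, ← LeftInvariantDerivation.comp_L] at h1
  have h3 := h1.unique (hasDerivAt_const 0 (f g))
  have h4 : (X f) (g * 1) = 0 := h3
  rwa [mul_one] at h4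

theorem lie_eq_zero_of_mem_complexLieOfSubgroup {H : Subgroup G} {X : CLieAlg E G}
    (hX : X ∈ complexLieOfSubgroup H) {a : CFun E G} (ha : a ∈ rightInvariant E H) :
    ⁅X, a⁆ = 0 := by
  induction hX using Submodule.span_induction with
  | zero => exact zero_lie a
  | add X Y _ _ hX hY => rw [add_lie, hX, hY, add_zero]
  | smul c X _ hX => rw [smul_lie, hX, smul_zero]
  | mem X hX =>
    obtain ⟨X, hX, rfl⟩ := hX
    obtain ⟨f, f', rfl⟩ := CFun.exists_eq a
    have hff : ∀ h ∈ H, ∀ g, f (g * h) = f g ∧ f' (g * h) = f' g := by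
      intro h hh g
      have h1 := eval_mul_right ha hh g
      rw [CFun.eval_eq, CFun.eval_eq] at h1
      constructor
      · simpa using congrArg Complex.re h1
      · simpa using congrArg Complex.im h1
    change ⁅(1 : ℂ) ⊗ₜ[ℝ] X, _⁆ = _
    rw [lie_fun_add, lie_tmul, lie_tmul,
      apply_eq_zero_of_mem_lieOfSubgroup hX fun h hh g => (hff h hh g).1,
      apply_eq_zero_of_mem_lieOfSubgroup hX fun h hh g => (hff h hh g).2,
      TensorProduct.tmul_zero, TensorProduct.tmul_zero, add_zero]

variable {L : Type u} [LieRing L] [LieAlgebra ℂ L] (e : L ≃ₗ⁅ℂ⁆ CLieAlg E G)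

/-- The map `u ↦ u a` for a function `a`. -/
def act (a : CFun E G) : U L →ₗ[ℂ] CFun E G :=
  LinearMap.applyₗ a ∘ₗ (diffOp e).toLinearMap

theorem biDiffOp_eq_map (T : U L ⊗[ℂ] U L) (a b : CFun E G) :
    biDiffOp e T a b =
      LinearMap.mul' ℂ (CFun E G) (TensorProduct.map (act e a) (act e b) T) := by
  induction T using TensorProduct.induction_on with
  | zero => rw [biDiffOp_zero, LinearMap.map_zero, LinearMap.map_zero]
  | add x y hx hy => rw [biDiffOp_add, hx, hy, LinearMap.map_add, LinearMap.map_add]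
  | tmul u v => rfl

/-- The left invariant tridifferential operator given by an element of `U(g) ⊗ U(g) ⊗ U(g)`. -/
def triDiffOp (a b c : CFun E G) : U L ⊗[ℂ] (U L ⊗[ℂ] U L) →ₗ[ℂ] CFun E G :=
  LinearMap.mul' ℂ (CFun E G) ∘ₗ LinearMap.lTensor (CFun E G) (LinearMap.mul' ℂ (CFun E G)) ∘ₗ
    TensorProduct.map (act e a) (TensorProduct.map (act e b) (act e c))

theorem triDiffOp_tmul (a b c : CFun E G) (u v w : U L) : triDiffOp e a b c (u ⊗ₜ (v ⊗ₜ w)) =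
    diffOp e u a * (diffOp e v b * diffOp e w c) := rfl

theorem triDiffOp_tmul_right (a b c : CFun E G) (u : U L) (T : U L ⊗[ℂ] U L) :
    triDiffOp e a b c (u ⊗ₜ T) = diffOp e u a * biDiffOp e T b c := by
  induction T using TensorProduct.induction_on with
  | zero => rw [biDiffOp_zero, TensorProduct.tmul_zero, map_zero, mul_zero]
  | add x y hx hy => rw [biDiffOp_add, TensorProduct.tmul_add, map_add, hx, hy, mul_add]
  | tmul v w => rfl

theorem triDiffOp_assoc_tmul (a b c : CFun E G) (T : U L ⊗[ℂ] U L) (w : U L) :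
    triDiffOp e a b c (TensorProduct.assoc ℂ (U L) (U L) (U L) (T ⊗ₜ w)) =
      biDiffOp e T a b * diffOp e w c := by
  induction T using TensorProduct.induction_on with
  | zero => rw [biDiffOp_zero, TensorProduct.zero_tmul, map_zero, map_zero, zero_mul]
  | add x y hx hy =>
    rw [biDiffOp_add, TensorProduct.add_tmul, map_add, map_add, hx, hy, add_mul]
  | tmul u v =>
    rw [TensorProduct.assoc_tmul, triDiffOp_tmul, biDiffOp_tmul, mul_assoc]

theorem biDiffOp_mul_tmul (T : U L ⊗[ℂ] U L) (s t : U L) (a b : CFun E G) :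
    biDiffOp e (T * s ⊗ₜ t) a b = biDiffOp e T (diffOp e s a) (diffOp e t b) := by
  induction T using TensorProduct.induction_on with
  | zero => rw [zero_mul, biDiffOp_zero, biDiffOp_zero]
  | add x y hx hy => rw [biDiffOp_add, add_mul, biDiffOp_add, hx, hy]
  | tmul u v =>
    rw [Algebra.TensorProduct.tmul_mul_tmul, biDiffOp_tmul, biDiffOp_tmul, diffOp_mul, diffOp_mul]

theorem diffOp_biDiffOp (u : U L) (S : U L ⊗[ℂ] U L) (a b : CFun E G) :
    diffOp e u (biDiffOp e S a b) = biDiffOp e (coprod L u * S) a b := by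
  induction S using TensorProduct.induction_on with
  | zero => rw [biDiffOp_zero, mul_zero, map_zero, biDiffOp_zero]
  | add x y hx hy => rw [biDiffOp_add, map_add, hx, hy, mul_add, biDiffOp_add]
  | tmul s t => rw [biDiffOp_tmul, diffOp_mul_apply, biDiffOp_mul_tmul]

/-- An element of `U(g)` acts on the product of two functions through its coproduct. With its mirror
image below this turns the associativity equation into associativity of the product of functions. -/
theorem biDiffOp_biDiffOp_left (T S : U L ⊗[ℂ] U L) (a b c : CFun E G) :
    biDiffOp e T (biDiffOp e S a b) c = triDiffOp e a b c (Grading.leftComp T S) := by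
  induction T using TensorProduct.induction_on with
  | zero => rw [biDiffOp_zero, ← Grading.leftCompₗ_apply, map_zero, LinearMap.zero_apply, map_zero]
  | add x y hx hy =>
    rw [biDiffOp_add, hx, hy, ← Grading.leftCompₗ_apply,
      ← Grading.leftCompₗ_apply, ← Grading.leftCompₗ_apply, map_add, LinearMap.add_apply,
      map_add]
  | tmul u v =>
    rw [Grading.leftComp_tmul, triDiffOp_assoc_tmul, biDiffOp_tmul, diffOp_biDiffOp]

theorem biDiffOp_biDiffOp_right (T S : U L ⊗[ℂ] U L) (a b c : CFun E G) :
    biDiffOp e T a (biDiffOp e S b c) = triDiffOp e a b c (Grading.rightComp T S) := by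
  induction T using TensorProduct.induction_on with
  | zero => rw [biDiffOp_zero, ← Grading.rightCompₗ_apply, map_zero, LinearMap.zero_apply, map_zero]
  | add x y hx hy =>
    rw [biDiffOp_add, hx, hy, ← Grading.rightCompₗ_apply,
      ← Grading.rightCompₗ_apply, ← Grading.rightCompₗ_apply, map_add, LinearMap.add_apply,
      map_add]
  | tmul u v => rw [Grading.rightComp_tmul, triDiffOp_tmul_right, biDiffOp_tmul, diffOp_biDiffOp]

section Quotient

variable {Γ : Grading L} {H : Subgroup G}

/-- In `U(g) g₀` the factor applied first to the function is a vector field tangent to the cosets of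
`H`. -/
theorem diffOp_eq_zero_of_mem_leftIdeal
    (hlie : (Γ.piece 0).map e.toLinearEquiv.toLinearMap = complexLieOfSubgroup H)
    {a : CFun E G} (ha : a ∈ rightInvariant E H) {u : U L} (hu : u ∈ Γ.leftIdeal) :
    diffOp e u a = 0 := by
  have hu' : u ∈ Submodule.span (U L) (inc L '' (Γ.piece 0 : Set L)) := hu
  induction hu' using Submodule.span_induction with
  | zero => rw [map_zero, LinearMap.zero_apply]
  | add x y hx hy h1 h2 => rw [map_add, LinearMap.add_apply, h1 hx, h2 hy, add_zero]
  | smul c x hx h => rw [smul_eq_mul, diffOp_mul, h hx, map_zero]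
  | mem x hx =>
    obtain ⟨x, hx, rfl⟩ := hx
    rw [diffOp_inc]
    refine lie_eq_zero_of_mem_complexLieOfSubgroup ?_ ha
    rw [← hlie]
    exact ⟨x, hx, rfl⟩

/-- The map induced by `u ↦ u a` on `U(g) / U(g) g₀`, for a right invariant function `a`. -/
theorem exists_act_eq (hlie : (Γ.piece 0).map e.toLinearEquiv.toLinearMap = complexLieOfSubgroup H)
    {a : CFun E G} (ha : a ∈ rightInvariant E H) :
    ∃ f : Γ.W →ₗ[ℂ] CFun E G, act e a = f ∘ₗ Γ.leftIdeal.mkQ :=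
  ⟨Γ.leftIdeal.liftQ (act e a) fun _ hu => diffOp_eq_zero_of_mem_leftIdeal e hlie ha hu,
    (Submodule.liftQ_mkQ _ _ _).symm⟩

/-- Evaluation on right invariant functions factors through `W` in each tensor factor, so only the
class in `W ⊗ W` matters. -/
theorem biDiffOp_congr (hlie : (Γ.piece 0).map e.toLinearEquiv.toLinearMap = complexLieOfSubgroup H)
    {a b : CFun E G} (ha : a ∈ rightInvariant E H) (hb : b ∈ rightInvariant E H)
    {S T : U L ⊗[ℂ] U L} (h : Γ.proj₂ S = Γ.proj₂ T) : biDiffOp e S a b = biDiffOp e T a b := by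
  obtain ⟨f, hf⟩ := exists_act_eq e hlie ha
  obtain ⟨k, hk⟩ := exists_act_eq e hlie hb
  have key : TensorProduct.map (act e a) (act e b) = TensorProduct.map f k ∘ₗ Γ.proj₂ := by
    rw [hf, hk, TensorProduct.map_comp]; rfl
  rw [biDiffOp_eq_map, biDiffOp_eq_map, key, LinearMap.comp_apply, LinearMap.comp_apply, h]

theorem triDiffOp_congr
    (hlie : (Γ.piece 0).map e.toLinearEquiv.toLinearMap = complexLieOfSubgroup H)
    {a b c : CFun E G} (ha : a ∈ rightInvariant E H) (hb : b ∈ rightInvariant E H)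
    (hc : c ∈ rightInvariant E H) {S T : U L ⊗[ℂ] (U L ⊗[ℂ] U L)} (h : Γ.proj₃ S = Γ.proj₃ T) :
    triDiffOp e a b c S = triDiffOp e a b c T := by
  obtain ⟨f, hf⟩ := exists_act_eq e hlie ha
  obtain ⟨k, hk⟩ := exists_act_eq e hlie hb
  obtain ⟨l, hl⟩ := exists_act_eq e hlie hc
  have key : TensorProduct.map (act e a) (TensorProduct.map (act e b) (act e c)) =
      TensorProduct.map f (TensorProduct.map k l) ∘ₗ Γ.proj₃ := by
    rw [hf, hk, hl, TensorProduct.map_comp, TensorProduct.map_comp]; rfl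
  rw [triDiffOp, key]
  simp only [LinearMap.comp_apply, h]

end Quotient

end Homogeneous


/-! ### The star product on the homogeneous space -/

section StarProduct

variable {E : Type v} [NormedAddCommGroup E] [NormedSpace ℝ E]
  {G : Type w} [TopologicalSpace G] [ChartedSpace E G] [Group G] [LieGroup 𝓘(ℝ, E) ∞ G]

/-! ### Functions on the homogeneous space -/

section Pull

variable {H : Subgroup G}

omit [LieGroup 𝓘(ℝ, E) ∞ G] in
theorem exists_pull (f : smoothFun E H) :
    ∃ a : CFun E G, ∀ g, CFun.eval a g = (f : G ⧸ H → ℂ) g :=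
  CFun.exists_eval_eq f.2

/-- The pullback to the group of a function on the homogeneous space. -/
def pullFun (f : smoothFun E H) : CFun E G := (exists_pull f).choose

omit [LieGroup 𝓘(ℝ, E) ∞ G] in
theorem eval_pullFun (f : smoothFun E H) (g : G) :
    CFun.eval (pullFun f) g = (f : G ⧸ H → ℂ) g := (exists_pull f).choose_spec g

variable (E H) in
/-- The pullback to the group of functions on the homogeneous space, as an algebra
homomorphism. -/
def pull : smoothFun E H →ₐ[ℂ] CFun E G :=
  AlgHom.ofLinearMap
    { toFun := pullFun
      map_add' := fun f f' => CFun.ext fun g => by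
        rw [CFun.eval_add, eval_pullFun, eval_pullFun, eval_pullFun]; rfl
      map_smul' := fun c f => CFun.ext fun g => by
        rw [CFun.eval_smul, eval_pullFun, eval_pullFun]; rfl }
    (CFun.ext fun g => by
      change CFun.eval (pullFun 1) g = _
      rw [CFun.eval_one, eval_pullFun]; rfl)
    (fun f f' => CFun.ext fun g => by
      change CFun.eval (pullFun (f * f')) g = CFun.eval (pullFun f * pullFun f') g
      rw [CFun.eval_mul, eval_pullFun, eval_pullFun, eval_pullFun]; rfl)

omit [LieGroup 𝓘(ℝ, E) ∞ G] in
theorem eval_pull (f : smoothFun E H) (g : G) :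
    CFun.eval (pull E H f) g = (f : G ⧸ H → ℂ) g := eval_pullFun f g

omit [LieGroup 𝓘(ℝ, E) ∞ G] in
theorem pull_injective : Function.Injective (pull E H) := by
  intro f f' h
  refine Subtype.ext (funext fun x => ?_)
  induction x using QuotientGroup.induction_on with
  | H g => rw [← eval_pull, ← eval_pull, h]

theorem pull_mem_rightInvariant (f : smoothFun E H) : pull E H f ∈ rightInvariant E H :=
  mem_rightInvariant fun h hh g => by
    rw [eval_pull, eval_pull, QuotientGroup.mk_mul_of_mem g hh]

theorem exists_pull_eq {a : CFun E G} (ha : a ∈ rightInvariant E H) :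
    ∃ f : smoothFun E H, pull E H f = a := by
  have hrel : ∀ x y : G, QuotientGroup.leftRel H x y → CFun.eval a x = CFun.eval a y := by
    intro x y hxy
    have h1 := eval_mul_right ha (QuotientGroup.leftRel_apply.mp hxy) x
    rw [mul_inv_cancel_left] at h1
    exact h1.symm
  exact ⟨⟨Quotient.lift (CFun.eval a) hrel, CFun.contMDiff_eval a⟩,
    CFun.ext fun g => eval_pull _ g⟩

variable (E H) in
/-- Functions on the homogeneous space are the right invariant functions on the group. -/
def pullEquiv : smoothFun E H ≃ₗ[ℂ] rightInvariant E H :=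
  LinearEquiv.ofBijective
    ((pull E H).toLinearMap.codRestrict (Subalgebra.toSubmodule (rightInvariant E H))
      pull_mem_rightInvariant)
    ⟨fun _ _ h => pull_injective (congrArg Subtype.val h), fun a => by
      obtain ⟨f, hf⟩ := exists_pull_eq a.2
      exact ⟨f, Subtype.ext hf⟩⟩

theorem pull_pullEquiv_symm (a : rightInvariant E H) :
    pull E H ((pullEquiv E H).symm a) = a :=
  congrArg Subtype.val ((pullEquiv E H).apply_symm_apply a)

end Pull

variable {L : Type u} [LieRing L] [LieAlgebra ℂ L] (e : L ≃ₗ⁅ℂ⁆ CLieAlg E G)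

/-! ### Orders of left invariant operators -/

/-- Elements of `g` act by derivations, so each further letter raises the order by at most one. -/
theorem exists_isDiffOp_diffOp (u : U L) : ∃ k, IsDiffOp k (diffOp e u) := by
  induction u using U_induction with
  | one =>
    refine ⟨0, fun f => ?_⟩
    rw [map_one (diffOp e)]
    rfl
  | smul c u hu =>
    obtain ⟨k, hk⟩ := hu
    refine ⟨k, ?_⟩
    convert! hk.mulLeft_comp (algebraMap ℂ (CFun E G) c) using 1
    refine LinearMap.ext fun a => ?_
    rw [map_smul (diffOp e), LinearMap.smul_apply, LinearMap.comp_apply, LinearMap.mulLeft_apply]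
    exact Algebra.smul_def (A := CFun E G) c _
  | add u v hu hv =>
    obtain ⟨k, hk⟩ := hu
    obtain ⟨l, hl⟩ := hv
    rw [map_add (diffOp e)]
    exact ⟨max k l, (hk.mono (le_max_left k l)).add (hl.mono (le_max_right k l))⟩
  | mul x u hu =>
    obtain ⟨k, hk⟩ := hu
    rw [map_mul (diffOp e)]
    refine ⟨k + 1, hk.derivation_comp fun a b => ?_⟩
    rw [diffOp_inc, diffOp_inc, diffOp_inc, lie_mul]

/-- The bidifferential operator given by an element of `U(g) ⊗ U(g)`, as a bilinear map. -/
def biDiffOpₗ (T : U L ⊗[ℂ] U L) : CFun E G →ₗ[ℂ] CFun E G →ₗ[ℂ] CFun E G :=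
  LinearMap.mk₂ ℂ (biDiffOp e T)
    (fun a a' b => by
      simp only [biDiffOp, TensorProduct.add_tmul, LinearMap.map_add])
    (fun c a b => by
      simp only [biDiffOp, ← TensorProduct.smul_tmul', LinearMap.map_smul])
    (fun a b b' => by
      simp only [biDiffOp, TensorProduct.tmul_add, LinearMap.map_add])
    (fun c a b => by
      simp only [biDiffOp, TensorProduct.tmul_smul, LinearMap.map_smul])

theorem biDiffOpₗ_add (S T : U L ⊗[ℂ] U L) :
    biDiffOpₗ e (S + T) = biDiffOpₗ e S + biDiffOpₗ e T :=
  LinearMap.ext fun a => LinearMap.ext fun b => biDiffOp_add e S T a b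

theorem exists_isDiffOp_biDiffOp (T : U L ⊗[ℂ] U L) :
    ∃ k, ∀ a, IsDiffOp k (biDiffOpₗ e T a) ∧ IsDiffOp k ((biDiffOpₗ e T).flip a) := by
  induction T using TensorProduct.induction_on with
  | zero =>
    refine ⟨0, fun a => ?_⟩
    have h : biDiffOpₗ e (0 : U L ⊗[ℂ] U L) = 0 :=
      LinearMap.ext fun a => LinearMap.ext fun b => biDiffOp_zero e a b
    rw [h]
    exact ⟨isDiffOp_zero 0, isDiffOp_zero 0⟩
  | add x y hx hy =>
    obtain ⟨k, hk⟩ := hx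
    obtain ⟨l, hl⟩ := hy
    rw [biDiffOpₗ_add]
    exact ⟨max k l, fun a =>
      ⟨((hk a).1.mono (le_max_left k l)).add ((hl a).1.mono (le_max_right k l)),
        ((hk a).2.mono (le_max_left k l)).add ((hl a).2.mono (le_max_right k l))⟩⟩
  | tmul u v =>
    obtain ⟨k, hk⟩ := exists_isDiffOp_diffOp e u
    obtain ⟨l, hl⟩ := exists_isDiffOp_diffOp e v
    have h1 : ∀ a, biDiffOpₗ e (u ⊗ₜ v) a =
        LinearMap.mulLeft ℂ (diffOp e u a) ∘ₗ diffOp e v := fun a => rfl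
    have h2 : ∀ b, (biDiffOpₗ e (u ⊗ₜ v)).flip b =
        LinearMap.mulLeft ℂ (diffOp e v b) ∘ₗ diffOp e u :=
      fun b => LinearMap.ext fun a => mul_comm _ _
    refine ⟨max k l, fun a => ⟨?_, ?_⟩⟩
    · rw [h1]
      exact (hl.mono (le_max_right k l)).mulLeft_comp _
    · rw [h2]
      exact (hk.mono (le_max_left k l)).mulLeft_comp _

/-! ### Bidifferential operators on the homogeneous space -/

section QuotOp

variable {H : Subgroup G} {T : U L ⊗[ℂ] U L}

/-- Right translation by `h` carries the operator of `T` to that of its adjoint transform, which is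
`T` again. -/
theorem biDiffOp_mem_rightInvariant (hT : ∀ h ∈ H,
      TensorProduct.map (AdU e h).toLinearMap (AdU e h).toLinearMap T = T)
    {a b : CFun E G} (ha : a ∈ rightInvariant E H) (hb : b ∈ rightInvariant E H) :
    biDiffOp e T a b ∈ rightInvariant E H := fun h hh => by
  rw [right_biDiffOp, hT h hh, ha h hh, hb h hh]

/-- An element of `U(g) ⊗ U(g)` that is invariant under the adjoint action of `H` acts by a
bidifferential operator on functions on `G / H`. -/
def quotOp (hT : ∀ h ∈ H,
      TensorProduct.map (AdU e h).toLinearMap (AdU e h).toLinearMap T = T) :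
    smoothFun E H →ₗ[ℂ] smoothFun E H →ₗ[ℂ] smoothFun E H :=
  LinearMap.mk₂ ℂ (fun f f' => (pullEquiv E H).symm ⟨biDiffOpₗ e T (pull E H f) (pull E H f'),
      biDiffOp_mem_rightInvariant e hT (pull_mem_rightInvariant f) (pull_mem_rightInvariant f')⟩)
    (fun f f₂ f' => by
      rw [← map_add]; congr 1; apply Subtype.ext
      change biDiffOpₗ e T _ _ = biDiffOpₗ e T _ _ + biDiffOpₗ e T _ _
      rw [map_add (pull E H), LinearMap.map_add, LinearMap.add_apply])
    (fun c f f' => by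
      rw [← map_smul]; congr 1; apply Subtype.ext
      change biDiffOpₗ e T _ _ = c • biDiffOpₗ e T _ _
      rw [map_smul (pull E H), LinearMap.map_smul, LinearMap.smul_apply])
    (fun f f' f₂ => by
      rw [← map_add]; congr 1; apply Subtype.ext
      change biDiffOpₗ e T _ _ = biDiffOpₗ e T _ _ + biDiffOpₗ e T _ _
      rw [map_add (pull E H), LinearMap.map_add])
    (fun c f f' => by
      rw [← map_smul]; congr 1; apply Subtype.ext
      change biDiffOpₗ e T _ _ = c • biDiffOpₗ e T _ _
      rw [map_smul (pull E H), LinearMap.map_smul])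

theorem pull_quotOp (hT : ∀ h ∈ H,
      TensorProduct.map (AdU e h).toLinearMap (AdU e h).toLinearMap T = T) (f f' : smoothFun E H) :
    pull E H (quotOp e hT f f') = biDiffOp e T (pull E H f) (pull E H f') :=
  pull_pullEquiv_symm _

theorem eval_quotOp (hT : ∀ h ∈ H,
      TensorProduct.map (AdU e h).toLinearMap (AdU e h).toLinearMap T = T) (f f' : smoothFun E H)
    (g : G) : (quotOp e hT f f' : G ⧸ H → ℂ) g =
      CFun.eval (biDiffOp e T (pull E H f) (pull E H f')) g := by
  rw [← pull_quotOp e hT, eval_pull]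

end QuotOp

/-- A solution of the associativity equation that has an `H`-invariant representative and has
constant term one defines an invariant star product on `G / H`. -/
theorem exists_isInvariantStarProduct {Γ : Grading L} {H : Subgroup G}
    (hlie : (Γ.piece 0).map e.toLinearEquiv.toLinearMap = complexLieOfSubgroup H)
    {T : ℕ → U L ⊗[ℂ] U L} (hT : ∀ m, ∀ h ∈ H,
      TensorProduct.map (AdU e h).toLinearMap (AdU e h).toLinearMap (T m) = T m)
    (hzero : Γ.proj₂ (T 0) = Γ.proj₂ 1) (hassoc : Γ.IsAssociative fun m => Γ.proj₂ (T m)) :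
    ∃ P : ℕ → smoothFun E H →ₗ[ℂ] smoothFun E H →ₗ[ℂ] smoothFun E H,
      IsInvariantStarProduct H P ∧ IsDefinedBy Γ e H P fun m => Γ.proj₂ (T m) := by
  refine ⟨fun m => quotOp e (hT m), ⟨fun m => ?_, fun f f' => ?_, fun m f₁ f₂ f₃ => ?_, ?_⟩, ?_⟩
  · obtain ⟨k, hk⟩ := exists_isDiffOp_biDiffOp e (T m)
    exact ⟨k, fun f =>
      ⟨IsDiffOp.of_injective (pull E H) pull_injective (hk (pull E H f)).1
          fun f' => pull_quotOp e (hT m) f f',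
        IsDiffOp.of_injective (pull E H) pull_injective (hk (pull E H f)).2
          fun f' => pull_quotOp e (hT m) f' f⟩⟩
  · apply pull_injective
    rw [pull_quotOp, map_mul (pull E H), biDiffOp_congr e hlie (pull_mem_rightInvariant f)
      (pull_mem_rightInvariant f') hzero, Algebra.TensorProduct.one_def, biDiffOp_tmul,
      diffOp_one, diffOp_one]
  · apply pull_injective
    rw [map_sum (pull E H), map_sum (pull E H)]
    have h := triDiffOp_congr e hlie (pull_mem_rightInvariant f₁) (pull_mem_rightInvariant f₂)
      (pull_mem_rightInvariant f₃) (hassoc T T (fun _ => rfl) (fun _ => rfl) m)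
    rw [map_sum (triDiffOp e _ _ _), map_sum (triDiffOp e _ _ _)] at h
    convert! h using 2 with p _ p _
    · rw [pull_quotOp, pull_quotOp, biDiffOp_biDiffOp_left]
    · rw [pull_quotOp, pull_quotOp, biDiffOp_biDiffOp_right]
  -- The action of `G` on `G / H` lifts to left translation on `G`, which commutes with left
  -- invariant operators.
  · intro m g f f' k k' hk hk' x
    have hl : ∀ f k : smoothFun E H,
        (∀ x : G ⧸ H, (k : G ⧸ H → ℂ) x = (f : G ⧸ H → ℂ) (g • x)) →
        pull E H k = CFun.left E g (pull E H f) := fun f k h => CFun.ext fun y => by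
      rw [CFun.eval_left, eval_pull, eval_pull, h]; rfl
    induction x using QuotientGroup.induction_on with
    | H y =>
      have h1 : (g • (y : G ⧸ H)) = ((g * y : G) : G ⧸ H) := rfl
      rw [h1, eval_quotOp, eval_quotOp, hl f k hk, hl f' k' hk', ← left_biDiffOp, CFun.eval_left]
  · intro m S hS f f' a a' ha ha' g
    have h1 : a = pull E H f := CFun.ext fun g => by rw [ha, eval_pull]
    have h2 : a' = pull E H f' := CFun.ext fun g => by rw [ha', eval_pull]
    rw [eval_quotOp, h1, h2, biDiffOp_congr e hlie (pull_mem_rightInvariant f)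
      (pull_mem_rightInvariant f') hS]

namespace Grading

variable {Γ : Grading L} {χ : LieAlgebra.LieCharacter ℂ Γ.zeroPart}

theorem isSymmetry_AdC {H : Subgroup G} (hH : IsCompatible Γ χ e H) {h : G} (hh : h ∈ H) :
    Γ.IsSymmetry χ (AdC e h) :=
  ⟨hH.grading h hh, hH.character h hh⟩

namespace DualSystem

variable (D : DualSystem Γ χ)

/-- A sum over all degrees of the components of a coefficient of the expansion. -/
def expansionSum [FiniteDimensional ℂ L] (m : ℕ) : U L ⊗[ℂ] U L :=
  ∑ n ∈ (D.finite_expansion_ne_zero m).toFinset, Γ.inclDeg n (D.expansion m n)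

theorem proj₂_expansionSum [FiniteDimensional ℂ L] (m : ℕ) :
    Γ.proj₂ (D.expansionSum m) = Γ.total (Γ.projSeries D.expansion) m :=
  (D.total_eq m fun n hn => by simpa using hn).symm

/-- Both `h` and `h⁻¹` act by symmetries, which supplies the inverse needed in `map_expansion`. The
invariance is that of the representative itself under the whole group `H`, stronger than the
infinitesimal one in `W ⊗ W`. -/
theorem map_expansionSum [FiniteDimensional ℂ L] {H : Subgroup G} (hH : IsCompatible Γ χ e H)
    (m : ℕ) (h : G) (hh : h ∈ H) :
    TensorProduct.map (AdU e h).toLinearMap (AdU e h).toLinearMap (D.expansionSum m) =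
      D.expansionSum m := by
  rw [expansionSum, map_sum]
  exact Finset.sum_congr rfl fun n _ =>
    (isSymmetry_AdC e hH hh).map_expansion (AdU_inc e h) D (isSymmetry_AdC e hH (H.inv_mem hh))
      (AdU_inc e h⁻¹) (AdU_AdU_inv e h) m n

theorem projSeries_zero_zero : Γ.projSeries D.expansion 0 0 = Γ.proj₂ 1 :=
  congrArg Γ.proj₂ D.expansion_zero_zero

theorem projSeries_zero_of_ne {n : ℤ} (hn : n ≠ 0) : Γ.projSeries D.expansion 0 n = 0 := by
  rw [projSeries, D.expansion_zero_of_ne hn, map_zero, map_zero]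

theorem exists_isInvariantStarProduct [FiniteDimensional ℂ L] {H : Subgroup G}
    (hH : IsCompatible Γ χ e H) :
    ∃ P : ℕ → smoothFun E H →ₗ[ℂ] smoothFun E H →ₗ[ℂ] smoothFun E H,
      IsInvariantStarProduct H P ∧
      IsDefinedBy Γ e H P (Γ.total (Γ.projSeries D.expansion)) := by
  have hB : (fun m => Γ.proj₂ (D.expansionSum m)) = Γ.total (Γ.projSeries D.expansion) :=
    funext D.proj₂_expansionSum
  have h := InvStar.exists_isInvariantStarProduct e hH.lie (D.map_expansionSum e hH)
    (by
      rw [D.proj₂_expansionSum, total, finsum_eq_single _ (0 : ℤ) fun n hn =>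
        D.projSeries_zero_of_ne hn, D.projSeries_zero_zero])
    (by rw [hB]; exact D.isAssociative_total)
  rwa [hB] at h

end DualSystem

end Grading

end StarProduct

end InvStar

end

/-! ### The main theorem -/

theorem mainTheorem1 {L : Type*} [LieRing L] [LieAlgebra ℂ L] (Γ : InvStar.Grading L)
    (χ : LieAlgebra.LieCharacter ℂ Γ.zeroPart) (hχ : Γ.IsNonsingularCharacter χ) :
    -- the canonical element `F_lam` is defined for all but countably many `lam`
    {lam : ℂ | ¬ Γ.PairingNonsingular χ lam}.Countable ∧
    (∀ lam : ℂ, Γ.PairingNonsingular χ lam →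
      ∀ n, Γ.IsCanonical χ lam n (Γ.canonicalElement χ lam n)) ∧
    -- its expansion `F` at infinity exists and is unique
    ∃ F : ℕ → ∀ n : ℤ, Γ.UnegDeg n ⊗[ℂ] Γ.UposDeg n,
      Γ.IsExpansionAtInfinity χ F ∧ (∀ F', Γ.IsExpansionAtInfinity χ F' → F' = F) ∧
      -- `B = π F` has constant term one, is invariant, and is associative
      Γ.projSeries F 0 0 = Γ.proj₂ 1 ∧ (∀ n, n ≠ 0 → Γ.projSeries F 0 n = 0) ∧
      (∀ m n, Γ.IsInvariant (Γ.projSeries F m n)) ∧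
      Γ.IsAssociativeCompleted (Γ.projSeries F) ∧
      -- if `L` has finite dimension then no completion is needed
      (FiniteDimensional ℂ L →
        (∀ m, {n : ℤ | F m n ≠ 0}.Finite) ∧
        (∀ m, Γ.IsInvariant (Γ.total (Γ.projSeries F) m)) ∧
        Γ.IsAssociative (Γ.total (Γ.projSeries F)) ∧
        -- and `B` defines an invariant star product on `G / H`
        ∀ {E : Type*} [NormedAddCommGroup E] [NormedSpace ℝ E] [FiniteDimensional ℝ E]
          {G : Type*} [TopologicalSpace G] [ChartedSpace E G] [Group G]
          [LieGroup 𝓘(ℝ, E) ∞ G] (e : L ≃ₗ⁅ℂ⁆ InvStar.CLieAlg E G) (H : Subgroup G),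
          InvStar.IsCompatible Γ χ e H →
          ∃ P : ℕ → InvStar.smoothFun E H →ₗ[ℂ] InvStar.smoothFun E H →ₗ[ℂ]
              InvStar.smoothFun E H,
            InvStar.IsInvariantStarProduct H P ∧
            InvStar.IsDefinedBy Γ e H P (Γ.total (Γ.projSeries F))) := by
  obtain ⟨D⟩ := hχ.exists_dualSystem
  refine ⟨D.countable_singular, fun lam hl => D.isCanonical_canonicalElement hl, D.expansion,
    D.isExpansionAtInfinity_expansion, fun F' hF' => D.eq_expansion hF', D.projSeries_zero_zero,
    fun n hn => D.projSeries_zero_of_ne hn, D.isInvariant_projSeries, D.isAssociativeCompleted,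
    fun hfin => ⟨D.finite_expansion_ne_zero, D.isInvariant_total, D.isAssociative_total, ?_⟩⟩
  intro E _ _ _ G _ _ _ _ e H hH
  exact D.exists_isInvariantStarProduct e hH
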